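/- **Setting.** Let $n\ge 0$, let $\tilde{\mathsf M}$ be a compact $C^\infty$ manifold of dimension $n+1$ with boundary $\mathbb B$ (a closed $n$-manifold, not necessarily connected) and with a smooth metric $\tilde g$, $g_{\mathbb B}=\tilde g|_{\mathbb B}$, and let $\mathsf M=\tilde{\mathsf M}\setminus\mathbb B$ carry a smooth metric $g$ which equals $dx^2+x^2g_{\mathbb B}$ in a closed collar $(0,1]\times\mathbb B\ni(x,y)$ of the boundary and is equivalent to $\tilde g$ outside the collar (a conic manifold). Fix a cut-off function $\omega\in C^\infty([0,1),[0,1])$ with $\omega\equiv1$ near $0$ and $\omega\equiv0$ near $1$, extended by zero to $\mathsf M$ outside the collar. Let $s\ge0$, $1<p<\infty$, $k\in\mathbb N_0$. For a Banach space $X$ and a Euclidean space $\mathbb R^d$, $H^s_p(\mathbb R^d,X)$ is the Sobolev space $W^s_p(\mathbb R^d,X)$ (weak derivatives of order $\le s$ in $L_p$) if $s\in\mathbb N_0$, and the complex interpolation space $[W^m_p(\mathbb R^d,X),W^{m+1}_p(\mathbb R^d,X)]_{s-m}$ if $m<s<m+1$, $m\in\mathbb N_0$ (for real $X$, after complexification);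 for $X=\mathbb C$, and more generally for UMD spaces $X$, this is the usual Bessel potential space. On $\overline{\mathbb R}_+\times\mathbb B$ and on $\mathsf M$ the spaces $H^s_p$ are defined by means of finitely many charts of $\mathbb B$, resp. $\tilde{\mathsf M}$, and subordinate smooth partitions of unity. For $\gamma\in\mathbb R$ put $S_\gamma u(t,y)=e^{(\gamma-\frac{n+1}2)t}u(e^{-t},y)$. The Mellin–Sobolev space $\mathcal H^{s,\gamma}_p(\mathsf M,X)$ consists of all $u:\mathsf M\to X$ (modulo null sets) with $$\|u\|_{s,\gamma;p}=\|S_\gamma(\omega u)\|_{H^s_p(\overline{\mathbb R}_+\times\mathbb B,X)}+\|(1-\omega)u\|_{H^s_p(\mathsf M,X)}<\infty ,$$ and $\mathcal C^k_g(\mathsf M,X)$ consists of all $k$ times continuously differentiable $u:\mathsf M\to X$ with $$\|u\|_{k,\infty;c}=\|(1-\omega)u\|_{k,\infty}+\sum_{j+|\alpha|\le k}\bigl\|\partial_x^j(\tfrac1x\partial_y)^\alpha(\omega u)\bigr\|_\infty<\infty ,$$ where $\partial_y$ and the derivatives in $\|\cdot\|_{k,\infty}$ are taken in the charts. We write $\mathcal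 H^{s,\gamma}_p(\mathsf M)$ if $X=\mathbb C$. **Theorem.** Let $X_0,X_1,X_2$ be Banach spaces and let $\bullet:X_1\times X_2\to X_0$ be a Banach multiplication, i.e. a bilinear map with $\|v_1\bullet v_2\|_{X_0}\le c\|v_1\|_{X_1}\|v_2\|_{X_2}$. Then the pointwise product $(u,v)\mapsto u\bullet v$ is (i) for all $\gamma,\gamma'\in\mathbb R$, a continuous bilinear map $$\mathcal H^{s,\gamma}_p(\mathsf M,X_1)\times\mathcal H^{s,\gamma'}_p(\mathsf M,X_2)\to\mathcal H^{s,\gamma+\gamma'-\frac{n+1}2}_p(\mathsf M,X_0)\quad\text{if } s>\tfrac{n+1}p;$$ in particular, if in addition $\gamma\ge\frac{n+1}2$, then $\mathcal H^{s,\gamma}_p(\mathsf M)$ is a Banach algebra under pointwise multiplication (possibly without unit, and for an equivalent norm); (ii) for all $\gamma\in\mathbb R$, a continuous bilinear map $$\mathcal H^{s,\gamma}_p(\mathsf M,X_1)\times\mathcal C^k_g(\mathsf M,X_2)\to\mathcal H^{s,\gamma}_p(\mathsf M,X_0)\quad\text{if } k\ge s.$$ -/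

import Mathlib

open MeasureTheory Filter Set
open scoped Topology ENNReal NNReal Manifold ContDiff

universe u

noncomputable section

/-! ## Complex interpolation

All norms are extended norms `V → ℝ≥0∞` on an ambient real vector space `V`; the normed space
belonging to `N` is `{v | N v < ⊤}` (modulo `{v | N v = 0}`). -/

section ComplexInterpolation

variable {V : Type*} [AddCommGroup V] [Module ℝ V]

/-- The norm of the sum `A₀ + A₁` of an interpolation couple. -/
def sumENorm (N₀ N₁ : V → ℝ≥0∞) (v : V) : ℝ≥0∞ :=
  ⨅ a : V, N₀ a + N₁ (v - a)

/-- The induced norm on the complexification `V ⊕ iV`, whose elements `v + iw` are written as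
pairs `(v, w)`. -/
def complexifiedENorm (N : V → ℝ≥0∞) (v : V × V) : ℝ≥0∞ :=
  N v.1 + N v.2

/-- Multiplication by a complex number on the complexification of `V`. -/
def complexifiedSMul (c : ℂ) (v : V × V) : V × V :=
  (c.re • v.1 - c.im • v.2, c.im • v.1 + c.re • v.2)

/-- The admissible functions of the complex method for the couple `(A₀, A₁)`: bounded continuous
functions on the strip `0 ≤ Re z ≤ 1` with values in (the complexification of) `A₀ + A₁`, which are
holomorphic inside the strip and are bounded and continuous with values in `A_j` on
`Re z = j`, for `j = 0, 1`. -/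
structure IsCalderonFunction (N₀ N₁ : V → ℝ≥0∞) (F : ℂ → V × V) : Prop where
  bounded : ∃ C : ℝ≥0, ∀ z : ℂ, z.re ∈ Icc (0 : ℝ) 1 →
    complexifiedENorm (sumENorm N₀ N₁) (F z) ≤ C
  continuous : ∀ z : ℂ, z.re ∈ Icc (0 : ℝ) 1 →
    Tendsto (fun w => complexifiedENorm (sumENorm N₀ N₁) (F w - F z))
      (𝓝[{w : ℂ | w.re ∈ Icc (0 : ℝ) 1}] z) (𝓝 0)
  holomorphic : ∀ z : ℂ, z.re ∈ Ioo (0 : ℝ) 1 → ∃ D : V × V,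
    Tendsto (fun h : ℂ => complexifiedENorm (sumENorm N₀ N₁)
      (F (z + h) - F z - complexifiedSMul h D) / ‖h‖ₑ) (𝓝[≠] 0) (𝓝 0)
  bounded_left : ∃ C : ℝ≥0, ∀ t : ℝ, complexifiedENorm N₀ (F (t * Complex.I)) ≤ C
  bounded_right : ∃ C : ℝ≥0, ∀ t : ℝ, complexifiedENorm N₁ (F (1 + t * Complex.I)) ≤ C
  continuous_left : ∀ t : ℝ, Tendsto
    (fun r : ℝ => complexifiedENorm N₀ (F (r * Complex.I) - F (t * Complex.I))) (𝓝 t) (𝓝 0)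
  continuous_right : ∀ t : ℝ, Tendsto
    (fun r : ℝ => complexifiedENorm N₁ (F (1 + r * Complex.I) - F (1 + t * Complex.I)))
    (𝓝 t) (𝓝 0)

/-- The norm of the complex interpolation space `[A₀, A₁]_θ`. It is `⊤` if there is no admissible
function with value `v` at `θ`. -/
def complexInterpolationENorm (N₀ N₁ : V → ℝ≥0∞) (θ : ℝ) (v : V) : ℝ≥0∞ :=
  ⨅ (F : ℂ → V × V) (_ : IsCalderonFunction N₀ N₁ F) (_ : F (θ : ℂ) = (v, 0)),
    max (⨆ t : ℝ, complexifiedENorm N₀ (F (t * Complex.I)))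
      (⨆ t : ℝ, complexifiedENorm N₁ (F (1 + t * Complex.I)))

end ComplexInterpolation

/-! ## Banach-space valued Sobolev and Bessel potential spaces on a Euclidean space -/

section Euclidean

variable {E : Type*} [NormedAddCommGroup E] [NormedSpace ℝ E] [MeasureSpace E]
  {X : Type*} [NormedAddCommGroup X] [NormedSpace ℝ X]

/-- `G` is the weak `j`-th derivative (a field of `X`-valued `j`-linear forms) of `f`. -/
def IsWeakIteratedDeriv (j : ℕ) (f : E → X) (G : E → E [×j]→L[ℝ] X) : Prop :=
  ∀ φ : E → ℝ, ContDiff ℝ ∞ φ → HasCompactSupport φ → ∀ m : Fin j → E,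
    ∫ x, (iteratedFDeriv ℝ j φ x m) • f x = (-1 : ℝ) ^ j • ∫ x, φ x • G x m

/-- The norm of the Sobolev space `W^k_p(E, X)`: the sum of the `L_p`-norms of the weak derivatives
of order at most `k`; it is `⊤` if `f` is not in the space. -/
def sobolevNatENorm (k : ℕ) (p : ℝ) (f : E → X) : ℝ≥0∞ :=
  ⨅ (_ : MemLp f (ENNReal.ofReal p) volume)
    (G : (j : ℕ) → E → E [×j]→L[ℝ] X)
    (_ : ∀ j ≤ k, MemLp (G j) (ENNReal.ofReal p) volume ∧ IsWeakIteratedDeriv j f (G j)),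
    ∑ j ∈ Finset.range (k + 1), eLpNorm (G j) (ENNReal.ofReal p) volume

/-- The norm of the space `H^s_p(E, X)`, `s ≥ 0`: it is the Sobolev space `W^s_p(E, X)` if `s` is an
integer, and the complex interpolation space `[W^k_p(E, X), W^{k+1}_p(E, X)]_{s - k}` if
`k < s < k + 1`. -/
def besselENorm (s p : ℝ) (f : E → X) : ℝ≥0∞ :=
  open scoped Classical in
  if s = (⌊s⌋₊ : ℝ) then sobolevNatENorm ⌊s⌋₊ p f
  else complexInterpolationENorm (sobolevNatENorm ⌊s⌋₊ p) (sobolevNatENorm (⌊s⌋₊ + 1) p)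
    (s - ⌊s⌋₊) f

end Euclidean

/-! ## Localization on manifolds -/

/-- A finite family of smooth charts of a manifold, with a subordinate smooth partition of unity. -/
structure FiniteLocalization {E : Type*} [NormedAddCommGroup E] [NormedSpace ℝ E]
    {H : Type*} [TopologicalSpace H] (I : ModelWithCorners ℝ E H)
    (M : Type*) [TopologicalSpace M] [ChartedSpace H M] where
  /-- the number of charts -/
  num : ℕ
  /-- the charts -/
  chart : Fin num → OpenPartialHomeomorph M H
  chart_mem : ∀ i, chart i ∈ IsManifold.maximalAtlas I ∞ M
  /-- the partition of unity -/
  weight : Fin num → M → ℝ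
  weight_smooth : ∀ i, ContMDiff I 𝓘(ℝ, ℝ) ∞ (weight i)
  weight_nonneg : ∀ i p, 0 ≤ weight i p
  weight_tsupport : ∀ i, tsupport (weight i) ⊆ (chart i).source
  weight_sum : ∀ p, ∑ i, weight i p = 1

namespace FiniteLocalization

variable {E : Type*} [NormedAddCommGroup E] [NormedSpace ℝ E]
  {H : Type*} [TopologicalSpace H] {I : ModelWithCorners ℝ E H}
  {M : Type*} [TopologicalSpace M] [ChartedSpace H M]
  {X : Type*} [NormedAddCommGroup X] [NormedSpace ℝ X]

/-- `weight i • w` in the `i`-th chart, extended by zero to the whole model vector space. -/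
def localize (L : FiniteLocalization I M) (i : Fin L.num) (w : M → X) : E → X :=
  (((L.chart i).extend I).target).indicator fun z =>
    L.weight i (((L.chart i).extend I).symm z) • w (((L.chart i).extend I).symm z)

end FiniteLocalization

/-! ## Conic manifolds -/

/-- The data making the interior `M` of a compact `(n+1)`-dimensional manifold with boundary `Mt`
into a conic manifold. The closed manifold `B` is identified with the boundary of `Mt` by means of
the collar. -/
structure ConicManifold (n : ℕ)
    (Mt : Type*) [TopologicalSpace Mt] [ChartedSpace (EuclideanHalfSpace (n + 1)) Mt]
    [IsManifold (𝓡∂ (n + 1)) ∞ Mt]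
    (B : Type*) [TopologicalSpace B] [ChartedSpace (EuclideanSpace ℝ (Fin n)) B]
    [IsManifold (𝓡 n) ∞ B] where
  /-- The closed collar: a diffeomorphism of `[0,1] × B` onto a closed neighbourhood of the boundary
  of `Mt`. -/
  collar : PartialEquiv (ℝ × B) Mt
  collar_source : collar.source = Icc (0 : ℝ) 1 ×ˢ (univ : Set B)
  collar_smooth : ContMDiffOn (𝓘(ℝ, ℝ).prod (𝓡 n)) (𝓡∂ (n + 1)) ∞ collar collar.source
  collar_symm_smooth :
    ContMDiffOn (𝓡∂ (n + 1)) (𝓘(ℝ, ℝ).prod (𝓡 n)) ∞ collar.symm collar.target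
  collar_isOpen : IsOpen (collar '' (Ico (0 : ℝ) 1 ×ˢ (univ : Set B)))
  collar_boundary : collar '' ({(0 : ℝ)} ×ˢ (univ : Set B)) = (𝓡∂ (n + 1)).boundary Mt
  /-- The smooth metric on the compact manifold with boundary. -/
  gt : Bundle.ContMDiffRiemannianMetric (𝓡∂ (n + 1)) ∞ (EuclideanSpace ℝ (Fin (n + 1)))
    (fun p : Mt => TangentSpace (𝓡∂ (n + 1)) p)
  /-- The metric on `B`; it is the one induced by `gt` on the boundary. -/
  gB : Bundle.ContMDiffRiemannianMetric (𝓡 n) ∞ (EuclideanSpace ℝ (Fin n))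
    (fun y : B => TangentSpace (𝓡 n) y)
  gB_eq : ∀ (y : B) (v w : TangentSpace (𝓡 n) y),
    gB.inner y v w = gt.inner (collar (0, y))
      (mfderiv (𝓡 n) (𝓡∂ (n + 1)) (fun y' : B => collar (0, y')) y v)
      (mfderiv (𝓡 n) (𝓡∂ (n + 1)) (fun y' : B => collar (0, y')) y w)
  /-- The conic metric on the interior of `Mt` (its values on the boundary are irrelevant). -/
  g : ∀ p : Mt, TangentSpace (𝓡∂ (n + 1)) p →L[ℝ] TangentSpace (𝓡∂ (n + 1)) p →L[ℝ] ℝ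
  g_symm : ∀ p ∈ (𝓡∂ (n + 1)).interior Mt, ∀ v w, g p v w = g p w v
  g_pos : ∀ p ∈ (𝓡∂ (n + 1)).interior Mt, ∀ v, v ≠ 0 → 0 < g p v v
  g_smooth : ContMDiffOn (𝓡∂ (n + 1)) ((𝓡∂ (n + 1)).prod
      𝓘(ℝ, EuclideanSpace ℝ (Fin (n + 1)) →L[ℝ] EuclideanSpace ℝ (Fin (n + 1)) →L[ℝ] ℝ)) ∞
    (fun p : Mt => Bundle.TotalSpace.mk'
      (EuclideanSpace ℝ (Fin (n + 1)) →L[ℝ] EuclideanSpace ℝ (Fin (n + 1)) →L[ℝ] ℝ)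
      (E := fun p : Mt =>
        TangentSpace (𝓡∂ (n + 1)) p →L[ℝ] TangentSpace (𝓡∂ (n + 1)) p →L[ℝ] ℝ) p (g p))
    ((𝓡∂ (n + 1)).interior Mt)
  /-- `g = dx² + x² gB` in the collar. -/
  g_conic : ∀ x ∈ Ioo (0 : ℝ) 1, ∀ (y : B) (a b : ℝ) (v w : TangentSpace (𝓡 n) y),
    g (collar (x, y))
      (mfderiv (𝓘(ℝ, ℝ).prod (𝓡 n)) (𝓡∂ (n + 1)) collar (x, y)
        ((a, v) : ℝ × EuclideanSpace ℝ (Fin n)))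
      (mfderiv (𝓘(ℝ, ℝ).prod (𝓡 n)) (𝓡∂ (n + 1)) collar (x, y)
        ((b, w) : ℝ × EuclideanSpace ℝ (Fin n))) = a * b + x ^ 2 * gB.inner y v w
  /-- Outside the collar, `g` is equivalent to `gt`. -/
  g_equiv : ∃ c : ℝ, 0 < c ∧ ∀ p ∉ collar.target, ∀ v : TangentSpace (𝓡∂ (n + 1)) p,
    c⁻¹ * gt.inner p v v ≤ g p v v ∧ g p v v ≤ c * gt.inner p v v

/-- A cut-off function on `[0,1)`: smooth with values in `[0,1]`, equal to `1` near `0` and to `0`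
near `1` (and extended by zero beyond `1`). -/
structure IsConeCutoff (χ : ℝ → ℝ) : Prop where
  smooth : ContDiff ℝ ∞ χ
  mem_Icc : ∀ x, χ x ∈ Icc (0 : ℝ) 1
  eq_one : χ =ᶠ[𝓝 0] 1
  eq_zero : ∃ r < (1 : ℝ), ∀ x, r ≤ x → χ x = 0

namespace ConicManifold

variable {n : ℕ}
  {Mt : Type*} [TopologicalSpace Mt] [ChartedSpace (EuclideanHalfSpace (n + 1)) Mt]
  [IsManifold (𝓡∂ (n + 1)) ∞ Mt]
  {B : Type*} [TopologicalSpace B] [ChartedSpace (EuclideanSpace ℝ (Fin n)) B]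
  [IsManifold (𝓡 n) ∞ B]
  {X : Type*} [NormedAddCommGroup X] [NormedSpace ℝ X]

/-- The function `χ` of the collar variable `x`, as a function on the manifold. -/
def cutoff (C : ConicManifold n Mt B) (χ : ℝ → ℝ) : Mt → ℝ :=
  C.collar.target.indicator fun p => χ (C.collar.symm p).1

/-- `S_γ(χ u)(t, y) = e^{(γ - (n+1)/2) t} (χ u)(e^{-t}, y)` on the half cylinder `t > 0`, extended
by zero to the whole cylinder `ℝ × B` (it vanishes for `t` near `0`). -/
def conePart (C : ConicManifold n Mt B) (χ : ℝ → ℝ) (γ : ℝ) (u : Mt → X) (t : ℝ) (y : B) : X :=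
  open scoped Classical in
  if 0 < t then
    Real.exp ((γ - ((n : ℝ) + 1) / 2) * t) •
      (χ (Real.exp (-t)) • u (C.collar (Real.exp (-t), y)))
  else 0

/-- The part `(1 - χ) u` of a function, supported away from the conic singularities. -/
def regularPart (C : ConicManifold n Mt B) (χ : ℝ → ℝ) (u : Mt → X) (p : Mt) : X :=
  (1 - C.cutoff χ p) • u p

/-- The norm of the Mellin-Sobolev space `𝓗^{s,γ}_p(M, X)`, that is
`‖S_γ(χ u)‖_{H^s_p(ℝ₊ × B, X)} + ‖(1 - χ) u‖_{H^s_p(M, X)}`, where the two `H^s_p`-norms are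
computed by means of localizations of `B` and of the compact manifold. It is `⊤` if `u` does not
belong to the space. Functions on `M` are written as functions on `Mt`; only their restrictions to
the interior matter. -/
def mellinENorm (C : ConicManifold n Mt B) (χ : ℝ → ℝ) (LB : FiniteLocalization (𝓡 n) B)
    (LM : FiniteLocalization (𝓡∂ (n + 1)) Mt) (s γ p : ℝ) (u : Mt → X) : ℝ≥0∞ :=
  (∑ i, besselENorm s p fun tz : ℝ × EuclideanSpace ℝ (Fin n) =>
      LB.localize i (C.conePart χ γ u tz.1) tz.2)
    + ∑ i, besselENorm s p (LM.localize i (C.regularPart χ u))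

/-- The norm of the conic `BC^k`-space `𝓒_g^k(M, X)`, that is
`‖(1 - χ) u‖_{k,∞} + ∑_{j+|α| ≤ k} ‖∂_x^j (x⁻¹ ∂_y)^α (χ u)‖_∞`, where derivatives are taken in the
charts of localizations. It is `⊤` if `u` is not `k` times continuously differentiable on the
interior. -/
def conicCkENorm (C : ConicManifold n Mt B) (χ : ℝ → ℝ) (LB : FiniteLocalization (𝓡 n) B)
    (LM : FiniteLocalization (𝓡∂ (n + 1)) Mt) (k : ℕ) (u : Mt → X) : ℝ≥0∞ :=
  ⨅ _ : ContMDiffOn (𝓡∂ (n + 1)) 𝓘(ℝ, X) k u ((𝓡∂ (n + 1)).interior Mt),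
    (∑ i, ∑ j ∈ Finset.range (k + 1), ⨆ z : EuclideanSpace ℝ (Fin (n + 1)),
        ‖iteratedFDeriv ℝ j (LM.localize i (C.regularPart χ u)) z‖ₑ)
      + ∑ i, ∑ jm ∈ (Finset.range (k + 1) ×ˢ Finset.range (k + 1)).filter
          (fun jm => jm.1 + jm.2 ≤ k),
        ⨆ (x : ℝ) (_ : x ∈ Ioo (0 : ℝ) 1) (z : EuclideanSpace ℝ (Fin n)),
          ‖iteratedDeriv jm.1 (fun x' : ℝ => (x' ^ jm.2)⁻¹ •
            iteratedFDeriv ℝ jm.2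
              (LB.localize i fun y => χ x' • u (C.collar (x', y))) z) x‖ₑ

end ConicManifold

end

noncomputable section

/-! ## Extended norms -/

section ExtendedNorms

variable {V V' : Type*} [AddCommGroup V] [Module ℝ V] [AddCommGroup V'] [Module ℝ V']

/-! Put δ = γ - (n+1)/2 and x = e^{-t}. The Mellin-Sobolev norm is then a finite sum of Euclidean
H^s_p-norms of localizations: the cone patches, with parameters (t, z), carry the density e^{δt},
and the chart patches of the interior carry none (`ConicManifold.mellinENorm_eq`). The weight γ + γ'
- (n+1)/2 corresponds to δ + δ', and densities multiply. Hence the localization of a product in a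
patch is the localization of u times a function T v on the whole Euclidean space which agrees with
density times v wherever the weight of the patch is nonzero. By the partition of unity, T v can be
taken as a sum of weighted pullbacks of the localizations of v (`PatchCover.exists_extension`), so
it is controlled by the norm of v. This reduces the theorem to products of Banach space valued
functions on a Euclidean space of dimension d = n + 1.

For (ii), multiplication by a function with bounded derivatives up to order k is a linear operator
in the other factor. It is bounded on W^m_p for m ≤ k, hence on H^s_p by complex interpolation
(`besselENorm_bilin_le`). The substitution x = e^{-t} turns bounds for the conic derivatives into
bounds for ordinary derivatives in (t, z) (`ConicManifold.exists_hasBoundedDerivs_conePatch`).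

For (i), the core is that H^s_p is stable under products if s > d/p (`exists_besselENorm_mul_le`).
The target spaces are arbitrary Banach spaces, so neither Fourier multipliers nor square functions
are used, only mollification and interpolation of linear operators. Let Φ_k be mollification at
scale 2^{-k}, R_k = 1 - Φ_k and S_k = 1 - R_k^N. Each factor R_k gains 2^{-k} at the cost of one
derivative. The difference S_{k+1} - S_k is (Φ_{k+1} - Φ_k) applied to a polynomial of degree N - 1
in R_k and R_{k+1}. So the map f ↦ D^a (S_{k+1} - S_k) f (x) has norm O(2^{k(a + d/p - m)}) on
W^m_p, and interpolation gives O(2^{k(a + d/p - s)}) on H^s_p (`exists_enorm_smoothEnd_sub_le`). For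
small ε > 0 this yields the bounds of `IsSmoothingSeq` for S_k f: S_k f bounded, D^a S_k f of size
2^{k(a-ε)} for a ≥ 1, and increments of size 2^{-kε}.

Telescoping B(S_k f, S_k g) writes the product as B(S_0 f, S_0 g) plus two paraproducts
(`bilin_smoothMap_eq`). With one factor frozen, a paraproduct g ↦ ∑ B(w_k, (S_{k+1} - S_k) g) is
linear in the other. It is bounded on every W^m_p with m ≤ ⌊s⌋ + 1
(`exists_eLpNorm_paraproduct_le`): where no derivative falls on w_k, Abel summation moves the
difference onto w_k, whose increments are summable; where a ≥ 1 derivatives do, the growth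
2^{k(a-ε)} meets a gain 2^{-ka}. Interpolation of this linear operator gives the bound on H^s_p
(`exists_paraproduct`).

For the Banach algebra, δ ≥ 0 makes the norm for δ dominated by the one for 2δ
(`ConicManifold.exists_norm_cover_mono`), so the product maps the space into itself. Completeness
descends from L_p to W^m_p, through complex interpolation to H^s_p
(`IsOrderedCouple.complete_interpolation`), and from the localizations to the manifold
(`PatchCover.EComplete_norm`). Dividing by the functions of norm zero and rescaling the norm gives
the algebra (`exists_banachAlgebra`). -/

/-- An extended seminorm on a real vector space. -/
structure IsENorm (N : V → ℝ≥0∞) : Prop where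
  zero : N 0 = 0
  add_le : ∀ v w, N (v + w) ≤ N v + N w
  smul_le : ∀ (c : ℝ) v, N (c • v) ≤ ‖c‖ₑ * N v

namespace IsENorm

variable {N : V → ℝ≥0∞}

lemma smul (h : IsENorm N) (c : ℝ) (v : V) : N (c • v) = ‖c‖ₑ * N v := by
  refine le_antisymm (h.smul_le c v) ?_
  rcases eq_or_ne c 0 with rfl | hc
  · simp
  · have h1 := h.smul_le c⁻¹ (c • v)
    rw [smul_smul, inv_mul_cancel₀ hc, one_smul] at h1
    calc ‖c‖ₑ * N v ≤ ‖c‖ₑ * (‖c⁻¹‖ₑ * N (c • v)) := by gcongr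
      _ = N (c • v) := by
        rw [← mul_assoc, ← enorm_mul, mul_inv_cancel₀ hc, enorm_one, one_mul]

lemma neg (h : IsENorm N) (v : V) : N (-v) = N v := by
  have := h.smul (-1) v
  simpa using this

lemma sub_le (h : IsENorm N) (v w : V) : N (v - w) ≤ N v + N w := by
  rw [sub_eq_add_neg, ← h.neg w]; exact h.add_le _ _

lemma sub_comm (h : IsENorm N) (v w : V) : N (v - w) = N (w - v) := by
  rw [← h.neg, neg_sub]

lemma sum_le (h : IsENorm N) {ι : Type*} (s : Finset ι) (v : ι → V) :
    N (∑ i ∈ s, v i) ≤ ∑ i ∈ s, N (v i) := by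
  classical
  induction s using Finset.induction_on with
  | empty => simp [h.zero]
  | insert a s ha ih =>
    rw [Finset.sum_insert ha, Finset.sum_insert ha]
    exact (h.add_le _ _).trans (by gcongr)

/-- The space of vectors of finite norm. -/
def space (h : IsENorm N) : Submodule ℝ V where
  carrier := {v | N v < ⊤}
  zero_mem' := by simp [h.zero]
  add_mem' hv hw := (h.add_le _ _).trans_lt (ENNReal.add_lt_top.2 ⟨hv, hw⟩)
  smul_mem' c v hv := (h.smul_le c v).trans_lt (ENNReal.mul_lt_top enorm_lt_top hv)

lemma mem_space (h : IsENorm N) {v : V} : v ∈ h.space ↔ N v < ⊤ := Iff.rfl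

instance (h : IsENorm N) : SeminormedAddCommGroup h.space :=
  AddGroupSeminorm.toSeminormedAddCommGroup
    { toFun := fun v => (N v).toReal
      map_zero' := by simp [h.zero]
      add_le' := fun v w => by
        rw [← ENNReal.toReal_add v.2.ne w.2.ne]
        exact ENNReal.toReal_mono (ENNReal.add_lt_top.2 ⟨v.2, w.2⟩).ne (h.add_le _ _)
      neg' := fun v => by simp [h.neg] }

lemma norm_def (h : IsENorm N) (v : h.space) : ‖v‖ = (N v).toReal := rfl

lemma enorm_eq (h : IsENorm N) (v : h.space) : ‖v‖ₑ = N v := by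
  rw [← ofReal_norm, norm_def, ENNReal.ofReal_toReal v.2.ne]

instance (h : IsENorm N) : NormedSpace ℝ h.space where
  norm_smul_le c v := by
    rw [norm_def, norm_def, Submodule.coe_smul, h.smul, ENNReal.toReal_mul]
    simp

/-- A linear projection onto the space of vectors of finite norm. -/
lemma exists_proj (h : IsENorm N) : ∃ π : V →ₗ[ℝ] h.space, ∀ v : h.space, π v = v := by
  obtain ⟨g, hg⟩ := LinearMap.exists_extend (LinearMap.id : h.space →ₗ[ℝ] h.space)
  exact ⟨g, fun v => by simpa using LinearMap.congr_fun hg v⟩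

end IsENorm

/-- Completeness of an extended seminorm: absolutely convergent series converge. -/
def EComplete (N : V → ℝ≥0∞) : Prop :=
  ∀ u : ℕ → V, ∑' k, N (u k) ≠ ⊤ →
    ∃ x, Tendsto (fun K => N (x - ∑ k ∈ Finset.range K, u k)) atTop (𝓝 0)

/-- The separation quotient is a normed group, where it suffices to sum absolutely convergent
series, and representatives of the terms are summed by `EComplete`. The limit has finite norm
because it is within distance one of some partial sum. -/
lemma IsENorm.completeSpace {N : V → ℝ≥0∞} (h : IsENorm N) (hc : EComplete N) :
    CompleteSpace h.space := by
  rw [← SeparationQuotient.completeSpace_iff]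
  refine NormedAddCommGroup.completeSpace_of_summable_imp_tendsto fun u hu => ?_
  choose v hv using fun k => SeparationQuotient.surjective_mk (u k)
  have hnorm : ∀ k, ‖u k‖ = ‖v k‖ := fun k => by rw [← hv k, SeparationQuotient.norm_mk]
  have hfin : ∑' k, N (v k : V) ≠ ⊤ := by
    have : ∀ k, N (v k : V) = ENNReal.ofReal ‖v k‖ := fun k => by
      rw [ofReal_norm, h.enorm_eq]
    simp_rw [this]
    simp_rw [hnorm] at hu
    exact hu.tsum_ofReal_ne_top
  obtain ⟨x, hx⟩ := hc (fun k => v k) hfin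
  have hxs : N x < ⊤ := by
    obtain ⟨K, hK⟩ := (hx.eventually (gt_mem_nhds (zero_lt_one' ℝ≥0∞))).exists
    have : x = (x - ∑ k ∈ Finset.range K, (v k : V)) + ∑ k ∈ Finset.range K, (v k : V) := by abel
    rw [this]
    refine (h.add_le _ _).trans_lt (ENNReal.add_lt_top.2 ⟨hK.trans ENNReal.one_lt_top, ?_⟩)
    exact h.mem_space.1 (Submodule.sum_mem _ fun k _ => (v k).2)
  refine ⟨SeparationQuotient.mk (⟨x, hxs⟩ : h.space), ?_⟩
  rw [tendsto_iff_norm_sub_tendsto_zero]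
  have h2 := (ENNReal.tendsto_toReal ENNReal.zero_ne_top).comp hx
  refine (tendsto_congr fun K => ?_).1 h2
  have h3 : ∑ i ∈ Finset.range K, u i
      = SeparationQuotient.mk (∑ i ∈ Finset.range K, v i : h.space) := by
    simp_rw [← hv]
    exact (map_sum (SeparationQuotient.mkCLM ℝ h.space) v _).symm
  rw [h3, ← SeparationQuotient.mk_sub, SeparationQuotient.norm_mk, ← norm_neg, neg_sub]
  simp [h.norm_def]

/-- Cauchy sequences converge for a complete extended norm. -/
lemma EComplete.exists_tendsto {N : V → ℝ≥0∞} (hc : EComplete N) (h : IsENorm N) {u : ℕ → V}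
    (hu : ∀ k, N (u k) < ⊤)
    (hC : ∀ ε > (0 : ℝ), ∃ K, ∀ k ≥ K, ∀ l ≥ K, N (u k - u l) ≤ ENNReal.ofReal ε) :
    ∃ x, N x < ⊤ ∧ Tendsto (fun k => N (u k - x)) atTop (𝓝 0) := by
  have := h.completeSpace hc
  let v : ℕ → h.space := fun k => ⟨u k, hu k⟩
  have hv : CauchySeq v := by
    refine Metric.cauchySeq_iff.2 fun ε hε => ?_
    obtain ⟨K, hK⟩ := hC (ε / 2) (by positivity)
    refine ⟨K, fun k hk l hl => ?_⟩
    rw [dist_eq_norm, h.norm_def]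
    have := ENNReal.toReal_mono ENNReal.ofReal_ne_top (hK k hk l hl)
    rw [ENNReal.toReal_ofReal (by positivity)] at this
    exact lt_of_le_of_lt this (by linarith)
  obtain ⟨x, hx⟩ := cauchySeq_tendsto_of_complete hv
  refine ⟨x, x.2, ?_⟩
  have h2 := tendsto_iff_norm_sub_tendsto_zero.1 hx
  have h3 := ENNReal.tendsto_ofReal h2
  rw [ENNReal.ofReal_zero] at h3
  refine (tendsto_congr fun k => ?_).1 h3
  rw [ofReal_norm, h.enorm_eq]; rfl

omit [Module ℝ V] in
lemma sumENorm_le_left {N₀ N₁ : V → ℝ≥0∞} (h₁ : N₁ 0 = 0) (v : V) : sumENorm N₀ N₁ v ≤ N₀ v :=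
  (iInf_le _ v).trans (by simp [h₁])

/-- Only couples whose second space lies in the first occur, such as W^{m+1}_p in W^m_p, and then
the sum of the couple is its first space. This removes the infimum from the conditions on admissible
functions. -/
lemma sumENorm_eq_left {N₀ N₁ : V → ℝ≥0∞} (h₀ : IsENorm N₀) (h₁ : N₁ 0 = 0)
    (h : ∀ v, N₀ v ≤ N₁ v) : sumENorm N₀ N₁ = N₀ := by
  ext v
  refine le_antisymm (sumENorm_le_left h₁ v) (le_iInf fun a => ?_)
  calc N₀ v = N₀ (a + (v - a)) := by congr 1; abel
    _ ≤ _ := (h₀.add_le _ _).trans (by gcongr; exact h _)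

/-- Two extended seminorms, the second of which dominates the first. -/
structure IsOrderedCouple (N₀ N₁ : V → ℝ≥0∞) : Prop where
  left : IsENorm N₀
  right : IsENorm N₁
  le : ∀ v, N₀ v ≤ N₁ v

lemma IsOrderedCouple.sumENorm_eq {N₀ N₁ : V → ℝ≥0∞} (h : IsOrderedCouple N₀ N₁) :
    sumENorm N₀ N₁ = N₀ := sumENorm_eq_left h.left h.right.zero h.le

lemma IsENorm.complexified {N : V → ℝ≥0∞} (h : IsENorm N) : IsENorm (complexifiedENorm N) where
  zero := by simp [complexifiedENorm, h.zero]
  add_le v w := by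
    simp only [complexifiedENorm, Prod.fst_add, Prod.snd_add]
    calc _ ≤ (N v.1 + N w.1) + (N v.2 + N w.2) := add_le_add (h.add_le _ _) (h.add_le _ _)
      _ = _ := by ring
  smul_le c v := by
    simp only [complexifiedENorm, Prod.smul_fst, Prod.smul_snd, mul_add]
    exact add_le_add (h.smul_le _ _) (h.smul_le _ _)

lemma complexifiedSMul_add (c : ℂ) (v w : V × V) :
    complexifiedSMul c (v + w) = complexifiedSMul c v + complexifiedSMul c w := by
  simp only [complexifiedSMul, Prod.fst_add, Prod.snd_add, Prod.mk_add_mk, smul_add]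
  congr 1 <;> abel

lemma prodMap_complexifiedSMul (T : V →ₗ[ℝ] V') (c : ℂ) (v : V × V) :
    T.prodMap T (complexifiedSMul c v) = complexifiedSMul c (T.prodMap T v) := by
  simp [complexifiedSMul]

omit [AddCommGroup V] [Module ℝ V] in
lemma complexifiedENorm_mono {N N' : V → ℝ≥0∞} (h : ∀ v, N v ≤ N' v) (v : V × V) :
    complexifiedENorm N v ≤ complexifiedENorm N' v := add_le_add (h _) (h _)

/-- A decomposition of `v` is mapped to one of `T v`. The constant must be neither zero nor infinite
in order to pass through the infimum. -/
lemma sumENorm_map_le {N₀ N₁ : V → ℝ≥0∞} {N₀' N₁' : V' → ℝ≥0∞} (T : V →ₗ[ℝ] V') (M : ℝ≥0∞)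
    (hM0 : M ≠ 0) (hM : M ≠ ⊤)
    (h₀ : ∀ v, N₀' (T v) ≤ M * N₀ v) (h₁ : ∀ v, N₁' (T v) ≤ M * N₁ v) (v : V) :
    sumENorm N₀' N₁' (T v) ≤ M * sumENorm N₀ N₁ v := by
  rw [sumENorm, sumENorm, ENNReal.mul_iInf_of_ne hM0 hM]
  refine le_iInf fun a => (iInf_le _ (T a)).trans ?_
  rw [← map_sub, mul_add]
  exact add_le_add (h₀ _) (h₁ _)

lemma complexifiedENorm_map_le {N : V → ℝ≥0∞} {N' : V' → ℝ≥0∞} (T : V →ₗ[ℝ] V') (M : ℝ≥0∞)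
    (h : ∀ v, N' (T v) ≤ M * N v) (v : V × V) :
    complexifiedENorm N' (T.prodMap T v) ≤ M * complexifiedENorm N v := by
  simp only [complexifiedENorm, mul_add]
  exact add_le_add (h _) (h _)

lemma tendsto_zero_of_le_mul {ι : Type*} {l : Filter ι} {f g : ι → ℝ≥0∞} {M : ℝ≥0∞} (hM : M ≠ ⊤)
    (hg : Tendsto g l (𝓝 0)) (h : ∀ i, f i ≤ M * g i) : Tendsto f l (𝓝 0) := by
  have := ENNReal.Tendsto.const_mul (a := M) hg (Or.inr hM)
  rw [mul_zero] at this
  exact tendsto_of_tendsto_of_tendsto_of_le_of_le tendsto_const_nhds this (fun _ => zero_le) h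

/-- Bounded linear maps preserve admissible functions. -/
lemma IsCalderonFunction.map {N₀ N₁ : V → ℝ≥0∞} {N₀' N₁' : V' → ℝ≥0∞} {F : ℂ → V × V}
    (hF : IsCalderonFunction N₀ N₁ F) (T : V →ₗ[ℝ] V') {M : ℝ≥0} (hM0 : M ≠ 0)
    (h₀ : ∀ v, N₀' (T v) ≤ M * N₀ v) (h₁ : ∀ v, N₁' (T v) ≤ M * N₁ v) :
    IsCalderonFunction N₀' N₁' (fun z => T.prodMap T (F z)) := by
  have hs := sumENorm_map_le T (M : ℝ≥0∞) (by simpa using hM0) ENNReal.coe_ne_top h₀ h₁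
  refine ⟨?_, fun z hz => ?_, fun z hz => ?_, ?_, ?_, fun t => ?_, fun t => ?_⟩
  · obtain ⟨C, hC⟩ := hF.bounded
    exact ⟨M * C, fun z hz => (complexifiedENorm_map_le T M hs _).trans (by
      push_cast; gcongr; exact hC z hz)⟩
  · refine tendsto_zero_of_le_mul (M := M) ENNReal.coe_ne_top (hF.continuous z hz) fun w => ?_
    rw [← map_sub]
    exact complexifiedENorm_map_le T M hs _
  · obtain ⟨D, hD⟩ := hF.holomorphic z hz
    refine ⟨T.prodMap T D, tendsto_zero_of_le_mul (M := M) ENNReal.coe_ne_top hD fun w => ?_⟩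
    rw [← prodMap_complexifiedSMul, ← map_sub, ← map_sub, ← mul_div_assoc]
    gcongr
    exact complexifiedENorm_map_le T M hs _
  · obtain ⟨C, hC⟩ := hF.bounded_left
    exact ⟨M * C, fun t => (complexifiedENorm_map_le T M h₀ _).trans (by
      push_cast; gcongr; exact hC t)⟩
  · obtain ⟨C, hC⟩ := hF.bounded_right
    exact ⟨M * C, fun t => (complexifiedENorm_map_le T M h₁ _).trans (by
      push_cast; gcongr; exact hC t)⟩
  · refine tendsto_zero_of_le_mul (M := M) ENNReal.coe_ne_top (hF.continuous_left t) fun w => ?_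
    rw [← map_sub]
    exact complexifiedENorm_map_le T M h₀ _
  · refine tendsto_zero_of_le_mul (M := M) ENNReal.coe_ne_top (hF.continuous_right t) fun w => ?_
    rw [← map_sub]
    exact complexifiedENorm_map_le T M h₁ _

/-- The norm on the boundary of the strip of an admissible function. -/
def calderonENorm (N₀ N₁ : V → ℝ≥0∞) (F : ℂ → V × V) : ℝ≥0∞ :=
  max (⨆ t : ℝ, complexifiedENorm N₀ (F (t * Complex.I)))
    (⨆ t : ℝ, complexifiedENorm N₁ (F (1 + t * Complex.I)))

omit [AddCommGroup V] [Module ℝ V] in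
lemma calderonENorm_le {N₀ N₁ : V → ℝ≥0∞} {F : ℂ → V × V} {c : ℝ≥0∞} :
    calderonENorm N₀ N₁ F ≤ c ↔ (∀ t : ℝ, complexifiedENorm N₀ (F (t * Complex.I)) ≤ c) ∧
      ∀ t : ℝ, complexifiedENorm N₁ (F (1 + t * Complex.I)) ≤ c := by
  simp [calderonENorm]

lemma complexInterpolationENorm_le {N₀ N₁ : V → ℝ≥0∞} {θ : ℝ} {v : V} {F : ℂ → V × V}
    (hF : IsCalderonFunction N₀ N₁ F) (hv : F θ = (v, 0)) :
    complexInterpolationENorm N₀ N₁ θ v ≤ calderonENorm N₀ N₁ F :=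
  iInf_le_of_le F (iInf_le_of_le hF (iInf_le _ hv))

lemma le_complexInterpolationENorm {N₀ N₁ : V → ℝ≥0∞} {θ : ℝ} {v : V} {c : ℝ≥0∞}
    (h : ∀ F, IsCalderonFunction N₀ N₁ F → F θ = (v, 0) → c ≤ calderonENorm N₀ N₁ F) :
    c ≤ complexInterpolationENorm N₀ N₁ θ v :=
  le_iInf fun F => le_iInf fun hF => le_iInf fun hv => h F hF hv

lemma exists_calderon_of_lt {N₀ N₁ : V → ℝ≥0∞} {θ : ℝ} {v : V} {c : ℝ≥0∞}
    (h : complexInterpolationENorm N₀ N₁ θ v < c) :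
    ∃ F, IsCalderonFunction N₀ N₁ F ∧ F θ = (v, 0) ∧ calderonENorm N₀ N₁ F < c := by
  by_contra! hcon
  exact absurd h (not_lt.2 (le_complexInterpolationENorm hcon))

/-- Interpolation of bounded linear maps. -/
lemma complexInterpolationENorm_map_le {N₀ N₁ : V → ℝ≥0∞} {N₀' N₁' : V' → ℝ≥0∞}
    (T : V →ₗ[ℝ] V') {M : ℝ≥0} (hM0 : M ≠ 0)
    (h₀ : ∀ v, N₀' (T v) ≤ M * N₀ v) (h₁ : ∀ v, N₁' (T v) ≤ M * N₁ v) (θ : ℝ) (v : V) :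
    complexInterpolationENorm N₀' N₁' θ (T v) ≤ M * complexInterpolationENorm N₀ N₁ θ v := by
  have hM0' : (M : ℝ≥0∞) ≠ 0 := by simpa using hM0
  rw [mul_comm, ← ENNReal.div_le_iff hM0' ENNReal.coe_ne_top]
  refine le_complexInterpolationENorm fun F hF hv => ?_
  rw [ENNReal.div_le_iff hM0' ENNReal.coe_ne_top, mul_comm]
  refine (complexInterpolationENorm_le (hF.map T hM0 h₀ h₁) (v := T v) (by simp [hv])).trans ?_
  refine calderonENorm_le.2 ⟨fun t => ?_, fun t => ?_⟩
  · exact (complexifiedENorm_map_le T M h₀ _).trans (by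
      gcongr; exact (calderonENorm_le.1 le_rfl).1 t)
  · exact (complexifiedENorm_map_le T M h₁ _).trans (by
      gcongr; exact (calderonENorm_le.1 le_rfl).2 t)

lemma IsCalderonFunction.zero {N₀ N₁ : V → ℝ≥0∞} (h : IsOrderedCouple N₀ N₁) :
    IsCalderonFunction N₀ N₁ (fun _ => 0) := by
  have e0 := h.left.complexified.zero
  have e1 := h.right.complexified.zero
  refine ⟨⟨0, ?_⟩, ?_, fun z hz => ⟨0, ?_⟩, ⟨0, ?_⟩, ⟨0, ?_⟩, ?_, ?_⟩ <;>
    simp [h.sumENorm_eq, e0, e1, complexifiedSMul, show ((0 : V), (0 : V)) = 0 from rfl,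
      tendsto_const_nhds]

lemma IsCalderonFunction.add {N₀ N₁ : V → ℝ≥0∞} (h : IsOrderedCouple N₀ N₁) {F G : ℂ → V × V}
    (hF : IsCalderonFunction N₀ N₁ F) (hG : IsCalderonFunction N₀ N₁ G) :
    IsCalderonFunction N₀ N₁ (fun z => F z + G z) := by
  have a0 := h.left.complexified.add_le
  have a1 := h.right.complexified.add_le
  have key : ∀ {N : V × V → ℝ≥0∞} (_ : ∀ v w, N (v + w) ≤ N v + N w) {ι : Type} {l : Filter ι}
      {f g k : ι → V × V} (_ : ∀ i, k i = f i + g i), Tendsto (fun i => N (f i)) l (𝓝 0) →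
      Tendsto (fun i => N (g i)) l (𝓝 0) → Tendsto (fun i => N (k i)) l (𝓝 0) := by
    intro N hN ι l f g k hk hf hg
    have := hf.add hg
    rw [add_zero] at this
    exact tendsto_of_tendsto_of_tendsto_of_le_of_le tendsto_const_nhds this (fun _ => zero_le)
      (fun i => by rw [hk]; exact hN _ _)
  obtain ⟨C1, hC1⟩ := hF.bounded
  obtain ⟨C2, hC2⟩ := hG.bounded
  obtain ⟨C3, hC3⟩ := hF.bounded_left
  obtain ⟨C4, hC4⟩ := hG.bounded_left
  obtain ⟨C5, hC5⟩ := hF.bounded_right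
  obtain ⟨C6, hC6⟩ := hG.bounded_right
  have c1 := hF.continuous
  have c2 := hG.continuous
  have d1 := hF.holomorphic
  have d2 := hG.holomorphic
  rw [h.sumENorm_eq] at *
  refine ⟨⟨C1 + C2, fun z hz => ?_⟩, fun z hz => ?_, fun z hz => ?_, ⟨C3 + C4, fun t => ?_⟩,
    ⟨C5 + C6, fun t => ?_⟩, fun t => ?_, fun t => ?_⟩
  · rw [h.sumENorm_eq]
    exact (a0 _ _).trans (by push_cast; exact add_le_add (hC1 z hz) (hC2 z hz))
  · rw [h.sumENorm_eq]
    exact key a0 (fun w => add_sub_add_comm _ _ _ _) (c1 z hz) (c2 z hz)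
  · rw [h.sumENorm_eq]
    obtain ⟨D, hD⟩ := d1 z hz
    obtain ⟨D', hD'⟩ := d2 z hz
    refine ⟨D + D', ?_⟩
    have := hD.add hD'
    rw [add_zero] at this
    refine tendsto_of_tendsto_of_tendsto_of_le_of_le tendsto_const_nhds this (fun _ => zero_le)
      (fun w => ?_)
    rw [complexifiedSMul_add]
    simp only
    rw [← ENNReal.add_div]
    gcongr
    refine le_trans (le_of_eq ?_) (a0 _ _)
    congr 1
    abel
  · exact (a0 _ _).trans (by push_cast; exact add_le_add (hC3 t) (hC4 t))
  · exact (a1 _ _).trans (by push_cast; exact add_le_add (hC5 t) (hC6 t))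
  · exact key a0 (fun w => add_sub_add_comm _ _ _ _) (hF.continuous_left t) (hG.continuous_left t)
  · exact key a1 (fun w => add_sub_add_comm _ _ _ _) (hF.continuous_right t) (hG.continuous_right t)

lemma IsCalderonFunction.neg {N₀ N₁ : V → ℝ≥0∞} (h : IsOrderedCouple N₀ N₁) {F : ℂ → V × V}
    (hF : IsCalderonFunction N₀ N₁ F) : IsCalderonFunction N₀ N₁ (fun z => -F z) := by
  have := hF.map (-LinearMap.id : V →ₗ[ℝ] V) (M := 1) one_ne_zero (N₀' := N₀) (N₁' := N₁)
    (by simp [h.left.neg]) (by simp [h.right.neg])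
  exact this

lemma IsCalderonFunction.sum {N₀ N₁ : V → ℝ≥0∞} (h : IsOrderedCouple N₀ N₁) {F : ℕ → ℂ → V × V}
    (hF : ∀ k, IsCalderonFunction N₀ N₁ (F k)) (K : ℕ) :
    IsCalderonFunction N₀ N₁ (fun z => ∑ k ∈ Finset.range K, F k z) := by
  induction K with
  | zero => simpa using IsCalderonFunction.zero h
  | succ K ih => simpa only [Finset.sum_range_succ] using ih.add h (hF K)

/-- The complex interpolation norm is an extended norm. -/
lemma IsOrderedCouple.interpolation {N₀ N₁ : V → ℝ≥0∞} (h : IsOrderedCouple N₀ N₁) (θ : ℝ) :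
    IsENorm (complexInterpolationENorm N₀ N₁ θ) := by
  have h0 : complexInterpolationENorm N₀ N₁ θ 0 = 0 := by
    refine le_antisymm ((complexInterpolationENorm_le (IsCalderonFunction.zero h) rfl).trans ?_)
      zero_le
    refine calderonENorm_le.2 ⟨fun t => ?_, fun t => ?_⟩
    · exact h.left.complexified.zero.le
    · exact h.right.complexified.zero.le
  refine ⟨h0, fun v w => ?_, fun c v => ?_⟩
  · by_cases hv : complexInterpolationENorm N₀ N₁ θ v = ⊤
    · simp [hv]
    by_cases hw : complexInterpolationENorm N₀ N₁ θ w = ⊤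
    · simp [hw]
    refine ENNReal.le_of_forall_pos_le_add fun ε hε _ => ?_
    have hε2 : ((ε / 2 : ℝ≥0) : ℝ≥0∞) ≠ 0 := by simp [hε.ne']
    obtain ⟨F, hF, hFv, hFn⟩ := exists_calderon_of_lt (ENNReal.lt_add_right hv hε2)
    obtain ⟨G, hG, hGv, hGn⟩ := exists_calderon_of_lt (ENNReal.lt_add_right hw hε2)
    refine (complexInterpolationENorm_le (hF.add h hG) (by simp [hFv, hGv])).trans ?_
    have hsum : calderonENorm N₀ N₁ F + calderonENorm N₀ N₁ G ≤
        complexInterpolationENorm N₀ N₁ θ v + complexInterpolationENorm N₀ N₁ θ w + ε := by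
      refine (add_le_add hFn.le hGn.le).trans (le_of_eq ?_)
      rw [add_add_add_comm, ← ENNReal.coe_add, add_halves]
    refine le_trans (calderonENorm_le.2 ⟨fun t => ?_, fun t => ?_⟩) hsum
    · exact (h.left.complexified.add_le _ _).trans (add_le_add ((calderonENorm_le.1 le_rfl).1 t)
        ((calderonENorm_le.1 le_rfl).1 t))
    · exact (h.right.complexified.add_le _ _).trans (add_le_add ((calderonENorm_le.1 le_rfl).2 t)
        ((calderonENorm_le.1 le_rfl).2 t))
  · rcases eq_or_ne c 0 with rfl | hc
    · simp [h0]
    have := complexInterpolationENorm_map_le (N₀ := N₀) (N₁ := N₁) (N₀' := N₀) (N₁' := N₁)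
      (c • LinearMap.id : V →ₗ[ℝ] V) (M := ‖c‖₊) (by simpa using hc)
      (fun v => h.left.smul_le c v) (fun v => h.right.smul_le c v) θ v
    exact this

end ExtendedNorms

/-! ### Admissible functions as holomorphic functions, and the three lines theorem. -/

section Holomorphy

open Complex.HadamardThreeLines

variable {V : Type*} [AddCommGroup V] [Module ℝ V] {N₀ N₁ : V → ℝ≥0∞}
  {Z : Type*} [NormedAddCommGroup Z] [NormedSpace ℂ Z]

lemma enorm_tendsto_zero_iff {ι Z : Type*} [SeminormedAddCommGroup Z] {l : Filter ι} {f : ι → Z} :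
    Tendsto (fun i => ‖f i‖ₑ) l (𝓝 0) ↔ Tendsto f l (𝓝 0) := by
  rw [tendsto_zero_iff_norm_tendsto_zero]
  constructor
  · intro h
    have := (ENNReal.tendsto_toReal ENNReal.zero_ne_top).comp h
    simpa [Function.comp_def] using this
  · intro h
    have := ENNReal.tendsto_ofReal h
    simpa using this

/-- An admissible function becomes holomorphic after composition with a bounded linear map. -/
lemma IsCalderonFunction.diffContOnCl {F : ℂ → V × V} (hF : IsCalderonFunction N₀ N₁ F)
    (J : V × V →+ Z) (hJ : ∀ c v, J (complexifiedSMul c v) = c • J v) {C : ℝ≥0}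
    (hC : ∀ v, ‖J v‖ₑ ≤ C * complexifiedENorm (sumENorm N₀ N₁) v) :
    DiffContOnCl ℂ (fun z => J (F z)) (verticalStrip 0 1) ∧
      BddAbove ((norm ∘ fun z => J (F z)) '' verticalClosedStrip 0 1) := by
  have hcl : closure (verticalStrip 0 1) = {w : ℂ | w.re ∈ Icc (0 : ℝ) 1} := by
    rw [verticalStrip, Complex.closure_preimage_re, closure_Ioo zero_ne_one]; rfl
  refine ⟨⟨fun z hz => ?_, fun z hz => ?_⟩, ?_⟩
  · obtain ⟨D, hD⟩ := hF.holomorphic z hz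
    refine (HasDerivAt.differentiableAt (f' := J D) ?_).differentiableWithinAt
    rw [hasDerivAt_iff_tendsto_slope_zero, tendsto_iff_norm_sub_tendsto_zero,
      ← tendsto_zero_iff_norm_tendsto_zero, ← enorm_tendsto_zero_iff]
    refine tendsto_of_tendsto_of_tendsto_of_le_of_le' tendsto_const_nhds
      (tendsto_zero_of_le_mul (M := C) ENNReal.coe_ne_top hD (fun _ => le_rfl))
      (Eventually.of_forall fun _ => zero_le) ?_
    filter_upwards [self_mem_nhdsWithin] with h hh
    have hh0 : h ≠ 0 := hh
    have : h⁻¹ • (J (F (z + h)) - J (F z)) - J D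
        = h⁻¹ • J (F (z + h) - F z - complexifiedSMul h D) := by
      rw [map_sub, map_sub, hJ, smul_sub h⁻¹ _ (h • J D), smul_smul, inv_mul_cancel₀ hh0, one_smul]
    rw [this, enorm_smul, enorm_inv hh0, mul_comm, ← div_eq_mul_inv, ← mul_div_assoc]
    gcongr
    exact hC _
  · rw [hcl] at hz ⊢
    rw [ContinuousWithinAt, tendsto_iff_norm_sub_tendsto_zero,
      ← tendsto_zero_iff_norm_tendsto_zero, ← enorm_tendsto_zero_iff]
    refine tendsto_zero_of_le_mul (M := C) ENNReal.coe_ne_top (hF.continuous z hz) fun w => ?_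
    rw [← map_sub]; exact hC _
  · obtain ⟨B, hB⟩ := hF.bounded
    refine ⟨C * B, ?_⟩
    rintro _ ⟨z, hz, rfl⟩
    have : ‖J (F z)‖ₑ ≤ ((C * B : ℝ≥0) : ℝ≥0∞) := (hC _).trans (by
      push_cast; gcongr; exact hB z hz)
    exact_mod_cast enorm_le_coe.1 this

lemma rpow_one_sub_mul_rpow {b : ℝ} (hb : 0 < b) (x : ℝ) : b ^ (1 - x) * b ^ x = b := by
  rw [← Real.rpow_add hb]; simp

/-- The three lines theorem for admissible functions. -/
lemma IsCalderonFunction.norm_le {F : ℂ → V × V} (hF : IsCalderonFunction N₀ N₁ F)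
    (J : V × V →+ Z) (hJ : ∀ c v, J (complexifiedSMul c v) = c • J v) {C : ℝ≥0}
    (hC : ∀ v, ‖J v‖ₑ ≤ C * complexifiedENorm (sumENorm N₀ N₁) v) {a b : ℝ}
    (ha : ∀ t : ℝ, ‖J (F (t * Complex.I))‖ ≤ a) (hb : ∀ t : ℝ, ‖J (F (1 + t * Complex.I))‖ ≤ b)
    {z : ℂ} (hz : z.re ∈ Icc (0 : ℝ) 1) :
    ‖J (F z)‖ ≤ a ^ (1 - z.re) * b ^ z.re := by
  obtain ⟨h1, h2⟩ := hF.diffContOnCl J hJ hC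
  refine norm_le_interp_of_mem_verticalClosedStrip₀₁' (fun z => J (F z)) hz h1 h2 ?_ ?_
  · intro w hw
    have : w = (w.im : ℂ) * Complex.I := by
      apply Complex.ext <;> simp; exact hw
    rw [this]; exact ha _
  · intro w hw
    have : w = 1 + (w.im : ℂ) * Complex.I := by
      apply Complex.ext <;> simp; exact hw
    rw [this]; exact hb _

/-- A linear functional on the interpolation space of a couple. -/
lemma enorm_functional_le_complexInterpolation (T : V →ₗ[ℝ] ℝ) {M₀ M₁ : ℝ≥0} (hM₀ : 0 < M₀)
    (hM₁ : 0 < M₁) (h₀ : ∀ v, ‖T v‖ₑ ≤ M₀ * N₀ v) (h₁ : ∀ v, ‖T v‖ₑ ≤ M₁ * N₁ v) {θ : ℝ}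
    (hθ : θ ∈ Icc (0 : ℝ) 1) (v : V) :
    ‖T v‖ₑ ≤ ((M₀ ^ (1 - θ) * M₁ ^ θ : ℝ≥0) : ℝ≥0∞) * complexInterpolationENorm N₀ N₁ θ v := by
  have hc : ((M₀ ^ (1 - θ) * M₁ ^ θ : ℝ≥0) : ℝ≥0∞) ≠ 0 := by
    have := NNReal.rpow_pos (p := 1 - θ) hM₀
    have := NNReal.rpow_pos (p := θ) hM₁
    rw [ENNReal.coe_ne_zero]; positivity
  rw [mul_comm, ← ENNReal.div_le_iff hc ENNReal.coe_ne_top]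
  refine le_complexInterpolationENorm fun F hF hv => ?_
  rw [ENNReal.div_le_iff hc ENNReal.coe_ne_top, mul_comm]
  -- The complex linear extension v + iw ↦ T v + i T w to the complexification.
  let J : V × V →+ ℂ := LinearMap.toAddMonoidHom <| (Complex.ofRealLI.toLinearMap ∘ₗ T ∘ₗ LinearMap.fst ℝ V V) +
    (LinearMap.mulLeft ℝ Complex.I) ∘ₗ (Complex.ofRealLI.toLinearMap ∘ₗ T ∘ₗ LinearMap.snd ℝ V V)
  have hJv : ∀ v, J v = (T v.1 : ℂ) + Complex.I * T v.2 := fun v => rfl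
  have hJ : ∀ c v, J (complexifiedSMul c v) = c • J v := by
    intro c v
    rw [hJv, hJv]
    apply Complex.ext <;> simp [complexifiedSMul]
    ring
  have hJle : ∀ v, ‖J v‖ₑ ≤ ‖T v.1‖ₑ + ‖T v.2‖ₑ := by
    intro v
    rw [hJv]
    refine (enorm_add_le _ _).trans (le_of_eq ?_)
    congr 1
    · simp [← ofReal_norm]
    · simp [← ofReal_norm]
  -- Boundedness on the sum of the couple serves only as the a priori bound in the three lines
  -- theorem; the constant does not enter the result.
  have hTs : ∀ v, ‖T v‖ₑ ≤ (max M₀ M₁ : ℝ≥0) * sumENorm N₀ N₁ v := by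
    intro v
    rw [sumENorm, ENNReal.mul_iInf_of_ne (by
      rw [ENNReal.coe_ne_zero]; exact (lt_max_of_lt_left hM₀).ne') ENNReal.coe_ne_top]
    refine le_iInf fun a => ?_
    calc ‖T v‖ₑ = ‖T a + T (v - a)‖ₑ := by rw [← map_add]; congr 2; abel
      _ ≤ ‖T a‖ₑ + ‖T (v - a)‖ₑ := enorm_add_le _ _
      _ ≤ M₀ * N₀ a + M₁ * N₁ (v - a) := add_le_add (h₀ _) (h₁ _)
      _ ≤ (max M₀ M₁ : ℝ≥0) * N₀ a + (max M₀ M₁ : ℝ≥0) * N₁ (v - a) := by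
        gcongr
        · exact le_max_left _ _
        · exact le_max_right _ _
      _ = _ := by rw [mul_add]
  by_cases hB : calderonENorm N₀ N₁ F = ⊤
  · rw [hB, ENNReal.mul_top hc]; exact le_top
  lift calderonENorm N₀ N₁ F to ℝ≥0 using hB with B hBe
  have hB2 := calderonENorm_le.1 hBe.ge
  have hl : ∀ t : ℝ, ‖J (F (t * Complex.I))‖ ≤ M₀ * B := by
    intro t
    have : ‖J (F (t * Complex.I))‖ₑ ≤ ((M₀ * B : ℝ≥0) : ℝ≥0∞) := by
      refine (hJle _).trans ((add_le_add (h₀ _) (h₀ _)).trans ?_)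
      rw [← mul_add]; push_cast; gcongr; exact hB2.1 t
    exact_mod_cast enorm_le_coe.1 this
  have hr : ∀ t : ℝ, ‖J (F (1 + t * Complex.I))‖ ≤ M₁ * B := by
    intro t
    have : ‖J (F (1 + t * Complex.I))‖ₑ ≤ ((M₁ * B : ℝ≥0) : ℝ≥0∞) := by
      refine (hJle _).trans ((add_le_add (h₁ _) (h₁ _)).trans ?_)
      rw [← mul_add]; push_cast; gcongr; exact hB2.2 t
    exact_mod_cast enorm_le_coe.1 this
  have := hF.norm_le J hJ (C := max M₀ M₁) (fun v => (hJle v).trans (by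
    rw [complexifiedENorm, mul_add]; exact add_le_add (hTs _) (hTs _))) hl hr (z := (θ : ℂ))
    (by simpa using hθ)
  rw [hv, hJv] at this
  simp only [map_zero, Complex.ofReal_zero, mul_zero, add_zero, Complex.norm_real,
    Complex.ofReal_re] at this
  rw [← ENNReal.coe_mul, enorm_le_coe, ← NNReal.coe_le_coe]
  push_cast
  refine this.trans (le_of_eq ?_)
  rw [Real.mul_rpow M₀.coe_nonneg B.coe_nonneg, Real.mul_rpow M₁.coe_nonneg B.coe_nonneg]
  -- For B = 0 at least one of the exponents 1 - θ, θ is nonzero, so both sides vanish.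
  rcases eq_or_lt_of_le B.coe_nonneg with h0 | h0
  · have hB0 : (B : ℝ) = 0 := h0.symm
    rw [hB0, mul_zero]
    rcases eq_or_ne θ 0 with rfl | h
    · simp
    · rw [Real.zero_rpow h]; simp
  · have := rpow_one_sub_mul_rpow h0 θ
    linear_combination ((M₀ : ℝ) ^ (1 - θ) * (M₁ : ℝ) ^ θ) * this

/-- A bounded linear map from a couple to a normed space. -/
lemma enorm_le_complexInterpolation {Y : Type*} [NormedAddCommGroup Y] [NormedSpace ℝ Y]
    (T : V →ₗ[ℝ] Y) {M₀ M₁ : ℝ≥0} (hM₀ : 0 < M₀)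
    (hM₁ : 0 < M₁) (h₀ : ∀ v, ‖T v‖ₑ ≤ M₀ * N₀ v) (h₁ : ∀ v, ‖T v‖ₑ ≤ M₁ * N₁ v) {θ : ℝ}
    (hθ : θ ∈ Icc (0 : ℝ) 1) (v : V) :
    ‖T v‖ₑ ≤ ((M₀ ^ (1 - θ) * M₁ ^ θ : ℝ≥0) : ℝ≥0∞) * complexInterpolationENorm N₀ N₁ θ v := by
  -- A norming functional reduces the claim to scalar values.
  obtain ⟨g, hg, hgv⟩ := exists_dual_vector'' ℝ (T v)
  have hle : ∀ w, ‖(g.toLinearMap ∘ₗ T) w‖ₑ ≤ ‖T w‖ₑ := by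
    intro w
    rw [enorm_le_iff_norm_le]
    calc ‖g (T w)‖ ≤ ‖g‖ * ‖T w‖ := g.le_opNorm _
      _ ≤ 1 * ‖T w‖ := by gcongr
      _ = _ := one_mul _
  have := enorm_functional_le_complexInterpolation (g.toLinearMap ∘ₗ T) hM₀ hM₁
    (fun v => (hle v).trans (h₀ v)) (fun v => (hle v).trans (h₁ v)) hθ v
  convert this using 1
  simp [hgv]

end Holomorphy

/-! ### Completeness of complex interpolation spaces. -/

section Completeness


open Complex.HadamardThreeLines

variable {V : Type u} [AddCommGroup V] [Module ℝ V] {N₀ N₁ : V → ℝ≥0∞}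

/-- The complexification of a seminormed space embeds into a complex Banach space. -/
lemma IsENorm.exists_complex_embedding {V : Type u} [AddCommGroup V] [Module ℝ V]
    {N : V → ℝ≥0∞} (h : IsENorm N) :
    ∃ (Z : Type u) (_ : NormedAddCommGroup Z) (_ : NormedSpace ℂ Z) (_ : CompleteSpace Z)
      (J : V × V →+ Z), (∀ c v, J (complexifiedSMul c v) = c • J v) ∧
      (∀ v, ‖J v‖ₑ ≤ complexifiedENorm N v) ∧
      (∀ v : V × V, N v.1 < ⊤ → N v.2 < ⊤ → complexifiedENorm N v ≤ 2 * ‖J v‖ₑ) := by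
  obtain ⟨π₀, hπ₀⟩ := h.exists_proj
  let π : V →ₗ[ℝ] SeparationQuotient h.space :=
    (SeparationQuotient.mkCLM ℝ h.space).toLinearMap ∘ₗ π₀
  have hπ : ∀ v (hv : N v < ⊤), N v = ‖π v‖ₑ := by
    intro v hv
    have e : π₀ v = ⟨v, hv⟩ := hπ₀ ⟨v, hv⟩
    have : ‖π v‖ = ‖π₀ v‖ := SeparationQuotient.norm_mk _
    rw [← ofReal_norm, this, ofReal_norm, h.enorm_eq, e]
  -- The vector v + iw acts on the real dual by ℓ ↦ ℓ(v) + iℓ(w). The real linear maps from the dual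
  -- to ℂ form a complex Banach space, whether or not `N` is complete.
  let ev : SeparationQuotient h.space → ((SeparationQuotient h.space →L[ℝ] ℝ) →L[ℝ] ℂ) := fun x =>
    Complex.ofRealCLM.comp (ContinuousLinearMap.apply ℝ ℝ x)
  have hev : ∀ x ℓ, ev x ℓ = (ℓ x : ℂ) := fun x ℓ => rfl
  have hevn : ∀ x, ‖ev x‖ ≤ ‖x‖ := fun x =>
    ContinuousLinearMap.opNorm_le_bound _ (norm_nonneg _) fun ℓ => by
      rw [hev, Complex.norm_real, mul_comm]; exact ℓ.le_opNorm x
  let J : V × V →+ ((SeparationQuotient h.space →L[ℝ] ℝ) →L[ℝ] ℂ) :=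
    AddMonoidHom.mk' (fun v => ev (π v.1) + Complex.I • ev (π v.2)) fun v w => by
      ext ℓ
      change (ℓ (π (v.1 + w.1)) : ℂ) + Complex.I * ℓ (π (v.2 + w.2)) =
        ((ℓ (π v.1) : ℂ) + Complex.I * ℓ (π v.2)) + ((ℓ (π w.1) : ℂ) + Complex.I * ℓ (π w.2))
      simp only [map_add, Complex.ofReal_add]
      ring
  have hJ : ∀ v ℓ, J v ℓ = (ℓ (π v.1) : ℂ) + Complex.I * ℓ (π v.2) := fun v ℓ => rfl
  refine ⟨(SeparationQuotient h.space →L[ℝ] ℝ) →L[ℝ] ℂ, inferInstance, inferInstance, inferInstance, J,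
    fun c v => ?_, fun v => ?_, fun v h1 h2 => ?_⟩
  · ext ℓ
    change J _ ℓ = c * J v ℓ
    rw [hJ, hJ]
    simp only [complexifiedSMul, map_sub, map_add, map_smul, smul_eq_mul]
    apply Complex.ext <;> simp
    ring
  · by_cases h1 : N v.1 < ⊤
    · by_cases h2 : N v.2 < ⊤
      · have n1 := hπ v.1 h1
        have n2 := hπ v.2 h2
        have : ‖J v‖ ≤ ‖π v.1‖ + ‖π v.2‖ := by
          refine ContinuousLinearMap.opNorm_le_bound _ (by positivity) fun ℓ => ?_
          rw [hJ]
          refine (norm_add_le _ _).trans ?_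
          rw [norm_mul, Complex.norm_I, one_mul, Complex.norm_real, Complex.norm_real, add_mul,
            mul_comm ‖π v.1‖, mul_comm ‖π v.2‖]
          exact add_le_add (ℓ.le_opNorm _) (ℓ.le_opNorm _)
        rw [← ofReal_norm, complexifiedENorm, n1, n2, ← ofReal_norm, ← ofReal_norm,
          ← ENNReal.ofReal_add (norm_nonneg _) (norm_nonneg _)]
        exact ENNReal.ofReal_le_ofReal this
      · simp only [not_lt, top_le_iff] at h2
        simp [complexifiedENorm, h2]
    · simp only [not_lt, top_le_iff] at h1
      simp [complexifiedENorm, h1]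
  · have n1 := hπ v.1 h1
    have n2 := hπ v.2 h2
    -- Real and imaginary parts of J v ℓ are ℓ(v) and ℓ(w). Norming functionals chosen for each
    -- component give the lower bound, with the factor 2 for the sum.
    have key : ∀ ℓ : SeparationQuotient h.space →L[ℝ] ℝ, ‖ℓ‖ ≤ 1 →
        |ℓ (π v.1)| ≤ ‖J v‖ ∧ |ℓ (π v.2)| ≤ ‖J v‖ := by
      intro ℓ hℓ
      have h3 : ‖J v ℓ‖ ≤ ‖J v‖ := by
        refine ((J v).le_opNorm ℓ).trans ?_
        exact mul_le_of_le_one_right (norm_nonneg _) hℓ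
      have h4 := hJ v ℓ
      constructor
      · refine le_trans ?_ ((Complex.abs_re_le_norm _).trans h3)
        rw [h4]; simp
      · refine le_trans ?_ ((Complex.abs_im_le_norm _).trans h3)
        rw [h4]; simp
    obtain ⟨ℓ₁, hℓ₁, hv₁⟩ := exists_dual_vector'' ℝ (π v.1)
    obtain ⟨ℓ₂, hℓ₂, hv₂⟩ := exists_dual_vector'' ℝ (π v.2)
    have k1 := (key ℓ₁ hℓ₁).1
    have k2 := (key ℓ₂ hℓ₂).2
    rw [hv₁] at k1
    rw [hv₂] at k2
    rw [complexifiedENorm, two_mul, n1, n2]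
    refine add_le_add ?_ ?_ <;> rw [enorm_le_iff_norm_le]
    · simpa using k1
    · simpa using k2

set_option maxHeartbeats 1600000 in
/-- The complex interpolation space of a complete ordered couple is complete. -/
lemma IsOrderedCouple.complete_interpolation (h : IsOrderedCouple N₀ N₁) (hc₀ : EComplete N₀)
    (hc₁ : EComplete N₁) {θ : ℝ} (hθ : θ ∈ Ioo (0 : ℝ) 1) :
    EComplete (complexInterpolationENorm N₀ N₁ θ) := by
  intro u hu
  have hθ' : ((θ : ℂ)).re ∈ Icc (0 : ℝ) 1 := by simpa using ⟨hθ.1.le, hθ.2.le⟩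
  have := h.left.completeSpace hc₀
  obtain ⟨Z, _, _, _, J, hJsmul, hJle, hJge⟩ := h.left.exists_complex_embedding
  have hJle' : ∀ v, ‖J v‖ₑ ≤ (1 : ℝ≥0) * complexifiedENorm (sumENorm N₀ N₁) v := by
    intro v; rw [h.sumENorm_eq]; simpa using hJle v
  have hc01 : ∀ v, complexifiedENorm N₀ v ≤ complexifiedENorm N₁ v := complexifiedENorm_mono h.le
  have hC0 := h.left.complexified
  have hC1 := h.right.complexified
  have fin_of : ∀ {N : V → ℝ≥0∞} {v : V × V}, complexifiedENorm N v < ⊤ → N v.1 < ⊤ ∧ N v.2 < ⊤ :=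
    fun hv => ENNReal.add_lt_top.1 hv
  -- admissible functions for the terms of the series
  obtain ⟨ε, hε, hεs⟩ := ENNReal.exists_pos_sum_of_countable (one_ne_zero' ℝ≥0∞) ℕ
  set b : ℕ → ℝ≥0∞ := fun k => complexInterpolationENorm N₀ N₁ θ (u k) + ε k with hb
  have hbs : ∑' k, b k ≠ ⊤ := by
    rw [hb, ENNReal.tsum_add]
    exact ENNReal.add_ne_top.2 ⟨hu, (hεs.trans ENNReal.one_lt_top).ne⟩
  have hbt : ∀ k, b k ≠ ⊤ := ENNReal.ne_top_of_tsum_ne_top hbs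
  have hb0 : ∀ k, 0 < (b k).toReal := fun k => ENNReal.toReal_pos
    (by simp [hb, (hε k).ne']) (hbt k)
  have hbS : Summable fun k => (b k).toReal := ENNReal.summable_toReal hbs
  choose F hF hFθ hFb using fun k => exists_calderon_of_lt (N₀ := N₀) (N₁ := N₁) (θ := θ)
    (v := u k) (c := b k) (ENNReal.lt_add_right (ENNReal.ne_top_of_tsum_ne_top hu k)
      (by simpa using (hε k).ne'))
  have hFl : ∀ k (t : ℝ), complexifiedENorm N₀ (F k (t * Complex.I)) ≤ b k :=
    fun k t => (calderonENorm_le.1 (hFb k).le).1 t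
  have hFr : ∀ k (t : ℝ), complexifiedENorm N₁ (F k (1 + t * Complex.I)) ≤ b k :=
    fun k t => (calderonENorm_le.1 (hFb k).le).2 t
  have hFin : ∀ k (z : ℂ), z.re ∈ Icc (0 : ℝ) 1 → complexifiedENorm N₀ (F k z) < ⊤ := by
    intro k z hz
    obtain ⟨C, hC⟩ := (hF k).bounded
    have := hC z hz
    rw [h.sumENorm_eq] at this
    exact this.trans_lt ENNReal.coe_lt_top
  have toR : ∀ k (v : V × V), complexifiedENorm N₀ v ≤ b k → ‖J v‖ ≤ (b k).toReal := by
    intro k v hv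
    have := ENNReal.toReal_mono (hbt k) ((hJle v).trans hv)
    simpa using this
  -- The same bound holds on both boundary lines, so the three lines theorem carries it into the
  -- strip. The series then converges uniformly there.
  have hJF : ∀ k (z : ℂ), z.re ∈ Icc (0 : ℝ) 1 → ‖J (F k z)‖ ≤ (b k).toReal := by
    intro k z hz
    have := (hF k).norm_le J hJsmul hJle' (fun t => toR k _ (hFl k t))
      (fun t => toR k _ ((hc01 _).trans (hFr k t))) hz
    rwa [rpow_one_sub_mul_rpow (hb0 k)] at this
  -- the sum
  set G : ℂ → Z := fun z => ∑' k, J (F k z) with hG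
  have hGsum : ∀ z : ℂ, z.re ∈ Icc (0 : ℝ) 1 → HasSum (fun k => J (F k z)) (G z) := fun z hz =>
    (Summable.of_norm_bounded hbS (fun k => hJF k z hz)).hasSum
  have hGd : DifferentiableOn ℂ G (verticalStrip 0 1) := by
    refine Complex.differentiableOn_tsum_of_summable_norm hbS (fun k =>
      ((hF k).diffContOnCl J hJsmul hJle').1.1) (isOpen_Ioo.preimage Complex.continuous_re)
      (fun k w hw => hJF k w ⟨hw.1.le, hw.2.le⟩)
  have hcl : closure (verticalStrip 0 1) = {w : ℂ | w.re ∈ Icc (0 : ℝ) 1} := by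
    rw [verticalStrip, Complex.closure_preimage_re, closure_Ioo zero_ne_one]; rfl
  have hGc : ContinuousOn G {w : ℂ | w.re ∈ Icc (0 : ℝ) 1} := by
    refine continuousOn_tsum (fun k => ?_) hbS (fun k w hw => hJF k w hw)
    rw [← hcl]
    exact ((hF k).diffContOnCl J hJsmul hJle').1.2
  -- the range of the embedding is closed
  let Jr : h.left.space × h.left.space →+ Z :=
    J.comp (h.left.space.subtype.prodMap h.left.space.subtype).toAddMonoidHom
  have hJr : ∀ x, Jr x = J ((x.1 : V), (x.2 : V)) := fun x => rfl
  have hS : ∀ y : h.left.space, N₀ y ≠ ⊤ := fun y => (h.left.mem_space.1 y.2).ne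
  -- `Jr` is bounded above and below on a complete space. Limits of its values, such as `G` and the
  -- derivative of `G`, can therefore be lifted back to pairs of vectors.
  have hR : IsClosed (range Jr) := by
    have h1 : ∀ x, ‖Jr x‖ ≤ 2 * ‖x‖ := by
      intro x
      have h1 := ENNReal.toReal_mono (ENNReal.add_ne_top.2 ⟨hS x.1, hS x.2⟩)
        (hJle ((x.1 : V), (x.2 : V)))
      rw [ENNReal.toReal_add (hS x.1) (hS x.2)] at h1
      have h2 : ‖Jr x‖ ≤ ‖x.1‖ + ‖x.2‖ := by
        simpa [hJr, IsENorm.norm_def] using h1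
      linarith [norm_fst_le x, norm_snd_le x]
    have h2 : ∀ x, ‖x‖ ≤ (2 : ℝ≥0) * ‖Jr x‖ := by
      intro x
      have h1 := ENNReal.toReal_mono (by simp [ENNReal.mul_eq_top])
        (hJge ((x.1 : V), (x.2 : V)) x.1.2 x.2.2)
      simp only [complexifiedENorm] at h1
      rw [ENNReal.toReal_add (hS x.1) (hS x.2)] at h1
      have h2 : ‖x.1‖ + ‖x.2‖ ≤ 2 * ‖Jr x‖ := by
        simpa [hJr, IsENorm.norm_def] using h1
      rw [Prod.norm_def]
      have := norm_nonneg x.1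
      have := norm_nonneg x.2
      exact max_le (by push_cast; linarith) (by push_cast; linarith)
    have h3 : AntilipschitzWith 2 Jr := AddMonoidHomClass.antilipschitz_of_bound Jr h2
    exact h3.isClosed_range (AddMonoidHomClass.lipschitz_of_bound Jr 2 h1).uniformContinuous
  have hJmem : ∀ v : V × V, complexifiedENorm N₀ v < ⊤ → J v ∈ range Jr := fun v hv =>
    ⟨(⟨v.1, (fin_of hv).1⟩, ⟨v.2, (fin_of hv).2⟩), rfl⟩
  have hGR : ∀ z : ℂ, z.re ∈ Icc (0 : ℝ) 1 → G z ∈ range Jr := by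
    intro z hz
    refine hR.mem_of_tendsto (hGsum z hz).tendsto_sum_nat (Eventually.of_forall fun K => ?_)
    rw [← map_sum]
    refine hJmem _ ((hC0.sum_le _ _).trans_lt ?_)
    exact ENNReal.sum_lt_top.2 fun k _ => hFin k z hz
  -- the limits of the partial sums
  have hpart : ∀ (z : ℂ), z.re ∈ Icc (0 : ℝ) 1 → ∀ v : V × V,
      Tendsto (fun K => complexifiedENorm N₀ (v - ∑ k ∈ Finset.range K, F k z)) atTop (𝓝 0) →
      J v = G z := by
    intro z hz v hv
    have h1 : Tendsto (fun K => J v - ∑ k ∈ Finset.range K, J (F k z)) atTop (𝓝 0) := by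
      rw [← enorm_tendsto_zero_iff]
      refine tendsto_of_tendsto_of_tendsto_of_le_of_le tendsto_const_nhds hv (fun _ => zero_le)
        fun K => ?_
      rw [← map_sum, ← map_sub]
      exact hJle _
    have h2 := ((hGsum z hz).tendsto_sum_nat).const_sub (J v)
    exact sub_eq_zero.1 (tendsto_nhds_unique h2 h1)
  have hu0 : ∀ k, N₀ (u k) ≤ 2 * b k := fun k => by
    have h0 : N₀ (u k) < ⊤ := by
      have := hFin k θ hθ'
      rw [hFθ] at this
      exact (fin_of this).1
    have h1 := hJge (u k, 0) h0 (by simp [h.left.zero])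
    simp only [complexifiedENorm, h.left.zero, add_zero] at h1
    refine h1.trans ?_
    gcongr
    have h2 := hJF k θ hθ'
    rw [hFθ] at h2
    rw [← ofReal_norm, ← ENNReal.ofReal_toReal (hbt k)]
    exact ENNReal.ofReal_le_ofReal h2
  obtain ⟨x, hx⟩ := hc₀ u (ne_top_of_le_ne_top (b := ∑' k, 2 * b k) (by
    rw [ENNReal.tsum_mul_left]; exact ENNReal.mul_ne_top (by simp) hbs)
    (ENNReal.tsum_le_tsum hu0))
  have hxK : ∀ K, (x, (0 : V)) - ∑ k ∈ Finset.range K, F k θ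
      = (x - ∑ k ∈ Finset.range K, u k, 0) := fun K => by
    simp_rw [hFθ]
    ext <;> simp [Prod.fst_sum, Prod.snd_sum]
  have fin_lim : ∀ {N : V → ℝ≥0∞} (_ : IsENorm N) {v : ℕ → V} {y : V},
      Tendsto (fun K => N (y - ∑ k ∈ Finset.range K, v k)) atTop (𝓝 0) → (∀ k, N (v k) < ⊤) →
      N y < ⊤ := by
    intro N hN v y hy hv
    obtain ⟨K, hK⟩ := (hy.eventually (gt_mem_nhds (zero_lt_one' ℝ≥0∞))).exists
    have : y = (y - ∑ k ∈ Finset.range K, v k) + ∑ k ∈ Finset.range K, v k := by abel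
    rw [this]
    refine (hN.add_le _ _).trans_lt (ENNReal.add_lt_top.2 ⟨hK.trans ENNReal.one_lt_top, ?_⟩)
    exact (hN.sum_le _ _).trans_lt (ENNReal.sum_lt_top.2 fun k _ => hv k)
  -- `G` fixes a value only up to vectors of `N₀`-norm zero. On Re z = 1 the representative must be
  -- a limit for the stronger norm `N₁`, and at θ it must be (x, 0) exactly, not just up to a null
  -- vector.
  have hex : ∀ z : ℂ, ∃ v : V × V, (z.re ∈ Icc (0 : ℝ) 1 →
      (complexifiedENorm N₀ v < ⊤ ∧ J v = G z)) ∧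
      (z.re = 1 → Tendsto (fun K => complexifiedENorm N₁ (v - ∑ k ∈ Finset.range K, F k z))
        atTop (𝓝 0)) ∧ (z = θ → v = (x, 0)) := by
    intro z
    by_cases hz : z = θ
    · subst hz
      refine ⟨(x, 0), fun _ => ⟨?_, hpart _ hθ' _ ?_⟩, fun h1 => ?_, fun _ => rfl⟩
      · have := fin_lim h.left hx (fun k => (hu0 k).trans_lt
          (ENNReal.mul_lt_top (by simp) (hbt k).lt_top))
        simpa [complexifiedENorm, h.left.zero] using this
      · simp_rw [hxK]
        simpa [complexifiedENorm, h.left.zero] using hx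
      · exact absurd h1 (by simpa using hθ.2.ne)
    by_cases hz1 : z.re = 1
    · have hzs : z.re ∈ Icc (0 : ℝ) 1 := by rw [hz1]; simp
      have hzz : z = 1 + (z.im : ℂ) * Complex.I := by apply Complex.ext <;> simp [hz1]
      have hb1 : ∀ k, complexifiedENorm N₁ (F k z) ≤ b k := fun k => by
        rw [hzz]; exact hFr k _
      obtain ⟨y₁, hy₁⟩ := hc₁ (fun k => (F k z).1) (ne_top_of_le_ne_top hbs
        (ENNReal.tsum_le_tsum fun k => le_self_add.trans (hb1 k)))
      obtain ⟨y₂, hy₂⟩ := hc₁ (fun k => (F k z).2) (ne_top_of_le_ne_top hbs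
        (ENNReal.tsum_le_tsum fun k => le_add_self.trans (hb1 k)))
      have hy : Tendsto (fun K => complexifiedENorm N₁ ((y₁, y₂) - ∑ k ∈ Finset.range K, F k z))
          atTop (𝓝 0) := by
        have := hy₁.add hy₂
        rw [add_zero] at this
        simpa [complexifiedENorm, Prod.fst_sum, Prod.snd_sum] using this
      refine ⟨(y₁, y₂), fun _ => ⟨?_, hpart z hzs _ ?_⟩, fun _ => hy, fun h => absurd h hz⟩
      · refine (hc01 _).trans_lt ?_
        have k1 := fin_lim h.right hy₁ fun k => (le_self_add.trans (hb1 k)).trans_lt (hbt k).lt_top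
        have k2 := fin_lim h.right hy₂ fun k => (le_add_self.trans (hb1 k)).trans_lt (hbt k).lt_top
        exact ENNReal.add_lt_top.2 ⟨k1, k2⟩
      · exact tendsto_of_tendsto_of_tendsto_of_le_of_le tendsto_const_nhds hy (fun _ => zero_le)
          fun K => hc01 _
    · by_cases hzs : z.re ∈ Icc (0 : ℝ) 1
      · obtain ⟨⟨v, w⟩, hvw⟩ := hGR z hzs
        refine ⟨(v, w), fun _ => ⟨?_, hvw⟩, fun h => absurd h hz1, fun h => absurd h hz⟩
        exact ENNReal.add_lt_top.2 ⟨v.2, w.2⟩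
      · exact ⟨0, fun h => absurd h hzs, fun h => absurd h hz1, fun h => absurd h hz⟩
  choose f hf hf1 hfθ using hex
  -- the error of the partial sums
  have hJge' : ∀ v, complexifiedENorm N₀ v < ⊤ → complexifiedENorm N₀ v ≤ 2 * ‖J v‖ₑ :=
    fun v hv => hJge v (fin_of hv).1 (fin_of hv).2
  have hsubfin : ∀ v w, complexifiedENorm N₀ v < ⊤ → complexifiedENorm N₀ w < ⊤ →
      complexifiedENorm N₀ (v - w) < ⊤ := fun v w hv hw =>
    (hC0.sub_le v w).trans_lt (ENNReal.add_lt_top.2 ⟨hv, hw⟩)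
  set τ : ℕ → ℝ≥0∞ := fun K => ∑' k, b (k + K) with hτ
  have hτ0 : Tendsto τ atTop (𝓝 0) := ENNReal.tendsto_sum_nat_add b hbs
  have hτt : ∀ K, τ K ≠ ⊤ := fun K => ne_top_of_le_ne_top hbs
    (ENNReal.tsum_comp_le_tsum_of_injective (add_left_injective K) b)
  have herr : ∀ K (z : ℂ), z.re ∈ Icc (0 : ℝ) 1 →
      complexifiedENorm N₀ (f z - ∑ k ∈ Finset.range K, F k z) ≤ 2 * τ K := by
    intro K z hz
    have hfinS : complexifiedENorm N₀ (∑ k ∈ Finset.range K, F k z) < ⊤ :=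
      (hC0.sum_le _ _).trans_lt (ENNReal.sum_lt_top.2 fun k _ => hFin k z hz)
    refine (hJge' _ (hsubfin _ _ (hf z hz).1 hfinS)).trans ?_
    gcongr
    rw [map_sub, (hf z hz).2, map_sum]
    have h1 : G z - ∑ k ∈ Finset.range K, J (F k z) = ∑' k, J (F (k + K) z) := by
      simp only [hG]
      rw [← (hGsum z hz).summable.sum_add_tsum_nat_add K]; simp
    rw [h1]
    have h2 : Summable fun k => (b (k + K)).toReal := (summable_nat_add_iff K).2 hbS
    have h3 := tsum_of_norm_bounded h2.hasSum (fun k => hJF (k + K) z hz)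
    rw [← ofReal_norm]
    refine (ENNReal.ofReal_le_ofReal h3).trans (le_of_eq ?_)
    rw [hτ, ← ENNReal.tsum_toReal_eq (fun k => hbt _), ENNReal.ofReal_toReal (hτt K)]
  -- The tail from `K` to a later index `L` is bounded by `τ K` uniformly in `L`; then L → ∞.
  have herr1 : ∀ K (t : ℝ), complexifiedENorm N₁ (f (1 + t * Complex.I) -
      ∑ k ∈ Finset.range K, F k (1 + t * Complex.I)) ≤ τ K := by
    intro K t
    have h1 := (hf1 (1 + t * Complex.I) (by simp)).add_const (τ K)
    rw [zero_add] at h1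
    refine ge_of_tendsto h1 ?_
    filter_upwards [eventually_ge_atTop K] with L hL
    have h2 : f (1 + t * Complex.I) - ∑ k ∈ Finset.range K, F k (1 + t * Complex.I) =
        (f (1 + t * Complex.I) - ∑ k ∈ Finset.range L, F k (1 + t * Complex.I)) +
        ∑ k ∈ Finset.Ico K L, F k (1 + t * Complex.I) := by
      rw [Finset.sum_Ico_eq_sub _ hL]; abel
    rw [h2]
    refine (hC1.add_le _ _).trans ?_
    gcongr
    refine (hC1.sum_le _ _).trans ((Finset.sum_le_sum fun k _ => hFr k t).trans ?_)
    rw [Finset.sum_Ico_eq_sum_range]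
    simp_rw [add_comm K]
    exact ENNReal.sum_le_tsum _
  have hbd : ∀ z : ℂ, z.re ∈ Icc (0 : ℝ) 1 → complexifiedENorm N₀ (f z) ≤ 2 * τ 0 := fun z hz => by
    simpa using herr 0 z hz
  have hcont : ∀ z : ℂ, z.re ∈ Icc (0 : ℝ) 1 →
      Tendsto (fun w => complexifiedENorm N₀ (f w - f z))
        (𝓝[{w : ℂ | w.re ∈ Icc (0 : ℝ) 1}] z) (𝓝 0) := by
    intro z hz
    have h1 : Tendsto (fun w => ‖G w - G z‖ₑ) (𝓝[{w : ℂ | w.re ∈ Icc (0 : ℝ) 1}] z) (𝓝 0) := by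
      rw [enorm_tendsto_zero_iff]
      have := (hGc z hz).sub_const (G z)
      rwa [sub_self] at this
    refine tendsto_of_tendsto_of_tendsto_of_le_of_le' tendsto_const_nhds
      (tendsto_zero_of_le_mul (M := 2) (by simp) h1 (fun _ => le_rfl))
      (Eventually.of_forall fun _ => zero_le) ?_
    filter_upwards [self_mem_nhdsWithin] with w hw
    rw [← (hf w hw).2, ← (hf z hz).2, ← map_sub]
    exact hJge' _ (hsubfin _ _ (hf w hw).1 (hf z hz).1)
  have h2τ : 2 * τ 0 ≠ ⊤ := ENNReal.mul_ne_top (by simp) (hτt 0)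
  have hfC : IsCalderonFunction N₀ N₁ f := by
    refine ⟨⟨(2 * τ 0).toNNReal, fun z hz => ?_⟩, fun z hz => ?_, fun z hz => ?_,
      ⟨(2 * τ 0).toNNReal, fun t => ?_⟩, ⟨(τ 0).toNNReal, fun t => ?_⟩, fun t => ?_, fun t => ?_⟩
    · rw [ENNReal.coe_toNNReal h2τ, h.sumENorm_eq]; exact hbd z hz
    · rw [h.sumENorm_eq]; exact hcont z hz
    · rw [h.sumENorm_eq]
      have hzI : z.re ∈ Icc (0 : ℝ) 1 := ⟨hz.1.le, hz.2.le⟩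
      have hopen : IsOpen (verticalStrip 0 1) := isOpen_Ioo.preimage Complex.continuous_re
      have hd := ((hGd z hz).differentiableAt (hopen.mem_nhds hz)).hasDerivAt
      rw [hasDerivAt_iff_tendsto_slope_zero] at hd
      have hev : ∀ᶠ w in 𝓝[≠] (0 : ℂ), z + w ∈ verticalStrip 0 1 := by
        have : Tendsto (fun w => z + w) (𝓝[≠] (0 : ℂ)) (𝓝 z) := by
          have : Tendsto (fun w => z + w) (𝓝 (0 : ℂ)) (𝓝 (z + 0)) := tendsto_id.const_add z
          rw [add_zero] at this
          exact this.mono_left nhdsWithin_le_nhds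
        exact this.eventually (hopen.mem_nhds hz)
      have hsm : ∀ (c : ℂ) v, complexifiedENorm N₀ v < ⊤ →
          complexifiedENorm N₀ (complexifiedSMul c v) < ⊤ := by
        intro c v hv
        have e1 : v.1 ∈ h.left.space := (fin_of hv).1
        have e2 : v.2 ∈ h.left.space := (fin_of hv).2
        exact ENNReal.add_lt_top.2 ⟨h.left.space.sub_mem (h.left.space.smul_mem _ e1)
          (h.left.space.smul_mem _ e2), h.left.space.add_mem (h.left.space.smul_mem _ e1)
          (h.left.space.smul_mem _ e2)⟩
      -- Difference quotients of `G` lie in the closed range of `Jr`, hence so does their limit.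
      have hD : deriv G z ∈ range Jr := by
        refine hR.mem_of_tendsto hd ?_
        filter_upwards [hev] with w hw
        have hwI : (z + w).re ∈ Icc (0 : ℝ) 1 := ⟨hw.1.le, hw.2.le⟩
        rw [← (hf _ hwI).2, ← (hf z hzI).2, ← map_sub, ← hJsmul]
        exact hJmem _ (hsm _ _ (hsubfin _ _ (hf _ hwI).1 (hf z hzI).1))
      obtain ⟨⟨v, w⟩, hvw⟩ := hD
      have hDfin : complexifiedENorm N₀ ((v : V), (w : V)) < ⊤ := ENNReal.add_lt_top.2 ⟨v.2, w.2⟩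
      have hJD : J ((v : V), (w : V)) = deriv G z := hvw
      refine ⟨((v : V), (w : V)), ?_⟩
      have hd2 : Tendsto (fun t => ‖t⁻¹ • (G (z + t) - G z) - deriv G z‖ₑ) (𝓝[≠] 0) (𝓝 0) := by
        rw [enorm_tendsto_zero_iff]
        have := hd.sub_const (deriv G z)
        rwa [sub_self] at this
      refine tendsto_of_tendsto_of_tendsto_of_le_of_le' tendsto_const_nhds
        (tendsto_zero_of_le_mul (M := 2) (by simp) hd2 (fun _ => le_rfl))
        (Eventually.of_forall fun _ => zero_le) ?_
      filter_upwards [hev, self_mem_nhdsWithin] with t ht ht0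
      have ht0' : t ≠ 0 := ht0
      have htI : (z + t).re ∈ Icc (0 : ℝ) 1 := ⟨ht.1.le, ht.2.le⟩
      have h3 := hJge' _ (hsubfin _ _ (hsubfin _ _ (hf _ htI).1 (hf z hzI).1) (hsm t _ hDfin))
      rw [map_sub, map_sub, hJsmul, (hf _ htI).2, (hf z hzI).2, hJD] at h3
      have h4 : t⁻¹ • (G (z + t) - G z) - deriv G z = t⁻¹ • (G (z + t) - G z - t • deriv G z) := by
        rw [smul_sub t⁻¹ _ (t • deriv G z), smul_smul, inv_mul_cancel₀ ht0', one_smul]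
      rw [h4, enorm_smul, enorm_inv ht0']
      calc _ ≤ 2 * ‖G (z + t) - G z - t • deriv G z‖ₑ / ‖t‖ₑ := by gcongr
        _ = _ := by rw [div_eq_mul_inv]; ring
    · rw [ENNReal.coe_toNNReal h2τ]; exact hbd _ (by simp)
    · rw [ENNReal.coe_toNNReal (hτt 0)]; simpa using herr1 0 t
    · refine (hcont (t * Complex.I) (by simp)).comp (tendsto_nhdsWithin_iff.2 ⟨?_, ?_⟩)
      · exact (Continuous.tendsto (by fun_prop) t)
      · exact Eventually.of_forall fun r => by simp
    · rw [ENNReal.tendsto_nhds_zero]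
      intro δ hδ
      -- On Re z = 1 the partial sums approximate uniformly in `N₁`, and each of them is continuous
      -- there because it is admissible.
      have h4 : Tendsto (fun K => τ K + τ K) atTop (𝓝 0) := by simpa using hτ0.add hτ0
      obtain ⟨K, hK⟩ := ((ENNReal.tendsto_nhds_zero.1 h4) (δ / 2)
        (ENNReal.half_pos hδ.ne')).exists
      filter_upwards [(ENNReal.tendsto_nhds_zero.1
        ((IsCalderonFunction.sum h hF K).continuous_right t)) (δ / 2) (ENNReal.half_pos hδ.ne')]
        with r hr
      have h5 : f (1 + r * Complex.I) - f (1 + t * Complex.I) =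
          (f (1 + r * Complex.I) - ∑ k ∈ Finset.range K, F k (1 + r * Complex.I)) -
          (f (1 + t * Complex.I) - ∑ k ∈ Finset.range K, F k (1 + t * Complex.I)) +
          (∑ k ∈ Finset.range K, F k (1 + r * Complex.I) -
            ∑ k ∈ Finset.range K, F k (1 + t * Complex.I)) := by abel
      rw [h5]
      calc _ ≤ (τ K + τ K) + δ / 2 := (hC1.add_le _ _).trans (add_le_add
            ((hC1.sub_le _ _).trans (add_le_add (herr1 K r) (herr1 K t))) hr)
        _ ≤ δ / 2 + δ / 2 := by gcongr
        _ = δ := ENNReal.add_halves δ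
  refine ⟨x, tendsto_zero_of_le_mul (M := 2) (by simp) hτ0 fun K => ?_⟩
  have hK : IsCalderonFunction N₀ N₁ (fun z => f z - ∑ k ∈ Finset.range K, F k z) := by
    have := hfC.add h ((IsCalderonFunction.sum h hF K).neg h)
    simpa only [sub_eq_add_neg] using this
  refine (complexInterpolationENorm_le hK (v := x - ∑ k ∈ Finset.range K, u k) ?_).trans ?_
  · rw [hfθ _ rfl, hxK]
  · refine calderonENorm_le.2 ⟨fun t => herr K _ (by simp), fun t => (herr1 K t).trans ?_⟩
    rw [two_mul]; exact le_self_add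

end Completeness

/-! ### Weak derivatives: consistency, mollification and uniqueness. -/

section WeakDerivatives

variable {E : Type*} [NormedAddCommGroup E] [NormedSpace ℝ E]
  {X : Type*} [NormedAddCommGroup X] [NormedSpace ℝ X]

/-- A directional derivative commutes with iterated derivatives. -/
lemma iteratedFDeriv_fderiv_apply_comm (j : ℕ) {f : E → X} (hf : ContDiff ℝ (j + 1 : ℕ) f)
    (x v : E) (w : Fin j → E) :
    iteratedFDeriv ℝ j (fun y => fderiv ℝ f y v) x w =
      fderiv ℝ (fun y => iteratedFDeriv ℝ j f y w) x v := by
  induction j generalizing x with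
  | zero => simp
  | succ j ih =>
    have hf1 : ContDiff ℝ (j + 1 : ℕ) f := hf.of_le (by exact_mod_cast Nat.le_succ _)
    have hg : ContDiff ℝ 2 (fun y => iteratedFDeriv ℝ j f y (Fin.tail w)) :=
      (ContinuousMultilinearMap.apply ℝ (fun _ : Fin j => E) X (Fin.tail w)).contDiff.comp
        (hf.iteratedFDeriv_right (m := 2) (by exact_mod_cast (by omega)))
    have hd : ContDiff ℝ (j + 1 : ℕ) (fun y => fderiv ℝ f y v) :=
      (hf.fderiv_right (m := (j + 1 : ℕ)) le_rfl).clm_apply contDiff_const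
    have h1 : ∀ {g : E → X} (_ : ContDiff ℝ (j + 1 : ℕ) g) (y : E) (u : Fin (j + 1) → E),
        iteratedFDeriv ℝ (j + 1) g y u =
          fderiv ℝ (fun z => iteratedFDeriv ℝ j g z (Fin.tail u)) y (u 0) := by
      intro g hg y u
      rw [iteratedFDeriv_succ_apply_left]
      have hdiff : DifferentiableAt ℝ (iteratedFDeriv ℝ j g) y :=
        (hg.differentiable_iteratedFDeriv (by exact_mod_cast Nat.lt_succ_self j)) y
      have := ((ContinuousMultilinearMap.apply ℝ (fun _ : Fin j => E) X
        (Fin.tail u)).hasFDerivAt.comp y hdiff.hasFDerivAt).fderiv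
      change fderiv ℝ (fun z => iteratedFDeriv ℝ j g z (Fin.tail u)) y = _ at this
      rw [this]; rfl
    rw [h1 hd]
    have h2 : (fun z => iteratedFDeriv ℝ j (fun y => fderiv ℝ f y v) z (Fin.tail w)) =
        fun z => fderiv ℝ (fun y => iteratedFDeriv ℝ j f y (Fin.tail w)) z v := by
      ext z; exact ih hf1 z _
    have h3 : (fun y => iteratedFDeriv ℝ (j + 1) f y w) =
        fun y => fderiv ℝ (fun z => iteratedFDeriv ℝ j f z (Fin.tail w)) y (w 0) := by
      ext z; exact h1 hf1 z _
    rw [h2, h3]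
    -- Symmetry of the second derivative exchanges the directions `v` and `w 0`.
    have hs := (hg.contDiffAt (x := x)).isSymmSndFDerivAt (by simp)
    have hd2 : DifferentiableAt ℝ (fderiv ℝ (fun y => iteratedFDeriv ℝ j f y (Fin.tail w))) x :=
      (hg.fderiv_right (m := 1) (by norm_num)).differentiable one_ne_zero x
    have e : ∀ a b : E, fderiv ℝ (fun z => fderiv ℝ (fun y =>
        iteratedFDeriv ℝ j f y (Fin.tail w)) z a) x b =
        fderiv ℝ (fderiv ℝ (fun y => iteratedFDeriv ℝ j f y (Fin.tail w))) x b a := by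
      intro a b
      rw [fderiv_clm_apply hd2 (differentiableAt_const a)]
      simp
    rw [e, e]
    exact hs.eq _ _

lemma iteratedFDeriv_succ_apply_fderiv {j : ℕ} {g : E → X} (hg : ContDiff ℝ (j + 1 : ℕ) g) (y : E)
    (u : Fin (j + 1) → E) : iteratedFDeriv ℝ (j + 1) g y u =
      fderiv ℝ (fun z => iteratedFDeriv ℝ j g z (Fin.tail u)) y (u 0) := by
  rw [iteratedFDeriv_succ_apply_left]
  have hdiff : DifferentiableAt ℝ (iteratedFDeriv ℝ j g) y :=
    (hg.differentiable_iteratedFDeriv (by exact_mod_cast Nat.lt_succ_self j)) y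
  have := ((ContinuousMultilinearMap.apply ℝ (fun _ : Fin j => E) X
    (Fin.tail u)).hasFDerivAt.comp y hdiff.hasFDerivAt).fderiv
  change fderiv ℝ (fun z => iteratedFDeriv ℝ j g z (Fin.tail u)) y = _ at this
  rw [this]; rfl

lemma contDiff_iteratedFDeriv_apply {φ : E → X} (hφ : ContDiff ℝ ∞ φ) (j : ℕ) (m : Fin j → E) :
    ContDiff ℝ ∞ (fun x => iteratedFDeriv ℝ j φ x m) :=
  (ContinuousMultilinearMap.apply ℝ (fun _ : Fin j => E) X m).contDiff.comp
    (hφ.iteratedFDeriv_right (m := ∞) (by norm_cast))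

lemma hasCompactSupport_iteratedFDeriv_apply {φ : E → X} (hφ : HasCompactSupport φ) (j : ℕ)
    (m : Fin j → E) : HasCompactSupport (fun x => iteratedFDeriv ℝ j φ x m) :=
  (hφ.iteratedFDeriv (𝕜 := ℝ) j).comp_left (g := fun L : E [×j]→L[ℝ] X => L m) rfl

lemma iteratedFDeriv_sub_left {φ : E → X} (hφ : ContDiff ℝ ∞ φ) (j : ℕ) (x y : E)
    (m : Fin j → E) : iteratedFDeriv ℝ j (fun y => φ (x - y)) y m =
      (-1 : ℝ) ^ j • iteratedFDeriv ℝ j φ (x - y) m := by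
  have hφx : ContDiff ℝ ∞ (fun y => φ (x - y)) := hφ.comp (contDiff_const.sub contDiff_id)
  induction j generalizing y with
  | zero => simp
  | succ j ih =>
    rw [iteratedFDeriv_succ_apply_fderiv (hφx.of_le (by exact_mod_cast le_top)),
      iteratedFDeriv_succ_apply_fderiv (hφ.of_le (by exact_mod_cast le_top))]
    simp_rw [ih]
    have hψ := (contDiff_iteratedFDeriv_apply hφ j (Fin.tail m)).differentiable (by simp) (x - y)
    have h1 : HasFDerivAt (fun z : E => x - z) (-ContinuousLinearMap.id ℝ E) y := by
      simpa using (hasFDerivAt_id y).const_sub x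
    have h2 := ((hψ.hasFDerivAt.comp y h1).const_smul ((-1 : ℝ) ^ j)).fderiv
    simp only [Function.comp_def] at h2
    change fderiv ℝ (fun z => (-1 : ℝ) ^ j • iteratedFDeriv ℝ j φ (x - z) (Fin.tail m)) y = _ at h2
    rw [h2]
    simp [pow_succ]

variable [FiniteDimensional ℝ E] [MeasureSpace E] [BorelSpace E]
  [(volume : Measure E).IsAddHaarMeasure]

/-- Classical derivatives are weak derivatives. -/
lemma ContDiff.isWeakIteratedDeriv (j : ℕ) {f : E → X} (hf : ContDiff ℝ j f) :
    IsWeakIteratedDeriv j f (iteratedFDeriv ℝ j f) := by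
  induction j generalizing f with
  | zero => intro φ _ _ m; simp
  | succ j ih =>
    intro φ hφ hφc m
    have hfd : ContDiff ℝ j (fun y => fderiv ℝ f y (m 0)) :=
      (hf.fderiv_right (m := (j : ℕ)) le_rfl).clm_apply contDiff_const
    have hψ := contDiff_iteratedFDeriv_apply hφ j (Fin.tail m)
    have hψc := hasCompactSupport_iteratedFDeriv_apply hφc j (Fin.tail m)
    -- The induction hypothesis, applied to the derivative of `f` along `m 0`, accounts for the
    -- other directions; one integration by parts along `m 0` does the rest.
    have h1 := ih hfd φ hφ hφc (Fin.tail m)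
    have hf0 : Continuous f := hf.continuous
    have hψ' : Continuous fun x => fderiv ℝ (fun x => iteratedFDeriv ℝ j φ x (Fin.tail m)) x (m 0) :=
      (hψ.continuous_fderiv (by simp)).clm_apply continuous_const
    have ibp := integral_smul_fderiv_eq_neg_fderiv_smul_of_integrable (μ := (volume : Measure E))
      (f := fun x => iteratedFDeriv ℝ j φ x (Fin.tail m)) (g := f) (v := m 0)
      ((hψ'.smul hf0).integrable_of_hasCompactSupport
        ((hψc.fderiv_apply (𝕜 := ℝ) (m 0)).smul_right))
      ((hψ.continuous.smul hfd.continuous).integrable_of_hasCompactSupport hψc.smul_right)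
      ((hψ.continuous.smul hf0).integrable_of_hasCompactSupport hψc.smul_right)
      (fun x _ => hψ.differentiable (by simp) x)
      (fun x _ => hf.differentiable (by simp) x)
    rw [h1] at ibp
    have e1 : ∀ x, iteratedFDeriv ℝ (j + 1) φ x m =
        fderiv ℝ (fun x => iteratedFDeriv ℝ j φ x (Fin.tail m)) x (m 0) := fun x =>
      iteratedFDeriv_succ_apply_fderiv (hφ.of_le (by exact_mod_cast le_top)) x m
    have e2 : ∀ x, iteratedFDeriv ℝ (j + 1) f x m =
        iteratedFDeriv ℝ j (fun y => fderiv ℝ f y (m 0)) x (Fin.tail m) := fun x => by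
      rw [iteratedFDeriv_fderiv_apply_comm j hf, iteratedFDeriv_succ_apply_fderiv hf]
    simp_rw [e1, e2]
    rw [pow_succ, mul_neg_one, neg_smul, ibp, neg_neg]

/-- Derivatives of a convolution fall on the test function. -/
lemma iteratedFDeriv_convolution_apply {φ : E → ℝ} (hφ : ContDiff ℝ ∞ φ)
    (hφc : HasCompactSupport φ) {f : E → X} (hf : LocallyIntegrable f volume) (j : ℕ) (x : E)
    (m : Fin j → E) :
    iteratedFDeriv ℝ j (convolution φ f (ContinuousLinearMap.lsmul ℝ ℝ) volume) x m =
      ∫ t, iteratedFDeriv ℝ j φ t m • f (x - t) := by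
  have hc : ContDiff ℝ ∞ (convolution φ f (ContinuousLinearMap.lsmul ℝ ℝ) volume) :=
    hφc.contDiff_convolution_left _ hφ hf
  induction j generalizing x with
  | zero => simp [convolution]
  | succ j ih =>
    rw [iteratedFDeriv_succ_apply_fderiv (hc.of_le (by exact_mod_cast le_top))]
    simp_rw [ih]
    have hψ := contDiff_iteratedFDeriv_apply hφ j (Fin.tail m)
    have hψc := hasCompactSupport_iteratedFDeriv_apply hφc j (Fin.tail m)
    have h1 := (hψc.hasFDerivAt_convolution_left (ContinuousLinearMap.lsmul ℝ ℝ)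
      (hψ.of_le (by norm_cast)) hf x).fderiv
    have e1 : (fun z => ∫ t, iteratedFDeriv ℝ j φ t (Fin.tail m) • f (z - t)) =
      convolution (fun x => iteratedFDeriv ℝ j φ x (Fin.tail m)) f
        (ContinuousLinearMap.lsmul ℝ ℝ) volume := rfl
    rw [e1, h1, convolution]
    have hex := (hψc.fderiv (𝕜 := ℝ)).convolutionExists_left
      ((ContinuousLinearMap.lsmul ℝ ℝ : ℝ →L[ℝ] X →L[ℝ] X).precompL E)
      (hψ.continuous_fderiv (by simp)) hf x
    rw [ContinuousLinearMap.integral_apply hex]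
    refine integral_congr_ae (Eventually.of_forall fun t => ?_)
    simp only
    rw [iteratedFDeriv_succ_apply_fderiv (hφ.of_le (by exact_mod_cast le_top))]
    rfl

/-- Mollification commutes with weak derivatives. -/
lemma IsWeakIteratedDeriv.iteratedFDeriv_convolution [CompleteSpace X] {j : ℕ} {f : E → X}
    {G : E → E [×j]→L[ℝ] X} (h : IsWeakIteratedDeriv j f G) (hf : LocallyIntegrable f volume)
    (hG : LocallyIntegrable G volume) {φ : E → ℝ} (hφ : ContDiff ℝ ∞ φ)
    (hφc : HasCompactSupport φ) (x : E) :
    iteratedFDeriv ℝ j (convolution φ f (ContinuousLinearMap.lsmul ℝ ℝ) volume) x =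
      convolution φ G (ContinuousLinearMap.lsmul ℝ ℝ) volume x := by
  ext m
  rw [iteratedFDeriv_convolution_apply hφ hφc hf]
  have hex := hφc.convolutionExists_left (ContinuousLinearMap.lsmul ℝ ℝ) hφ.continuous hG x
  have e1 : convolution φ G (ContinuousLinearMap.lsmul ℝ ℝ) volume x m =
      ∫ t, φ t • G (x - t) m := by
    rw [convolution]
    exact ((ContinuousMultilinearMap.apply ℝ (fun _ : Fin j => E) X m).integral_comp_comm
      hex).symm
  rw [e1, ← integral_sub_left_eq_self _ volume x,
    ← integral_sub_left_eq_self (fun t => φ t • G (x - t) m) volume x]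
  simp only [sub_sub_cancel]
  have hφx : ContDiff ℝ ∞ (fun y => φ (x - y)) := hφ.comp (contDiff_const.sub contDiff_id)
  have hφxc : HasCompactSupport (fun y => φ (x - y)) :=
    hφc.comp_homeomorph (Homeomorph.subLeft x)
  have h1 := h _ hφx hφxc m
  -- The sign (-1)^j from differentiating φ(x - y) in y equals the sign in the definition of weak
  -- derivatives, so the two cancel.
  simp_rw [iteratedFDeriv_sub_left hφ] at h1
  simp_rw [smul_assoc] at h1
  rw [integral_smul] at h1
  have h2 : ((-1 : ℝ) ^ j) ≠ 0 := pow_ne_zero _ (by norm_num)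
  exact smul_right_injective _ h2 h1

/-- Weak derivatives are unique. -/
lemma IsWeakIteratedDeriv.ae_eq [CompleteSpace X] {j : ℕ} {f : E → X}
    {G G' : E → E [×j]→L[ℝ] X} (h : IsWeakIteratedDeriv j f G) (h' : IsWeakIteratedDeriv j f G')
    (hG : LocallyIntegrable G volume) (hG' : LocallyIntegrable G' volume) :
    G =ᵐ[volume] G' := by
  have hap : ∀ {H : E → E [×j]→L[ℝ] X} (m : Fin j → E), LocallyIntegrable H volume →
      LocallyIntegrable (fun x => H x m) volume := fun m hH x => by
    obtain ⟨s, hs, hi⟩ := hH x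
    exact ⟨s, hs, (ContinuousMultilinearMap.apply ℝ (fun _ : Fin j => E) X m).integrable_comp hi⟩
  have key : ∀ m : Fin j → E, ∀ᵐ x, G x m - G' x m = 0 := by
    intro m
    refine ae_eq_zero_of_integral_contDiff_smul_eq_zero ((hap m hG).sub (hap m hG')) ?_
    intro φ hφ hφc
    have e := (h φ hφ hφc m).symm.trans (h' φ hφ hφc m)
    have e' := smul_right_injective X (pow_ne_zero j (by norm_num : (-1 : ℝ) ≠ 0)) e
    simp_rw [smul_sub]
    rw [integral_sub, e', sub_self]
    · exact (hap m hG).integrable_smul_left_of_hasCompactSupport hφ.continuous hφc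
    · exact (hap m hG').integrable_smul_left_of_hasCompactSupport hφ.continuous hφc
  -- Each direction has its own null set; a countable dense set of directions gives a common one,
  -- and continuity extends the equality to all directions.
  have hall := ae_all_iff.2 fun i : ℕ => key (TopologicalSpace.denseSeq (Fin j → E) i)
  filter_upwards [hall] with x hx
  ext m
  have hcl : IsClosed {m : Fin j → E | G x m = G' x m} :=
    isClosed_eq (G x).cont (G' x).cont
  have := (TopologicalSpace.denseRange_denseSeq (Fin j → E)).induction_on (p := fun m =>
    G x m = G' x m) m hcl (fun i => sub_eq_zero.1 (hx i))
  exact this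

end WeakDerivatives

/-! ### Mollification on L_p. -/

section Mollification

variable {E : Type*} [NormedAddCommGroup E] [NormedSpace ℝ E] [FiniteDimensional ℝ E]
  [MeasureSpace E] [BorelSpace E] [(volume : Measure E).IsAddHaarMeasure]
  {X : Type*} [NormedAddCommGroup X] [NormedSpace ℝ X]
  {Y : Type*} [NormedAddCommGroup Y] {p : ℝ}

/-- Jensen's inequality, obtained from Hölder's inequality against the constant 1. -/
lemma lintegral_rpow_le_of_isProbabilityMeasure {α : Type*} [MeasurableSpace α] (ν : Measure α)
    [IsProbabilityMeasure ν] (hp : 1 < p) {F : α → ℝ≥0∞} (hF : AEMeasurable F ν) :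
    (∫⁻ t, F t ∂ν) ^ p ≤ ∫⁻ t, F t ^ p ∂ν := by
  have h := ENNReal.lintegral_mul_le_Lp_mul_Lq ν (Real.HolderConjugate.conjExponent hp) hF
    (aemeasurable_const (b := (1 : ℝ≥0∞)))
  simp only [Pi.mul_apply, mul_one, ENNReal.one_rpow, lintegral_const, measure_univ] at h
  calc (∫⁻ t, F t ∂ν) ^ p ≤ ((∫⁻ t, F t ^ p ∂ν) ^ (1 / p)) ^ p := by gcongr
    _ = _ := by
      rw [← ENNReal.rpow_mul, one_div, inv_mul_cancel₀ (by linarith), ENNReal.rpow_one]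

/-- Averages of translates do not increase the `L_p`-norm. -/
lemma eLpNorm_le_of_average (hp : 1 < p) (ν : Measure E) [IsProbabilityMeasure ν]
    {F : E → ℝ≥0∞} (hF : Measurable F) {g : E → Y} (h : ∀ x, ‖g x‖ₑ ≤ ∫⁻ t, F (x - t) ∂ν) :
    eLpNorm g (ENNReal.ofReal p) volume ≤ eLpNorm F (ENNReal.ofReal p) volume := by
  have hp0 : 0 < p := by linarith
  have h0 : ENNReal.ofReal p ≠ 0 := by simpa using hp0
  rw [eLpNorm_eq_lintegral_rpow_enorm_toReal h0 ENNReal.ofReal_ne_top,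
    eLpNorm_eq_lintegral_rpow_enorm_toReal h0 ENNReal.ofReal_ne_top,
    ENNReal.toReal_ofReal hp0.le]
  simp only [enorm_eq_self]
  gcongr ?_ ^ (1 / p)
  -- Jensen's inequality at each point, then Tonelli and translation invariance.
  calc ∫⁻ x, ‖g x‖ₑ ^ p ≤ ∫⁻ x, ∫⁻ t, F (x - t) ^ p ∂ν := by
        refine lintegral_mono fun x => ?_
        calc ‖g x‖ₑ ^ p ≤ (∫⁻ t, F (x - t) ∂ν) ^ p := by gcongr; exact h x
          _ ≤ _ := lintegral_rpow_le_of_isProbabilityMeasure ν hp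
            (hF.comp (measurable_const.sub measurable_id)).aemeasurable
    _ = ∫⁻ t, (∫⁻ x, F (x - t) ^ p) ∂ν := by
        refine lintegral_lintegral_swap (f := fun x t => F (x - t) ^ p) ?_
        exact ((hF.comp (measurable_fst.sub measurable_snd)).pow_const p).aemeasurable
    _ = ∫⁻ t, (∫⁻ x, F x ^ p) ∂ν := by
        refine lintegral_congr fun t => ?_
        exact lintegral_sub_right_eq_self (fun x => F x ^ p) t
    _ = _ := by simp

/-- A nonnegative test function of integral one, supported in the ball of radius `r`. -/
structure IsMollifier (φ : E → ℝ) (r : ℝ) : Prop where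
  smooth : ContDiff ℝ ∞ φ
  compact : HasCompactSupport φ
  nonneg : ∀ x, 0 ≤ φ x
  integral : ∫ x, φ x = 1
  support : ∀ x, φ x ≠ 0 → ‖x‖ ≤ r

/-- Convolution with a scalar function. -/
def mollify (φ : E → ℝ) (f : E → X) : E → X :=
  convolution φ f (ContinuousLinearMap.lsmul ℝ ℝ) volume

omit [NormedSpace ℝ E] [FiniteDimensional ℝ E] [BorelSpace E]
  [(volume : Measure E).IsAddHaarMeasure] in
lemma mollify_apply (φ : E → ℝ) (f : E → X) (x : E) : mollify φ f x = ∫ t, φ t • f (x - t) := rfl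

lemma mollify_congr_ae (φ : E → ℝ) {f g : E → X} (h : f =ᵐ[volume] g) :
    mollify φ f = mollify φ g := by
  ext x
  simp only [mollify_apply]
  refine integral_congr_ae ?_
  have := (quasiMeasurePreserving_sub_left_of_right_invariant (volume : Measure E) x).ae h
  filter_upwards [this] with t ht
  rw [ht]

namespace IsMollifier

variable {φ : E → ℝ} {r : ℝ} (hφ : IsMollifier φ r)
include hφ

lemma integrable : Integrable φ volume :=
  hφ.smooth.continuous.integrable_of_hasCompactSupport hφ.compact

lemma isProbabilityMeasure :
    IsProbabilityMeasure (volume.withDensity fun x => ENNReal.ofReal (φ x)) := by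
  constructor
  rw [withDensity_apply _ MeasurableSet.univ, Measure.restrict_univ,
    ← ofReal_integral_eq_lintegral_ofReal hφ.integrable
      (Eventually.of_forall hφ.nonneg), hφ.integral, ENNReal.ofReal_one]

lemma measurable_density : Measurable fun x => ENNReal.ofReal (φ x) :=
  hφ.smooth.continuous.measurable.ennreal_ofReal

lemma contDiff_mollify {f : E → X} (hf : LocallyIntegrable f volume) :
    ContDiff ℝ ∞ (mollify φ f) := hφ.compact.contDiff_convolution_left _ hφ.smooth hf

lemma exists_convolution {f : E → X} (hf : LocallyIntegrable f volume) (x : E) :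
    Integrable (fun t => φ t • f (x - t)) volume :=
  hφ.compact.convolutionExists_left (ContinuousLinearMap.lsmul ℝ ℝ) hφ.smooth.continuous hf x

/-- The measure with density φ is a probability measure, so mollification averages translates. -/
lemma eLpNorm_mollify_le (hp : 1 < p) {f : E → X} (hf : AEStronglyMeasurable f volume) :
    eLpNorm (mollify φ f) (ENNReal.ofReal p) volume ≤ eLpNorm f (ENNReal.ofReal p) volume := by
  have := hφ.isProbabilityMeasure
  rw [mollify_congr_ae φ hf.ae_eq_mk, eLpNorm_congr_ae hf.ae_eq_mk]
  have hm := hf.stronglyMeasurable_mk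
  have h := eLpNorm_le_of_average (g := mollify φ (hf.mk f)) hp
    (volume.withDensity fun x => ENNReal.ofReal (φ x))
    (F := fun x => ‖hf.mk f x‖ₑ) hm.enorm fun x => ?_
  · refine h.trans (le_of_eq ?_)
    exact eLpNorm_congr_enorm_ae (Eventually.of_forall fun x => by simp)
  · have hmx : Measurable fun t => ‖hf.mk f (x - t)‖ₑ :=
      hm.enorm.comp (measurable_const.sub measurable_id)
    rw [lintegral_withDensity_eq_lintegral_mul _ hφ.measurable_density hmx]
    refine (enorm_integral_le_lintegral_enorm _).trans (le_of_eq ?_)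
    refine lintegral_congr fun t => ?_
    simp only [Pi.mul_apply, ContinuousLinearMap.lsmul_apply, enorm_smul]
    rw [← ofReal_norm (φ t), Real.norm_of_nonneg (hφ.nonneg t)]

lemma memLp_mollify (hp : 1 < p) {f : E → X} (hf : MemLp f (ENNReal.ofReal p) volume) :
    MemLp (mollify φ f) (ENNReal.ofReal p) volume :=
  ⟨(hφ.contDiff_mollify (hf.locallyIntegrable (by simpa using hp.le))).continuous.aestronglyMeasurable,
    (hφ.eLpNorm_mollify_le hp hf.1).trans_lt hf.2⟩

/-- The difference h(x) - h(x - t) is the integral over s in (0, 1) of Dh(x - st) t, and |t| ≤ r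
where φ(t) ≠ 0. So the left side is dominated by an average of translates of r‖Dh‖. This is the
source of every gain of a power of 2^{-k} below. -/
lemma eLpNorm_sub_mollify_le [CompleteSpace X] (hp : 1 < p) {h : E → X} (hh : ContDiff ℝ 1 h) :
    eLpNorm (fun x => h x - mollify φ h x) (ENNReal.ofReal p) volume ≤
      ENNReal.ofReal r * eLpNorm (fderiv ℝ h) (ENNReal.ofReal p) volume := by
  have := hφ.isProbabilityMeasure
  -- A negative radius would force φ = 0, against its integral being one.
  have hr : 0 ≤ r := by
    by_contra hr
    have : φ = 0 := by
      ext x; by_contra hx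
      have := hφ.support x hx
      linarith [norm_nonneg x]
    have h1 := hφ.integral
    simp [this] at h1
  have hdc : Continuous (fderiv ℝ h) := hh.continuous_fderiv one_ne_zero
  set μ := volume.withDensity fun x : E => ENNReal.ofReal (φ x) with hμ
  have : IsProbabilityMeasure ((volume : Measure ℝ).restrict (Ioc 0 1)) := ⟨by simp⟩
  have hmeas : Measurable fun ts : E × ℝ => ts.2 • ts.1 := measurable_snd.smul measurable_fst
  -- The law of s t, for s uniform on (0, 1] and t with density φ.
  set ν := (μ.prod ((volume : Measure ℝ).restrict (Ioc 0 1))).map (fun ts : E × ℝ => ts.2 • ts.1)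
    with hν
  have : IsProbabilityMeasure ν := Measure.isProbabilityMeasure_map hmeas.aemeasurable
  have hFm : Measurable fun x => ENNReal.ofReal r * ‖fderiv ℝ h x‖ₑ :=
    (hdc.enorm.measurable).const_mul _
  have key := eLpNorm_le_of_average (g := fun x => h x - mollify φ h x) hp ν
    (F := fun x => ENNReal.ofReal r * ‖fderiv ℝ h x‖ₑ) hFm fun x => ?_
  · refine key.trans (le_of_eq ?_)
    have h1 : eLpNorm (fun x => ENNReal.ofReal r * ‖fderiv ℝ h x‖ₑ) (ENNReal.ofReal p) volume =
        eLpNorm (r • fderiv ℝ h) (ENNReal.ofReal p) volume := by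
      refine eLpNorm_congr_enorm_ae (Eventually.of_forall fun x => ?_)
      simp only [enorm_eq_self, Pi.smul_apply, enorm_smul]
      rw [← ofReal_norm r, Real.norm_of_nonneg hr]
    rw [h1]
    refine (eLpNorm_const_smul (𝕜 := ℝ) r (fderiv ℝ h) _ _).trans ?_
    rw [← ofReal_norm r, Real.norm_of_nonneg hr]
  · have hli : LocallyIntegrable h volume := hh.continuous.locallyIntegrable
    have e1 : h x - mollify φ h x = ∫ t, φ t • (h x - h (x - t)) := by
      simp_rw [smul_sub]
      rw [integral_sub (hφ.integrable.smul_const _) (hφ.exists_convolution hli x),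
        integral_smul_const, hφ.integral, one_smul, mollify_apply]
    have hFx : Measurable fun t => ENNReal.ofReal r * ‖fderiv ℝ h (x - t)‖ₑ :=
      hFm.comp (measurable_const.sub measurable_id)
    have hFts : Measurable fun ts : E × ℝ =>
        ENNReal.ofReal r * ‖fderiv ℝ h (x - ts.2 • ts.1)‖ₑ := hFx.comp hmeas
    rw [e1, hν, lintegral_map hFx hmeas, lintegral_prod _ hFts.aemeasurable,
      hμ, lintegral_withDensity_eq_lintegral_mul _ hφ.measurable_density
        (Measurable.lintegral_prod_right'
          (f := fun ts : E × ℝ => ENNReal.ofReal r * ‖fderiv ℝ h (x - ts.2 • ts.1)‖ₑ)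
          hFts)]
    refine (enorm_integral_le_lintegral_enorm _).trans (lintegral_mono fun t => ?_)
    simp only [Pi.mul_apply, enorm_smul]
    rw [← ofReal_norm (φ t), Real.norm_of_nonneg (hφ.nonneg t)]
    by_cases ht : φ t = 0
    · simp [ht]
    refine mul_le_mul_right ?_ _
    have htr := hφ.support t ht
    have hcurve : ∀ s : ℝ, HasDerivAt (fun s : ℝ => h (x - s • t))
        (-(fderiv ℝ h (x - s • t) t)) s := by
      intro s
      have h1 : HasDerivAt (fun s : ℝ => x - s • t) (-t) s := by
        simpa using ((hasDerivAt_id s).smul_const t).const_sub x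
      have h2 := ((hh.differentiable one_ne_zero (x - s • t)).hasFDerivAt).comp_hasDerivAt s h1
      rw [map_neg] at h2
      exact h2
    have hcc : Continuous fun s : ℝ => fderiv ℝ h (x - s • t) t :=
      (hdc.comp (by fun_prop)).clm_apply continuous_const
    have hftc := intervalIntegral.integral_eq_sub_of_hasDerivAt (a := 0) (b := 1)
      (fun s _ => hcurve s) (hcc.neg.intervalIntegrable _ _)
    have e2 : h x - h (x - t) = ∫ s in (0 : ℝ)..1, fderiv ℝ h (x - s • t) t := by
      rw [intervalIntegral.integral_neg] at hftc
      have := congrArg Neg.neg hftc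
      simpa using this.symm
    rw [e2, intervalIntegral.integral_of_le zero_le_one]
    refine (enorm_integral_le_lintegral_enorm _).trans (lintegral_mono fun s => ?_)
    simp only [Function.comp_def]
    calc ‖fderiv ℝ h (x - s • t) t‖ₑ ≤ ‖fderiv ℝ h (x - s • t)‖ₑ * ‖t‖ₑ :=
          ContinuousLinearMap.le_opENorm _ _
      _ ≤ ‖fderiv ℝ h (x - s • t)‖ₑ * ENNReal.ofReal r := by
          gcongr
          rw [← ofReal_norm]; exact ENNReal.ofReal_le_ofReal htr
      _ = _ := mul_comm _ _

end IsMollifier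

lemma eLpNorm_fderiv_lt_top {g : E → X} (hg : ContDiff ℝ ∞ g) (hgc : HasCompactSupport g)
    (q : ℝ≥0∞) : eLpNorm (fderiv ℝ g) q volume < ⊤ :=
  ((hg.continuous_fderiv (by simp)).memLp_of_hasCompactSupport (hgc.fderiv (𝕜 := ℝ))).2

lemma mollify_sub {φ : E → ℝ} {r : ℝ} (hφ : IsMollifier φ r) {f g : E → X}
    (hf : LocallyIntegrable f volume) (hg : LocallyIntegrable g volume) :
    mollify φ (f - g) = mollify φ f - mollify φ g := by
  ext x
  simp only [mollify_apply, Pi.sub_apply, smul_sub]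
  exact integral_sub (hφ.exists_convolution hf x) (hφ.exists_convolution hg x)

/-- Mollifications converge in `L_p`. -/
lemma tendsto_eLpNorm_mollify_sub [CompleteSpace X] (hp : 1 < p) {φ : ℕ → E → ℝ} {r : ℕ → ℝ}
    (hφ : ∀ k, IsMollifier (φ k) (r k)) (hr : Tendsto r atTop (𝓝 0)) {f : E → X}
    (hf : MemLp f (ENNReal.ofReal p) volume) :
    Tendsto (fun k => eLpNorm (mollify (φ k) f - f) (ENNReal.ofReal p) volume) atTop (𝓝 0) := by
  have hq : 1 ≤ ENNReal.ofReal p := by simpa using hp.le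
  rw [ENNReal.tendsto_nhds_zero]
  intro ε hε
  by_cases hεt : ε = ⊤
  · simp [hεt]
  have hε3 : 0 < (ε / 3).toReal := ENNReal.toReal_pos
    (ENNReal.div_pos hε.ne' (by simp)).ne' (ENNReal.div_lt_top hεt (by simp)).ne
  -- For a smooth compactly supported `g` the error is at most r_k ‖Dg‖; the difference f - g is
  -- handled by contractivity.
  obtain ⟨g, hgc, hg, hfg⟩ := hf.exist_eLpNorm_sub_le ENNReal.ofReal_ne_top hq hε3
  rw [ENNReal.ofReal_toReal (ENNReal.div_lt_top hεt (by simp)).ne] at hfg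
  have hgL : MemLp g (ENNReal.ofReal p) volume :=
    hg.continuous.memLp_of_hasCompactSupport hgc
  have hlim : Tendsto (fun k => ENNReal.ofReal (r k) *
      eLpNorm (fderiv ℝ g) (ENNReal.ofReal p) volume) atTop (𝓝 0) := by
    have := ENNReal.Tendsto.mul_const (b := eLpNorm (fderiv ℝ g) (ENNReal.ofReal p) volume)
      (ENNReal.tendsto_ofReal hr) (Or.inr (eLpNorm_fderiv_lt_top hg hgc _).ne)
    simpa using this
  filter_upwards [(ENNReal.tendsto_nhds_zero.1 hlim) (ε / 3)
    (ENNReal.div_pos hε.ne' (by simp))] with k hk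
  have hfgL := hf.sub hgL
  have e : mollify (φ k) f - f = mollify (φ k) (f - g) - (f - g) - (g - mollify (φ k) g) := by
    rw [mollify_sub (hφ k) (hf.locallyIntegrable hq) (hgL.locallyIntegrable hq)]; abel
  have hm1 := ((hφ k).memLp_mollify hp hfgL).1
  have hm2 := ((hφ k).memLp_mollify hp hgL).1
  rw [e]
  calc _ ≤ eLpNorm (mollify (φ k) (f - g)) (ENNReal.ofReal p) volume +
        eLpNorm (f - g) (ENNReal.ofReal p) volume +
        eLpNorm (g - mollify (φ k) g) (ENNReal.ofReal p) volume :=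
      (eLpNorm_sub_le (hm1.sub hfgL.1) (hgL.1.sub hm2) hq).trans (by
        gcongr; exact eLpNorm_sub_le hm1 hfgL.1 hq)
    _ ≤ ε / 3 + ε / 3 + ε / 3 := by
      gcongr
      · exact ((hφ k).eLpNorm_mollify_le hp hfgL.1).trans hfg
      · exact ((hφ k).eLpNorm_sub_mollify_le hp (hg.of_le (by norm_cast))).trans hk
    _ = ε := ENNReal.add_thirds ε

variable (E) in
/-- A standard mollifier. -/
lemma exists_isMollifier_one : ∃ η : E → ℝ, IsMollifier η 1 := by
  let b : ContDiffBump (0 : E) := ⟨1 / 2, 1, by norm_num, by norm_num⟩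
  refine ⟨b.normed volume, b.contDiff_normed, b.hasCompactSupport_normed, b.nonneg_normed,
    b.integral_normed, fun x hx => ?_⟩
  have : x ∈ Function.support (b.normed volume) := hx
  rw [b.support_normed_eq] at this
  simpa using (Metric.mem_ball.1 this).le

variable (E) in
/-- The standard mollifier at scale one. -/
def stdMollifier : E → ℝ := (exists_isMollifier_one E).choose

variable (E) in
lemma isMollifier_std : IsMollifier (stdMollifier E) 1 := (exists_isMollifier_one E).choose_spec

/-- The standard mollifier at scale `2 ^ (-k)`. -/
def scaledMollifier (k : ℕ) (x : E) : ℝ :=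
  ((2 : ℝ) ^ k) ^ (Module.finrank ℝ E) * stdMollifier E ((2 : ℝ) ^ k • x)

lemma isMollifier_scaled (k : ℕ) :
    IsMollifier (scaledMollifier (E := E) k) ((2 : ℝ) ^ k)⁻¹ := by
  have h := isMollifier_std E
  have h2 : (0 : ℝ) < 2 ^ k := by positivity
  refine ⟨?_, ?_, fun x => ?_, ?_, fun x hx => ?_⟩
  · exact contDiff_const.mul (h.smooth.comp (contDiff_const_smul _))
  · exact HasCompactSupport.mul_left (h.compact.comp_smul h2.ne')
  · exact mul_nonneg (by positivity) (h.nonneg _)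
  · unfold scaledMollifier
    rw [integral_const_mul, Measure.integral_comp_smul, h.integral, abs_of_pos (by positivity),
      smul_eq_mul, mul_one, mul_inv_cancel₀ (by positivity)]
  · have h1 : stdMollifier E ((2 : ℝ) ^ k • x) ≠ 0 := right_ne_zero_of_mul hx
    have h3 := h.support _ h1
    rw [norm_smul, Real.norm_of_nonneg h2.le] at h3
    rw [← one_div, le_div_iff₀ h2]; linarith

lemma tendsto_inv_two_pow : Tendsto (fun k : ℕ => ((2 : ℝ) ^ k)⁻¹) atTop (𝓝 0) :=
  (tendsto_pow_atTop_atTop_of_one_lt one_lt_two).inv_tendsto_atTop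

end Mollification

/-! ### Elementary facts on L_p in a form suited to fields of multilinear maps. -/

section LpNormed

variable {α Y : Type*} {mα : MeasurableSpace α} {μ : Measure α} [NormedAddCommGroup Y] {q : ℝ≥0∞}
  {f g : α → Y}

lemma memLp_add (hf : MemLp f q μ) (hg : MemLp g q μ) : MemLp (f + g) q μ := hf.add hg

lemma memLp_sub (hf : MemLp f q μ) (hg : MemLp g q μ) : MemLp (f - g) q μ := hf.sub hg

lemma memLp_zero : MemLp (0 : α → Y) q μ := MemLp.zero

lemma eLpNorm_pi_zero : eLpNorm (0 : α → Y) q μ = 0 := eLpNorm_zero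

lemma eLpNorm_add_le_of_memLp (hf : MemLp f q μ) (hg : MemLp g q μ) (hq : 1 ≤ q) :
    eLpNorm (f + g) q μ ≤ eLpNorm f q μ + eLpNorm g q μ := eLpNorm_add_le hf.1 hg.1 hq

end LpNormed

/-! ### The spaces W^m_p: jets of weak derivatives and completeness. -/

section SobolevJets

variable {E : Type*} [NormedAddCommGroup E] [NormedSpace ℝ E] [MeasureSpace E]
  {X : Type*} [NormedAddCommGroup X] [NormedSpace ℝ X] {p : ℝ} {m : ℕ}

/-- `G` is the family of weak derivatives up to order `m` of `f ∈ W^m_p(E, X)`. -/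
structure IsSobolevJet (m : ℕ) (p : ℝ) (f : E → X) (G : (j : ℕ) → E → E [×j]→L[ℝ] X) : Prop where
  memLp : MemLp f (ENNReal.ofReal p) volume
  deriv_memLp : ∀ j ≤ m, MemLp (G j) (ENNReal.ofReal p) volume
  weak : ∀ j ≤ m, IsWeakIteratedDeriv j f (G j)

lemma IsSobolevJet.le {f : E → X} {G : (j : ℕ) → E → E [×j]→L[ℝ] X} (h : IsSobolevJet m p f G) :
    sobolevNatENorm m p f ≤ ∑ j ∈ Finset.range (m + 1), eLpNorm (G j) (ENNReal.ofReal p) volume :=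
  iInf_le_of_le h.memLp <| iInf_le_of_le G <|
    iInf_le_of_le (fun j hj => ⟨h.deriv_memLp j hj, h.weak j hj⟩) le_rfl

lemma exists_isSobolevJet_of_lt {f : E → X} {c : ℝ≥0∞} (h : sobolevNatENorm m p f < c) :
    ∃ G : (j : ℕ) → E → E [×j]→L[ℝ] X, IsSobolevJet m p f G := by
  simp only [sobolevNatENorm, iInf_lt_iff] at h
  obtain ⟨hf, G, hG, -⟩ := h
  exact ⟨G, hf, fun j hj => (hG j hj).1, fun j hj => (hG j hj).2⟩

lemma IsSobolevJet.mono {f : E → X} {G : (j : ℕ) → E → E [×j]→L[ℝ] X} (h : IsSobolevJet m p f G)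
    {m' : ℕ} (hm : m' ≤ m) : IsSobolevJet m' p f G :=
  ⟨h.memLp, fun j hj => h.deriv_memLp j (hj.trans hm), fun j hj => h.weak j (hj.trans hm)⟩

lemma IsSobolevJet.congr_ae {f f' : E → X} {G : (j : ℕ) → E → E [×j]→L[ℝ] X}
    (h : IsSobolevJet m p f G) (hf : f =ᵐ[volume] f') : IsSobolevJet m p f' G := by
  refine ⟨h.memLp.ae_eq hf, h.deriv_memLp, fun j hj φ hφ hφc w => ?_⟩
  rw [← h.weak j hj φ hφ hφc w]
  refine integral_congr_ae ?_
  filter_upwards [hf] with x hx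
  rw [hx]

lemma sobolevNatENorm_congr_ae {f f' : E → X} (hf : f =ᵐ[volume] f') :
    sobolevNatENorm m p f = sobolevNatENorm m p f' := by
  have key : ∀ {f f' : E → X}, f =ᵐ[volume] f' →
      sobolevNatENorm m p f' ≤ sobolevNatENorm m p f := by
    intro f f' hf
    refine le_iInf fun h1 => le_iInf fun G => le_iInf fun h2 => ?_
    have h : IsSobolevJet m p f G := ⟨h1, fun j hj => (h2 j hj).1, fun j hj => (h2 j hj).2⟩
    exact (h.congr_ae hf).le
  exact le_antisymm (key hf.symm) (key hf)

variable [FiniteDimensional ℝ E] [BorelSpace E] [(volume : Measure E).IsAddHaarMeasure]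

lemma one_le_ofReal {p : ℝ} (hp : 1 < p) : 1 ≤ ENNReal.ofReal p := by simpa using hp.le

/-- Pairing a convergent sequence in `L_p` with a test function. -/
lemma tendsto_integral_smul_of_eLpNorm [CompleteSpace X] (hp : 1 < p) {ψ : E → ℝ}
    (hψ : Continuous ψ) (hψc : HasCompactSupport ψ) {F : ℕ → E → X} {F' : E → X}
    (hF : ∀ k, MemLp (F k) (ENNReal.ofReal p) volume) (hF' : MemLp F' (ENNReal.ofReal p) volume)
    (h : Tendsto (fun k => eLpNorm (F k - F') (ENNReal.ofReal p) volume) atTop (𝓝 0)) :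
    Tendsto (fun k => ∫ x, ψ x • F k x) atTop (𝓝 (∫ x, ψ x • F' x)) := by
  have hq := one_le_ofReal hp
  have hi : ∀ {g : E → X}, MemLp g (ENNReal.ofReal p) volume →
      Integrable (fun x => ψ x • g x) volume := fun hg =>
    (hg.locallyIntegrable hq).integrable_smul_left_of_hasCompactSupport hψ hψc
  refine tendsto_integral_of_L1' _ (hi hF').aestronglyMeasurable (Eventually.of_forall fun k => hi (hF k)) ?_
  -- Hölder's inequality, with ψ in the L-space of the conjugate exponent.
  have := (Real.HolderConjugate.conjExponent hp).symm.ennrealOfReal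
  have hψq : MemLp ψ (ENNReal.ofReal p.conjExponent) volume := hψ.memLp_of_hasCompactSupport hψc
  refine tendsto_zero_of_le_mul hψq.2.ne h (fun k => ?_)
  have e : ((fun x => ψ x • F k x) - fun x => ψ x • F' x) = ψ • (F k - F') := by
    ext x; simp [smul_sub]
  rw [e]
  exact eLpNorm_smul_le_mul_eLpNorm ((hF k).sub hF').1 hψq.1

lemma IsSobolevJet.ae_eq [CompleteSpace X] (hp : 1 < p) {f : E → X}
    {G G' : (j : ℕ) → E → E [×j]→L[ℝ] X} (h : IsSobolevJet m p f G) (h' : IsSobolevJet m p f G')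
    {j : ℕ} (hj : j ≤ m) : G j =ᵐ[volume] G' j :=
  (h.weak j hj).ae_eq (h'.weak j hj) ((h.deriv_memLp j hj).locallyIntegrable (one_le_ofReal hp))
    ((h'.deriv_memLp j hj).locallyIntegrable (one_le_ofReal hp))

/-- Jets of the same function agree almost everywhere, so the infimum over jets in `sobolevNatENorm`
is attained at any one of them. -/
lemma IsSobolevJet.eq [CompleteSpace X] (hp : 1 < p) {f : E → X}
    {G : (j : ℕ) → E → E [×j]→L[ℝ] X} (h : IsSobolevJet m p f G) :
    sobolevNatENorm m p f =
      ∑ j ∈ Finset.range (m + 1), eLpNorm (G j) (ENNReal.ofReal p) volume := by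
  refine le_antisymm h.le (le_iInf fun h1 => le_iInf fun G' => le_iInf fun h2 => ?_)
  have h' : IsSobolevJet m p f G' := ⟨h1, fun j hj => (h2 j hj).1, fun j hj => (h2 j hj).2⟩
  refine le_of_eq (Finset.sum_congr rfl fun j hj => eLpNorm_congr_ae (h.ae_eq hp h' ?_))
  exact Nat.lt_succ_iff.1 (Finset.mem_range.1 hj)

lemma IsSobolevJet.lt_top [CompleteSpace X] (hp : 1 < p) {f : E → X}
    {G : (j : ℕ) → E → E [×j]→L[ℝ] X} (h : IsSobolevJet m p f G) : sobolevNatENorm m p f < ⊤ := by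
  rw [h.eq hp, ENNReal.sum_lt_top]
  exact fun j hj => (h.deriv_memLp j (Nat.lt_succ_iff.1 (Finset.mem_range.1 hj))).2

lemma IsSobolevJet.eLpNorm_le [CompleteSpace X] (hp : 1 < p) {f : E → X}
    {G : (j : ℕ) → E → E [×j]→L[ℝ] X} (h : IsSobolevJet m p f G) {j : ℕ} (hj : j ≤ m) :
    eLpNorm (G j) (ENNReal.ofReal p) volume ≤ sobolevNatENorm m p f := by
  rw [h.eq hp]
  exact Finset.single_le_sum (f := fun j => eLpNorm (G j) (ENNReal.ofReal p) volume)
    (fun _ _ => zero_le) (Finset.mem_range.2 (Nat.lt_succ_iff.2 hj))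

lemma MemLp.isWeakIteratedDeriv_iteratedFDeriv_zero (f : E → X) :
    IsWeakIteratedDeriv 0 f (iteratedFDeriv ℝ 0 f) := by
  intro φ _ _ m; simp

lemma aestronglyMeasurable_iteratedFDeriv_zero {f : E → X} :
    AEStronglyMeasurable (iteratedFDeriv ℝ 0 f) (volume : Measure E) ↔
      AEStronglyMeasurable f (volume : Measure E) := by
  rw [iteratedFDeriv_zero_eq_comp]
  exact (continuousMultilinearCurryFin0 ℝ E X).symm.isometry.isEmbedding.aestronglyMeasurable_comp_iff

lemma eLpNorm_iteratedFDeriv_zero (f : E → X) (q : ℝ≥0∞) :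
    eLpNorm (iteratedFDeriv ℝ 0 f) q volume = eLpNorm f q volume :=
  eLpNorm_congr_norm_ae (Eventually.of_forall fun x => norm_iteratedFDeriv_zero)

lemma memLp_iteratedFDeriv_zero {f : E → X} {q : ℝ≥0∞} :
    MemLp (iteratedFDeriv ℝ 0 f) q (volume : Measure E) ↔ MemLp f q (volume : Measure E) := by
  rw [MemLp, MemLp, aestronglyMeasurable_iteratedFDeriv_zero, eLpNorm_iteratedFDeriv_zero]

lemma isSobolevJet_zero_iteratedFDeriv {f : E → X} (hf : MemLp f (ENNReal.ofReal p) volume) :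
    IsSobolevJet 0 p f (fun j => iteratedFDeriv ℝ j f) := by
  refine ⟨hf, fun j hj => ?_, fun j hj => ?_⟩ <;> obtain rfl := Nat.le_zero.1 hj
  · exact memLp_iteratedFDeriv_zero.2 hf
  · exact MemLp.isWeakIteratedDeriv_iteratedFDeriv_zero f

/-- The jet of a classically differentiable function. -/
lemma ContDiff.isSobolevJet {f : E → X} (hf : ContDiff ℝ m f)
    (h : ∀ j ≤ m, MemLp (iteratedFDeriv ℝ j f) (ENNReal.ofReal p) volume) :
    IsSobolevJet m p f (fun j => iteratedFDeriv ℝ j f) :=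
  ⟨memLp_iteratedFDeriv_zero.1 (h 0 (Nat.zero_le _)), h, fun j hj =>
    ContDiff.isWeakIteratedDeriv j (hf.of_le (by exact_mod_cast hj))⟩

lemma IsWeakIteratedDeriv.add [CompleteSpace X] {j : ℕ} {f f' : E → X}
    {G G' : E → E [×j]→L[ℝ] X}
    (h : IsWeakIteratedDeriv j f G) (h' : IsWeakIteratedDeriv j f' G')
    (hf : LocallyIntegrable f volume) (hf' : LocallyIntegrable f' volume)
    (hG : LocallyIntegrable G volume) (hG' : LocallyIntegrable G' volume) :
    IsWeakIteratedDeriv j (f + f') (G + G') := by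
  have hap : ∀ {H : E → E [×j]→L[ℝ] X} (m : Fin j → E), LocallyIntegrable H volume →
      LocallyIntegrable (fun x => H x m) volume := fun m hH x => by
    obtain ⟨s, hs, hi⟩ := hH x
    exact ⟨s, hs, (ContinuousMultilinearMap.apply ℝ (fun _ : Fin j => E) X m).integrable_comp hi⟩
  intro φ hφ hφc w
  have hψ := (contDiff_iteratedFDeriv_apply hφ j w).continuous
  have hψc := hasCompactSupport_iteratedFDeriv_apply hφc j w
  simp only [Pi.add_apply, smul_add, ContinuousMultilinearMap.add_apply]
  rw [integral_add, integral_add, h φ hφ hφc w, h' φ hφ hφc w, smul_add]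
  · exact (hap w hG).integrable_smul_left_of_hasCompactSupport hφ.continuous hφc
  · exact (hap w hG').integrable_smul_left_of_hasCompactSupport hφ.continuous hφc
  · exact hf.integrable_smul_left_of_hasCompactSupport hψ hψc
  · exact hf'.integrable_smul_left_of_hasCompactSupport hψ hψc

omit [FiniteDimensional ℝ E] [BorelSpace E] [(volume : Measure E).IsAddHaarMeasure] in
lemma IsWeakIteratedDeriv.const_smul {j : ℕ} {f : E → X} {G : E → E [×j]→L[ℝ] X}
    (h : IsWeakIteratedDeriv j f G) (c : ℝ) : IsWeakIteratedDeriv j (c • f) (c • G) := by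
  intro φ hφ hφc w
  simp only [Pi.smul_apply, ContinuousMultilinearMap.smul_apply]
  simp_rw [fun x => smul_comm (iteratedFDeriv ℝ j φ x w) c (f x), fun x => smul_comm (φ x) c (G x w)]
  rw [integral_smul, integral_smul, h φ hφ hφc w, smul_comm]

lemma IsSobolevJet.add [CompleteSpace X] (hp : 1 < p) {f f' : E → X}
    {G G' : (j : ℕ) → E → E [×j]→L[ℝ] X} (h : IsSobolevJet m p f G) (h' : IsSobolevJet m p f' G') :
    IsSobolevJet m p (f + f') (fun j => G j + G' j) :=
  by
  have hq := one_le_ofReal hp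
  constructor
  · exact h.memLp.add h'.memLp
  · intro j hj
    exact memLp_add (h.deriv_memLp j hj) (h'.deriv_memLp j hj)
  · intro j hj
    exact (h.weak j hj).add (h'.weak j hj) (h.memLp.locallyIntegrable hq)
      (h'.memLp.locallyIntegrable hq) ((h.deriv_memLp j hj).locallyIntegrable hq)
      ((h'.deriv_memLp j hj).locallyIntegrable hq)

omit [FiniteDimensional ℝ E] [BorelSpace E] [(volume : Measure E).IsAddHaarMeasure] in
lemma IsSobolevJet.const_smul {f : E → X} {G : (j : ℕ) → E → E [×j]→L[ℝ] X}
    (h : IsSobolevJet m p f G) (c : ℝ) : IsSobolevJet m p (c • f) (fun j => c • G j) :=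
  ⟨h.memLp.const_smul c, fun j hj => (h.deriv_memLp j hj).const_smul c, fun j hj =>
    (h.weak j hj).const_smul c⟩

lemma IsSobolevJet.sub [CompleteSpace X] (hp : 1 < p) {f f' : E → X}
    {G G' : (j : ℕ) → E → E [×j]→L[ℝ] X} (h : IsSobolevJet m p f G) (h' : IsSobolevJet m p f' G') :
    IsSobolevJet m p (f - f') (fun j => G j - G' j) := by
  have := h.add hp (h'.const_smul (-1))
  simpa [sub_eq_add_neg] using this

omit [FiniteDimensional ℝ E] [BorelSpace E] [(volume : Measure E).IsAddHaarMeasure] in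
lemma IsSobolevJet.zero : IsSobolevJet m p (0 : E → X) (fun _ => 0) :=
  ⟨memLp_zero, fun _ _ => memLp_zero, fun j _ φ _ _ w => by simp⟩

lemma isENorm_sobolevNatENorm [CompleteSpace X] (hp : 1 < p) :
    IsENorm (sobolevNatENorm (E := E) (X := X) m p) where
  zero := by
    rw [(IsSobolevJet.zero (m := m) (p := p) (E := E) (X := X)).eq hp]
    exact Finset.sum_eq_zero fun j _ => eLpNorm_pi_zero
  add_le f g := by
    by_cases hf : sobolevNatENorm m p f < ⊤
    swap; · rw [not_lt_top_iff.1 hf]; simp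
    by_cases hg : sobolevNatENorm m p g < ⊤
    swap; · rw [not_lt_top_iff.1 hg]; simp
    obtain ⟨F, hF⟩ := exists_isSobolevJet_of_lt hf
    obtain ⟨G, hG⟩ := exists_isSobolevJet_of_lt hg
    rw [hF.eq hp, hG.eq hp, ← Finset.sum_add_distrib]
    refine (hF.add hp hG).le.trans (Finset.sum_le_sum fun j hj => ?_)
    have hj' := Nat.lt_succ_iff.1 (Finset.mem_range.1 hj)
    exact eLpNorm_add_le_of_memLp (hF.deriv_memLp j hj') (hG.deriv_memLp j hj') (one_le_ofReal hp)
  smul_le c f := by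
    rcases eq_or_ne c 0 with rfl | hc
    · rw [zero_smul, (IsSobolevJet.zero (m := m) (p := p) (E := E) (X := X)).eq hp]
      exact (Finset.sum_eq_zero fun j _ => eLpNorm_pi_zero).le.trans zero_le
    by_cases hf : sobolevNatENorm m p f < ⊤
    swap; · rw [not_lt_top_iff.1 hf, ENNReal.mul_top (by simpa using hc)]; exact le_top
    obtain ⟨F, hF⟩ := exists_isSobolevJet_of_lt hf
    rw [hF.eq hp, Finset.mul_sum]
    exact (hF.const_smul c).le.trans (Finset.sum_le_sum fun j _ =>
      (eLpNorm_const_smul (𝕜 := ℝ) c (F j) _ _).le)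

lemma sobolevNatENorm_mono [CompleteSpace X] (hp : 1 < p) {m' : ℕ} (hm : m' ≤ m) (f : E → X) :
    sobolevNatENorm m' p f ≤ sobolevNatENorm m p f := by
  by_cases hf : sobolevNatENorm m p f < ⊤
  swap; · rw [not_lt_top_iff.1 hf]; exact le_top
  obtain ⟨F, hF⟩ := exists_isSobolevJet_of_lt hf
  rw [hF.eq hp, (hF.mono hm).eq hp]
  exact Finset.sum_le_sum_of_subset (Finset.range_subset_range.2 (by omega))

lemma sobolevNatENorm_zero_eq [CompleteSpace X] (hp : 1 < p) {f : E → X}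
    (hf : MemLp f (ENNReal.ofReal p) volume) :
    sobolevNatENorm 0 p f = eLpNorm f (ENNReal.ofReal p) volume := by
  rw [(isSobolevJet_zero_iteratedFDeriv hf).eq hp]
  simp [eLpNorm_iteratedFDeriv_zero]

lemma memLp_of_sobolevNatENorm_lt_top {f : E → X} (h : sobolevNatENorm m p f < ⊤) :
    MemLp f (ENNReal.ofReal p) volume := by
  obtain ⟨G, hG⟩ := exists_isSobolevJet_of_lt h
  exact hG.memLp

lemma eLpNorm_le_sobolevNatENorm [CompleteSpace X] (hp : 1 < p) (f : E → X) :
    eLpNorm f (ENNReal.ofReal p) volume ≤ sobolevNatENorm m p f := by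
  by_cases hf : sobolevNatENorm m p f < ⊤
  swap; · rw [not_lt_top_iff.1 hf]; exact le_top
  rw [← sobolevNatENorm_zero_eq hp (memLp_of_sobolevNatENorm_lt_top hf)]
  exact sobolevNatENorm_mono hp (Nat.zero_le _) f

lemma isOrderedCouple_sobolevNatENorm [CompleteSpace X] (hp : 1 < p) :
    IsOrderedCouple (sobolevNatENorm (E := E) (X := X) m p) (sobolevNatENorm (m + 1) p) :=
  ⟨isENorm_sobolevNatENorm hp, isENorm_sobolevNatENorm hp, fun f =>
    sobolevNatENorm_mono hp (Nat.le_succ _) f⟩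

/-- Both sides of the defining identity of a weak derivative are pairings with fixed test functions,
and these are continuous for convergence in L_p. -/
lemma IsSobolevJet.of_tendsto [CompleteSpace X] (hp : 1 < p) {f : ℕ → E → X} {f' : E → X}
    {G : ℕ → (j : ℕ) → E → E [×j]→L[ℝ] X} {G' : (j : ℕ) → E → E [×j]→L[ℝ] X}
    (h : ∀ k, IsSobolevJet m p (f k) (G k)) (hf' : MemLp f' (ENNReal.ofReal p) volume)
    (hG' : ∀ j ≤ m, MemLp (G' j) (ENNReal.ofReal p) volume)
    (hf : Tendsto (fun k => eLpNorm (f k - f') (ENNReal.ofReal p) volume) atTop (𝓝 0))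
    (hG : ∀ j ≤ m, Tendsto (fun k => eLpNorm (G k j - G' j) (ENNReal.ofReal p) volume) atTop (𝓝 0)) :
    IsSobolevJet m p f' G' := by
  refine ⟨hf', hG', fun j hj φ hφ hφc w => ?_⟩
  have h1 := tendsto_integral_smul_of_eLpNorm hp (contDiff_iteratedFDeriv_apply hφ j w).continuous
    (hasCompactSupport_iteratedFDeriv_apply hφc j w) (fun k => (h k).memLp) hf' hf
  have h2 := tendsto_integral_smul_of_eLpNorm hp hφ.continuous hφc
    (fun k => (h k).deriv_memLp j hj) (hG' j hj) (hG j hj)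
  have e : ∀ {H : E → E [×j]→L[ℝ] X}, MemLp H (ENNReal.ofReal p) volume →
      (∫ x, φ x • H x) w = ∫ x, φ x • H x w := fun hH =>
    ((ContinuousMultilinearMap.apply ℝ (fun _ : Fin j => E) X w).integral_comp_comm
      ((hH.locallyIntegrable (one_le_ofReal hp)).integrable_smul_left_of_hasCompactSupport
        hφ.continuous hφc)).symm
  have h3 := (((ContinuousMultilinearMap.apply ℝ (fun _ : Fin j => E) X w).continuous.tendsto
    _).comp h2).const_smul ((-1 : ℝ) ^ j)
  refine tendsto_nhds_unique h1 ?_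
  rw [← e (hG' j hj)]
  refine h3.congr fun k => ?_
  rw [(h k).weak j hj φ hφ hφc w, ← e ((h k).deriv_memLp j hj)]
  rfl

/-- `L_p` is complete, in terms of functions. -/
lemma exists_tendsto_eLpNorm_sum {Y : Type*} [NormedAddCommGroup Y] [CompleteSpace Y] (hp : 1 < p)
    {g : ℕ → E → Y} (hg : ∀ k, MemLp (g k) (ENNReal.ofReal p) volume)
    (hs : ∑' k, eLpNorm (g k) (ENNReal.ofReal p) volume ≠ ⊤) :
    ∃ g' : E → Y, MemLp g' (ENNReal.ofReal p) volume ∧ Tendsto (fun K =>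
      eLpNorm (∑ k ∈ Finset.range K, g k - g') (ENNReal.ofReal p) volume) atTop (𝓝 0) := by
  have : Fact (1 ≤ ENNReal.ofReal p) := ⟨one_le_ofReal hp⟩
  have hsum : Summable fun k => (hg k).toLp (g k) := by
    refine Summable.of_enorm ?_
    simpa [Lp.enorm_toLp] using hs
  have ht := hsum.hasSum.tendsto_sum_nat
  set l := ∑' k, (hg k).toLp (g k)
  refine ⟨l, Lp.memLp l, ?_⟩
  rw [tendsto_iff_edist_tendsto_0] at ht
  refine ht.congr fun K => ?_
  rw [Lp.edist_def]
  refine eLpNorm_congr_ae ?_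
  have h1 : ∀ K : ℕ, ⇑(∑ k ∈ Finset.range K, (hg k).toLp (g k)) =ᵐ[volume]
      ∑ k ∈ Finset.range K, g k := by
    intro K
    induction K with
    | zero => simpa using Lp.coeFn_zero Y (ENNReal.ofReal p) (volume : Measure E)
    | succ K ih =>
      rw [Finset.sum_range_succ, Finset.sum_range_succ]
      exact (Lp.coeFn_add _ _).trans (ih.add (hg K).coeFn_toLp)
  exact (h1 K).sub (EventuallyEq.refl _ _)

lemma IsSobolevJet.sum [CompleteSpace X] (hp : 1 < p) {f : ℕ → E → X}
    {G : ℕ → (j : ℕ) → E → E [×j]→L[ℝ] X} (h : ∀ k, IsSobolevJet m p (f k) (G k)) (K : ℕ) :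
    IsSobolevJet m p (∑ k ∈ Finset.range K, f k) (fun j => ∑ k ∈ Finset.range K, G k j) := by
  induction K with
  | zero => simpa using IsSobolevJet.zero
  | succ K ih =>
    simp only [Finset.sum_range_succ]
    exact ih.add hp (h K)

/-- The series of the functions and those of their derivatives of each order converge in L_p; the
limits form a jet by `IsSobolevJet.of_tendsto`. -/
lemma EComplete_sobolevNatENorm [CompleteSpace X] (hp : 1 < p) :
    EComplete (sobolevNatENorm (E := E) (X := X) m p) := by
  intro u hu
  have hlt : ∀ k, sobolevNatENorm m p (u k) < ⊤ := fun k => (ENNReal.ne_top_of_tsum_ne_top hu k).lt_top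
  choose G hG using fun k => exists_isSobolevJet_of_lt (hlt k)
  obtain ⟨f', hf', hf⟩ := exists_tendsto_eLpNorm_sum hp (fun k => (hG k).memLp)
    (ne_top_of_le_ne_top hu (ENNReal.tsum_le_tsum fun k => eLpNorm_le_sobolevNatENorm hp (u k)))
  have hH : ∀ j, ∃ g : E → E [×j]→L[ℝ] X, j ≤ m → MemLp g (ENNReal.ofReal p) volume ∧
      Tendsto (fun K => eLpNorm (∑ k ∈ Finset.range K, G k j - g) (ENNReal.ofReal p) volume)
        atTop (𝓝 0) := by
    intro j
    by_cases hj : j ≤ m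
    · obtain ⟨g, hg⟩ := exists_tendsto_eLpNorm_sum hp (fun k => (hG k).deriv_memLp j hj)
        (ne_top_of_le_ne_top hu (ENNReal.tsum_le_tsum fun k => (hG k).eLpNorm_le hp hj))
      exact ⟨g, fun _ => hg⟩
    · exact ⟨0, fun h => absurd h hj⟩
  choose H hH using hH
  have hJ : IsSobolevJet m p f' H := IsSobolevJet.of_tendsto hp (IsSobolevJet.sum hp hG) hf'
    (fun j hj => (hH j hj).1) hf (fun j hj => (hH j hj).2)
  refine ⟨f', ?_⟩
  have e : ∀ K, sobolevNatENorm m p (f' - ∑ k ∈ Finset.range K, u k) =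
      ∑ j ∈ Finset.range (m + 1),
        eLpNorm (∑ k ∈ Finset.range K, G k j - H j) (ENNReal.ofReal p) volume := by
    intro K
    rw [(isENorm_sobolevNatENorm hp).sub_comm, ((IsSobolevJet.sum hp hG K).sub hp hJ).eq hp]
  simp_rw [e]
  have := tendsto_finsetSum (Finset.range (m + 1)) fun j hj =>
    (hH j (Nat.lt_succ_iff.1 (Finset.mem_range.1 hj))).2
  simpa using this

end SobolevJets

/-! ### Density of smooth functions and extension of operators. -/

section SobolevExtension

variable {E : Type*} [NormedAddCommGroup E] [NormedSpace ℝ E] [FiniteDimensional ℝ E]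
  [MeasureSpace E] [BorelSpace E] [(volume : Measure E).IsAddHaarMeasure]
  {X : Type*} [NormedAddCommGroup X] [NormedSpace ℝ X] [CompleteSpace X] {p : ℝ} {m : ℕ}

lemma IsSobolevJet.iteratedFDeriv_mollify (hp : 1 < p) {f : E → X}
    {G : (j : ℕ) → E → E [×j]→L[ℝ] X} (h : IsSobolevJet m p f G) {φ : E → ℝ} {r : ℝ}
    (hφ : IsMollifier φ r) {j : ℕ} (hj : j ≤ m) :
    iteratedFDeriv ℝ j (mollify φ f) = mollify φ (G j) := by
  ext1 x
  exact (h.weak j hj).iteratedFDeriv_convolution (h.memLp.locallyIntegrable (one_le_ofReal hp))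
    ((h.deriv_memLp j hj).locallyIntegrable (one_le_ofReal hp)) hφ.smooth hφ.compact x

lemma IsSobolevJet.mollify (hp : 1 < p) {f : E → X}
    {G : (j : ℕ) → E → E [×j]→L[ℝ] X} (h : IsSobolevJet m p f G) {φ : E → ℝ} {r : ℝ}
    (hφ : IsMollifier φ r) :
    IsSobolevJet m p (mollify φ f) (fun j => _root_.mollify φ (G j)) := by
  have hc : ContDiff ℝ ∞ (_root_.mollify φ f) :=
    hφ.contDiff_mollify (h.memLp.locallyIntegrable (one_le_ofReal hp))
  refine ⟨hφ.memLp_mollify hp h.memLp, fun j hj => hφ.memLp_mollify hp (h.deriv_memLp j hj),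
    fun j hj => ?_⟩
  rw [← h.iteratedFDeriv_mollify hp hφ hj]
  exact ContDiff.isWeakIteratedDeriv j (hc.of_le (by exact_mod_cast le_top))

lemma sobolevNatENorm_mollify_le (hp : 1 < p) {φ : E → ℝ} {r : ℝ} (hφ : IsMollifier φ r)
    (f : E → X) : sobolevNatENorm m p (mollify φ f) ≤ sobolevNatENorm m p f := by
  by_cases hf : sobolevNatENorm m p f < ⊤
  swap; · rw [not_lt_top_iff.1 hf]; exact le_top
  obtain ⟨G, hG⟩ := exists_isSobolevJet_of_lt hf
  rw [(hG.mollify hp hφ).eq hp, hG.eq hp]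
  exact Finset.sum_le_sum fun j hj => hφ.eLpNorm_mollify_le hp
    (hG.deriv_memLp j (Nat.lt_succ_iff.1 (Finset.mem_range.1 hj))).1

lemma tendsto_sobolevNatENorm_mollify_sub (hp : 1 < p) {φ : ℕ → E → ℝ} {r : ℕ → ℝ}
    (hφ : ∀ k, IsMollifier (φ k) (r k)) (hr : Tendsto r atTop (𝓝 0)) {f : E → X}
    (hf : sobolevNatENorm m p f < ⊤) :
    Tendsto (fun k => sobolevNatENorm m p (mollify (φ k) f - f)) atTop (𝓝 0) := by
  obtain ⟨G, hG⟩ := exists_isSobolevJet_of_lt hf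
  have e : ∀ k, sobolevNatENorm m p (mollify (φ k) f - f) = ∑ j ∈ Finset.range (m + 1),
      eLpNorm (mollify (φ k) (G j) - G j) (ENNReal.ofReal p) volume := fun k =>
    ((hG.mollify hp (hφ k)).sub hp hG).eq hp
  simp_rw [e]
  have := tendsto_finsetSum (Finset.range (m + 1)) fun j hj =>
    tendsto_eLpNorm_mollify_sub hp hφ hr
      (hG.deriv_memLp j (Nat.lt_succ_iff.1 (Finset.mem_range.1 hj)))
  simpa using this

/-- Smooth functions are dense in `W^m_p`. -/
lemma exists_smooth_tendsto_sobolevNatENorm (hp : 1 < p) {f : E → X}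
    (hf : sobolevNatENorm m p f < ⊤) : ∃ g : ℕ → E → X, (∀ k, ContDiff ℝ ∞ (g k)) ∧
      (∀ k, sobolevNatENorm m p (g k) ≤ sobolevNatENorm m p f) ∧
      (∀ k, ∀ j ≤ m, MemLp (iteratedFDeriv ℝ j (g k)) (ENNReal.ofReal p) volume) ∧
      Tendsto (fun k => sobolevNatENorm m p (g k - f)) atTop (𝓝 0) := by
  obtain ⟨G, hG⟩ := exists_isSobolevJet_of_lt hf
  have hφ := isMollifier_scaled (E := E)
  refine ⟨fun k => mollify (scaledMollifier k) f, fun k => (hφ k).contDiff_mollify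
    (hG.memLp.locallyIntegrable (one_le_ofReal hp)), fun k => sobolevNatENorm_mollify_le hp (hφ k) f,
    fun k j hj => ?_, tendsto_sobolevNatENorm_mollify_sub hp hφ tendsto_inv_two_pow hf⟩
  rw [hG.iteratedFDeriv_mollify hp (hφ k) hj]
  exact (hφ k).memLp_mollify hp (hG.deriv_memLp j hj)

lemma eLpNorm_sub_eq_zero_of_tendsto (hp : 1 < p) {f g : E → X} {u : ℕ → E → X}
    (hu : ∀ k, MemLp (u k) (ENNReal.ofReal p) volume) (hfm : MemLp f (ENNReal.ofReal p) volume)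
    (hgm : MemLp g (ENNReal.ofReal p) volume)
    (hf : Tendsto (fun k => eLpNorm (u k - f) (ENNReal.ofReal p) volume) atTop (𝓝 0))
    (hg : Tendsto (fun k => eLpNorm (u k - g) (ENNReal.ofReal p) volume) atTop (𝓝 0)) :
    f =ᵐ[volume] g := by
  have h0 : eLpNorm (f - g) (ENNReal.ofReal p) volume = 0 := by
    refine le_antisymm (ge_of_tendsto' (x := atTop) (by simpa using hg.add hf) fun k => ?_) zero_le
    have e : f - g = (u k - g) - (u k - f) := by abel
    rw [e]
    exact eLpNorm_sub_le ((hu k).sub hgm).1 ((hu k).sub hfm).1 (one_le_ofReal hp)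
  have h1 := (eLpNorm_eq_zero_iff (hfm.sub hgm).1 (by simpa using zero_lt_one.trans hp)).1 h0
  filter_upwards [h1] with x hx
  exact sub_eq_zero.1 hx

variable {E' : Type*} [NormedAddCommGroup E'] [NormedSpace ℝ E'] [FiniteDimensional ℝ E']
  [MeasureSpace E'] [BorelSpace E'] [(volume : Measure E').IsAddHaarMeasure]
  {X' : Type*} [NormedAddCommGroup X'] [NormedSpace ℝ X'] [CompleteSpace X']

/-- An operator bounded on `L_p`, and bounded for the `W^m_p`-norms on smooth functions, is bounded
on `W^m_p`. -/
lemma sobolevNatENorm_map_le_of_smooth (hp : 1 < p) (T : (E → X) →ₗ[ℝ] (E' → X'))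
    {M₀ M : ℝ≥0} (h0 : ∀ f, sobolevNatENorm 0 p (T f) ≤ M₀ * sobolevNatENorm 0 p f)
    (h : ∀ f : E → X, ContDiff ℝ ∞ f →
      (∀ j ≤ m, MemLp (iteratedFDeriv ℝ j f) (ENNReal.ofReal p) volume) →
      sobolevNatENorm m p (T f) ≤ M * sobolevNatENorm m p f) (f : E → X) (hM : M ≠ 0) :
    sobolevNatENorm m p (T f) ≤ M * sobolevNatENorm m p f := by
  by_cases hf : sobolevNatENorm m p f < ⊤
  swap
  · rw [not_lt_top_iff.1 hf, ENNReal.mul_top (by simpa using hM)]; exact le_top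
  obtain ⟨g, hgc, hgle, hgm, hg⟩ := exists_smooth_tendsto_sobolevNatENorm hp hf
  have hN := isENorm_sobolevNatENorm (E := E) (X := X) (m := m) hp
  have hN' := isENorm_sobolevNatENorm (E := E') (X := X') (m := m) hp
  have hgN : ∀ k, sobolevNatENorm m p (g k) < ⊤ := fun k => (hgle k).trans_lt hf
  have hTg : ∀ k, sobolevNatENorm m p (T (g k)) ≤ M * sobolevNatENorm m p f := fun k =>
    (h _ (hgc k) (hgm k)).trans (by gcongr; exact hgle k)
  have htop : M * sobolevNatENorm m p f < ⊤ := ENNReal.mul_lt_top (by simp) hf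
  have hd : ∀ k l, sobolevNatENorm m p (T (g k) - T (g l)) ≤
      M * (sobolevNatENorm m p (g k - f) + sobolevNatENorm m p (g l - f)) := by
    intro k l
    have hkl : g k - g l = (g k - f) - (g l - f) := by abel
    rw [← map_sub]
    refine (h (g k - g l) ((hgc k).sub (hgc l)) fun j hj => ?_).trans ?_
    · have e : iteratedFDeriv ℝ j (g k - g l) = iteratedFDeriv ℝ j (g k) - iteratedFDeriv ℝ j (g l) := by
        ext1 x
        exact iteratedFDeriv_sub_apply ((hgc k).contDiffAt.of_le (by exact_mod_cast le_top))
          ((hgc l).contDiffAt.of_le (by exact_mod_cast le_top))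
      rw [e]
      exact memLp_sub (hgm k j hj) (hgm l j hj)
    · gcongr
      rw [hkl]
      exact hN.sub_le _ _
  obtain ⟨x, hx, hxt⟩ := (EComplete_sobolevNatENorm hp).exists_tendsto hN' (u := fun k => T (g k))
    (fun k => (hTg k).trans_lt htop) (fun ε hε => by
      have ht : Tendsto (fun k => (M : ℝ≥0∞) * sobolevNatENorm m p (g k - f)) atTop (𝓝 0) := by
        simpa using ENNReal.Tendsto.const_mul hg (Or.inr (by simp : (M : ℝ≥0∞) ≠ ⊤))
      obtain ⟨K, hK⟩ := eventually_atTop.1 ((ENNReal.tendsto_nhds_zero.1 ht) (ENNReal.ofReal (ε / 2))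
        (by simpa using hε))
      refine ⟨K, fun k hk l hl => (hd k l).trans ?_⟩
      rw [mul_add]
      calc _ ≤ ENNReal.ofReal (ε / 2) + ENNReal.ofReal (ε / 2) := add_le_add (hK k hk) (hK l hl)
        _ = ENNReal.ofReal ε := by
          rw [← ENNReal.ofReal_add (by positivity) (by positivity), add_halves])
  have hTf0 : sobolevNatENorm 0 p (T f) < ⊤ := (h0 f).trans_lt (ENNReal.mul_lt_top (by simp)
    ((sobolevNatENorm_mono hp (Nat.zero_le m) f).trans_lt hf))
  -- The sequence T g_k converges to `x` in W^m_p and to `T f` in L_p, so the two limits agree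
  -- almost everywhere.
  have hae : T f =ᵐ[volume] x := by
    refine eLpNorm_sub_eq_zero_of_tendsto hp (u := fun k => T (g k))
      (fun k => memLp_of_sobolevNatENorm_lt_top ((hTg k).trans_lt htop))
      (memLp_of_sobolevNatENorm_lt_top hTf0) (memLp_of_sobolevNatENorm_lt_top hx) ?_ ?_
    · refine tendsto_zero_of_le_mul (M := M₀) (by simp) hg fun k => ?_
      rw [← map_sub]
      calc _ ≤ sobolevNatENorm 0 p (T (g k - f)) := eLpNorm_le_sobolevNatENorm hp _
        _ ≤ M₀ * sobolevNatENorm 0 p (g k - f) := h0 _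
        _ ≤ _ := by gcongr; exact sobolevNatENorm_mono hp (Nat.zero_le m) _
    · exact tendsto_of_tendsto_of_tendsto_of_le_of_le tendsto_const_nhds hxt
        (fun _ => zero_le) fun k => eLpNorm_le_sobolevNatENorm hp _
  rw [sobolevNatENorm_congr_ae hae]
  have hlim : Tendsto (fun k => sobolevNatENorm m p (T (g k) - x) + M * sobolevNatENorm m p f) atTop
      (𝓝 (0 + M * sobolevNatENorm m p f)) := hxt.add tendsto_const_nhds
  rw [zero_add] at hlim
  refine ge_of_tendsto' hlim fun k => ?_
  calc sobolevNatENorm m p x = sobolevNatENorm m p ((x - T (g k)) + T (g k)) := by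
        rw [sub_add_cancel]
    _ ≤ sobolevNatENorm m p (x - T (g k)) + sobolevNatENorm m p (T (g k)) := hN'.add_le _ _
    _ ≤ _ := by
      rw [hN'.sub_comm]
      gcongr
      exact hTg k

end SobolevExtension

/-! ### The spaces H^s_p: completeness and interpolation of operators. -/

section Bessel

variable {E : Type*} [NormedAddCommGroup E] [NormedSpace ℝ E] [FiniteDimensional ℝ E]
  [MeasureSpace E] [BorelSpace E] [(volume : Measure E).IsAddHaarMeasure]
  {X : Type*} [NormedAddCommGroup X] [NormedSpace ℝ X] [CompleteSpace X] {s p : ℝ}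

lemma isENorm_besselENorm (hp : 1 < p) : IsENorm (besselENorm (E := E) (X := X) s p) := by
  by_cases h : s = (⌊s⌋₊ : ℝ)
  · have e : besselENorm (E := E) (X := X) s p = sobolevNatENorm ⌊s⌋₊ p := by
      ext f; exact if_pos h
    rw [e]; exact isENorm_sobolevNatENorm hp
  · have e : besselENorm (E := E) (X := X) s p = complexInterpolationENorm (sobolevNatENorm ⌊s⌋₊ p)
        (sobolevNatENorm (⌊s⌋₊ + 1) p) (s - ⌊s⌋₊) := by
      ext f; exact if_neg h
    rw [e]
    exact (isOrderedCouple_sobolevNatENorm hp).interpolation _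

lemma sub_floor_mem_Ioo (hs : 0 ≤ s) (h : s ≠ (⌊s⌋₊ : ℝ)) : s - ⌊s⌋₊ ∈ Ioo (0 : ℝ) 1 :=
  ⟨sub_pos.2 (lt_of_le_of_ne (Nat.floor_le hs) (Ne.symm h)), by
    linarith [Nat.lt_floor_add_one s]⟩

lemma EComplete_besselENorm (hp : 1 < p) (hs : 0 ≤ s) :
    EComplete (besselENorm (E := E) (X := X) s p) := by
  by_cases h : s = (⌊s⌋₊ : ℝ)
  · have e : besselENorm (E := E) (X := X) s p = sobolevNatENorm ⌊s⌋₊ p := by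
      ext f; exact if_pos h
    rw [e]; exact EComplete_sobolevNatENorm hp
  · have e : besselENorm (E := E) (X := X) s p = complexInterpolationENorm (sobolevNatENorm ⌊s⌋₊ p)
        (sobolevNatENorm (⌊s⌋₊ + 1) p) (s - ⌊s⌋₊) := by
      ext f; exact if_neg h
    rw [e]
    exact (isOrderedCouple_sobolevNatENorm hp).complete_interpolation (EComplete_sobolevNatENorm hp)
      (EComplete_sobolevNatENorm hp) (sub_floor_mem_Ioo hs h)

variable {E' : Type*} [NormedAddCommGroup E'] [NormedSpace ℝ E'] [MeasureSpace E']
  {X' : Type*} [NormedAddCommGroup X'] [NormedSpace ℝ X']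

omit [FiniteDimensional ℝ E] [BorelSpace E] [(volume : Measure E).IsAddHaarMeasure]
  [CompleteSpace X] in
/-- Operators bounded on the Sobolev spaces of integral order are bounded on the spaces `H^s_p`. -/
lemma besselENorm_map_le (hs : 0 ≤ s) (T : (E → X) →ₗ[ℝ] (E' → X')) {M : ℝ≥0} (hM : M ≠ 0)
    (h : ∀ m : ℕ, (m : ℝ) < s + 1 → ∀ f, sobolevNatENorm m p (T f) ≤ M * sobolevNatENorm m p f)
    (f : E → X) : besselENorm s p (T f) ≤ M * besselENorm s p f := by
  by_cases hf : s = (⌊s⌋₊ : ℝ)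
  · rw [besselENorm, besselENorm, if_pos hf, if_pos hf]
    exact h _ (by linarith) f
  · rw [besselENorm, besselENorm, if_neg hf, if_neg hf]
    -- The orders ⌊s⌋ and ⌊s⌋ + 1 are both below s + 1 since s is not an integer. For integral s the
    -- condition m < s + 1 stops at s, and this is why k = s suffices for multipliers of class C^k.
    refine complexInterpolationENorm_map_le T hM (h _ ?_) (h _ ?_) _ f
    · linarith [Nat.floor_le hs]
    · push_cast
      linarith [(sub_floor_mem_Ioo hs hf).1]

omit [FiniteDimensional ℝ E] [BorelSpace E] [(volume : Measure E).IsAddHaarMeasure]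
  [CompleteSpace X] in
/-- Interpolation of operators with values in a normed space. -/
lemma enorm_le_besselENorm {Y : Type*} [NormedAddCommGroup Y] [NormedSpace ℝ Y] (hs : 0 ≤ s)
    (T : (E → X) →ₗ[ℝ] Y) {C L : ℝ} (hC : 0 < C) (hL : 0 < L)
    (h : ∀ m : ℕ, (m : ℝ) < s + 1 → ∀ f, ‖T f‖ₑ ≤
      ENNReal.ofReal (C * L ^ (m : ℝ)) * sobolevNatENorm m p f) (f : E → X) :
    ‖T f‖ₑ ≤ ENNReal.ofReal (C * L ^ s) * besselENorm s p f := by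
  by_cases hf : s = (⌊s⌋₊ : ℝ)
  · rw [besselENorm, if_pos hf]
    have := h ⌊s⌋₊ (by linarith) f
    rwa [← hf] at this
  · rw [besselENorm, if_neg hf]
    have hθ := sub_floor_mem_Ioo hs hf
    set m := ⌊s⌋₊
    have h0 := h m (by linarith [Nat.floor_le hs])
    have h1 := h (m + 1) (by push_cast; linarith [hθ.1])
    have key := enorm_le_complexInterpolation T (M₀ := (C * L ^ (m : ℝ)).toNNReal)
      (M₁ := (C * L ^ ((m + 1 : ℕ) : ℝ)).toNNReal) (Real.toNNReal_pos.2 (by positivity))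
      (Real.toNNReal_pos.2 (by positivity)) h0 h1 (Ioo_subset_Icc_self hθ) f
    refine key.trans (le_of_eq ?_)
    congr 1
    rw [ENNReal.ofReal, ENNReal.coe_inj, ← NNReal.coe_inj]
    push_cast
    rw [Real.coe_toNNReal _ (by positivity), Real.coe_toNNReal _ (by positivity),
      Real.coe_toNNReal _ (by positivity), Real.mul_rpow hC.le (by positivity),
      Real.mul_rpow hC.le (by positivity), ← Real.rpow_mul hL.le, ← Real.rpow_mul hL.le]
    -- The bounds C L^m are log-linear in the order m, so interpolation returns exactly C L^s, with
    -- no loss in the dependence on C and L.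
    have e1 : C ^ (1 - (s - m)) * C ^ (s - m) = C := rpow_one_sub_mul_rpow hC _
    have e2 : L ^ ((m : ℝ) * (1 - (s - m))) * L ^ (((m : ℝ) + 1) * (s - m)) = L ^ s := by
      rw [← Real.rpow_add hL]; congr 1; ring
    calc _ = (C ^ (1 - (s - m)) * C ^ (s - m)) *
          (L ^ ((m : ℝ) * (1 - (s - m))) * L ^ (((m : ℝ) + 1) * (s - m))) := by ring
      _ = _ := by rw [e1, e2]

end Bessel

/-! ### Multiplication by functions with bounded derivatives. -/

section BoundedDerivatives

variable {E : Type*} [NormedAddCommGroup E] [NormedSpace ℝ E]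
  {X X₀ X₁ X₂ : Type*} [NormedAddCommGroup X] [NormedSpace ℝ X]
  [NormedAddCommGroup X₀] [NormedSpace ℝ X₀] [NormedAddCommGroup X₁] [NormedSpace ℝ X₁]
  [NormedAddCommGroup X₂] [NormedSpace ℝ X₂] {p : ℝ} {m : ℕ}

/-- `a` is of class `C^m`, with all derivatives of order at most `m` bounded by `A`. -/
structure HasBoundedDerivs (m : ℕ) (A : ℝ) (a : E → X) : Prop where
  contDiff : ContDiff ℝ m a
  bound : ∀ j ≤ m, ∀ x, ‖iteratedFDeriv ℝ j a x‖ ≤ A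

lemma HasBoundedDerivs.nonneg {A : ℝ} {a : E → X} (h : HasBoundedDerivs m A a) : 0 ≤ A :=
  (norm_nonneg _).trans (h.bound 0 (Nat.zero_le _) 0)

lemma HasBoundedDerivs.mono {A A' : ℝ} {a : E → X} (h : HasBoundedDerivs m A a) {m' : ℕ}
    (hm : m' ≤ m) (hA : A ≤ A') : HasBoundedDerivs m' A' a :=
  ⟨h.contDiff.of_le (by exact_mod_cast hm), fun j hj x => (h.bound j (hj.trans hm) x).trans hA⟩

lemma norm_iteratedFDeriv_bilin_le (B : X₁ →L[ℝ] X₂ →L[ℝ] X₀) {A : ℝ} {a : E → X₁}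
    (ha : HasBoundedDerivs m A a) {g : E → X₂} (hg : ContDiff ℝ m g) {i : ℕ} (hi : i ≤ m) (x : E) :
    ‖iteratedFDeriv ℝ i (fun y => B (a y) (g y)) x‖ ≤
      ∑ l ∈ Finset.range (i + 1), (‖B‖ * 2 ^ m * A) * ‖iteratedFDeriv ℝ l g x‖ := by
  refine (B.norm_iteratedFDeriv_le_of_bilinear ha.contDiff hg x (n := i)
    (by exact_mod_cast hi)).trans ?_
  -- Reflecting the Leibniz sum lets the index count the derivatives of `g`.
  rw [← Finset.sum_range_reflect, Finset.mul_sum]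
  refine Finset.sum_le_sum fun l hl => ?_
  have hl' := Nat.lt_succ_iff.1 (Finset.mem_range.1 hl)
  have e : i - (i + 1 - 1 - l) = l := by omega
  rw [e]
  have h1 : ((i.choose (i + 1 - 1 - l) : ℕ) : ℝ) ≤ 2 ^ m := by
    have h2 := (Nat.choose_le_two_pow i (i + 1 - 1 - l)).trans (Nat.pow_le_pow_right two_pos hi)
    exact_mod_cast h2
  have h3 := ha.bound (i + 1 - 1 - l) (by omega) x
  have hA := ha.nonneg
  calc _ ≤ ‖B‖ * ((2 ^ m * A) * ‖iteratedFDeriv ℝ l g x‖) := by gcongr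
    _ = _ := by ring

variable [MeasureSpace E]

lemma eLpNorm_le_sum_of_norm_le {α Y : Type*} {mα : MeasurableSpace α} {μ : Measure α}
    [NormedAddCommGroup Y] {q : ℝ≥0∞} (hq : 1 ≤ q) {ι : Type*} (s : Finset ι) {Z : ι → Type*}
    [∀ i, NormedAddCommGroup (Z i)] {g : α → Y} {G : ∀ i, α → Z i} {c : ℝ} (hc : 0 ≤ c)
    (hG : ∀ i ∈ s, AEStronglyMeasurable (G i) μ) (h : ∀ x, ‖g x‖ ≤ ∑ i ∈ s, c * ‖G i x‖) :
    eLpNorm g q μ ≤ ENNReal.ofReal c * ∑ i ∈ s, eLpNorm (G i) q μ := by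
  have h1 : eLpNorm g q μ ≤ eLpNorm (∑ i ∈ s, fun x => c * ‖G i x‖) q μ := by
    refine eLpNorm_mono_real fun x => ?_
    simpa using h x
  refine h1.trans ((eLpNorm_sum_le (fun i hi => ((hG i hi).norm.const_mul c)) hq).trans ?_)
  rw [Finset.mul_sum]
  refine Finset.sum_le_sum fun i _ => ?_
  have h2 := eLpNorm_const_smul (𝕜 := ℝ) c (fun x => ‖G i x‖) q μ
  rw [eLpNorm_norm] at h2
  rw [← Real.enorm_of_nonneg hc, ← h2]
  rfl

variable [FiniteDimensional ℝ E] [BorelSpace E] [(volume : Measure E).IsAddHaarMeasure]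

lemma sobolevNatENorm_le_of_contDiff {f : E → X} (hf : ContDiff ℝ m f) {c : ℝ≥0∞} (hc : c < ⊤)
    (h : ∀ i ≤ m, eLpNorm (iteratedFDeriv ℝ i f) (ENNReal.ofReal p) volume ≤ c) :
    sobolevNatENorm m p f ≤ (m + 1 : ℕ) * c := by
  have hJ : IsSobolevJet m p f (fun j => iteratedFDeriv ℝ j f) := hf.isSobolevJet fun j hj =>
    ⟨(hf.continuous_iteratedFDeriv (by exact_mod_cast hj)).aestronglyMeasurable,
      (h j hj).trans_lt hc⟩
  refine hJ.le.trans ((Finset.sum_le_sum fun j hj =>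
    h j (Nat.lt_succ_iff.1 (Finset.mem_range.1 hj))).trans ?_)
  simp

variable [CompleteSpace X₀] [CompleteSpace X₂]

omit [NormedSpace ℝ E] [FiniteDimensional ℝ E] [BorelSpace E]
  [(volume : Measure E).IsAddHaarMeasure] [CompleteSpace X₀] [CompleteSpace X₂] in
lemma eLpNorm_bilin_le (B : X₁ →L[ℝ] X₂ →L[ℝ] X₀) {A : ℝ} (hA : 0 ≤ A) {a : E → X₁}
    (ha : ∀ x, ‖a x‖ ≤ A) (g : E → X₂) (q : ℝ≥0∞) :
    eLpNorm (fun x => B (a x) (g x)) q volume ≤ ENNReal.ofReal (‖B‖ * A) * eLpNorm g q volume := by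
  refine eLpNorm_le_mul_eLpNorm_of_ae_le_mul (Eventually.of_forall fun x => ?_) q
  calc ‖B (a x) (g x)‖ ≤ ‖B‖ * ‖a x‖ * ‖g x‖ := B.le_opNorm₂ _ _
    _ ≤ _ := by gcongr; exact ha x

/-- Multiplication by a function with bounded derivatives on Sobolev spaces. -/
lemma sobolevNatENorm_bilin_le (hp : 1 < p) (B : X₁ →L[ℝ] X₂ →L[ℝ] X₀) {A : ℝ} (hA : 0 < A)
    {a : E → X₁} (ha : HasBoundedDerivs m A a) (g : E → X₂) :
    sobolevNatENorm m p (fun x => B (a x) (g x)) ≤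
      (((m + 1 : ℕ) * ((m + 1) * ((‖B‖ + 1) * 2 ^ m * A))).toNNReal : ℝ≥0∞) *
        sobolevNatENorm m p g := by
  -- The summand 1 keeps the constant positive when B = 0, as the extension by density requires.
  set C : ℝ := (‖B‖ + 1) * 2 ^ m * A with hC
  have hC0 : 0 < C := by positivity
  have hBC : ‖B‖ * 2 ^ m * A ≤ C := by
    rw [hC]; gcongr; linarith
  let T : (E → X₂) →ₗ[ℝ] (E → X₀) :=
    { toFun := fun g x => B (a x) (g x)
      map_add' := fun g g' => by ext x; simp
      map_smul' := fun c g => by ext x; simp }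
  refine sobolevNatENorm_map_le_of_smooth hp T
    (M₀ := ((m + 1 : ℕ) * ((m + 1) * C)).toNNReal) ?_ ?_ g ?_
  · intro f
    by_cases hf : sobolevNatENorm 0 p f < ⊤
    swap
    · rw [not_lt_top_iff.1 hf, ENNReal.mul_top]; · exact le_top
      simp only [ne_eq, ENNReal.coe_eq_zero, Real.toNNReal_eq_zero, not_le]
      positivity
    have hfm := memLp_of_sobolevNatENorm_lt_top hf
    have ha0 : ∀ x, ‖a x‖ ≤ A := fun x => by
      simpa using ha.bound 0 (Nat.zero_le _) x
    have hle := eLpNorm_bilin_le B hA.le ha0 f (ENNReal.ofReal p)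
    have hTm : MemLp (T f) (ENNReal.ofReal p) volume :=
      ⟨B.aestronglyMeasurable_comp₂ ha.contDiff.continuous.aestronglyMeasurable hfm.1,
        hle.trans_lt (ENNReal.mul_lt_top ENNReal.ofReal_lt_top hfm.2)⟩
    rw [sobolevNatENorm_zero_eq hp hTm, sobolevNatENorm_zero_eq hp hfm]
    refine hle.trans ?_
    gcongr
    change _ ≤ ENNReal.ofReal _
    apply ENNReal.ofReal_le_ofReal
    have h2 : ‖B‖ * A ≤ C := by
      rw [hC]
      have : (1 : ℝ) ≤ 2 ^ m := one_le_pow₀ one_le_two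
      calc ‖B‖ * A = ‖B‖ * 1 * A := by ring
        _ ≤ _ := by gcongr; linarith
    have h3 : (1 : ℝ) ≤ (m + 1 : ℕ) := by norm_cast; omega
    have h4 : (1 : ℝ) ≤ (m + 1 : ℝ) := by exact_mod_cast h3
    nlinarith [mul_le_mul h3 (mul_le_mul h4 h2 (by positivity) (by positivity))
      (by positivity) (by positivity)]
  · intro f hf hfm
    have hfm' : ContDiff ℝ m f := hf.of_le (by exact_mod_cast le_top)
    have hJ := hfm'.isSobolevJet hfm
    have hc : ContDiff ℝ m (T f) := B.isBoundedBilinearMap.contDiff.comp₂ ha.contDiff hfm'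
    have := sobolevNatENorm_le_of_contDiff (p := p) hc
      (c := ENNReal.ofReal ((m + 1) * C) * sobolevNatENorm m p f)
      (ENNReal.mul_lt_top ENNReal.ofReal_lt_top (hJ.lt_top hp)) fun i hi => ?_
    · refine this.trans (le_of_eq ?_)
      rw [← mul_assoc]
      congr 1
      rw [← ENNReal.ofReal_natCast, ← ENNReal.ofReal_mul (by positivity)]
      rfl
    · have h1 := eLpNorm_le_sum_of_norm_le (μ := volume) (one_le_ofReal hp) (Finset.range (i + 1)) (c := C) hC0.le
        (G := fun l => iteratedFDeriv ℝ l f) (g := iteratedFDeriv ℝ i (T f)) (fun l hl =>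
          (hfm l ((Nat.lt_succ_iff.1 (Finset.mem_range.1 hl)).trans hi)).1) fun x =>
        (norm_iteratedFDeriv_bilin_le B ha hfm' hi x).trans (Finset.sum_le_sum fun l _ => by gcongr)
      refine h1.trans ?_
      rw [mul_comm ((m : ℝ) + 1), ENNReal.ofReal_mul hC0.le, mul_assoc]
      gcongr
      rw [hJ.eq hp]
      calc _ ≤ ∑ j ∈ Finset.range (m + 1), eLpNorm (iteratedFDeriv ℝ j f) (ENNReal.ofReal p) volume :=
            Finset.sum_le_sum_of_subset (Finset.range_subset_range.2 (by omega))
        _ ≤ _ := by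
          refine le_mul_of_one_le_left' ?_
          rw [ENNReal.one_le_ofReal]; linarith [(Nat.cast_nonneg m : (0:ℝ) ≤ m)]
  · simp only [ne_eq, Real.toNNReal_eq_zero, not_le]
    positivity

/-- For fixed `a` the product is linear in `g`, so the bounds on W^m_p for m ≤ k interpolate. The
constant is independent of `a` apart from the factor A. -/
lemma besselENorm_bilin_le {s : ℝ} (hs : 0 ≤ s) (hp : 1 < p) (B : X₁ →L[ℝ] X₂ →L[ℝ] X₀) {k : ℕ}
    (hk : s ≤ k) : ∃ C : ℝ≥0, ∀ (A : ℝ) (a : E → X₁), 0 < A → HasBoundedDerivs k A a →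
      ∀ g : E → X₂, besselENorm s p (fun x => B (a x) (g x)) ≤
        C * ENNReal.ofReal A * besselENorm s p g := by
  refine ⟨((k + 1 : ℕ) * ((k + 1) * ((‖B‖ + 1) * 2 ^ k))).toNNReal, fun A a hA ha g => ?_⟩
  let T : (E → X₂) →ₗ[ℝ] (E → X₀) :=
    { toFun := fun g x => B (a x) (g x)
      map_add' := fun g g' => by ext x; simp
      map_smul' := fun c g => by ext x; simp }
  have hpos : 0 < (k + 1 : ℕ) * (((k : ℝ) + 1) * ((‖B‖ + 1) * 2 ^ k)) := by positivity
  have key := besselENorm_map_le hs T (p := p)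
    (M := ((k + 1 : ℕ) * ((k + 1) * ((‖B‖ + 1) * 2 ^ k))).toNNReal * A.toNNReal)
    (mul_ne_zero (Real.toNNReal_pos.2 hpos).ne' (Real.toNNReal_pos.2 hA).ne') ?_ g
  · exact_mod_cast key
  · intro m hm f
    have hmk : m ≤ k := by
      have : (m : ℝ) < k + 1 := by linarith
      exact Nat.lt_succ_iff.1 (by exact_mod_cast this)
    refine (sobolevNatENorm_bilin_le hp B hA (ha.mono hmk le_rfl) f).trans ?_
    gcongr
    rw [← Real.toNNReal_mul hpos.le]
    refine Real.toNNReal_le_toNNReal ?_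
    calc _ ≤ ((k + 1 : ℕ) : ℝ) * ((k + 1) * ((‖B‖ + 1) * 2 ^ k * A)) := by
          gcongr; exact one_le_two
      _ = _ := by ring

end BoundedDerivatives

/-! ### Mollifications and their remainders as commuting operators on L_p. -/

section MollifierOperators

variable {E : Type*} [NormedAddCommGroup E] [NormedSpace ℝ E] [FiniteDimensional ℝ E]
  [MeasureSpace E] [BorelSpace E] [(volume : Measure E).IsAddHaarMeasure]
  {X : Type*} [NormedAddCommGroup X] [NormedSpace ℝ X] [CompleteSpace X] {p : ℝ}

omit [CompleteSpace X] in
-- Convolution is associative, and that of the two scalar factors is commutative.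
lemma mollify_comm [CompleteSpace X] {φ ψ : E → ℝ} {r r' : ℝ} (hφ : IsMollifier φ r) (hψ : IsMollifier ψ r')
    {f : E → X} (hf : LocallyIntegrable f volume) :
    mollify φ (mollify ψ f) = mollify ψ (mollify φ f) := by
  have hfn : LocallyIntegrable (fun x => ‖f x‖) volume := fun x => by
    obtain ⟨s, hs, hi⟩ := hf x
    exact ⟨s, hs, hi.norm⟩
  have key : ∀ {φ ψ : E → ℝ} {r r' : ℝ}, IsMollifier φ r → IsMollifier ψ r' →
      mollify φ (mollify ψ f) = mollify (mollify φ ψ) f := by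
    intro φ ψ r r' hφ hψ
    ext x
    symm
    refine convolution_assoc (ContinuousLinearMap.lsmul ℝ ℝ) (ContinuousLinearMap.lsmul ℝ ℝ)
      (ContinuousLinearMap.lsmul ℝ ℝ) (ContinuousLinearMap.lsmul ℝ ℝ) (fun a b c => by
        simp [mul_smul, smul_comm a b c]) hφ.smooth.continuous.aestronglyMeasurable
      hψ.smooth.continuous.aestronglyMeasurable hf.aestronglyMeasurable ?_ ?_ ?_
    · exact Eventually.of_forall fun y => hφ.compact.convolutionExists_left _
        hφ.smooth.continuous (hψ.smooth.continuous.locallyIntegrable) y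
    · exact Eventually.of_forall fun y => hψ.compact.norm.convolutionExists_left _
        hψ.smooth.continuous.norm hfn y
    · refine hφ.compact.norm.convolutionExists_left _ hφ.smooth.continuous.norm ?_ x
      exact (hψ.compact.norm.continuous_convolution_left _ hψ.smooth.continuous.norm
        hfn).locallyIntegrable
  rw [key hφ hψ, key hψ hφ]
  congr 1
  ext x
  rw [mollify_apply, mollify_apply, ← integral_sub_left_eq_self _ volume x]
  simp [mul_comm]

omit [NormedSpace ℝ E] [FiniteDimensional ℝ E] [BorelSpace E]
  [(volume : Measure E).IsAddHaarMeasure] in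
lemma eLpNorm_eq_of_norm_eq {Y Z : Type*} [NormedAddCommGroup Y] [NormedAddCommGroup Z]
    {f : E → Y} {g : E → Z} (h : ∀ x, ‖f x‖ = ‖g x‖) (q : ℝ≥0∞) :
    eLpNorm f q volume = eLpNorm g q volume :=
  eLpNorm_congr_norm_ae (Eventually.of_forall h)

lemma IsMollifier.eLpNorm_sub_mollify_le_of_norm_eq {φ : E → ℝ} {r : ℝ} (hφ : IsMollifier φ r)
    (hp : 1 < p) {h : E → X} (hh : ContDiff ℝ 1 h) {Z : Type*} [NormedAddCommGroup Z] {G : E → Z}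
    (hG : ∀ x, ‖fderiv ℝ h x‖ = ‖G x‖) :
    eLpNorm (fun x => h x - mollify φ h x) (ENNReal.ofReal p) volume ≤
      ENNReal.ofReal r * eLpNorm G (ENNReal.ofReal p) volume := by
  rw [← eLpNorm_eq_of_norm_eq hG]
  exact hφ.eLpNorm_sub_mollify_le hp hh

variable (E X p) in
/-- The functions in `L_p`. -/
def lpFun : Submodule ℝ (E → X) where
  carrier := {f | MemLp f (ENNReal.ofReal p) volume}
  zero_mem' := memLp_zero
  add_mem' hf hg := memLp_add hf hg
  smul_mem' c _ hf := hf.const_smul c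

/-- The `L_p`-norm. -/
def lpENorm (f : lpFun E X p) : ℝ≥0∞ := eLpNorm (f : E → X) (ENNReal.ofReal p) volume

omit [FiniteDimensional ℝ E] [BorelSpace E] [(volume : Measure E).IsAddHaarMeasure]
  [CompleteSpace X] [NormedSpace ℝ E] in
lemma lpENorm_lt_top (f : lpFun E X p) : lpENorm f < ⊤ := f.2.2

omit [FiniteDimensional ℝ E] [BorelSpace E] [(volume : Measure E).IsAddHaarMeasure]
  [CompleteSpace X] [NormedSpace ℝ E] in
lemma isENorm_lpENorm (hp : 1 < p) : IsENorm (lpENorm (E := E) (X := X) (p := p)) where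
  zero := eLpNorm_pi_zero
  add_le f g := eLpNorm_add_le_of_memLp f.2 g.2 (one_le_ofReal hp)
  smul_le c f := (eLpNorm_const_smul (𝕜 := ℝ) c (f : E → X) _ _).le

/-- Mollification at scale `2 ^ (-k)` as an operator on `L_p`. -/
def mollifyEnd (hp : 1 < p) (k : ℕ) : Module.End ℝ (lpFun E X p) where
  toFun f := ⟨mollify (scaledMollifier k) f, (isMollifier_scaled k).memLp_mollify hp f.2⟩
  map_add' f g := by
    ext x
    simp only [Submodule.coe_add, mollify_apply, Pi.add_apply, smul_add]
    exact integral_add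
      ((isMollifier_scaled k).exists_convolution (MemLp.locallyIntegrable f.2 (one_le_ofReal hp)) x)
      ((isMollifier_scaled k).exists_convolution (MemLp.locallyIntegrable g.2 (one_le_ofReal hp)) x)
  map_smul' c f := by
    ext x
    simp only [Submodule.coe_smul, mollify_apply, Pi.smul_apply, RingHom.id_apply]
    rw [← integral_smul]
    exact integral_congr_ae (Eventually.of_forall fun t => smul_comm _ _ _)

/-- The remainder of mollification at scale `2 ^ (-k)`. -/
def remainderEnd (hp : 1 < p) (k : ℕ) : Module.End ℝ (lpFun E X p) := 1 - mollifyEnd hp k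

lemma commute_mollifyEnd (hp : 1 < p) (k l : ℕ) :
    Commute (mollifyEnd (E := E) (X := X) hp k) (mollifyEnd hp l) := by
  ext f : 2
  exact mollify_comm (isMollifier_scaled k) (isMollifier_scaled l)
    (MemLp.locallyIntegrable f.2 (one_le_ofReal hp))

lemma commute_remainderEnd (hp : 1 < p) (k l : ℕ) :
    Commute (remainderEnd (E := E) (X := X) hp k) (remainderEnd hp l) :=
  by
  have h := fun f => LinearMap.congr_fun (commute_mollifyEnd (E := E) (X := X) hp k l).eq f
  refine LinearMap.ext fun f => ?_
  have h := h f
  simp only [Module.End.mul_apply] at h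
  simp only [remainderEnd, Module.End.mul_apply, LinearMap.sub_apply, Module.End.one_apply, map_sub,
    h]
  abel

lemma lpENorm_mollifyEnd_le (hp : 1 < p) (k : ℕ) (f : lpFun E X p) :
    lpENorm (mollifyEnd hp k f) ≤ lpENorm f :=
  (isMollifier_scaled k).eLpNorm_mollify_le hp f.2.1

lemma lpENorm_remainderEnd_le (hp : 1 < p) (k : ℕ) (f : lpFun E X p) :
    lpENorm (remainderEnd hp k f) ≤ 2 * lpENorm f := by
  rw [two_mul]
  exact ((isENorm_lpENorm hp).sub_le f (mollifyEnd hp k f)).trans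
    (add_le_add le_rfl (lpENorm_mollifyEnd_le hp k f))

lemma lpENorm_remainderEnd_pow_le (hp : 1 < p) (k N : ℕ) (f : lpFun E X p) :
    lpENorm ((remainderEnd hp k ^ N) f) ≤ 2 ^ N * lpENorm f := by
  induction N with
  | zero => simp
  | succ N ih =>
    rw [pow_succ', pow_succ', Module.End.mul_apply, mul_assoc]
    exact (lpENorm_remainderEnd_le hp k _).trans (by gcongr)

lemma tendsto_remainderEnd_pow (hp : 1 < p) {N : ℕ} (hN : N ≠ 0) (f : lpFun E X p) :
    Tendsto (fun k => lpENorm ((remainderEnd hp k ^ N) f)) atTop (𝓝 0) := by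
  obtain ⟨N, rfl⟩ := Nat.exists_eq_succ_of_ne_zero hN
  have h := tendsto_eLpNorm_mollify_sub hp isMollifier_scaled tendsto_inv_two_pow f.2
  refine tendsto_zero_of_le_mul (M := 2 ^ N) (by simp) h fun k => ?_
  rw [pow_succ, Module.End.mul_apply]
  refine (lpENorm_remainderEnd_pow_le hp k N _).trans ?_
  gcongr
  exact ((isENorm_lpENorm hp).sub_comm _ _).le

/-- Smooth functions with derivatives up to order `m` in `L_p`. -/
structure IsSmoothLp (m : ℕ) (p : ℝ) (g : E → X) : Prop where
  contDiff : ContDiff ℝ ∞ g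
  memLp : ∀ j ≤ m, MemLp (iteratedFDeriv ℝ j g) (ENNReal.ofReal p) volume

namespace IsSmoothLp

variable {m : ℕ} {g : E → X} (hg : IsSmoothLp m p g)
include hg

omit [CompleteSpace X] in
lemma isSobolevJet : IsSobolevJet m p g (fun j => iteratedFDeriv ℝ j g) :=
  (hg.contDiff.of_le (by exact_mod_cast le_top) : ContDiff ℝ m g).isSobolevJet hg.memLp

/-- The function as an element of `L_p`. -/
def toLp : lpFun E X p := ⟨g, hg.isSobolevJet.memLp⟩

/-- The derivative of order `j` as an element of `L_p`. -/
def deriv {j : ℕ} (hj : j ≤ m) : lpFun E (E [×j]→L[ℝ] X) p := ⟨iteratedFDeriv ℝ j g, hg.memLp j hj⟩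

/-- Mollification commutes with derivatives, hence so do powers of the remainder operator. -/
lemma remainder (hp : 1 < p) (k N : ℕ) : IsSmoothLp m p ((remainderEnd hp k ^ N) hg.toLp : E → X) ∧
    ∀ j (hj : j ≤ m), iteratedFDeriv ℝ j ((remainderEnd hp k ^ N) hg.toLp : E → X) =
      (remainderEnd hp k ^ N) (hg.deriv hj) := by
  induction N with
  | zero => exact ⟨hg, fun j hj => rfl⟩
  | succ N ih =>
    obtain ⟨ih1, ih2⟩ := ih
    have hφ := isMollifier_scaled (E := E) k
    have hmc : ContDiff ℝ ∞ (mollify (scaledMollifier k)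
        ((remainderEnd hp k ^ N) hg.toLp : E → X)) :=
      hφ.contDiff_mollify (ih1.isSobolevJet.memLp.locallyIntegrable (one_le_ofReal hp))
    have e : ((remainderEnd hp k ^ (N + 1)) hg.toLp : E → X) =
        ((remainderEnd hp k ^ N) hg.toLp : E → X) -
          mollify (scaledMollifier k) ((remainderEnd hp k ^ N) hg.toLp : E → X) := by
      rw [pow_succ', Module.End.mul_apply]; rfl
    have hd : ∀ j (hj : j ≤ m), iteratedFDeriv ℝ j
        ((remainderEnd hp k ^ (N + 1)) hg.toLp : E → X) =
        (remainderEnd hp k ^ (N + 1)) (hg.deriv hj) := by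
      intro j hj
      rw [e]
      have h1 : iteratedFDeriv ℝ j (((remainderEnd hp k ^ N) hg.toLp : E → X) -
          mollify (scaledMollifier k) ((remainderEnd hp k ^ N) hg.toLp : E → X)) =
          iteratedFDeriv ℝ j ((remainderEnd hp k ^ N) hg.toLp : E → X) -
          iteratedFDeriv ℝ j
            (mollify (scaledMollifier k) ((remainderEnd hp k ^ N) hg.toLp : E → X)) := by
        ext1 x
        exact iteratedFDeriv_sub_apply (ih1.contDiff.contDiffAt.of_le (by exact_mod_cast le_top))
          (hmc.contDiffAt.of_le (by exact_mod_cast le_top))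
      rw [h1, ih1.isSobolevJet.iteratedFDeriv_mollify hp hφ hj, ih2 j hj, pow_succ',
        Module.End.mul_apply]
      rfl
    refine ⟨⟨?_, fun j hj => ?_⟩, hd⟩
    · rw [e]; exact ih1.contDiff.sub hmc
    · rw [hd j hj]
      exact ((remainderEnd hp k ^ (N + 1)) (hg.deriv hj)).2

/-- Each factor of the remainder is estimated by `IsMollifier.eLpNorm_sub_mollify_le`: it gives a
factor 2^{-k} and adds one derivative, which commutes past the remaining factors. -/
lemma lpENorm_remainder_le (hp : 1 < p) (k : ℕ) {i j l : ℕ} (h : i + j = l) (hj : j ≤ m)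
    (hl : l ≤ m) : lpENorm ((remainderEnd hp k ^ i) (hg.deriv hj)) ≤
      ENNReal.ofReal (((2 : ℝ) ^ k)⁻¹ ^ i) * lpENorm (hg.deriv hl) := by
  induction i generalizing j with
  | zero =>
    obtain rfl : j = l := by omega
    simp
  | succ i ih =>
    have hj1 : j + 1 ≤ m := by omega
    obtain ⟨h1, h2⟩ := hg.remainder hp k i
    have e1 := h2 j hj
    have e2 := h2 (j + 1) hj1
    have hc : ContDiff ℝ 1 (((remainderEnd hp k ^ i) (hg.deriv hj) :
        lpFun E (E [×j]→L[ℝ] X) p) : E → E [×j]→L[ℝ] X) := by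
      rw [← h2 j hj]
      exact h1.contDiff.iteratedFDeriv_right (m := 1) (by exact_mod_cast le_top)
    have h3 := (isMollifier_scaled k).eLpNorm_sub_mollify_le_of_norm_eq hp hc
      (G := (((remainderEnd hp k ^ i) (hg.deriv hj1) : lpFun E (E [×(j + 1)]→L[ℝ] X) p) :
        E → E [×(j + 1)]→L[ℝ] X)) fun x => by
      rw [← e1, ← e2]
      exact norm_fderiv_iteratedFDeriv
    rw [pow_succ', Module.End.mul_apply]
    refine h3.trans ?_
    rw [pow_succ', ENNReal.ofReal_mul (by positivity), mul_assoc]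
    gcongr
    exact ih (by omega) hj1

end IsSmoothLp

end MollifierOperators

/-! ### Pointwise bounds for derivatives of mollified functions. -/

section SupBounds

variable {E : Type*} [NormedAddCommGroup E] [NormedSpace ℝ E] [FiniteDimensional ℝ E]
  [MeasureSpace E] [BorelSpace E] [(volume : Measure E).IsAddHaarMeasure]
  {X : Type*} [NormedAddCommGroup X] [NormedSpace ℝ X] {p : ℝ}

variable (E) in
lemma exists_norm_iteratedFDeriv_scaledMollifier_le (a : ℕ) : ∃ S : ℝ, 0 ≤ S ∧ ∀ (k : ℕ) (x : E),
    ‖iteratedFDeriv ℝ a (scaledMollifier k) x‖ ≤ S * ((2 : ℝ) ^ k) ^ (Module.finrank ℝ E + a) := by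
  have h := isMollifier_std E
  obtain ⟨S, hS⟩ := (h.smooth.continuous_iteratedFDeriv (m := a)
    (by exact_mod_cast le_top)).bounded_above_of_compact_support (h.compact.iteratedFDeriv (𝕜 := ℝ) a)
  have hS0 : 0 ≤ S := (norm_nonneg _).trans (hS 0)
  refine ⟨S, hS0, fun k x => ?_⟩
  have h2 : (0 : ℝ) < 2 ^ k := by positivity
  let L : E →L[ℝ] E := (2 : ℝ) ^ k • ContinuousLinearMap.id ℝ E
  have hL : ‖L‖ ≤ 2 ^ k := by
    refine ContinuousLinearMap.opNorm_le_bound _ h2.le fun y => le_of_eq ?_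
    simp [L, norm_smul]
  have e : scaledMollifier (E := E) k =
      fun x => (((2 : ℝ) ^ k) ^ (Module.finrank ℝ E)) • (stdMollifier E ∘ L) x := by
    ext x; rfl
  have hc : ContDiff ℝ a (stdMollifier E ∘ L) :=
    (h.smooth.of_le (by exact_mod_cast le_top)).comp L.contDiff
  rw [e, iteratedFDeriv_const_smul_apply' hc.contDiffAt,
    L.iteratedFDeriv_comp_right h.smooth x (by exact_mod_cast le_top), norm_smul,
    Real.norm_of_nonneg (by positivity)]
  calc _ ≤ ((2 : ℝ) ^ k) ^ Module.finrank ℝ E * (S * ∏ _i : Fin a, (2 : ℝ) ^ k) := by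
        gcongr
        refine (ContinuousMultilinearMap.norm_compContinuousLinearMap_le _ _).trans ?_
        gcongr
        · exact hS _
    _ = _ := by
      rw [Finset.prod_const, Finset.card_univ, Fintype.card_fin, pow_add]; ring

lemma support_iteratedFDeriv_scaledMollifier (a k : ℕ) :
    Function.support (iteratedFDeriv ℝ a (scaledMollifier (E := E) k)) ⊆
      Metric.closedBall 0 ((2 : ℝ) ^ k)⁻¹ := by
  refine (support_iteratedFDeriv_subset a).trans (closure_minimal (fun x hx => ?_)
    Metric.isClosed_closedBall)
  simpa using (isMollifier_scaled k).support x hx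

variable (E) in
-- Derivatives fall on the mollifier, and Hölder's inequality applies with the exponent q conjugate
-- to p. The derivative of order a has size 2^{k(d+a)} on a ball of volume comparable to 2^{-kd}, so
-- its L_q-norm is of order 2^{k(a + d/p)}.
lemma exists_enorm_iteratedFDeriv_mollify_le (hp : 1 < p) (a : ℕ) : ∃ C : ℝ, 0 < C ∧
    ∀ (k : ℕ) (X : Type*) [NormedAddCommGroup X] [NormedSpace ℝ X] (h : E → X)
      (_ : MemLp h (ENNReal.ofReal p) volume) (x : E),
      ‖iteratedFDeriv ℝ a (mollify (scaledMollifier k) h) x‖ₑ ≤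
        ENNReal.ofReal (C * ((2 : ℝ) ^ k) ^ (a + Module.finrank ℝ E / p : ℝ)) *
          eLpNorm h (ENNReal.ofReal p) volume := by
  obtain ⟨S, hS0, hS⟩ := exists_norm_iteratedFDeriv_scaledMollifier_le E a
  set d := Module.finrank ℝ E
  have hp0 : 0 < p := by linarith
  have hconj := Real.HolderConjugate.conjExponent hp
  set q := p.conjExponent
  have hq0 : 0 < q := hconj.symm.pos
  have hE := hconj.symm.ennrealOfReal
  set V := (volume : Measure E) (Metric.ball 0 1) with hV
  have hVt : V ≠ ⊤ := measure_ball_lt_top.ne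
  refine ⟨V.toReal ^ q⁻¹ * S + 1, by positivity, fun k X _ _ h hh x => ?_⟩
  set b : ℝ := 2 ^ k with hb
  have hb0 : 0 < b := by positivity
  set ψ : E → ℝ := fun t => ‖iteratedFDeriv ℝ a (scaledMollifier (E := E) k) t‖ with hψ
  have hsm := (isMollifier_scaled (E := E) k)
  have hψc : Continuous ψ := (hsm.smooth.continuous_iteratedFDeriv (by exact_mod_cast le_top)).norm
  have hloc := hh.locallyIntegrable (one_le_ofReal hp)
  have hmp : MeasurePreserving (fun t : E => x - t) volume volume :=
    Measure.measurePreserving_sub_left volume x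
  have hhx : MemLp (fun t => h (x - t)) (ENNReal.ofReal p) volume :=
    hh.comp_measurePreserving hmp
  have h1 : ‖iteratedFDeriv ℝ a (mollify (scaledMollifier k) h) x‖ₑ ≤
      eLpNorm (ψ • fun t => h (x - t)) 1 volume := by
    have hint : Integrable (ψ • fun t => h (x - t)) volume := by
      refine (hhx.locallyIntegrable (one_le_ofReal hp)).integrable_smul_left_of_hasCompactSupport
        hψc ?_
      exact (hsm.compact.iteratedFDeriv (𝕜 := ℝ) a).norm
    have h2 : ‖iteratedFDeriv ℝ a (mollify (scaledMollifier k) h) x‖ ≤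
        ∫ t, ‖(ψ • fun t => h (x - t)) t‖ := by
      refine ContinuousMultilinearMap.opNorm_le_bound (by positivity) fun m => ?_
      rw [mollify, iteratedFDeriv_convolution_apply hsm.smooth hsm.compact hloc,
        mul_comm, ← integral_const_mul]
      refine norm_integral_le_of_norm_le (hint.norm.const_mul _) (Eventually.of_forall fun t => ?_)
      simp only [Pi.smul_apply', norm_smul]
      rw [Real.norm_of_nonneg (norm_nonneg _), ← mul_assoc, mul_comm (∏ i, _)]
      gcongr
      exact (iteratedFDeriv ℝ a (scaledMollifier k) t).le_opNorm m
    rw [eLpNorm_one_eq_lintegral_enorm, ← ofReal_integral_norm_eq_lintegral_enorm hint,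
      ← ofReal_norm]
    exact ENNReal.ofReal_le_ofReal h2
  have h3 : eLpNorm (ψ • fun t => h (x - t)) 1 volume ≤
      eLpNorm ψ (ENNReal.ofReal q) volume * eLpNorm (fun t => h (x - t)) (ENNReal.ofReal p) volume :=
    eLpNorm_smul_le_mul_eLpNorm hhx.1 hψc.aestronglyMeasurable
  have h4 : eLpNorm (fun t => h (x - t)) (ENNReal.ofReal p) volume =
      eLpNorm h (ENNReal.ofReal p) volume := eLpNorm_comp_measurePreserving hh.1 hmp
  have hsub : Function.support ψ ⊆ Metric.closedBall 0 b⁻¹ := fun t ht =>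
    support_iteratedFDeriv_scaledMollifier a k (by simpa [hψ] using ht)
  have h5 : eLpNorm ψ (ENNReal.ofReal q) volume ≤
      ENNReal.ofReal (V.toReal ^ q⁻¹ * S * b ^ (a + d / p : ℝ)) := by
    rw [← eLpNorm_restrict_eq_of_support_subset hsub]
    refine (eLpNorm_le_of_ae_bound (C := S * b ^ (d + a)) (Eventually.of_forall fun t => ?_)).trans ?_
    · simpa [hψ] using hS k t
    · rw [Measure.restrict_apply_univ, Measure.addHaar_closedBall _ _ (by positivity),
        ENNReal.toReal_ofReal hq0.le, ← hV, ← ENNReal.ofReal_toReal hVt,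
        ← ENNReal.ofReal_mul (by positivity), ENNReal.ofReal_rpow_of_nonneg (by positivity)
        (by positivity), ← ENNReal.ofReal_mul (by positivity)]
      refine ENNReal.ofReal_le_ofReal (le_of_eq ?_)
      rw [ENNReal.ofReal_toReal hVt, Real.mul_rpow (by positivity) (by positivity),
        ← Real.rpow_natCast, ← Real.rpow_natCast, Real.inv_rpow hb0.le, Real.inv_rpow (by positivity),
        ← Real.rpow_mul hb0.le, ← Real.rpow_neg hb0.le]
      -- The exponent d + a - d/q equals a + d/p because 1/q = 1 - 1/p.
      have e : b ^ (a + d / p : ℝ) = b ^ (-((d : ℝ) * q⁻¹)) * b ^ ((d + a : ℕ) : ℝ) := by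
        rw [← Real.rpow_add hb0]
        congr 1
        have := hconj.inv_add_inv_eq_one
        have e2 : q⁻¹ = 1 - p⁻¹ := by linarith
        rw [e2]; push_cast; ring
      rw [e]; ring
  refine h1.trans (h3.trans ?_)
  rw [h4]
  gcongr
  refine h5.trans (ENNReal.ofReal_le_ofReal ?_)
  gcongr
  linarith

end SupBounds

/-! ### Dyadic smoothings of high order and their differences. -/

section LittlewoodPaley

variable {E : Type*} [NormedAddCommGroup E] [NormedSpace ℝ E] [FiniteDimensional ℝ E]
  [MeasureSpace E] [BorelSpace E] [(volume : Measure E).IsAddHaarMeasure]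
  {X : Type*} [NormedAddCommGroup X] [NormedSpace ℝ X] [CompleteSpace X] {p : ℝ}

variable (E X p) in
-- Interpolation of operators is formulated for linear maps on all functions, while mollification is
-- linear only where the integrals exist. Composing with an arbitrary linear projection onto L_p
-- removes the mismatch.
lemma exists_lpProj : ∃ π : (E → X) →ₗ[ℝ] lpFun E X p, ∀ f : lpFun E X p, π f = f := by
  obtain ⟨g, hg⟩ := LinearMap.exists_leftInverse_of_injective (lpFun E X p).subtype
    (Submodule.ker_subtype _)
  exact ⟨g, fun f => LinearMap.congr_fun hg f⟩

variable (E X p) in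
/-- A linear projection of the space of all functions onto `L_p`. -/
def lpProj : (E → X) →ₗ[ℝ] lpFun E X p := (exists_lpProj E X p).choose

lemma lpProj_coe (f : lpFun E X p) : lpProj E X p f = f := (exists_lpProj E X p).choose_spec f

/-- Smoothing at scale `2 ^ (-k)` with remainder of order `N`. -/
def smoothEnd (hp : 1 < p) (N k : ℕ) : Module.End ℝ (lpFun E X p) := 1 - remainderEnd hp k ^ N

/-- The cofactor of `mollifyEnd (k + 1) - mollifyEnd k` in `smoothEnd (k + 1) - smoothEnd k`. -/
def cofactorEnd (hp : 1 < p) (N k : ℕ) : Module.End ℝ (lpFun E X p) :=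
  ∑ i ∈ Finset.range N, remainderEnd hp k ^ i * remainderEnd hp (k + 1) ^ (N - 1 - i)

/-- The remainders at consecutive scales commute, so the difference of their N-th powers factors as
their difference times the cofactor. The first factor is a difference of mollifications and provides
sup bounds; the cofactor keeps N - 1 remainders, which provide decay in k. -/
lemma smoothEnd_sub (hp : 1 < p) (N k : ℕ) (f : lpFun E X p) :
    smoothEnd hp N (k + 1) f - smoothEnd hp N k f =
      mollifyEnd hp (k + 1) (cofactorEnd hp N k f) - mollifyEnd hp k (cofactorEnd hp N k f) := by
  have h := Commute.mul_geom_sum₂ (R := Module.End ℝ (lpFun E X p))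
    (commute_remainderEnd hp k (k + 1)) N
  have h1 := LinearMap.congr_fun h f
  have h2 : remainderEnd hp k (cofactorEnd hp N k f) - remainderEnd hp (k + 1) (cofactorEnd hp N k f)
      = (remainderEnd hp k ^ N) f - (remainderEnd hp (k + 1) ^ N) f := h1
  have e : ∀ l, smoothEnd hp N l f = f - (remainderEnd hp l ^ N) f := fun l => rfl
  have e' : ∀ (l) (g : lpFun E X p), remainderEnd hp l g = g - mollifyEnd hp l g := fun l g => rfl
  rw [e, e, sub_sub_sub_cancel_left, ← h2, e', e', sub_sub_sub_cancel_left]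

/-- The geometric sum 1 - R^N = (1 - R)(1 + R + … + R^{N-1}) exhibits the coarsest smoothing as a
mollification. -/
lemma smoothEnd_zero_eq (hp : 1 < p) (N : ℕ) (f : lpFun E X p) :
    smoothEnd hp N 0 f = mollifyEnd hp 0 (∑ i ∈ Finset.range N, (remainderEnd hp 0 ^ i) f) := by
  have h := LinearMap.congr_fun (Commute.mul_geom_sum₂ (R := Module.End ℝ (lpFun E X p))
    (Commute.one_left (remainderEnd hp 0)) N) f
  have e : mollifyEnd (E := E) (X := X) hp 0 = 1 - remainderEnd hp 0 := by
    refine LinearMap.ext fun g => ?_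
    change _ = g - (g - mollifyEnd hp 0 g)
    rw [sub_sub_cancel]
  rw [e]
  simp only [one_pow, one_mul] at h
  have h2 : (1 - remainderEnd hp 0 : Module.End ℝ (lpFun E X p))
      ((∑ i ∈ Finset.range N, (remainderEnd hp 0 ^ (N - 1 - i))) f) = smoothEnd hp N 0 f := h
  rw [← h2, LinearMap.sum_apply, Finset.sum_range_reflect (fun i => (remainderEnd hp 0 ^ i) f)]

lemma lpENorm_cofactorEnd_le (hp : 1 < p) (N k : ℕ) (f : lpFun E X p) :
    lpENorm (cofactorEnd hp N k f) ≤ (N * 2 ^ N : ℕ) * lpENorm f := by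
  rw [cofactorEnd, LinearMap.sum_apply]
  refine ((isENorm_lpENorm hp).sum_le _ _).trans ?_
  calc _ ≤ ∑ i ∈ Finset.range N, 2 ^ N * lpENorm f := by
        refine Finset.sum_le_sum fun i hi => ?_
        rw [Module.End.mul_apply]
        refine (lpENorm_remainderEnd_pow_le hp k i _).trans ?_
        refine (mul_le_mul_right (lpENorm_remainderEnd_pow_le hp (k + 1) _ f) _).trans ?_
        rw [← mul_assoc, ← pow_add]
        gcongr
        · exact one_le_two
        · have := Finset.mem_range.1 hi; omega
    _ = _ := by
      rw [Finset.sum_const, Finset.card_range, nsmul_eq_mul]; push_cast; ring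

namespace IsSmoothLp

variable {m : ℕ} {g : E → X} (hg : IsSmoothLp m p g)
include hg

/-- Of the `i` factors, `i'` are exchanged for derivatives; the others cost a factor 2 each. -/
lemma lpENorm_remainder_pow_le (hp : 1 < p) (k : ℕ) {i i' j l : ℕ} (h : i' + j = l) (hj : j ≤ m)
    (hl : l ≤ m) (hi : i' ≤ i) : lpENorm ((remainderEnd hp k ^ i) (hg.deriv hj)) ≤
      2 ^ i * ENNReal.ofReal (((2 : ℝ) ^ k)⁻¹ ^ i') * lpENorm (hg.deriv hl) := by
  obtain ⟨e, rfl⟩ := Nat.exists_eq_add_of_le' hi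
  rw [pow_add, Module.End.mul_apply, mul_assoc]
  refine (lpENorm_remainderEnd_pow_le hp k e _).trans ?_
  gcongr
  · exact one_le_two
  · omega
  · exact hg.lpENorm_remainder_le hp k h hj hl

lemma lpENorm_remainder_toLp (hp : 1 < p) (k i : ℕ) : lpENorm ((remainderEnd hp k ^ i) hg.toLp) =
    lpENorm ((remainderEnd hp k ^ i) (hg.deriv (Nat.zero_le m))) := by
  rw [lpENorm, lpENorm, ← (hg.remainder hp k i).2 0 (Nat.zero_le m), eLpNorm_iteratedFDeriv_zero]

omit [CompleteSpace X] in
lemma lpENorm_deriv_le [CompleteSpace X] (hp : 1 < p) {j : ℕ} (hj : j ≤ m) :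
    lpENorm (hg.deriv hj) ≤ sobolevNatENorm m p g := hg.isSobolevJet.eLpNorm_le hp hj

/-- Each term of the cofactor contains N - 1 ≥ m remainders, at scales 2^{-k} and 2^{-k-1}, and m of
them are exchanged for derivatives. -/
lemma lpENorm_cofactorEnd_le (hp : 1 < p) {N : ℕ} (hm : m + 1 ≤ N) (k : ℕ) :
    lpENorm (cofactorEnd hp N k hg.toLp) ≤
      (N * 2 ^ N : ℕ) * ENNReal.ofReal (((2 : ℝ) ^ k)⁻¹ ^ m) * sobolevNatENorm m p g := by
  rw [cofactorEnd, LinearMap.sum_apply]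
  refine ((isENorm_lpENorm hp).sum_le _ _).trans ?_
  calc _ ≤ ∑ i ∈ Finset.range N, 2 ^ N * ENNReal.ofReal (((2 : ℝ) ^ k)⁻¹ ^ m) *
          sobolevNatENorm m p g := by
        refine Finset.sum_le_sum fun i hi => ?_
        have hiN := Finset.mem_range.1 hi
        rw [Module.End.mul_apply]
        set b := N - 1 - i with hb
        -- As many as possible of the m exchanges use the factors at scale k + 1. The remaining m -
        -- b' are available at scale k because i + b = N - 1 ≥ m.
        set b' := min b m with hb'
        set i' := m - b' with hi'
        have hb1 : b' ≤ m := min_le_right _ _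
        have hii : i' ≤ i := by omega
        obtain ⟨h1, h2⟩ := hg.remainder hp (k + 1) b
        have e1 := h1.lpENorm_remainder_toLp hp k i
        change lpENorm ((remainderEnd hp k ^ i) ((remainderEnd hp (k + 1) ^ b) hg.toLp)) = _ at e1
        have e2 := h1.lpENorm_remainder_pow_le hp k (i := i) (i' := i') (j := 0) (l := i') rfl
          (Nat.zero_le m) (Nat.sub_le _ _) hii
        have e3 : h1.deriv (Nat.sub_le m b' : i' ≤ m) =
            (remainderEnd hp (k + 1) ^ b) (hg.deriv (Nat.sub_le m b')) :=
          Subtype.ext (h2 i' (Nat.sub_le _ _))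
        rw [e3] at e2
        have e4 := hg.lpENorm_remainder_pow_le hp (k + 1) (i := b) (i' := b') (j := i') (l := m)
          (by omega) (Nat.sub_le _ _) le_rfl (min_le_left _ _)
        rw [e1]
        refine e2.trans ((mul_le_mul_right e4 _).trans ?_)
        have hk : (((2 : ℝ) ^ (k + 1))⁻¹) ≤ ((2 : ℝ) ^ k)⁻¹ := by
          gcongr
          · exact one_le_two
          · omega
        calc _ = (2 ^ i * 2 ^ b) * (ENNReal.ofReal (((2 : ℝ) ^ k)⁻¹ ^ i') *
              ENNReal.ofReal (((2 : ℝ) ^ (k + 1))⁻¹ ^ b')) * lpENorm (hg.deriv le_rfl) := by ring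
          _ ≤ 2 ^ N * ENNReal.ofReal (((2 : ℝ) ^ k)⁻¹ ^ m) * lpENorm (hg.deriv le_rfl) := by
            rw [← pow_add, ← ENNReal.ofReal_mul (by positivity)]
            gcongr
            · exact one_le_two
            · omega
            · have : m = i' + b' := by omega
              rw [this, pow_add _ i' b']
              refine mul_le_mul_of_nonneg_left (pow_le_pow_left₀ (by positivity) hk _) (by positivity)
          _ ≤ _ := by gcongr; exact hg.lpENorm_deriv_le hp le_rfl
    _ = _ := by
      rw [Finset.sum_const, Finset.card_range, nsmul_eq_mul]; push_cast; ring

end IsSmoothLp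

/-- Smooth functions are dense in W^m_p and the cofactor is bounded on L_p. -/
lemma lpENorm_cofactorEnd_le_sobolev (hp : 1 < p) {m N : ℕ} (hm : m + 1 ≤ N) (k : ℕ)
    (f : lpFun E X p) : lpENorm (cofactorEnd hp N k f) ≤
      (N * 2 ^ N : ℕ) * ENNReal.ofReal (((2 : ℝ) ^ k)⁻¹ ^ m) * sobolevNatENorm m p (f : E → X) := by
  by_cases hf : sobolevNatENorm m p (f : E → X) < ⊤
  swap
  · rw [not_lt_top_iff.1 hf, ENNReal.mul_top]
    · exact le_top
    · refine mul_ne_zero ?_ ?_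
      · have : 0 < N := by omega
        exact_mod_cast (by positivity : N * 2 ^ N ≠ 0)
      · rw [ne_eq, ENNReal.ofReal_eq_zero, not_le]; positivity
  obtain ⟨g, hgc, hgle, hgm, hg⟩ := exists_smooth_tendsto_sobolevNatENorm hp hf
  have hgs : ∀ n, IsSmoothLp m p (g n) := fun n => ⟨hgc n, hgm n⟩
  set c : ℝ≥0∞ := (N * 2 ^ N : ℕ) * ENNReal.ofReal (((2 : ℝ) ^ k)⁻¹ ^ m)
  have hlim : Tendsto (fun n => ((N * 2 ^ N : ℕ) : ℝ≥0∞) * sobolevNatENorm m p (g n - (f : E → X)) +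
      c * sobolevNatENorm m p (f : E → X)) atTop (𝓝 (c * sobolevNatENorm m p (f : E → X))) := by
    have h1 := ENNReal.Tendsto.const_mul (a := ((N * 2 ^ N : ℕ) : ℝ≥0∞)) hg
      (Or.inr (ENNReal.natCast_ne_top _))
    have h2 := h1.add (tendsto_const_nhds (x := c * sobolevNatENorm m p (f : E → X)))
    simpa using h2
  refine ge_of_tendsto' hlim fun n => ?_
  have e : cofactorEnd hp N k f = cofactorEnd hp N k (f - (hgs n).toLp) +
      cofactorEnd hp N k (hgs n).toLp := by rw [← map_add, sub_add_cancel]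
  rw [e]
  refine ((isENorm_lpENorm hp).add_le _ _).trans (add_le_add ?_ ?_)
  · refine (lpENorm_cofactorEnd_le hp N k _).trans ?_
    gcongr
    rw [(isENorm_lpENorm hp).sub_comm]
    exact eLpNorm_le_sobolevNatENorm hp (g n - (f : E → X))
  · refine ((hgs n).lpENorm_cofactorEnd_le hp hm k).trans ?_
    gcongr
    exact hgle n

end LittlewoodPaley

/-! ### Pointwise bounds for the smoothings of a function in H^s_p. -/

section SmoothedSequences

variable {E : Type*} [NormedAddCommGroup E] [NormedSpace ℝ E] [FiniteDimensional ℝ E]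
  [MeasureSpace E] [BorelSpace E] [(volume : Measure E).IsAddHaarMeasure]
  {X : Type*} [NormedAddCommGroup X] [NormedSpace ℝ X] [CompleteSpace X] {s p : ℝ}

lemma contDiff_mollifyEnd (hp : 1 < p) (k : ℕ) (f : lpFun E X p) :
    ContDiff ℝ ∞ (mollifyEnd hp k f : E → X) :=
  (isMollifier_scaled k).contDiff_mollify (MemLp.locallyIntegrable f.2 (one_le_ofReal hp))

/-- The derivative of a mollification at a point. -/
def mollifyDerivAt (hp : 1 < p) (k a : ℕ) (x : E) : lpFun E X p →ₗ[ℝ] E [×a]→L[ℝ] X where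
  toFun f := iteratedFDeriv ℝ a (mollifyEnd hp k f : E → X) x
  map_add' f g := by
    rw [map_add]
    exact iteratedFDeriv_add_apply ((contDiff_mollifyEnd hp k f).contDiffAt.of_le
      (by exact_mod_cast le_top)) ((contDiff_mollifyEnd hp k g).contDiffAt.of_le
      (by exact_mod_cast le_top))
  map_smul' c f := by
    rw [map_smul]
    exact iteratedFDeriv_const_smul_apply ((contDiff_mollifyEnd hp k f).contDiffAt.of_le
      (by exact_mod_cast le_top))

/-- The derivative at a point of the difference of mollifications at consecutive scales. -/
def mollifyDiffDerivAt (hp : 1 < p) (k a : ℕ) (x : E) : lpFun E X p →ₗ[ℝ] E [×a]→L[ℝ] X :=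
  mollifyDerivAt hp (k + 1) a x - mollifyDerivAt hp k a x

lemma contDiff_smoothEnd (hp : 1 < p) (N k : ℕ) (f : lpFun E X p) :
    ContDiff ℝ ∞ (smoothEnd hp N k f : E → X) := by
  induction k with
  | zero => rw [smoothEnd_zero_eq]; exact contDiff_mollifyEnd hp 0 _
  | succ k ih =>
    have e : (smoothEnd hp N (k + 1) f : E → X) = smoothEnd hp N k f +
        ((mollifyEnd hp (k + 1) (cofactorEnd hp N k f) : lpFun E X p) -
          (mollifyEnd hp k (cofactorEnd hp N k f) : lpFun E X p) : E → X) := by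
      have h := congrArg (fun g : lpFun E X p => (g : E → X)) (smoothEnd_sub hp N k f)
      simp only [Submodule.coe_sub] at h
      rw [← h]; abel
    rw [e]
    exact ih.add ((contDiff_mollifyEnd hp _ _).sub (contDiff_mollifyEnd hp _ _))

lemma iteratedFDeriv_smoothEnd_succ (hp : 1 < p) (N k a : ℕ) (f : lpFun E X p) (x : E) :
    iteratedFDeriv ℝ a (smoothEnd hp N (k + 1) f : E → X) x =
      iteratedFDeriv ℝ a (smoothEnd hp N k f : E → X) x +
        mollifyDiffDerivAt hp k a x (cofactorEnd hp N k f) := by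
  have e : (smoothEnd hp N (k + 1) f : E → X) = smoothEnd hp N k f +
      ((mollifyEnd hp (k + 1) (cofactorEnd hp N k f) : lpFun E X p) -
        (mollifyEnd hp k (cofactorEnd hp N k f) : lpFun E X p) : E → X) := by
    have h := congrArg (fun g : lpFun E X p => (g : E → X)) (smoothEnd_sub hp N k f)
    simp only [Submodule.coe_sub] at h
    rw [← h]; abel
  have hle : ((a : ℕ) : ℕ∞ω) ≤ (∞ : ℕ∞ω) := by exact_mod_cast le_top
  have h1 := (contDiff_mollifyEnd hp (k + 1) (cofactorEnd hp N k f)).of_le hle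
  have h2 := (contDiff_mollifyEnd hp k (cofactorEnd hp N k f)).of_le hle
  rw [e]
  refine (iteratedFDeriv_add_apply ((contDiff_smoothEnd hp N k f).of_le hle).contDiffAt
    (h1.sub h2).contDiffAt).trans ?_
  congr 1
  exact iteratedFDeriv_sub_apply h1.contDiffAt h2.contDiffAt

/-- For fixed k and x this is a linear map with values in a normed space. On W^m_p the cofactor
contributes 2^{-km} and the mollification 2^{k(a + d/p)}. The bound is log-linear in m, so
`enorm_le_besselENorm` replaces m by s. The orders m < s + 1 occur, and N ≥ s + 2 ensures m + 1 ≤ N.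
-/
lemma exists_enorm_smoothEnd_sub_le (hp : 1 < p) (hs : 0 ≤ s) {N : ℕ} (hN : s + 2 ≤ N) (a : ℕ) :
    ∃ C : ℝ, 0 < C ∧ ∀ (k : ℕ) (x : E) (f : E → X),
      ‖mollifyDiffDerivAt hp k a x
        (cofactorEnd hp N k (lpProj E X p f))‖ₑ ≤
      ENNReal.ofReal (C * ((2 : ℝ) ^ k) ^ (a + Module.finrank ℝ E / p - s : ℝ)) *
        besselENorm s p f := by
  obtain ⟨C₀, hC₀, h₀⟩ := exists_enorm_iteratedFDeriv_mollify_le E hp a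
  set β : ℝ := a + Module.finrank ℝ E / p with hβ
  have hp0 : 0 < p := by linarith
  have hβ0 : 0 ≤ β := by positivity
  have hN0 : 0 < N := by
    have : (0 : ℝ) < N := by linarith
    exact_mod_cast this
  set C : ℝ := (C₀ * (2 : ℝ) ^ β + C₀) * (N * 2 ^ N : ℕ) with hC
  have hCpos : 0 < C := by
    have : (0 : ℝ) < (N * 2 ^ N : ℕ) := by exact_mod_cast (by positivity)
    positivity
  refine ⟨C, hCpos, fun k x f => ?_⟩
  set b : ℝ := 2 ^ k with hb
  have hb0 : 0 < b := by positivity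
  have key := enorm_le_besselENorm hs
    ((mollifyDiffDerivAt (X := X) hp k a x) ∘ₗ (cofactorEnd hp N k) ∘ₗ
      (lpProj E X p)) (C := C * b ^ β) (L := b⁻¹) (p := p) (s := s) (by positivity) (by positivity)
      ?_ f
  · refine key.trans (le_of_eq ?_)
    congr 2
    rw [Real.inv_rpow hb0.le, ← Real.rpow_neg hb0.le, mul_assoc, ← Real.rpow_add hb0]
    rfl
  · intro m hm f
    by_cases hf : sobolevNatENorm m p f < ⊤
    swap
    · rw [not_lt_top_iff.1 hf, ENNReal.mul_top]
      · exact le_top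
      · rw [ne_eq, ENNReal.ofReal_eq_zero, not_le]; positivity
    have hfm := memLp_of_sobolevNatENorm_lt_top hf
    have hmN : m + 1 ≤ N := by
      have : (m : ℝ) + 1 < N := by linarith
      exact_mod_cast this.le
    set F : lpFun E X p := ⟨f, hfm⟩ with hF
    have e : lpProj E X p f = F := lpProj_coe F
    simp only [LinearMap.comp_apply, e]
    set h := cofactorEnd hp N k F
    have h1 := lpENorm_cofactorEnd_le_sobolev hp hmN k F
    have h2 := h₀ (k + 1) X h h.2 x
    have h3 := h₀ k X h h.2 x
    calc ‖mollifyDiffDerivAt hp k a x h‖ₑ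
        ≤ ENNReal.ofReal (C₀ * ((2 : ℝ) ^ (k + 1)) ^ β) * lpENorm h +
          ENNReal.ofReal (C₀ * b ^ β) * lpENorm h :=
          (enorm_sub_le).trans (add_le_add h2 h3)
      _ = ENNReal.ofReal ((C₀ * (2 : ℝ) ^ β + C₀) * b ^ β) * lpENorm h := by
          rw [← add_mul, ← ENNReal.ofReal_add (by positivity) (by positivity)]
          congr 2
          rw [pow_succ, Real.mul_rpow (by positivity) (by positivity)]
          ring
      _ ≤ ENNReal.ofReal ((C₀ * (2 : ℝ) ^ β + C₀) * b ^ β) * ((N * 2 ^ N : ℕ) *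
          ENNReal.ofReal (b⁻¹ ^ m) * sobolevNatENorm m p f) := by gcongr
      _ = _ := by
          rw [← ENNReal.ofReal_natCast, ← ENNReal.ofReal_mul (by positivity), ← mul_assoc,
            ← ENNReal.ofReal_mul (by positivity), Real.rpow_natCast]
          congr 2
          rw [hC]; ring

/-- At the scale k = 0 no decay is needed, so the L_p-bound on every W^m_p is enough: the
interpolation is run with L = 1. -/
lemma exists_enorm_smoothEnd_zero_le (hp : 1 < p) (hs : 0 ≤ s) (N : ℕ) (a : ℕ) :
    ∃ C : ℝ, 0 < C ∧ ∀ (x : E) (f : E → X),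
      ‖iteratedFDeriv ℝ a (smoothEnd hp N 0 (lpProj E X p f) : E → X) x‖ₑ ≤
        ENNReal.ofReal C * besselENorm s p f := by
  obtain ⟨C₀, hC₀, h₀⟩ := exists_enorm_iteratedFDeriv_mollify_le E hp a
  have hpos : 0 < C₀ * (N * 2 ^ N + 1 : ℕ) := by positivity
  refine ⟨C₀ * (N * 2 ^ N + 1 : ℕ), hpos, fun x f => ?_⟩
  have key := enorm_le_besselENorm hs
    ((mollifyDerivAt (X := X) hp 0 a x) ∘ₗ (∑ i ∈ Finset.range N, remainderEnd hp 0 ^ i) ∘ₗ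
      (lpProj E X p)) (C := C₀ * (N * 2 ^ N + 1 : ℕ)) (L := 1) (p := p) (s := s) hpos one_pos
      ?_ f
  · simp only [Real.one_rpow, mul_one] at key
    refine le_trans (le_of_eq ?_) key
    rw [smoothEnd_zero_eq, ← LinearMap.sum_apply]
    rfl
  · intro m hm f
    simp only [Real.one_rpow, mul_one]
    by_cases hf : sobolevNatENorm m p f < ⊤
    swap
    · rw [not_lt_top_iff.1 hf, ENNReal.mul_top]
      · exact le_top
      · rw [ne_eq, ENNReal.ofReal_eq_zero, not_le]; exact hpos
    have hfm := memLp_of_sobolevNatENorm_lt_top hf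
    set F : lpFun E X p := ⟨f, hfm⟩ with hF
    have e : lpProj E X p f = F := lpProj_coe F
    simp only [LinearMap.comp_apply, e]
    have h1 : lpENorm ((∑ i ∈ Finset.range N, remainderEnd hp 0 ^ i) F) ≤
        ((N * 2 ^ N + 1 : ℕ) : ℝ≥0∞) * lpENorm F := by
      rw [LinearMap.sum_apply]
      refine ((isENorm_lpENorm hp).sum_le _ _).trans ?_
      calc _ ≤ ∑ i ∈ Finset.range N, 2 ^ N * lpENorm F := by
            refine Finset.sum_le_sum fun i hi => (lpENorm_remainderEnd_pow_le hp 0 i F).trans ?_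
            gcongr
            · exact one_le_two
            · exact (Finset.mem_range.1 hi).le
        _ = (N * 2 ^ N : ℕ) * lpENorm F := by
          rw [Finset.sum_const, Finset.card_range, nsmul_eq_mul]; push_cast; ring
        _ ≤ _ := by gcongr; omega
    have h2 := h₀ 0 X _ ((∑ i ∈ Finset.range N, remainderEnd hp 0 ^ i) F).2 x
    rw [pow_zero, Real.one_rpow, mul_one] at h2
    rw [ENNReal.ofReal_mul hC₀.le, ENNReal.ofReal_natCast, mul_assoc]
    refine h2.trans ?_
    gcongr
    refine h1.trans ?_
    gcongr
    exact eLpNorm_le_sobolevNatENorm hp f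

/-- Bounds for the smoothings, at scale `2 ^ (-k)`, of a Hölder continuous function. -/
structure IsSmoothingSeq (M : ℕ) (ε H : ℝ) (w : ℕ → E → X) : Prop where
  contDiff : ∀ k, ContDiff ℝ ∞ (w k)
  bound : ∀ k x, ‖w k x‖ ≤ H
  deriv_bound : ∀ k a, 1 ≤ a → a ≤ M → ∀ x,
    ‖iteratedFDeriv ℝ a (w k) x‖ ≤ H * ((2 : ℝ) ^ k) ^ ((a : ℝ) - ε)
  diff_bound : ∀ k x, ‖w (k + 1) x - w k x‖ ≤ H * ((2 : ℝ) ^ k) ^ (-ε)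

lemma norm_le_of_enorm_le {Y : Type*} [NormedAddCommGroup Y] {y : Y} {c : ℝ} (hc : 0 ≤ c)
    {b : ℝ≥0∞} (hb : b < ⊤) (h : ‖y‖ₑ ≤ ENNReal.ofReal c * b) : ‖y‖ ≤ c * b.toReal := by
  have := ENNReal.toReal_mono (ENNReal.mul_lt_top ENNReal.ofReal_lt_top hb).ne h
  rwa [toReal_enorm, ENNReal.toReal_mul, ENNReal.toReal_ofReal hc] at this

/-- The smoothings of a function in `H^s_p`, `s > d / p`. -/
lemma exists_isSmoothingSeq (hp : 1 < p) (hs : 0 ≤ s) {N : ℕ} (hN : s + 2 ≤ N) (M : ℕ) {ε : ℝ}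
    (hε : 0 < ε) (hε1 : ε < 1) (hεs : ε ≤ s - Module.finrank ℝ E / p) :
    ∃ C : ℝ, 0 < C ∧ ∀ f : E → X, besselENorm s p f < ⊤ →
      IsSmoothingSeq M ε (C * (besselENorm s p f).toReal)
        (fun k => (smoothEnd hp N k (lpProj E X p f) : E → X)) := by
  choose C₁ hC₁ h₁ using exists_enorm_smoothEnd_sub_le (E := E) (X := X) hp hs hN
  choose C₀ hC₀ h₀ using exists_enorm_smoothEnd_zero_le (E := E) (X := X) hp hs N
  have h2ε : (2 : ℝ) ^ (-ε) < 1 := Real.rpow_lt_one_of_one_lt_of_neg one_lt_two (by linarith)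
  set δ := 1 - (2 : ℝ) ^ (-ε) with hδ
  have hδ0 : 0 < δ := by rw [hδ]; linarith
  have hgeo : ∀ a : ℕ, 1 ≤ a → 0 < (2 : ℝ) ^ ((a : ℝ) - ε) - 1 := fun a ha => by
    have : (1 : ℝ) ≤ a := by exact_mod_cast ha
    have := Real.one_lt_rpow one_lt_two (by linarith : 0 < (a : ℝ) - ε)
    linarith
  -- The quotient is the constant of a geometric sum with ratio 2^{a-ε}. The absolute value only
  -- keeps `K 0` positive, where the ratio is below one.
  set K : ℕ → ℝ := fun a => C₀ a + C₁ a / |(2 : ℝ) ^ ((a : ℝ) - ε) - 1| with hK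
  have hKpos : ∀ a, 0 < K a := fun a => add_pos_of_pos_of_nonneg (hC₀ a)
    (div_nonneg (hC₁ a).le (abs_nonneg _))
  set C : ℝ := (C₁ 0 / δ + C₀ 0 + C₁ 0) + ∑ a ∈ Finset.range (M + 1), K a with hC
  have hsum : 0 ≤ ∑ a ∈ Finset.range (M + 1), K a := Finset.sum_nonneg fun a _ => (hKpos a).le
  have hC10 := hC₁ 0
  have hC00 := hC₀ 0
  have hdiv : 0 < C₁ 0 / δ := by positivity
  refine ⟨C, by positivity, fun f hf => ?_⟩
  set H := (besselENorm s p f).toReal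
  have hH : 0 ≤ H := ENNReal.toReal_nonneg
  set u := lpProj E X p f
  have hstep : ∀ (k a : ℕ) (x : E), ‖mollifyDiffDerivAt hp k a x
      (cofactorEnd hp N k u)‖ ≤ C₁ a * ((2 : ℝ) ^ k) ^ ((a : ℝ) - ε) * H := by
    intro k a x
    have hb1 : (1 : ℝ) ≤ 2 ^ k := one_le_pow₀ one_le_two
    refine (norm_le_of_enorm_le (mul_nonneg (hC₁ a).le (by positivity)) hf (h₁ a k x f)).trans ?_
    refine mul_le_mul_of_nonneg_right (mul_le_mul_of_nonneg_left ?_ (hC₁ a).le) hH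
    exact Real.rpow_le_rpow_of_exponent_le hb1 (by linarith)
  have hbase : ∀ (a : ℕ) (x : E), ‖iteratedFDeriv ℝ a (smoothEnd hp N 0 u : E → X) x‖ ≤ C₀ a * H :=
    fun a x => norm_le_of_enorm_le (hC₀ a).le hf (h₀ a x f)
  have hsplit : ∀ (k a : ℕ) (x : E), ‖iteratedFDeriv ℝ a (smoothEnd hp N (k + 1) u : E → X) x‖ ≤
      ‖iteratedFDeriv ℝ a (smoothEnd hp N k u : E → X) x‖ +
        C₁ a * ((2 : ℝ) ^ k) ^ ((a : ℝ) - ε) * H := by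
    intro k a x
    rw [iteratedFDeriv_smoothEnd_succ]
    exact (norm_add_le _ _).trans (by gcongr; exact hstep k a x)
  refine ⟨fun k => contDiff_smoothEnd hp N k u, fun k x => ?_, fun k a ha haM x => ?_, fun k x => ?_⟩
  -- The sum of the increments 2^{-kε} is finite. The induction carries the remaining tail as a
  -- negative term, so that it closes exactly.
  · have h0 : ∀ k, ‖iteratedFDeriv ℝ 0 (smoothEnd hp N k u : E → X) x‖ ≤
        (C₁ 0 / δ + C₀ 0 - C₁ 0 / δ * ((2 : ℝ) ^ k) ^ (-ε)) * H := by
      intro k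
      induction k with
      | zero =>
        refine (hbase 0 x).trans ?_
        rw [pow_zero, Real.one_rpow, mul_one, add_sub_cancel_left]
      | succ k ih =>
        refine (hsplit k 0 x).trans ((add_le_add ih le_rfl).trans (le_of_eq ?_))
        rw [pow_succ, Real.mul_rpow (by positivity) (by positivity), CharP.cast_eq_zero, zero_sub]
        have : (2 : ℝ) ^ (-ε) = 1 - δ := by rw [hδ]; ring
        rw [this]
        field_simp
        ring
    have h := h0 k
    rw [norm_iteratedFDeriv_zero] at h
    refine h.trans (mul_le_mul_of_nonneg_right ?_ hH)
    have : 0 ≤ C₁ 0 / δ * ((2 : ℝ) ^ k) ^ (-ε) := by positivity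
    linarith
  · have hg := hgeo a ha
    have h0 : ∀ k, ‖iteratedFDeriv ℝ a (smoothEnd hp N k u : E → X) x‖ ≤
        K a * ((2 : ℝ) ^ k) ^ ((a : ℝ) - ε) * H := by
      intro k
      induction k with
      | zero =>
        refine (hbase a x).trans (mul_le_mul_of_nonneg_right ?_ hH)
        rw [pow_zero, Real.one_rpow, mul_one]
        exact le_add_of_nonneg_right (div_nonneg (hC₁ a).le (abs_nonneg _))
      | succ k ih =>
        refine (hsplit k a x).trans ((add_le_add ih le_rfl).trans ?_)
        rw [← add_mul]
        refine mul_le_mul_of_nonneg_right ?_ hH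
        rw [pow_succ, Real.mul_rpow (by positivity) (by positivity), ← add_mul,
          mul_comm (((2 : ℝ) ^ k) ^ ((a : ℝ) - ε)), ← mul_assoc]
        refine mul_le_mul_of_nonneg_right ?_ (by positivity)
        -- For a ≥ 1 the exponent a - ε is positive because ε < 1, so the increments grow
        -- geometrically and are dominated by the last one.
        have h5 : C₁ a ≤ K a * ((2 : ℝ) ^ ((a : ℝ) - ε) - 1) := by
          have : C₁ a = C₁ a / |(2 : ℝ) ^ ((a : ℝ) - ε) - 1| * ((2 : ℝ) ^ ((a : ℝ) - ε) - 1) := by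
            rw [abs_of_pos hg]; field_simp
          nlinarith [hC₀ a, mul_pos (hC₀ a) hg]
        linarith
    have h1 : K a ≤ C := by
      have := Finset.single_le_sum (f := K) (fun a _ => (hKpos a).le)
        (Finset.mem_range.2 (Nat.lt_succ_iff.2 haM))
      linarith
    calc _ ≤ K a * ((2 : ℝ) ^ k) ^ ((a : ℝ) - ε) * H := h0 k
      _ ≤ C * ((2 : ℝ) ^ k) ^ ((a : ℝ) - ε) * H := by gcongr
      _ = _ := by ring
  · have h := hstep k 0 x
    have e := iteratedFDeriv_smoothEnd_succ hp N k 0 u x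
    rw [← sub_eq_iff_eq_add'] at e
    rw [← e] at h
    have e2 : iteratedFDeriv ℝ 0 (smoothEnd hp N (k + 1) u : E → X) x -
        iteratedFDeriv ℝ 0 (smoothEnd hp N k u : E → X) x =
        iteratedFDeriv ℝ 0 ((smoothEnd hp N (k + 1) u : E → X) - (smoothEnd hp N k u : E → X)) x := by
      ext; simp
    rw [e2, norm_iteratedFDeriv_zero, CharP.cast_eq_zero, zero_sub] at h
    refine h.trans ?_
    calc _ ≤ C * ((2 : ℝ) ^ k) ^ (-ε) * H := by
          gcongr
          linarith
      _ = _ := by ring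

end SmoothedSequences

/-! ### Strong limits of uniformly bounded operators. -/

section LimitOperators

variable {E : Type*} [NormedAddCommGroup E] [NormedSpace ℝ E] [FiniteDimensional ℝ E]
  [MeasureSpace E] [BorelSpace E] [(volume : Measure E).IsAddHaarMeasure]
  {X : Type*} [NormedAddCommGroup X] [NormedSpace ℝ X] [CompleteSpace X] {p : ℝ} {M : ℕ}
  {E' : Type*} [NormedAddCommGroup E'] [NormedSpace ℝ E'] [FiniteDimensional ℝ E']
  [MeasureSpace E'] [BorelSpace E'] [(volume : Measure E').IsAddHaarMeasure]
  {X' : Type*} [NormedAddCommGroup X'] [NormedSpace ℝ X'] [CompleteSpace X']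

/-- The Cauchy property on the dense set of smooth functions extends to all of W^m_p by uniform
boundedness, with three errors η/3. -/
lemma exists_tendsto_of_uniform_bound (hp : 1 < p) {m : ℕ} (T : ℕ → (E → X) →ₗ[ℝ] (E' → X'))
    {C : ℝ≥0} (hb : ∀ K f, sobolevNatENorm m p (T K f) ≤ C * sobolevNatENorm m p f)
    (hc : ∀ g : E → X, IsSmoothLp m p g → ∀ η > (0 : ℝ), ∃ K₀, ∀ K ≥ K₀, ∀ L ≥ K₀,
      sobolevNatENorm m p (T K g - T L g) ≤ ENNReal.ofReal η) {f : E → X}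
    (hf : sobolevNatENorm m p f < ⊤) : ∃ h : E' → X', sobolevNatENorm m p h ≤
      C * sobolevNatENorm m p f ∧
      Tendsto (fun K => sobolevNatENorm m p (T K f - h)) atTop (𝓝 0) := by
  have hN := isENorm_sobolevNatENorm (E := E) (X := X) (m := m) hp
  have hN' := isENorm_sobolevNatENorm (E := E') (X := X') (m := m) hp
  obtain ⟨g, hgc, hgle, hgm, hg⟩ := exists_smooth_tendsto_sobolevNatENorm hp hf
  have htop : C * sobolevNatENorm m p f < ⊤ := ENNReal.mul_lt_top (by simp) hf
  obtain ⟨h, hh, ht⟩ := (EComplete_sobolevNatENorm hp).exists_tendsto hN' (u := fun K => T K f)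
    (fun K => (hb K f).trans_lt htop) (fun η hη => by
      have h1 : Tendsto (fun n => (C : ℝ≥0∞) * sobolevNatENorm m p (g n - f)) atTop (𝓝 0) := by
        simpa using ENNReal.Tendsto.const_mul hg (Or.inr (by simp : (C : ℝ≥0∞) ≠ ⊤))
      obtain ⟨n, hn⟩ := ((ENNReal.tendsto_nhds_zero.1 h1) (ENNReal.ofReal (η / 3))
        (by simpa using hη)).exists
      obtain ⟨K₀, hK₀⟩ := hc (g n) ⟨hgc n, hgm n⟩ (η / 3) (by positivity)
      refine ⟨K₀, fun k hk l hl => ?_⟩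
      have e : T k f - T l f = (T k (g n) - T l (g n)) - (T k (g n - f) - T l (g n - f)) := by
        rw [map_sub, map_sub]; abel
      rw [e]
      calc _ ≤ sobolevNatENorm m p (T k (g n) - T l (g n)) +
            (sobolevNatENorm m p (T k (g n - f)) + sobolevNatENorm m p (T l (g n - f))) :=
            (hN'.sub_le _ _).trans (by gcongr; exact hN'.sub_le _ _)
        _ ≤ ENNReal.ofReal (η / 3) + (ENNReal.ofReal (η / 3) + ENNReal.ofReal (η / 3)) :=
            add_le_add (hK₀ k hk l hl) (add_le_add ((hb _ _).trans hn) ((hb _ _).trans hn))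
        _ = ENNReal.ofReal η := by
          rw [← ENNReal.ofReal_add (by positivity) (by positivity),
            ← ENNReal.ofReal_add (by positivity) (by positivity)]
          congr 1; ring)
  refine ⟨h, ?_, ht⟩
  have hlim : Tendsto (fun k => sobolevNatENorm m p (T k f - h) + C * sobolevNatENorm m p f) atTop
      (𝓝 (0 + C * sobolevNatENorm m p f)) := ht.add tendsto_const_nhds
  rw [zero_add] at hlim
  refine ge_of_tendsto' hlim fun k => ?_
  calc sobolevNatENorm m p h = sobolevNatENorm m p ((h - T k f) + T k f) := by rw [sub_add_cancel]
    _ ≤ sobolevNatENorm m p (h - T k f) + sobolevNatENorm m p (T k f) := hN'.add_le _ _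
    _ ≤ _ := by
      rw [hN'.sub_comm]
      gcongr
      exact hb k f

/-- Strong limits of operators which are uniformly bounded on Sobolev spaces. -/
lemma exists_limit_operator (hp : 1 < p) (T : ℕ → (E → X) →ₗ[ℝ] (E' → X')) {C : ℝ≥0} (hC : C ≠ 0)
    (hb : ∀ m ≤ M, ∀ K f, sobolevNatENorm m p (T K f) ≤ C * sobolevNatENorm m p f)
    (hc : ∀ m ≤ M, ∀ g : E → X, IsSmoothLp m p g → ∀ η > (0 : ℝ), ∃ K₀, ∀ K ≥ K₀, ∀ L ≥ K₀,
      sobolevNatENorm m p (T K g - T L g) ≤ ENNReal.ofReal η) :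
    ∃ S : (E → X) →ₗ[ℝ] (E' → X'),
      (∀ m ≤ M, ∀ f, sobolevNatENorm m p (S f) ≤ C * sobolevNatENorm m p f) ∧
      ∀ f, MemLp f (ENNReal.ofReal p) volume → MemLp (S f) (ENNReal.ofReal p) volume ∧
        Tendsto (fun K => eLpNorm (T K f - S f) (ENNReal.ofReal p) volume) atTop (𝓝 0) := by
  have hp0 : ∀ {f : E → X}, MemLp f (ENNReal.ofReal p) volume → sobolevNatENorm 0 p f < ⊤ :=
    fun hf => by rw [sobolevNatENorm_zero_eq hp hf]; exact hf.2
  have hTm : ∀ {f : E → X} (K), MemLp f (ENNReal.ofReal p) volume →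
      MemLp (T K f) (ENNReal.ofReal p) volume := fun K hf =>
    memLp_of_sobolevNatENorm_lt_top ((hb 0 (Nat.zero_le _) K _).trans_lt
      (ENNReal.mul_lt_top (by simp) (hp0 hf)))
  -- Limits are determined only almost everywhere. The limit relation is a linear subspace that
  -- projects onto L_p, and a linear right inverse of the projection selects limits linearly.
  let G : Submodule ℝ (lpFun E X p × (E' → X')) :=
    { carrier := {fh | MemLp fh.2 (ENNReal.ofReal p) volume ∧ Tendsto (fun K =>
        eLpNorm (T K fh.1 - fh.2) (ENNReal.ofReal p) volume) atTop (𝓝 0)}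
      zero_mem' := ⟨memLp_zero, by simp [eLpNorm_pi_zero]⟩
      add_mem' := by
        rintro ⟨f, h⟩ ⟨f', h'⟩ ⟨h1, h2⟩ ⟨h3, h4⟩
        refine ⟨memLp_add h1 h3, tendsto_of_tendsto_of_tendsto_of_le_of_le tendsto_const_nhds
          (by simpa using h2.add h4) (fun _ => zero_le) fun K => ?_⟩
        have e : T K ((f + f' : lpFun E X p) : E → X) - (h + h') = (T K f - h) + (T K f' - h') := by
          rw [Submodule.coe_add, map_add]; abel
        simp only [Prod.fst_add, Prod.snd_add, e]
        exact eLpNorm_add_le_of_memLp (memLp_sub (hTm K f.2) h1) (memLp_sub (hTm K f'.2) h3)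
          (one_le_ofReal hp)
      smul_mem' := by
        rintro c ⟨f, h⟩ ⟨h1, h2⟩
        refine ⟨h1.const_smul c, tendsto_zero_of_le_mul (M := ‖c‖ₑ) (by simp) h2 fun K => ?_⟩
        have e : T K ((c • f : lpFun E X p) : E → X) - c • h = c • (T K f - h) := by
          rw [Submodule.coe_smul, map_smul, smul_sub]
        simp only [Prod.smul_fst, Prod.smul_snd, e]
        exact (eLpNorm_const_smul (𝕜 := ℝ) c _ _ _).le }
  have hsurj : LinearMap.range ((LinearMap.fst ℝ (lpFun E X p) (E' → X')) ∘ₗ G.subtype) = ⊤ := by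
    rw [LinearMap.range_eq_top]
    intro f
    obtain ⟨h, h1, h2⟩ := exists_tendsto_of_uniform_bound hp T (hb 0 (Nat.zero_le _))
      (hc 0 (Nat.zero_le _)) (hp0 f.2)
    refine ⟨⟨(f, h), memLp_of_sobolevNatENorm_lt_top (h1.trans_lt
      (ENNReal.mul_lt_top (by simp) (hp0 f.2))), ?_⟩, rfl⟩
    exact tendsto_of_tendsto_of_tendsto_of_le_of_le tendsto_const_nhds h2 (fun _ => zero_le)
      fun K => eLpNorm_le_sobolevNatENorm hp _
  obtain ⟨σ, hσ⟩ := LinearMap.exists_rightInverse_of_surjective _ hsurj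
  let S : (E → X) →ₗ[ℝ] (E' → X') :=
    (LinearMap.snd ℝ (lpFun E X p) (E' → X')) ∘ₗ G.subtype ∘ₗ σ ∘ₗ lpProj E X p
  have hS : ∀ f, MemLp f (ENNReal.ofReal p) volume → MemLp (S f) (ENNReal.ofReal p) volume ∧
        Tendsto (fun K => eLpNorm (T K f - S f) (ENNReal.ofReal p) volume) atTop (𝓝 0) := by
    intro f hf
    have e : lpProj E X p f = ⟨f, hf⟩ := lpProj_coe ⟨f, hf⟩
    have h1 : (σ ⟨f, hf⟩ : lpFun E X p × (E' → X')).1 = ⟨f, hf⟩ := LinearMap.congr_fun hσ ⟨f, hf⟩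
    have h2 := (σ ⟨f, hf⟩).2
    have h3 : S f = (σ ⟨f, hf⟩ : lpFun E X p × (E' → X')).2 := by
      simp only [S, LinearMap.comp_apply, e]; rfl
    rw [h3]
    refine ⟨h2.1, ?_⟩
    have h4 := h2.2
    rw [h1] at h4
    exact h4
  refine ⟨S, fun m hm f => ?_, hS⟩
  by_cases hf : sobolevNatENorm m p f < ⊤
  swap
  · rw [not_lt_top_iff.1 hf, ENNReal.mul_top (by simpa using hC)]; exact le_top
  obtain ⟨h, h1, h2⟩ := exists_tendsto_of_uniform_bound hp T (hb m hm) (hc m hm) hf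
  have hfm := memLp_of_sobolevNatENorm_lt_top hf
  -- The limit in W^m_p is also a limit in L_p, hence it agrees with `S f` almost everywhere. One
  -- operator therefore serves all orders m.
  have hae : S f =ᵐ[volume] h := by
    refine eLpNorm_sub_eq_zero_of_tendsto hp (u := fun K => T K f) (fun K => hTm K hfm) (hS f hfm).1
      (memLp_of_sobolevNatENorm_lt_top (h1.trans_lt (ENNReal.mul_lt_top (by simp) hf)))
      (hS f hfm).2 ?_
    exact tendsto_of_tendsto_of_tendsto_of_le_of_le tendsto_const_nhds h2 (fun _ => zero_le)
      fun K => eLpNorm_le_sobolevNatENorm hp _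
  rw [sobolevNatENorm_congr_ae hae]
  exact h1

end LimitOperators

/-! ### Paraproducts on W^m_p. -/

section Paraproducts

variable {E : Type*} [NormedAddCommGroup E] [NormedSpace ℝ E]
  {X₀ X₁ X₂ : Type*} [NormedAddCommGroup X₀] [NormedSpace ℝ X₀] [NormedAddCommGroup X₁]
  [NormedSpace ℝ X₁] [NormedAddCommGroup X₂] [NormedSpace ℝ X₂]

lemma norm_comp_multilinear_le (B : X₁ →L[ℝ] X₂ →L[ℝ] X₀) {i : ℕ} (v : X₁) (T : E [×i]→L[ℝ] X₂) :
    ‖(B v).compContinuousMultilinearMap T‖ ≤ ‖B‖ * ‖v‖ * ‖T‖ :=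
  ((B v).norm_compContinuousMultilinearMap_le T).trans (by gcongr; exact B.le_opNorm v)

/-- The Leibniz formula up to derivatives of the first factor. -/
lemma norm_iteratedFDeriv_bilin_sub_le (B : X₁ →L[ℝ] X₂ →L[ℝ] X₀) {w : E → X₁} {v : E → X₂}
    (hw : ContDiff ℝ ∞ w) (hv : ContDiff ℝ ∞ v) (i : ℕ) (x : E) :
    ‖iteratedFDeriv ℝ i (fun y => B (w y) (v y)) x -
        (B (w x)).compContinuousMultilinearMap (iteratedFDeriv ℝ i v x)‖ ≤
      ∑ a ∈ Finset.range i, ‖B‖ * 2 ^ i * ‖iteratedFDeriv ℝ (a + 1) w x‖ *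
        ‖iteratedFDeriv ℝ (i - (a + 1)) v x‖ := by
  have hle : ((i : ℕ) : ℕ∞ω) ≤ (∞ : ℕ∞ω) := by exact_mod_cast le_top
  -- Freezing the value of `w` at `x` makes the new first factor vanish there, which removes the
  -- term without derivatives on `w` from the Leibniz sum.
  have hwx : ContDiff ℝ ∞ (fun y => w y - w x) := hw.sub contDiff_const
  have e1 : (fun y => B (w y) (v y)) = (fun y => B (w y - w x) (v y)) + (B (w x)) ∘ v := by
    ext y; simp
  have h1 : ContDiff ℝ ∞ (fun y => B (w y - w x) (v y)) :=
    B.isBoundedBilinearMap.contDiff.comp₂ hwx hv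
  have h2 : ContDiff ℝ ∞ ((B (w x)) ∘ v) := (B (w x)).contDiff.comp hv
  have e2 : iteratedFDeriv ℝ i (fun y => B (w y) (v y)) x =
      iteratedFDeriv ℝ i (fun y => B (w y - w x) (v y)) x +
        (B (w x)).compContinuousMultilinearMap (iteratedFDeriv ℝ i v x) := by
    rw [e1]
    refine (iteratedFDeriv_add_apply (h1.of_le hle).contDiffAt (h2.of_le hle).contDiffAt).trans ?_
    congr 1
    exact (B (w x)).iteratedFDeriv_comp_left hv.contDiffAt hle
  rw [e2, add_sub_cancel_right]
  refine (B.norm_iteratedFDeriv_le_of_bilinear hwx hv x hle).trans ?_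
  rw [Finset.sum_range_succ']
  have h0 : ‖iteratedFDeriv ℝ 0 (fun y => w y - w x) x‖ = 0 := by
    rw [norm_iteratedFDeriv_zero, sub_self, norm_zero]
  rw [h0, mul_zero, zero_mul, add_zero, Finset.mul_sum]
  refine Finset.sum_le_sum fun a ha => ?_
  have hd : iteratedFDeriv ℝ (a + 1) (fun y => w y - w x) x = iteratedFDeriv ℝ (a + 1) w x := by
    have h3 := iteratedFDeriv_sub_apply (𝕜 := ℝ) (i := a + 1) (f := w) (g := fun _ => w x) (x := x)
      (hw.of_le (by exact_mod_cast le_top)).contDiffAt contDiff_const.contDiffAt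
    have h4 : iteratedFDeriv ℝ (a + 1) (fun _ : E => w x) x = 0 := by
      rw [iteratedFDeriv_succ_const]; rfl
    rw [h4, sub_zero] at h3
    exact h3
  rw [hd]
  have hch : ((i.choose (a + 1) : ℕ) : ℝ) ≤ 2 ^ i := by
    exact_mod_cast Nat.choose_le_two_pow i (a + 1)
  calc _ ≤ ‖B‖ * (2 ^ i * ‖iteratedFDeriv ℝ (a + 1) w x‖ *
        ‖iteratedFDeriv ℝ (i - (a + 1)) v x‖) := by gcongr
    _ = _ := by ring

/-- Abel summation moves the difference from the remainders `r` to the coefficients `b`, whose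
increments are summable. This takes the place of square function estimates, so nothing is required
of the geometry of the Banach spaces. -/
lemma sum_by_parts {Y Z : Type*} [NormedAddCommGroup Y] [NormedSpace ℝ Y] [NormedAddCommGroup Z]
    [NormedSpace ℝ Z] (b : ℕ → Y →L[ℝ] Z) (r : ℕ → Y) {L K : ℕ} (h : L ≤ K) :
    ∑ k ∈ Finset.Ico L K, b k (r k - r (k + 1)) =
      b L (r L) - b K (r K) + ∑ k ∈ Finset.Ico L K, (b (k + 1) - b k) (r (k + 1)) := by
  induction K, h using Nat.le_induction with
  | base => simp
  | succ K h ih =>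
    rw [Finset.sum_Ico_succ_top h, Finset.sum_Ico_succ_top h, ih, map_sub,
      ContinuousLinearMap.sub_apply]
    abel

variable [FiniteDimensional ℝ E]
  [MeasureSpace E] [BorelSpace E] [(volume : Measure E).IsAddHaarMeasure] {p : ℝ}
  [CompleteSpace X₀] [CompleteSpace X₂]

namespace IsSmoothLp

variable {m : ℕ} {g : E → X₂} (hg : IsSmoothLp m p g)
include hg

/-- The remainder of the smoothing of the derivative of order `i`. -/
def rem (hp : 1 < p) (N : ℕ) {i : ℕ} (hi : i ≤ m) (k : ℕ) : lpFun E (E [×i]→L[ℝ] X₂) p :=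
  (remainderEnd hp k ^ N) (hg.deriv hi)

lemma contDiff_smoothEnd_sub (hp : 1 < p) (N k : ℕ) :
    ContDiff ℝ ∞ (smoothEnd hp N (k + 1) hg.toLp - smoothEnd hp N k hg.toLp : lpFun E X₂ p).1 :=
  (contDiff_smoothEnd hp N (k + 1) hg.toLp).sub (contDiff_smoothEnd hp N k hg.toLp)

lemma iteratedFDeriv_smoothEnd_sub (hp : 1 < p) (N k : ℕ) {i : ℕ} (hi : i ≤ m) (x : E) :
    iteratedFDeriv ℝ i
      (smoothEnd hp N (k + 1) hg.toLp - smoothEnd hp N k hg.toLp : lpFun E X₂ p).1 x =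
      (hg.rem hp N hi k : E → E [×i]→L[ℝ] X₂) x - (hg.rem hp N hi (k + 1) : E → E [×i]→L[ℝ] X₂) x := by
  have e : (smoothEnd hp N (k + 1) hg.toLp - smoothEnd hp N k hg.toLp : lpFun E X₂ p).1 =
      ((remainderEnd hp k ^ N) hg.toLp : E → X₂) - ((remainderEnd hp (k + 1) ^ N) hg.toLp : E → X₂) := by
    ext y
    have e' : ∀ l, smoothEnd hp N l hg.toLp = hg.toLp - (remainderEnd hp l ^ N) hg.toLp := fun l => rfl
    rw [e', e', sub_sub_sub_cancel_left]
    rfl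
  have hle : ((i : ℕ) : ℕ∞ω) ≤ (∞ : ℕ∞ω) := by exact_mod_cast le_top
  obtain ⟨h1, h2⟩ := hg.remainder hp k N
  obtain ⟨h3, h4⟩ := hg.remainder hp (k + 1) N
  rw [e]
  refine (iteratedFDeriv_sub_apply (h1.contDiff.of_le hle).contDiffAt
    (h3.contDiff.of_le hle).contDiffAt).trans ?_
  rw [h2 i hi, h4 i hi]
  rfl

lemma lpENorm_rem_le (hp : 1 < p) (N : ℕ) {i : ℕ} (hi : i ≤ m) (k : ℕ) :
    lpENorm (hg.rem hp N hi k) ≤ 2 ^ N * lpENorm (hg.deriv hi) :=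
  lpENorm_remainderEnd_pow_le hp k N _

lemma tendsto_rem (hp : 1 < p) {N : ℕ} (hN : N ≠ 0) {i : ℕ} (hi : i ≤ m) :
    Tendsto (fun k => lpENorm (hg.rem hp N hi k)) atTop (𝓝 0) := tendsto_remainderEnd_pow hp hN _

/-- Exchanging `a` of the remainders for derivatives gives 2^{-ka}. This balances the growth of the
derivatives of order `a` of the coefficients of a paraproduct. -/
lemma eLpNorm_iteratedFDeriv_smoothEnd_sub_le (hp : 1 < p) {N : ℕ} (hN : m ≤ N) (k : ℕ) {i a : ℕ}
    (hi : i ≤ m) (ha : a ≤ i) :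
    eLpNorm (iteratedFDeriv ℝ (i - a)
      (smoothEnd hp N (k + 1) hg.toLp - smoothEnd hp N k hg.toLp : lpFun E X₂ p).1)
      (ENNReal.ofReal p) volume ≤
      2 * 2 ^ N * ENNReal.ofReal (((2 : ℝ) ^ k)⁻¹ ^ a) * lpENorm (hg.deriv hi) := by
  have hj : i - a ≤ m := (Nat.sub_le _ _).trans hi
  have e : iteratedFDeriv ℝ (i - a)
      (smoothEnd hp N (k + 1) hg.toLp - smoothEnd hp N k hg.toLp : lpFun E X₂ p).1 =
      (hg.rem hp N hj k - hg.rem hp N hj (k + 1) : lpFun E (E [×(i - a)]→L[ℝ] X₂) p).1 :=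
    funext fun x => hg.iteratedFDeriv_smoothEnd_sub hp N k hj x
  rw [e]
  refine ((isENorm_lpENorm hp).sub_le (hg.rem hp N hj k) (hg.rem hp N hj (k + 1))).trans ?_
  have h1 := hg.lpENorm_remainder_pow_le hp k (i := N) (i' := a) (j := i - a) (l := i) (by omega) hj
    hi (by omega)
  have h2 := hg.lpENorm_remainder_pow_le hp (k + 1) (i := N) (i' := a) (j := i - a) (l := i)
    (by omega) hj hi (by omega)
  have h3 : ((2 : ℝ) ^ (k + 1))⁻¹ ^ a ≤ ((2 : ℝ) ^ k)⁻¹ ^ a := by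
    refine pow_le_pow_left₀ (by positivity) ?_ a
    gcongr
    · exact one_le_two
    · omega
  calc _ ≤ 2 ^ N * ENNReal.ofReal (((2 : ℝ) ^ k)⁻¹ ^ a) * lpENorm (hg.deriv hi) +
        2 ^ N * ENNReal.ofReal (((2 : ℝ) ^ k)⁻¹ ^ a) * lpENorm (hg.deriv hi) := by
        refine add_le_add h1 (h2.trans ?_)
        gcongr
    _ = _ := by ring

end IsSmoothLp

/-- A term of the paraproduct. -/
def paraTerm (B : X₁ →L[ℝ] X₂ →L[ℝ] X₀) (hp : 1 < p) (N : ℕ) (w : ℕ → E → X₁) (k : ℕ) :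
    (E → X₂) →ₗ[ℝ] (E → X₀) where
  toFun f x := B (w k x) ((smoothEnd hp N (k + 1) (lpProj E X₂ p f) -
    smoothEnd hp N k (lpProj E X₂ p f) : lpFun E X₂ p).1 x)
  map_add' f g := by
    ext x
    simp only [map_add, Submodule.coe_add, Submodule.coe_sub, Pi.add_apply, Pi.sub_apply, map_sub]
    abel
  map_smul' c f := by
    ext x
    simp only [map_smul, Submodule.coe_smul, Submodule.coe_sub, Pi.smul_apply, Pi.sub_apply, map_sub,
      RingHom.id_apply, smul_sub]

/-- The partial sums of the paraproduct. -/
def paraSum (B : X₁ →L[ℝ] X₂ →L[ℝ] X₀) (hp : 1 < p) (N : ℕ) (w : ℕ → E → X₁) (K : ℕ) :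
    (E → X₂) →ₗ[ℝ] (E → X₀) := ∑ k ∈ Finset.range K, paraTerm B hp N w k

omit [FiniteDimensional ℝ E] [BorelSpace E] [(volume : Measure E).IsAddHaarMeasure] in
lemma eLpNorm_le_of_norm_le_real {Y : Type*} [NormedAddCommGroup Y] {f : E → Y} {φ : E → ℝ}
    (h : ∀ x, ‖f x‖ ≤ φ x) (q : ℝ≥0∞) : eLpNorm f q volume ≤ eLpNorm φ q volume :=
  eLpNorm_mono_real h

omit [FiniteDimensional ℝ E] [BorelSpace E] [(volume : Measure E).IsAddHaarMeasure] in
lemma eLpNorm_const_mul_norm {Y : Type*} [NormedAddCommGroup Y] (f : E → Y) {c : ℝ} (hc : 0 ≤ c)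
    (q : ℝ≥0∞) : eLpNorm (fun x => c * ‖f x‖) q volume = ENNReal.ofReal c * eLpNorm f q volume := by
  have h2 := eLpNorm_const_smul (𝕜 := ℝ) c (fun x => ‖f x‖) q volume
  rw [eLpNorm_norm] at h2
  rw [← Real.enorm_of_nonneg hc, ← h2]
  rfl

/-- In the Leibniz expansion, the terms with no derivative on w_k form a sum of B(w_k)(r_k -
r_{k+1}), treated by `sum_by_parts`. The terms with a + 1 derivatives on w_k have size 2^{k(a+1-ε)}
times 2^{-k(a+1)}. Both leave the summable factor 2^{-kε}. The boundary terms at L and K are kept as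
they are: they are bounded, which gives uniform bounds, and tend to zero, which gives convergence.
-/
lemma exists_eLpNorm_paraproduct_le (B : X₁ →L[ℝ] X₂ →L[ℝ] X₀) (hp : 1 < p) {M N : ℕ}
    (hMN : M ≤ N) {ε : ℝ} : ∃ C : ℝ, 0 < C ∧ ∀ (H : ℝ) (w : ℕ → E → X₁),
      IsSmoothingSeq M ε H w → ∀ (m : ℕ) (hm : m ≤ M) (g : E → X₂) (hg : IsSmoothLp m p g) (i : ℕ)
        (hi : i ≤ m) (L K : ℕ) (_ : L ≤ K),
      ContDiff ℝ ∞ (∑ k ∈ Finset.Ico L K, paraTerm B hp N w k g) ∧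
      eLpNorm (iteratedFDeriv ℝ i (∑ k ∈ Finset.Ico L K, paraTerm B hp N w k g))
        (ENNReal.ofReal p) volume ≤ ENNReal.ofReal (C * H) *
          (lpENorm (hg.rem hp N hi L) + lpENorm (hg.rem hp N hi K) +
            ENNReal.ofReal (∑ k ∈ Finset.Ico L K, ((2 : ℝ) ^ k) ^ (-ε)) * lpENorm (hg.deriv hi)) := by
  set C : ℝ := (‖B‖ + 1) * (2 ^ N + M * (2 ^ M * (2 * 2 ^ N))) with hC
  have hCpos : 0 < C := by positivity
  refine ⟨C, hCpos, fun H w hw m hm g hg i hi L K hLK => ?_⟩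
  have hH : 0 ≤ H := (norm_nonneg _).trans (hw.bound 0 0)
  have hq := one_le_ofReal hp
  set u : ℕ → E → X₂ := fun k =>
    (smoothEnd hp N (k + 1) hg.toLp - smoothEnd hp N k hg.toLp : lpFun E X₂ p).1 with hu
  have huc : ∀ k, ContDiff ℝ ∞ (u k) := fun k => hg.contDiff_smoothEnd_sub hp N k
  set r : ℕ → E → E [×i]→L[ℝ] X₂ := fun k => (hg.rem hp N hi k : E → E [×i]→L[ℝ] X₂) with hr
  have hrm : ∀ k, AEStronglyMeasurable (r k) volume := fun k => (hg.rem hp N hi k).2.1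
  have hdu : ∀ k x, iteratedFDeriv ℝ i (u k) x = r k x - r (k + 1) x := fun k x =>
    hg.iteratedFDeriv_smoothEnd_sub hp N k hi x
  have hterm : ∀ k, paraTerm B hp N w k g = fun y => B (w k y) (u k y) := by
    intro k
    have e : lpProj E X₂ p g = hg.toLp := lpProj_coe hg.toLp
    ext y
    simp only [paraTerm, LinearMap.coe_mk, AddHom.coe_mk, e, hu]
  have hBc : ∀ k, ContDiff ℝ ∞ (fun y => B (w k y) (u k y)) := fun k =>
    B.isBoundedBilinearMap.contDiff.comp₂ (hw.contDiff k) (huc k)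
  have hsumc : ContDiff ℝ ∞ (∑ k ∈ Finset.Ico L K, paraTerm B hp N w k g) := by
    have e : (∑ k ∈ Finset.Ico L K, paraTerm B hp N w k g) =
        fun y => ∑ k ∈ Finset.Ico L K, B (w k y) (u k y) := by
      ext y; rw [Finset.sum_apply]; simp only [hterm]
    rw [e]
    exact ContDiff.sum fun k _ => hBc k
  refine ⟨hsumc, ?_⟩
  have hle : ((i : ℕ) : ℕ∞ω) ≤ (∞ : ℕ∞ω) := by exact_mod_cast le_top
  have hD : ∀ x, iteratedFDeriv ℝ i (∑ k ∈ Finset.Ico L K, paraTerm B hp N w k g) x =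
      ∑ k ∈ Finset.Ico L K, iteratedFDeriv ℝ i (fun y => B (w k y) (u k y)) x := by
    intro x
    have e : (∑ k ∈ Finset.Ico L K, paraTerm B hp N w k g) =
        fun y => ∑ k ∈ Finset.Ico L K, B (w k y) (u k y) := by
      ext y; rw [Finset.sum_apply]; simp only [hterm]
    rw [e]
    exact iteratedFDeriv_fun_sum_apply fun k _ => ((hBc k).of_le hle).contDiffAt
  -- The contribution of scale k: first the increment of w_k from the summation by parts, then the
  -- Leibniz terms with a + 1 derivatives on w_k.
  set ψ : ℕ → E → ℝ := fun k x => (‖B‖ * (H * ((2 : ℝ) ^ k) ^ (-ε))) * ‖r (k + 1) x‖ +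
    ∑ a ∈ Finset.range i, (‖B‖ * 2 ^ i * (H * ((2 : ℝ) ^ k) ^ (((a + 1 : ℕ) : ℝ) - ε))) *
      ‖iteratedFDeriv ℝ (i - (a + 1)) (u k) x‖ with hψ
  have hpt : ∀ x, ‖iteratedFDeriv ℝ i (∑ k ∈ Finset.Ico L K, paraTerm B hp N w k g) x‖ ≤
      (((fun x => ‖B‖ * H * ‖r L x‖) + (fun x => ‖B‖ * H * ‖r K x‖)) +
        ∑ k ∈ Finset.Ico L K, ψ k) x := by
    intro x
    let b : ℕ → (E [×i]→L[ℝ] X₂) →L[ℝ] (E [×i]→L[ℝ] X₀) := fun k =>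
      ContinuousLinearMap.compContinuousMultilinearMapL ℝ (fun _ : Fin i => E) X₂ X₀ (B (w k x))
    have hb : ∀ k T, ‖b k T‖ ≤ ‖B‖ * H * ‖T‖ := fun k T =>
      (norm_comp_multilinear_le B (w k x) T).trans (by gcongr; exact hw.bound k x)
    have hbd : ∀ k T, ‖(b (k + 1) - b k) T‖ ≤ ‖B‖ * (H * ((2 : ℝ) ^ k) ^ (-ε)) * ‖T‖ := by
      intro k T
      have e : (b (k + 1) - b k) T = (B (w (k + 1) x - w k x)).compContinuousMultilinearMap T := by
        ext v; simp [b]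
      rw [e]
      exact (norm_comp_multilinear_le B _ T).trans (by gcongr; exact hw.diff_bound k x)
    -- The terms with all derivatives on the smoothing difference are split off, ready for summation
    -- by parts.
    have e1 : iteratedFDeriv ℝ i (∑ k ∈ Finset.Ico L K, paraTerm B hp N w k g) x =
        ∑ k ∈ Finset.Ico L K, b k (r k x - r (k + 1) x) +
        ∑ k ∈ Finset.Ico L K, (iteratedFDeriv ℝ i (fun y => B (w k y) (u k y)) x -
          (B (w k x)).compContinuousMultilinearMap (iteratedFDeriv ℝ i (u k) x)) := by
      rw [hD, ← Finset.sum_add_distrib]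
      refine Finset.sum_congr rfl fun k _ => ?_
      rw [hdu]
      exact (add_sub_cancel _ _).symm
    rw [e1, sum_by_parts b (fun k => r k x) hLK]
    simp only [Pi.add_apply, Finset.sum_apply]
    have e2 : ∑ k ∈ Finset.Ico L K, ψ k x = ∑ k ∈ Finset.Ico L K,
        (‖B‖ * (H * ((2 : ℝ) ^ k) ^ (-ε))) * ‖r (k + 1) x‖ +
        ∑ k ∈ Finset.Ico L K, ∑ a ∈ Finset.range i, (‖B‖ * 2 ^ i *
          (H * ((2 : ℝ) ^ k) ^ (((a + 1 : ℕ) : ℝ) - ε))) *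
          ‖iteratedFDeriv ℝ (i - (a + 1)) (u k) x‖ := by
      rw [← Finset.sum_add_distrib]
    rw [e2, ← add_assoc]
    refine (norm_add_le _ _).trans (add_le_add ((norm_add_le _ _).trans (add_le_add
      ((norm_sub_le _ _).trans (add_le_add (hb _ _) (hb _ _))) ?_)) ?_)
    · exact (norm_sum_le _ _).trans (Finset.sum_le_sum fun k _ => hbd k _)
    · refine (norm_sum_le _ _).trans (Finset.sum_le_sum fun k _ => ?_)
      refine (norm_iteratedFDeriv_bilin_sub_le B (hw.contDiff k) (huc k) i x).trans
        (Finset.sum_le_sum fun a ha => ?_)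
      have ha' := Finset.mem_range.1 ha
      gcongr
      exact hw.deriv_bound k (a + 1) (by omega) (by omega) x
  have hrn : ∀ k (c : ℝ), AEStronglyMeasurable (fun x => c * ‖r k x‖) volume := fun k c =>
    (hrm k).norm.const_mul c
  have hun : ∀ k j (c : ℝ), AEStronglyMeasurable (fun x => c * ‖iteratedFDeriv ℝ j (u k) x‖)
      volume := fun k j c => (((huc k).continuous_iteratedFDeriv (m := j)
        (by exact_mod_cast le_top)).norm.aestronglyMeasurable).const_mul c
  have hψ' : ∀ k, ψ k = (fun x => (‖B‖ * (H * ((2 : ℝ) ^ k) ^ (-ε))) * ‖r (k + 1) x‖) +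
      ∑ a ∈ Finset.range i, fun x => (‖B‖ * 2 ^ i * (H * ((2 : ℝ) ^ k) ^ (((a + 1 : ℕ) : ℝ) - ε))) *
      ‖iteratedFDeriv ℝ (i - (a + 1)) (u k) x‖ := by
    intro k; ext x; simp [hψ]
  have hψm : ∀ k, AEStronglyMeasurable (ψ k) volume := fun k => by
    rw [hψ']
    exact (hrn _ _).add (Finset.aestronglyMeasurable_sum _ fun a _ => hun _ _ _)
  set D := lpENorm (hg.deriv hi) with hDdef
  have hψn : ∀ k, eLpNorm (ψ k) (ENNReal.ofReal p) volume ≤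
      ENNReal.ofReal (C * H * ((2 : ℝ) ^ k) ^ (-ε)) * D := by
    intro k
    rw [hψ']
    refine (eLpNorm_add_le (hrn _ _) (Finset.aestronglyMeasurable_sum _ fun a _ => hun _ _ _)
      hq).trans ?_
    have hb0 : (0 : ℝ) < 2 ^ k := by positivity
    set c : ℝ := ((2 : ℝ) ^ k) ^ (-ε) with hc
    have hc0 : 0 ≤ c := by positivity
    have h1 : eLpNorm (fun x => (‖B‖ * (H * c)) * ‖r (k + 1) x‖) (ENNReal.ofReal p) volume ≤
        ENNReal.ofReal (‖B‖ * (H * c) * 2 ^ N) * D := by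
      have e6 : ENNReal.ofReal (‖B‖ * (H * c) * 2 ^ N) * D =
          ENNReal.ofReal (‖B‖ * (H * c)) * (2 ^ N * D) := by
        rw [ENNReal.ofReal_mul (q := 2 ^ N) (by positivity), mul_assoc,
          ENNReal.ofReal_pow zero_le_two, ENNReal.ofReal_ofNat]
      rw [eLpNorm_const_mul_norm _ (by positivity), e6]
      exact mul_le_mul_right (hg.lpENorm_rem_le hp N hi (k + 1)) _
    have h2 : ∀ a ∈ Finset.range i, eLpNorm (fun x => (‖B‖ * 2 ^ i *
        (H * ((2 : ℝ) ^ k) ^ (((a + 1 : ℕ) : ℝ) - ε))) * ‖iteratedFDeriv ℝ (i - (a + 1)) (u k) x‖)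
        (ENNReal.ofReal p) volume ≤ ENNReal.ofReal (‖B‖ * 2 ^ M * (H * c) * (2 * 2 ^ N)) * D := by
      intro a ha
      have ha' := Finset.mem_range.1 ha
      rw [eLpNorm_const_mul_norm _ (by positivity)]
      have h3 := hg.eLpNorm_iteratedFDeriv_smoothEnd_sub_le hp (hm.trans hMN) k hi
        (by omega : a + 1 ≤ i)
      refine (mul_le_mul_right h3 _).trans ?_
      have e4 : (2 * 2 ^ N : ℝ≥0∞) = ENNReal.ofReal (2 * 2 ^ N) := by
        rw [ENNReal.ofReal_mul zero_le_two, ENNReal.ofReal_pow zero_le_two, ENNReal.ofReal_ofNat]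
      rw [e4, ← ENNReal.ofReal_mul (by positivity), ← mul_assoc, ← ENNReal.ofReal_mul (by positivity)]
      refine mul_le_mul_left (ENNReal.ofReal_le_ofReal ?_) _
      -- The growth from the derivatives of w_k and the gain from the remainders cancel up to
      -- 2^{-kε}.
      have e5 : ((2 : ℝ) ^ k) ^ (((a + 1 : ℕ) : ℝ) - ε) * ((2 : ℝ) ^ k)⁻¹ ^ (a + 1) = c := by
        rw [hc, inv_pow, ← Real.rpow_natCast ((2 : ℝ) ^ k) (a + 1), ← Real.rpow_neg hb0.le,
          ← Real.rpow_add hb0]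
        congr 1; ring
      calc _ = ‖B‖ * 2 ^ i * (H * (((2 : ℝ) ^ k) ^ (((a + 1 : ℕ) : ℝ) - ε) *
            ((2 : ℝ) ^ k)⁻¹ ^ (a + 1))) * (2 * 2 ^ N) := by ring
        _ = ‖B‖ * 2 ^ i * (H * c) * (2 * 2 ^ N) := by rw [e5]
        _ ≤ _ := by
          gcongr
          · exact one_le_two
          · omega
    refine (add_le_add h1 ((eLpNorm_sum_le (fun a _ => hun _ _ _) hq).trans
      (Finset.sum_le_sum h2))).trans ?_
    have e7 : (i : ℝ≥0∞) * (ENNReal.ofReal (‖B‖ * 2 ^ M * (H * c) * (2 * 2 ^ N)) * D) =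
        ENNReal.ofReal (i * (‖B‖ * 2 ^ M * (H * c) * (2 * 2 ^ N))) * D := by
      rw [ENNReal.ofReal_mul (p := (i : ℝ)) (by positivity), ENNReal.ofReal_natCast]
      exact (mul_assoc _ _ _).symm
    rw [Finset.sum_const, Finset.card_range, nsmul_eq_mul, e7, ← add_mul,
      ← ENNReal.ofReal_add (by positivity) (by positivity)]
    refine mul_le_mul_left (ENNReal.ofReal_le_ofReal ?_) _
    have hiM : (i : ℝ) ≤ M := by exact_mod_cast hi.trans hm
    calc _ = ‖B‖ * (2 ^ N + i * (2 ^ M * (2 * 2 ^ N))) * H * c := by ring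
      _ ≤ (‖B‖ + 1) * (2 ^ N + M * (2 ^ M * (2 * 2 ^ N))) * H * c := by
        gcongr; linarith
      _ = _ := by rw [hC]
  refine (eLpNorm_le_of_norm_le_real hpt _).trans ?_
  refine (eLpNorm_add_le ((hrn _ _).add (hrn _ _)) (Finset.aestronglyMeasurable_sum _
    fun k _ => hψm k) hq).trans ?_
  have hBC : ‖B‖ * H ≤ C * H := by
    gcongr
    rw [hC]
    have h1 : (1 : ℝ) ≤ 2 ^ N := one_le_pow₀ one_le_two
    have h2 : (0 : ℝ) ≤ M * (2 ^ M * (2 * 2 ^ N)) := by positivity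
    nlinarith [norm_nonneg B]
  have h5 : ∀ k, eLpNorm (fun x => ‖B‖ * H * ‖r k x‖) (ENNReal.ofReal p) volume ≤
      ENNReal.ofReal (C * H) * lpENorm (hg.rem hp N hi k) := fun k => by
    rw [eLpNorm_const_mul_norm _ (by positivity)]
    exact mul_le_mul_left (ENNReal.ofReal_le_ofReal hBC) _
  rw [mul_add, mul_add]
  refine add_le_add ((eLpNorm_add_le (hrn _ _) (hrn _ _) hq).trans (add_le_add (h5 L) (h5 K))) ?_
  refine ((eLpNorm_sum_le (fun k _ => hψm k) hq).trans (Finset.sum_le_sum fun k _ => hψn k)).trans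
    (le_of_eq ?_)
  rw [← Finset.sum_mul, ← ENNReal.ofReal_sum_of_nonneg (fun k _ => by positivity), ← mul_assoc,
    ← ENNReal.ofReal_mul (by positivity), Finset.mul_sum]

end Paraproducts

/-! ### The interpolation space lies between the two spaces of an ordered couple. -/

section Interpolation

variable {V : Type*} [AddCommGroup V] [Module ℝ V] {N₀ N₁ : V → ℝ≥0∞}

lemma IsCalderonFunction.const (h : IsOrderedCouple N₀ N₁) {v : V} (hv : N₁ v < ⊤) :
    IsCalderonFunction N₀ N₁ (fun _ => (v, 0)) := by
  have h0 := (h.le v).trans_lt hv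
  have e0 := h.left.complexified.zero
  have e1 := h.right.complexified.zero
  refine ⟨⟨(N₀ v).toNNReal, ?_⟩, ?_, fun z hz => ⟨0, ?_⟩, ⟨(N₀ v).toNNReal, ?_⟩,
    ⟨(N₁ v).toNNReal, ?_⟩, ?_, ?_⟩ <;>
  simp [h.sumENorm_eq, complexifiedENorm, h.left.zero, h.right.zero, h0.ne, hv.ne, complexifiedSMul]
  exact fun _ _ _ => tendsto_const_nhds

lemma IsOrderedCouple.interpolation_le_right (h : IsOrderedCouple N₀ N₁) (θ : ℝ) (v : V) :
    complexInterpolationENorm N₀ N₁ θ v ≤ N₁ v := by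
  by_cases hv : N₁ v < ⊤
  swap; · rw [not_lt_top_iff.1 hv]; exact le_top
  refine (complexInterpolationENorm_le (IsCalderonFunction.const h hv) rfl).trans ?_
  rw [calderonENorm_le]
  simp [complexifiedENorm, h.left.zero, h.right.zero, h.le]

/-- The value at θ of an admissible function lies in the sum of the couple, which is the larger
space. -/
lemma IsOrderedCouple.left_lt_top (h : IsOrderedCouple N₀ N₁) {θ : ℝ} (hθ : θ ∈ Ioo (0 : ℝ) 1)
    {v : V} (hv : complexInterpolationENorm N₀ N₁ θ v < ⊤) : N₀ v < ⊤ := by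
  obtain ⟨F, hF, hFv, -⟩ := exists_calderon_of_lt hv
  obtain ⟨C, hC⟩ := hF.bounded
  have h1 := hC θ (by simpa using ⟨hθ.1.le, hθ.2.le⟩)
  rw [hFv, h.sumENorm_eq] at h1
  exact (le_self_add.trans h1).trans_lt ENNReal.coe_lt_top

end Interpolation

/-! ### Null functions in H^s_p, and smoothing on Sobolev spaces. -/

section Algebra

variable {E : Type*} [NormedAddCommGroup E] [NormedSpace ℝ E] [FiniteDimensional ℝ E]
  [MeasureSpace E] [BorelSpace E] [(volume : Measure E).IsAddHaarMeasure]
  {X : Type*} [NormedAddCommGroup X] [NormedSpace ℝ X] [CompleteSpace X] {s p : ℝ} {m : ℕ}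

lemma memLp_of_besselENorm_lt_top (hp : 1 < p) (hs : 0 ≤ s) {f : E → X}
    (hf : besselENorm s p f < ⊤) : MemLp f (ENNReal.ofReal p) volume := by
  by_cases h : s = (⌊s⌋₊ : ℝ)
  · rw [besselENorm, if_pos h] at hf
    exact memLp_of_sobolevNatENorm_lt_top hf
  · rw [besselENorm, if_neg h] at hf
    exact memLp_of_sobolevNatENorm_lt_top
      ((isOrderedCouple_sobolevNatENorm hp).left_lt_top (sub_floor_mem_Ioo hs h) hf)

/-- Admissible functions take values in honest functions, so invariance under changes on null sets
is not immediate. A null function has norm zero in the smaller space, and its constant admissible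
function transfers this to the interpolation norm. -/
lemma besselENorm_eq_zero_of_ae (hp : 1 < p) {f : E → X} (hf : f =ᵐ[volume] 0) :
    besselENorm s p f = 0 := by
  have h0 : ∀ m : ℕ, sobolevNatENorm m p f = 0 := fun m => by
    rw [sobolevNatENorm_congr_ae hf]
    exact (isENorm_sobolevNatENorm hp).zero
  by_cases h : s = (⌊s⌋₊ : ℝ)
  · rw [besselENorm, if_pos h, h0]
  · rw [besselENorm, if_neg h]
    refine le_antisymm (((isOrderedCouple_sobolevNatENorm hp).interpolation_le_right _ f).trans ?_)
      zero_le
    rw [h0]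

lemma besselENorm_le_of_ae (hp : 1 < p) {f g : E → X} (h : f =ᵐ[volume] g) :
    besselENorm s p f ≤ besselENorm s p g := by
  calc besselENorm s p f = besselENorm s p (g + (f - g)) := by rw [add_sub_cancel]
    _ ≤ besselENorm s p g + besselENorm s p (f - g) := (isENorm_besselENorm hp).add_le _ _
    _ = _ := by
      rw [besselENorm_eq_zero_of_ae hp (f := f - g), add_zero]
      filter_upwards [h] with x hx
      simp [hx]

lemma besselENorm_congr_ae (hp : 1 < p) {f g : E → X} (h : f =ᵐ[volume] g) :
    besselENorm s p f = besselENorm s p g :=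
  le_antisymm (besselENorm_le_of_ae hp h) (besselENorm_le_of_ae hp h.symm)

lemma sobolevNatENorm_remainderEnd_pow_le (hp : 1 < p) (N k : ℕ) (f : lpFun E X p) :
    sobolevNatENorm m p ((remainderEnd hp k ^ N) f : E → X) ≤
      2 ^ N * sobolevNatENorm m p (f : E → X) := by
  induction N with
  | zero => simp
  | succ N ih =>
    have e : ((remainderEnd hp k ^ (N + 1)) f : E → X) = ((remainderEnd hp k ^ N) f : E → X) -
        mollify (scaledMollifier k) ((remainderEnd hp k ^ N) f : E → X) := by
      rw [pow_succ', Module.End.mul_apply]; rfl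
    rw [e]
    refine ((isENorm_sobolevNatENorm hp).sub_le _ _).trans ?_
    refine (add_le_add ih ((sobolevNatENorm_mollify_le hp (isMollifier_scaled k) _).trans ih)).trans
      (le_of_eq ?_)
    rw [pow_succ]; ring

/-- Smoothing, as an operator on all functions. -/
def smoothMap (X : Type*) [NormedAddCommGroup X] [NormedSpace ℝ X] [CompleteSpace X]
    (hp : 1 < p) (N k : ℕ) : (E → X) →ₗ[ℝ] (E → X) :=
  (lpFun E X p).subtype ∘ₗ smoothEnd hp N k ∘ₗ lpProj E X p

lemma smoothMap_apply (hp : 1 < p) (N k : ℕ) (f : E → X) :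
    smoothMap X hp N k f = (smoothEnd hp N k (lpProj E X p f) : E → X) := rfl

lemma sobolevNatENorm_smoothMap_le (hp : 1 < p) (N k : ℕ) (f : E → X) :
    sobolevNatENorm m p (smoothMap X hp N k f) ≤
      ((1 + 2 ^ N : ℝ≥0) : ℝ≥0∞) * sobolevNatENorm m p f := by
  by_cases hf : sobolevNatENorm m p f < ⊤
  swap
  · rw [not_lt_top_iff.1 hf, ENNReal.mul_top]
    · exact le_top
    · simp
  have hfm := memLp_of_sobolevNatENorm_lt_top hf
  have e : lpProj E X p f = ⟨f, hfm⟩ := lpProj_coe ⟨f, hfm⟩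
  have e2 : smoothMap X hp N k f = f - ((remainderEnd hp k ^ N) ⟨f, hfm⟩ : E → X) := by
    rw [smoothMap_apply, e]; rfl
  rw [e2]
  refine ((isENorm_sobolevNatENorm hp).sub_le _ _).trans ?_
  refine (add_le_add le_rfl (sobolevNatENorm_remainderEnd_pow_le hp N k ⟨f, hfm⟩)).trans
    (le_of_eq ?_)
  push_cast
  ring

lemma tendsto_smoothMap_sub (hp : 1 < p) {N : ℕ} (hN : N ≠ 0) {f : E → X}
    (hf : MemLp f (ENNReal.ofReal p) volume) :
    Tendsto (fun k => eLpNorm (smoothMap X hp N k f - f) (ENNReal.ofReal p) volume) atTop (𝓝 0) := by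
  refine (tendsto_remainderEnd_pow hp hN ⟨f, hf⟩).congr fun k => ?_
  have e : lpProj E X p f = ⟨f, hf⟩ := lpProj_coe ⟨f, hf⟩
  have e2 : smoothMap X hp N k f - f = -((remainderEnd hp k ^ N) ⟨f, hf⟩ : E → X) := by
    rw [smoothMap_apply, e]
    change f - _ - f = _
    abel
  rw [e2, eLpNorm_neg]
  rfl

end Algebra

/-! ### Paraproducts as bounded operators on H^s_p. -/

section ParaproductOperators

variable {E : Type*} [NormedAddCommGroup E] [NormedSpace ℝ E] [FiniteDimensional ℝ E]
  [MeasureSpace E] [BorelSpace E] [(volume : Measure E).IsAddHaarMeasure]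
  {X₀ X₁ X₂ : Type*} [NormedAddCommGroup X₀] [NormedSpace ℝ X₀] [NormedAddCommGroup X₁]
  [NormedSpace ℝ X₁] [NormedAddCommGroup X₂] [NormedSpace ℝ X₂]
  [CompleteSpace X₀] [CompleteSpace X₂] {s p : ℝ}

lemma summable_two_pow_rpow_neg {ε : ℝ} (hε : 0 < ε) :
    Summable fun k : ℕ => ((2 : ℝ) ^ k) ^ (-ε) := by
  have e : (fun k : ℕ => ((2 : ℝ) ^ k) ^ (-ε)) = fun k : ℕ => ((2 : ℝ) ^ (-ε)) ^ k := by
    ext k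
    rw [← Real.rpow_natCast, ← Real.rpow_natCast, ← Real.rpow_mul zero_le_two,
      ← Real.rpow_mul zero_le_two, mul_comm]
  rw [e]
  exact summable_geometric_of_lt_one (by positivity)
    (Real.rpow_lt_one_of_one_lt_of_neg one_lt_two (by linarith))

/-- The second alternative avoids the case in which the constant vanishes and the right side would
be `0 * ⊤ = 0`. -/
lemma eLpNorm_paraTerm_le (B : X₁ →L[ℝ] X₂ →L[ℝ] X₀) (hp : 1 < p) (N : ℕ) {M : ℕ} {ε H : ℝ}
    {w : ℕ → E → X₁} (hw : IsSmoothingSeq M ε H w) (k : ℕ) (f : E → X₂) :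
    sobolevNatENorm 0 p (paraTerm B hp N w k f) ≤
      (((‖B‖ * H).toNNReal * (2 * (1 + 2 ^ N)) : ℝ≥0) : ℝ≥0∞) * sobolevNatENorm 0 p f ∨
      sobolevNatENorm 0 p f = ⊤ := by
  by_cases hf : sobolevNatENorm 0 p f < ⊤
  swap
  · exact Or.inr (not_lt_top_iff.1 hf)
  refine Or.inl ?_
  have hH : 0 ≤ H := (norm_nonneg _).trans (hw.bound 0 0)
  set v : E → X₂ := smoothMap X₂ hp N (k + 1) f - smoothMap X₂ hp N k f with hv
  have hvle : sobolevNatENorm 0 p v ≤ ((2 * (1 + 2 ^ N) : ℝ≥0) : ℝ≥0∞) * sobolevNatENorm 0 p f := by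
    refine ((isENorm_sobolevNatENorm hp).sub_le _ _).trans ((add_le_add
      (sobolevNatENorm_smoothMap_le hp N (k + 1) f)
      (sobolevNatENorm_smoothMap_le hp N k f)).trans (le_of_eq ?_))
    push_cast; ring
  have hvm := memLp_of_sobolevNatENorm_lt_top (hvle.trans_lt (ENNReal.mul_lt_top ENNReal.coe_lt_top hf))
  have e : paraTerm B hp N w k f = fun x => B (w k x) (v x) := rfl
  have hle := eLpNorm_bilin_le B hH (hw.bound k) v (ENNReal.ofReal p)
  have hm : MemLp (fun x => B (w k x) (v x)) (ENNReal.ofReal p) volume :=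
    ⟨B.aestronglyMeasurable_comp₂ (hw.contDiff k).continuous.aestronglyMeasurable hvm.1,
      hle.trans_lt (ENNReal.mul_lt_top (by simp) hvm.2)⟩
  rw [e, sobolevNatENorm_zero_eq hp hm, ENNReal.coe_mul, mul_assoc]
  refine hle.trans ?_
  rw [← sobolevNatENorm_zero_eq hp hvm]
  exact mul_le_mul_right hvle _

/-- The constant depends on K and only its finiteness matters: it permits
`sobolevNatENorm_map_le_of_smooth` to extend the bound for smooth functions, which is uniform in K.
-/
lemma sobolevNatENorm_zero_paraSum_le (B : X₁ →L[ℝ] X₂ →L[ℝ] X₀) (hp : 1 < p) (N : ℕ) {M : ℕ}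
    {ε H : ℝ} {w : ℕ → E → X₁} (hw : IsSmoothingSeq M ε H w) (K : ℕ) : ∃ M₀ : ℝ≥0, ∀ f : E → X₂,
    sobolevNatENorm 0 p (paraSum B hp N w K f) ≤ M₀ * sobolevNatENorm 0 p f := by
  refine ⟨K * ((‖B‖ * H).toNNReal * (2 * (1 + 2 ^ N))) + 1, fun f => ?_⟩
  by_cases hf : sobolevNatENorm 0 p f = ⊤
  · rw [hf, ENNReal.mul_top]
    · exact le_top
    · simp
  rw [paraSum, LinearMap.sum_apply]
  refine ((isENorm_sobolevNatENorm hp).sum_le _ _).trans ((Finset.sum_le_sum fun k _ =>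
    (eLpNorm_paraTerm_le B hp N hw k f).resolve_right hf).trans ?_)
  rw [Finset.sum_const, Finset.card_range, nsmul_eq_mul, ← mul_assoc]
  gcongr
  push_cast
  exact le_self_add

/-- The paraproduct with a sequence of smoothings. -/
lemma exists_paraproduct (B : X₁ →L[ℝ] X₂ →L[ℝ] X₀) (hp : 1 < p) (hs : 0 ≤ s) {N : ℕ}
    (hN : s + 1 ≤ N) {ε : ℝ} (hε : 0 < ε) : ∃ C : ℝ, 0 < C ∧ ∀ (H : ℝ) (w : ℕ → E → X₁), 0 < H →
      IsSmoothingSeq (⌊s⌋₊ + 1) ε H w → ∃ S : (E → X₂) →ₗ[ℝ] (E → X₀),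
        (∀ g, besselENorm s p (S g) ≤ ENNReal.ofReal (C * H) * besselENorm s p g) ∧
        ∀ g, MemLp g (ENNReal.ofReal p) volume → MemLp (S g) (ENNReal.ofReal p) volume ∧
          Tendsto (fun K => eLpNorm (paraSum B hp N w K g - S g) (ENNReal.ofReal p) volume)
            atTop (𝓝 0) := by
  set M := ⌊s⌋₊ + 1 with hM
  have hMN : M ≤ N := by
    have h1 : ((⌊s⌋₊ + 1 : ℕ) : ℝ) ≤ N := by
      push_cast; linarith [Nat.floor_le hs]
    exact_mod_cast h1
  obtain ⟨C, hC, hmain⟩ := exists_eLpNorm_paraproduct_le (E := E) B hp hMN (ε := ε)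
  have hsum := summable_two_pow_rpow_neg hε
  set σ := ∑' k : ℕ, ((2 : ℝ) ^ k) ^ (-ε) with hσ
  have hσ0 : 0 ≤ σ := tsum_nonneg fun k => by positivity
  have hIco : ∀ L K, ∑ k ∈ Finset.Ico L K, ((2 : ℝ) ^ k) ^ (-ε) ≤ σ := fun L K =>
    hsum.sum_le_tsum _ fun k _ => by positivity
  set C' : ℝ := (M + 1 : ℕ) * (C * (2 * 2 ^ N + σ)) with hC'
  have hC'0 : 0 < C' := by positivity
  refine ⟨C', hC'0, fun H w hH hw => ?_⟩
  -- The bound uniform in L and K: the boundary remainders cost at most 2^N each, and the sum of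
  -- 2^{-kε} at most σ.
  have hsm : ∀ m ≤ M, ∀ (g : E → X₂) (hg : IsSmoothLp m p g) (L K : ℕ), L ≤ K →
      sobolevNatENorm m p (∑ k ∈ Finset.Ico L K, paraTerm B hp N w k g) ≤
        ENNReal.ofReal (C' * H) * sobolevNatENorm m p g := by
    intro m hm g hg L K hLK
    have hgm : sobolevNatENorm m p g < ⊤ := hg.isSobolevJet.lt_top hp
    have h1 := hmain H w hw m hm g hg
    have hDle : ∀ i (hi : i ≤ m), lpENorm (hg.deriv hi) ≤ sobolevNatENorm m p g := fun i hi =>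
      hg.isSobolevJet.eLpNorm_le hp hi
    refine (sobolevNatENorm_le_of_contDiff (((h1 0 (Nat.zero_le _) L K hLK).1).of_le
      (by exact_mod_cast le_top)) (c := ENNReal.ofReal (C * (2 * 2 ^ N + σ) * H) *
        sobolevNatENorm m p g) (ENNReal.mul_lt_top ENNReal.ofReal_lt_top hgm) fun i hi => ?_).trans ?_
    · refine (h1 i hi L K hLK).2.trans ?_
      have e4 : (2 ^ N : ℝ≥0∞) = ENNReal.ofReal (2 ^ N) := by
        rw [ENNReal.ofReal_pow zero_le_two, ENNReal.ofReal_ofNat]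
      calc _ ≤ ENNReal.ofReal (C * H) * (2 ^ N * sobolevNatENorm m p g +
            2 ^ N * sobolevNatENorm m p g + ENNReal.ofReal σ * sobolevNatENorm m p g) := by
            refine mul_le_mul_right (add_le_add (add_le_add ?_ ?_) ?_) _
            · exact (hg.lpENorm_rem_le hp N hi L).trans (mul_le_mul_right (hDle i hi) _)
            · exact (hg.lpENorm_rem_le hp N hi K).trans (mul_le_mul_right (hDle i hi) _)
            · exact mul_le_mul' (ENNReal.ofReal_le_ofReal (hIco L K)) (hDle i hi)
        _ = _ := by
          rw [← add_mul, ← add_mul, ← mul_assoc, e4, ← ENNReal.ofReal_add (by positivity)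
            (by positivity), ← ENNReal.ofReal_add (by positivity) hσ0,
            ← ENNReal.ofReal_mul (by positivity)]
          congr 2; ring
    · rw [← mul_assoc, ← ENNReal.ofReal_natCast, ← ENNReal.ofReal_mul (by positivity)]
      refine mul_le_mul_left (ENNReal.ofReal_le_ofReal ?_) _
      have : ((m + 1 : ℕ) : ℝ) ≤ ((M + 1 : ℕ) : ℝ) := by exact_mod_cast Nat.succ_le_succ hm
      calc _ ≤ ((M + 1 : ℕ) : ℝ) * (C * (2 * 2 ^ N + σ) * H) := by gcongr
        _ = _ := by rw [hC']; ring
  have hT : ∀ K g, paraSum B hp N w K g = ∑ k ∈ Finset.Ico 0 K, paraTerm B hp N w k g := by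
    intro K g
    rw [paraSum, LinearMap.sum_apply, Finset.range_eq_Ico]
  have hne : (C' * H).toNNReal ≠ 0 := (Real.toNNReal_pos.2 (by positivity)).ne'
  obtain ⟨S, hS1, hS2⟩ := exists_limit_operator (M := M) hp (paraSum (E := E) B hp N w)
    (C := (C' * H).toNNReal) hne (fun m hm K f => by
      obtain ⟨M₀, hM₀⟩ := sobolevNatENorm_zero_paraSum_le (E := E) B hp N hw K
      refine sobolevNatENorm_map_le_of_smooth hp (paraSum B hp N w K) hM₀ (fun g hg1 hg2 => ?_) f hne
      rw [hT]
      exact hsm m hm g ⟨hg1, hg2⟩ 0 K (Nat.zero_le _)) (fun m hm g hg η hη => by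
      -- For a fixed smooth g both the boundary remainders and the tail of the geometric series
      -- vanish as L → ∞, so the partial sums are Cauchy in W^m_p.
      have hlim : ∀ i (hi : i ≤ m), Tendsto (fun L => ENNReal.ofReal (C * H) *
          (lpENorm (hg.rem hp N hi L) + ENNReal.ofReal (∑' k : ℕ, ((2 : ℝ) ^ (k + L)) ^ (-ε)) *
            lpENorm (hg.deriv hi))) atTop (𝓝 0) := by
        intro i hi
        have h1 := hg.tendsto_rem hp (N := N) (by omega) hi
        have h2 : Tendsto (fun L => ENNReal.ofReal (∑' k : ℕ, ((2 : ℝ) ^ (k + L)) ^ (-ε)))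
            atTop (𝓝 0) := by
          have := ENNReal.tendsto_ofReal (tendsto_sum_nat_add fun k : ℕ => ((2 : ℝ) ^ k) ^ (-ε))
          rwa [ENNReal.ofReal_zero] at this
        have h3 := ENNReal.Tendsto.mul_const h2 (Or.inr (lpENorm_lt_top (hg.deriv hi)).ne)
        rw [zero_mul] at h3
        have h4 := ENNReal.Tendsto.const_mul (h1.add h3) (a := ENNReal.ofReal (C * H))
          (Or.inr ENNReal.ofReal_ne_top)
        rwa [zero_add, mul_zero] at h4
      set η' : ℝ := η / (2 * (m + 1 : ℕ)) with hη'
      have hη'0 : 0 < η' := by positivity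
      have hev : ∀ᶠ L in atTop, ∀ i (hi : i ≤ m), ENNReal.ofReal (C * H) *
          (lpENorm (hg.rem hp N hi L) + ENNReal.ofReal (∑' k : ℕ, ((2 : ℝ) ^ (k + L)) ^ (-ε)) *
            lpENorm (hg.deriv hi)) ≤ ENNReal.ofReal η' := by
        have h5 : ∀ᶠ L in atTop, ∀ i : Fin (m + 1), ENNReal.ofReal (C * H) *
          (lpENorm (hg.rem hp N (Nat.lt_succ_iff.1 i.2) L) +
            ENNReal.ofReal (∑' k : ℕ, ((2 : ℝ) ^ (k + L)) ^ (-ε)) *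
            lpENorm (hg.deriv (Nat.lt_succ_iff.1 i.2))) ≤ ENNReal.ofReal η' :=
          eventually_all.2 fun i => (hlim i _).eventually_le_const (by simpa using hη'0)
        filter_upwards [h5] with L hL i hi using hL ⟨i, Nat.lt_succ_iff.2 hi⟩
      obtain ⟨K₀, hK₀⟩ := eventually_atTop.1 hev
      have hcau : ∀ L K, K₀ ≤ L → L ≤ K → sobolevNatENorm m p (paraSum B hp N w K g -
          paraSum B hp N w L g) ≤ ENNReal.ofReal η := by
        intro L K hL hLK
        have e : paraSum B hp N w K g - paraSum B hp N w L g =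
            ∑ k ∈ Finset.Ico L K, paraTerm B hp N w k g := by
          rw [hT, hT, Finset.sum_Ico_eq_sub _ hLK, Finset.range_eq_Ico, Finset.range_eq_Ico]
        rw [e]
        have h1 := hmain H w hw m hm g hg
        refine (sobolevNatENorm_le_of_contDiff (((h1 0 (Nat.zero_le _) L K hLK).1).of_le
          (by exact_mod_cast le_top)) (c := ENNReal.ofReal (2 * η')) ENNReal.ofReal_lt_top
          fun i hi => ?_).trans (le_of_eq ?_)
        · refine (h1 i hi L K hLK).2.trans ?_
          have h6 : ∑ k ∈ Finset.Ico L K, ((2 : ℝ) ^ k) ^ (-ε) ≤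
              ∑' k : ℕ, ((2 : ℝ) ^ (k + L)) ^ (-ε) := by
            rw [Finset.sum_Ico_eq_sum_range]
            simp_rw [add_comm L]
            exact ((summable_nat_add_iff L).2 hsum).sum_le_tsum _ fun k _ => by positivity
          calc _ ≤ ENNReal.ofReal (C * H) * (lpENorm (hg.rem hp N hi L) +
                ENNReal.ofReal (∑' k : ℕ, ((2 : ℝ) ^ (k + L)) ^ (-ε)) * lpENorm (hg.deriv hi)) +
                ENNReal.ofReal (C * H) * (lpENorm (hg.rem hp N hi K) +
                ENNReal.ofReal (∑' k : ℕ, ((2 : ℝ) ^ (k + K)) ^ (-ε)) * lpENorm (hg.deriv hi)) := by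
                rw [← mul_add]
                refine mul_le_mul_right ?_ _
                calc _ ≤ lpENorm (hg.rem hp N hi L) + lpENorm (hg.rem hp N hi K) +
                    ENNReal.ofReal (∑' k : ℕ, ((2 : ℝ) ^ (k + L)) ^ (-ε)) *
                      lpENorm (hg.deriv hi) := by gcongr
                  _ = lpENorm (hg.rem hp N hi L) + ENNReal.ofReal
                    (∑' k : ℕ, ((2 : ℝ) ^ (k + L)) ^ (-ε)) * lpENorm (hg.deriv hi) +
                      lpENorm (hg.rem hp N hi K) := by ring
                  _ ≤ _ := by gcongr; exact le_self_add
            _ ≤ ENNReal.ofReal η' + ENNReal.ofReal η' :=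
                add_le_add (hK₀ L hL i hi) (hK₀ K (hL.trans hLK) i hi)
            _ = _ := by rw [← ENNReal.ofReal_add hη'0.le hη'0.le, two_mul]
        · rw [← ENNReal.ofReal_natCast, ← ENNReal.ofReal_mul (by positivity), hη']
          congr 1
          field_simp
      refine ⟨K₀, fun K hK L hL => ?_⟩
      rcases le_total L K with h | h
      · exact hcau L K hL h
      · rw [(isENorm_sobolevNatENorm hp).sub_comm]
        exact hcau K L hK h)
  refine ⟨S, fun g => ?_, hS2⟩
  -- Orders below s + 1 are at most ⌊s⌋ + 1 = M.
  refine besselENorm_map_le hs S hne (fun m hm f => hS1 m ?_ f) g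
  have h1 : (m : ℝ) < ((⌊s⌋₊ + 2 : ℕ) : ℝ) := by
    push_cast; linarith [Nat.lt_floor_add_one s]
  have h2 : m < ⌊s⌋₊ + 2 := by exact_mod_cast h1
  omega

end ParaproductOperators

/-! ### Products in H^s_p for s > d/p. -/

section BesselAlgebra

variable {E : Type*} [NormedAddCommGroup E] [NormedSpace ℝ E]
  {X₀ X₁ X₂ : Type*} [NormedAddCommGroup X₀] [NormedSpace ℝ X₀] [NormedAddCommGroup X₁]
  [NormedSpace ℝ X₁] [NormedAddCommGroup X₂] [NormedSpace ℝ X₂] {s p : ℝ}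

namespace IsSmoothingSeq

variable {M : ℕ} {ε H H' : ℝ} {w : ℕ → E → X₁}

lemma mono (h : IsSmoothingSeq M ε H w) (hH : H ≤ H') : IsSmoothingSeq M ε H' w where
  contDiff := h.contDiff
  bound k x := (h.bound k x).trans hH
  deriv_bound k a ha haM x := (h.deriv_bound k a ha haM x).trans (by gcongr)
  diff_bound k x := (h.diff_bound k x).trans (by gcongr)

/-- The telescoped product pairs the increment of g at scale k with the smoothing of f at scale k +
1. The shift costs at most 2^M since a ≤ M. -/
lemma succ (h : IsSmoothingSeq M ε H w) (hε : 0 < ε) :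
    IsSmoothingSeq M ε (H * 2 ^ M) (fun k => w (k + 1)) := by
  have hH : 0 ≤ H := (norm_nonneg _).trans (h.bound 0 0)
  have h1 : (1 : ℝ) ≤ 2 ^ M := one_le_pow₀ one_le_two
  have e : ∀ (k : ℕ) (a : ℝ), ((2 : ℝ) ^ (k + 1)) ^ a = 2 ^ a * ((2 : ℝ) ^ k) ^ a := fun k a => by
    rw [pow_succ', Real.mul_rpow zero_le_two (by positivity)]
  refine ⟨fun k => h.contDiff _, fun k x => (h.bound _ x).trans (le_mul_of_one_le_right hH h1),
    fun k a ha haM x => (h.deriv_bound _ a ha haM x).trans ?_,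
    fun k x => (h.diff_bound _ x).trans ?_⟩
  · rw [e, mul_assoc]
    gcongr
    rw [← Real.rpow_natCast]
    refine Real.rpow_le_rpow_of_exponent_le one_le_two ?_
    have : (a : ℝ) ≤ M := by exact_mod_cast haM
    linarith
  · rw [e, mul_assoc]
    gcongr
    exact (Real.rpow_le_one_of_one_le_of_nonpos one_le_two (by linarith)).trans h1

lemma hasBoundedDerivs (h : IsSmoothingSeq M ε H w) : HasBoundedDerivs M H (w 0) where
  contDiff := (h.contDiff 0).of_le (by exact_mod_cast le_top)
  bound j hj x := by
    rcases Nat.eq_zero_or_pos j with rfl | h0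
    · rw [norm_iteratedFDeriv_zero]; exact h.bound 0 x
    · simpa using h.deriv_bound 0 j h0 hj x

end IsSmoothingSeq

lemma exists_subseq_tendsto_ae {α Y : Type*} [MeasurableSpace α] {μ : Measure α}
    [NormedAddCommGroup Y] {q : ℝ≥0∞} (hq : q ≠ 0) {u : ℕ → α → Y} {v : α → Y}
    (hu : ∀ k, AEStronglyMeasurable (u k) μ) (hv : AEStronglyMeasurable v μ)
    (h : Tendsto (fun k => eLpNorm (u k - v) q μ) atTop (𝓝 0)) {ns : ℕ → ℕ} (hns : StrictMono ns) :
    ∃ ms : ℕ → ℕ, StrictMono ms ∧ (∃ r : ℕ → ℕ, StrictMono r ∧ ms = ns ∘ r) ∧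
      ∀ᵐ x ∂μ, Tendsto (fun i => u (ms i) x) atTop (𝓝 (v x)) := by
  obtain ⟨r, hr, hr'⟩ := (tendstoInMeasure_of_tendsto_eLpNorm hq (fun k => hu (ns k)) hv
    (h.comp hns.tendsto_atTop)).exists_seq_tendsto_ae
  exact ⟨ns ∘ r, hns.comp hr, ⟨r, hr, rfl⟩, hr'⟩

variable [FiniteDimensional ℝ E]
  [MeasureSpace E] [BorelSpace E] [(volume : Measure E).IsAddHaarMeasure]
  [CompleteSpace X₀] [CompleteSpace X₁] [CompleteSpace X₂]

/-- Telescoping with B(a', b') - B(a, b) = B(a', b' - b) + B(a' - a, b). Taking the new scale in one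
term and the old in the other leaves no term in which both factors are differences. -/
lemma bilin_smoothMap_eq (B : X₁ →L[ℝ] X₂ →L[ℝ] X₀) (hp : 1 < p) (N K : ℕ) (f : E → X₁)
    (g : E → X₂) (x : E) : B (smoothMap X₁ hp N K f x) (smoothMap X₂ hp N K g x) =
      B (smoothMap X₁ hp N 0 f x) (smoothMap X₂ hp N 0 g x) +
      paraSum B hp N (fun k => smoothMap X₁ hp N (k + 1) f) K g x +
      paraSum B.flip hp N (fun k => smoothMap X₂ hp N k g) K f x := by
  have e1 : ∀ k, paraTerm B hp N (fun k => smoothMap X₁ hp N (k + 1) f) k g x =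
      B (smoothMap X₁ hp N (k + 1) f x) (smoothMap X₂ hp N (k + 1) g x - smoothMap X₂ hp N k g x) :=
    fun k => rfl
  have e2 : ∀ k, paraTerm B.flip hp N (fun k => smoothMap X₂ hp N k g) k f x =
      B (smoothMap X₁ hp N (k + 1) f x - smoothMap X₁ hp N k f x) (smoothMap X₂ hp N k g x) :=
    fun k => rfl
  simp only [paraSum, LinearMap.sum_apply, Finset.sum_apply, e1, e2]
  rw [add_assoc, ← Finset.sum_add_distrib]
  induction K with
  | zero => simp
  | succ K ih =>
    rw [Finset.sum_range_succ, ← add_assoc, ← ih]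
    simp only [map_sub, ContinuousLinearMap.sub_apply]
    abel

/-- `H^s_p` is stable under multiplication if `s > d / p`. -/
theorem exists_besselENorm_mul_le (B : X₁ →L[ℝ] X₂ →L[ℝ] X₀) (hp : 1 < p)
    (hs : Module.finrank ℝ E / p < s) : ∃ K : ℝ≥0, ∀ (f : E → X₁) (g : E → X₂),
      besselENorm s p f < ⊤ → besselENorm s p g < ⊤ →
        besselENorm s p (fun x => B (f x) (g x)) ≤ K * besselENorm s p f * besselENorm s p g := by
  have hs0 : 0 ≤ s := le_trans (by positivity) hs.le
  set N := ⌈s⌉₊ + 2 with hN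
  have hNs : s + 2 ≤ N := by
    rw [hN]; push_cast; linarith [Nat.le_ceil s]
  have hN0 : N ≠ 0 := by omega
  set M := ⌊s⌋₊ + 1 with hM
  have hMs : s ≤ M := by
    rw [hM]; push_cast; linarith [Nat.lt_floor_add_one s]
  -- Any ε in (0, 1) with ε ≤ s - d/p serves; ε < 1 makes the derivatives of order at least one grow
  -- geometrically.
  set ε : ℝ := min (1 / 2) (s - Module.finrank ℝ E / p) with hε
  have hε0 : 0 < ε := lt_min (by norm_num) (by linarith)
  have hε1 : ε < 1 := (min_le_left _ _).trans_lt (by norm_num)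
  obtain ⟨C₁, hC₁, h₁⟩ := exists_isSmoothingSeq (E := E) (X := X₁) hp hs0 hNs M hε0 hε1
    (min_le_right _ _)
  obtain ⟨C₂, hC₂, h₂⟩ := exists_isSmoothingSeq (E := E) (X := X₂) hp hs0 hNs M hε0 hε1
    (min_le_right _ _)
  obtain ⟨Ca, hCa, ha⟩ := exists_paraproduct (E := E) B hp hs0 (N := N) (by linarith) hε0
  obtain ⟨Cb, hCb, hb⟩ := exists_paraproduct (E := E) B.flip hp hs0 (N := N) (by linarith) hε0
  obtain ⟨c₀, hc₀⟩ := besselENorm_bilin_le (E := E) hs0 hp B hMs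
  set K : ℝ := c₀ * C₁ * (1 + 2 ^ N) + Ca * (C₁ * 2 ^ M) + Cb * C₂ with hK
  have hK0 : 0 ≤ K := by positivity
  refine ⟨K.toNNReal, fun f g hf hg => ?_⟩
  have hfm := memLp_of_besselENorm_lt_top hp hs0 hf
  have hgm := memLp_of_besselENorm_lt_top hp hs0 hg
  set F := (besselENorm s p f).toReal with hF
  set G := (besselENorm s p g).toReal with hG
  have hF0 : 0 ≤ F := ENNReal.toReal_nonneg
  have hG0 : 0 ≤ G := ENNReal.toReal_nonneg
  have eF : besselENorm s p f = ENNReal.ofReal F := (ENNReal.ofReal_toReal hf.ne).symm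
  have eG : besselENorm s p g = ENNReal.ofReal G := (ENNReal.ofReal_toReal hg.ne).symm
  -- `exists_paraproduct` requires a positive bound for the coefficients while the norms may vanish,
  -- so η is added to both and sent to zero at the end.
  have key : ∀ η > (0 : ℝ), besselENorm s p (fun x => B (f x) (g x)) ≤
      ENNReal.ofReal (K * (F + η) * (G + η)) := by
    intro η hη
    have hw₁ : IsSmoothingSeq M ε (C₁ * (F + η)) (fun k => smoothMap X₁ hp N k f) :=
      (h₁ f hf).mono (by gcongr; linarith)
    have hw₂ : IsSmoothingSeq M ε (C₂ * (G + η)) (fun k => smoothMap X₂ hp N k g) :=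
      (h₂ g hg).mono (by gcongr; linarith)
    obtain ⟨S₁, hS₁, hS₁'⟩ := ha _ _ (by positivity) (hw₁.succ hε0)
    obtain ⟨S₂, hS₂, hS₂'⟩ := hb _ _ (by positivity) hw₂
    have hq : ENNReal.ofReal p ≠ 0 := (zero_lt_one.trans_le (one_le_ofReal hp)).ne'
    have hsmeas : ∀ k, AEStronglyMeasurable (smoothMap X₁ hp N k f) volume := fun k =>
      (hw₁.contDiff k).continuous.aestronglyMeasurable
    have hsmeas' : ∀ k, AEStronglyMeasurable (smoothMap X₂ hp N k g) volume := fun k =>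
      (hw₂.contDiff k).continuous.aestronglyMeasurable
    have hpm : ∀ k, AEStronglyMeasurable
        (paraSum B hp N (fun k => smoothMap X₁ hp N (k + 1) f) k g) volume := fun k => by
      obtain ⟨M₀, h⟩ := sobolevNatENorm_zero_paraSum_le B hp N (hw₁.succ hε0) k
      exact (memLp_of_sobolevNatENorm_lt_top ((h g).trans_lt (ENNReal.mul_lt_top
        ENNReal.coe_lt_top (by rw [sobolevNatENorm_zero_eq hp hgm]; exact hgm.2)))).1
    have hpm' : ∀ k, AEStronglyMeasurable
        (paraSum B.flip hp N (fun k => smoothMap X₂ hp N k g) k f) volume := fun k => by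
      obtain ⟨M₀, h⟩ := sobolevNatENorm_zero_paraSum_le B.flip hp N hw₂ k
      exact (memLp_of_sobolevNatENorm_lt_top ((h f).trans_lt (ENNReal.mul_lt_top
        ENNReal.coe_lt_top (by rw [sobolevNatENorm_zero_eq hp hfm]; exact hfm.2)))).1
    -- Four successive extractions give one subsequence along which both smoothings and both partial
    -- sums converge almost everywhere; this identifies the product with the sum of the three
    -- limits.
    obtain ⟨n₁, hn₁, -, hl₁⟩ := exists_subseq_tendsto_ae hq hsmeas hfm.1
      (tendsto_smoothMap_sub hp hN0 hfm) strictMono_id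
    obtain ⟨n₂, hn₂, ⟨r₂, hr₂, e₂⟩, hl₂⟩ := exists_subseq_tendsto_ae hq hsmeas' hgm.1
      (tendsto_smoothMap_sub hp hN0 hgm) hn₁
    obtain ⟨n₃, hn₃, ⟨r₃, hr₃, e₃⟩, hl₃⟩ := exists_subseq_tendsto_ae hq hpm (hS₁' g hgm).1.1
      (hS₁' g hgm).2 hn₂
    obtain ⟨n₄, hn₄, ⟨r₄, hr₄, e₄⟩, hl₄⟩ := exists_subseq_tendsto_ae hq hpm' (hS₂' f hfm).1.1
      (hS₂' f hfm).2 hn₃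
    have hae : (fun x => B (f x) (g x)) =ᵐ[volume]
        (fun x => B (smoothMap X₁ hp N 0 f x) (smoothMap X₂ hp N 0 g x)) + S₁ g + S₂ f := by
      filter_upwards [hl₁, hl₂, hl₃, hl₄] with x hx₁ hx₂ hx₃ hx₄
      subst e₄ e₃ e₂
      have t₁ := hx₁.comp (hr₂.comp (hr₃.comp hr₄)).tendsto_atTop
      have t₂ := hx₂.comp (hr₃.comp hr₄).tendsto_atTop
      have t₃ := hx₃.comp hr₄.tendsto_atTop
      have hL : Tendsto (fun i => B (smoothMap X₁ hp N (((n₁ ∘ r₂) ∘ r₃) (r₄ i)) f x)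
          (smoothMap X₂ hp N (((n₁ ∘ r₂) ∘ r₃) (r₄ i)) g x)) atTop (𝓝 (B (f x) (g x))) :=
        ((B.isBoundedBilinearMap.continuous.tendsto (f x, g x)).comp (t₁.prodMk_nhds t₂) :)
      refine tendsto_nhds_unique hL ?_
      exact ((tendsto_const_nhds.add t₃).add hx₄).congr fun i =>
        (bilin_smoothMap_eq B hp N _ f g x).symm
    rw [besselENorm_congr_ae hp hae]
    have hP : besselENorm s p (smoothMap X₂ hp N 0 g) ≤
        ((1 + 2 ^ N : ℝ≥0) : ℝ≥0∞) * besselENorm s p g :=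
      besselENorm_map_le hs0 _ (by positivity) (fun m _ u => sobolevNatENorm_smoothMap_le hp N 0 u) g
    have e5 : ((1 + 2 ^ N : ℝ≥0) : ℝ≥0∞) = ENNReal.ofReal (1 + 2 ^ N) := by
      rw [ENNReal.ofReal, ENNReal.coe_inj, ← NNReal.coe_inj, Real.coe_toNNReal _ (by positivity)]
      simp
    calc _ ≤ besselENorm s p (fun x => B (smoothMap X₁ hp N 0 f x) (smoothMap X₂ hp N 0 g x)) +
          besselENorm s p (S₁ g) + besselENorm s p (S₂ f) :=
          ((isENorm_besselENorm hp).add_le _ _).trans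
            (add_le_add ((isENorm_besselENorm hp).add_le _ _) le_rfl)
      _ ≤ ENNReal.ofReal c₀ * ENNReal.ofReal (C₁ * (F + η)) *
            (ENNReal.ofReal (1 + 2 ^ N) * ENNReal.ofReal G) +
          ENNReal.ofReal (Ca * (C₁ * (F + η) * 2 ^ M)) * ENNReal.ofReal G +
          ENNReal.ofReal (Cb * (C₂ * (G + η))) * ENNReal.ofReal F := by
          rw [← eF, ← eG, ← e5, ENNReal.ofReal_coe_nnreal]
          refine add_le_add (add_le_add ?_ (hS₁ g)) (hS₂ f)
          exact (hc₀ _ _ (by positivity) hw₁.hasBoundedDerivs _).trans (mul_le_mul_right hP _)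
      _ = ENNReal.ofReal (c₀ * (C₁ * (F + η)) * ((1 + 2 ^ N) * G) +
          Ca * (C₁ * (F + η) * 2 ^ M) * G + Cb * (C₂ * (G + η)) * F) := by
          rw [← ENNReal.ofReal_mul (by positivity), ← ENNReal.ofReal_mul (by positivity),
            ← ENNReal.ofReal_mul (by positivity), ← ENNReal.ofReal_mul (by positivity),
            ← ENNReal.ofReal_mul (by positivity), ← ENNReal.ofReal_add (by positivity)
            (by positivity), ← ENNReal.ofReal_add (by positivity) (by positivity)]
      _ ≤ _ := by
          refine ENNReal.ofReal_le_ofReal ?_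
          calc _ ≤ c₀ * (C₁ * (F + η)) * ((1 + 2 ^ N) * (G + η)) +
              Ca * (C₁ * (F + η) * 2 ^ M) * (G + η) + Cb * (C₂ * (G + η)) * (F + η) := by
                gcongr <;> linarith
            _ = _ := by rw [hK]; ring
  have hlim : Tendsto (fun η : ℝ => ENNReal.ofReal (K * (F + η) * (G + η))) (𝓝[>] 0)
      (𝓝 (ENNReal.ofReal (K * (F + 0) * (G + 0)))) := by
    refine ENNReal.tendsto_ofReal (Tendsto.mono_left ?_ nhdsWithin_le_nhds)
    exact Continuous.tendsto (by fun_prop) 0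
  refine (ge_of_tendsto hlim (eventually_mem_nhdsWithin.mono fun η hη => key η hη)).trans
    (le_of_eq ?_)
  rw [eF, eG, add_zero, add_zero, ENNReal.ofReal_mul (by positivity), ENNReal.ofReal_mul hK0]
  rfl

end BesselAlgebra

/-! ### Weighted pullbacks on Sobolev spaces. -/

section Pullback

variable {E : Type*} [NormedAddCommGroup E] [NormedSpace ℝ E]
  {E' : Type*} [NormedAddCommGroup E'] [NormedSpace ℝ E']
  {X : Type*} [NormedAddCommGroup X] [NormedSpace ℝ X]

/-- A weight `A` and a map `τ`, for which the weighted pullback `w ↦ A • w ∘ τ` is bounded on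
Sobolev spaces. -/
structure IsPullbackPair (A : E → ℝ) (τ : E → E') : Prop where
  contDiff : ContDiff ℝ ∞ A
  contDiff_map : ContDiff ℝ ∞ τ
  bound : ∀ j : ℕ, ∃ C, ∀ x, ‖iteratedFDeriv ℝ j A x‖ ≤ C
  bound_map : ∀ j : ℕ, 1 ≤ j → ∃ C, ∀ x, ‖iteratedFDeriv ℝ j τ x‖ ≤ C
  lower : ∃ L : ℝ≥0, ∀ x ∈ tsupport A, ∀ y ∈ tsupport A, edist x y ≤ L * edist (τ x) (τ y)

/-- The weighted pullback. -/
def pullback (X : Type*) [NormedAddCommGroup X] [NormedSpace ℝ X] (A : E → ℝ) (τ : E → E') :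
    (E' → X) →ₗ[ℝ] (E → X) where
  toFun w x := A x • w (τ x)
  map_add' w w' := by ext x; simp
  map_smul' c w := funext fun x => smul_comm (A x) c (w (τ x))

/-- A common bound for finitely many bounds. -/
lemma exists_common_bound {P : ℕ → ℝ → Prop} (hP : ∀ j C C', C ≤ C' → P j C → P j C')
    (h : ∀ j : ℕ, ∃ C, P j C) (m : ℕ) : ∃ C, 1 ≤ C ∧ ∀ j ≤ m, P j C := by
  choose c hc using h
  refine ⟨1 + ∑ j ∈ Finset.range (m + 1), |c j|, ?_, fun j hj => hP j _ _ ?_ (hc j)⟩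
  · linarith [Finset.sum_nonneg fun j (_ : j ∈ Finset.range (m + 1)) => abs_nonneg (c j)]
  · have h1 := Finset.single_le_sum (f := fun j => |c j|) (fun j _ => abs_nonneg (c j))
      (Finset.mem_range.2 (Nat.lt_succ_iff.2 hj))
    linarith [le_abs_self (c j)]

/-- The Leibniz rule and the bound for derivatives of a composition, with all derivatives of w at τ
x gathered into one sum. -/
lemma IsPullbackPair.exists_norm_iteratedFDeriv_le {A : E → ℝ} {τ : E → E'}
    (h : IsPullbackPair A τ) (m : ℕ) : ∃ C : ℝ, 0 < C ∧ ∀ (w : E' → X) (i : ℕ), i ≤ m →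
      ContDiff ℝ i w → ∀ x, ‖iteratedFDeriv ℝ i (pullback X A τ w) x‖ ≤
        C * ∑ j ∈ Finset.range (i + 1), ‖iteratedFDeriv ℝ j w (τ x)‖ := by
  obtain ⟨a, ha1, ha⟩ := exists_common_bound (P := fun j C => ∀ x, ‖iteratedFDeriv ℝ j A x‖ ≤ C)
    (fun j C C' hC hP x => (hP x).trans hC) h.bound m
  obtain ⟨b, hb1, hb⟩ := exists_common_bound
    (P := fun j C => 1 ≤ j → ∀ x, ‖iteratedFDeriv ℝ j τ x‖ ≤ C)
    (fun j C C' hC hP hj x => (hP hj x).trans hC)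
    (fun j => by
      by_cases hj : 1 ≤ j
      · obtain ⟨C, hC⟩ := h.bound_map j hj
        exact ⟨C, fun _ => hC⟩
      · exact ⟨0, fun h => absurd h hj⟩) m
  refine ⟨(m + 1) * (2 ^ m * a * (m.factorial * b ^ m)), by positivity, fun w i hi hw x => ?_⟩
  set W := ∑ j ∈ Finset.range (i + 1), ‖iteratedFDeriv ℝ j w (τ x)‖ with hW
  have hW0 : 0 ≤ W := Finset.sum_nonneg fun _ _ => norm_nonneg _
  have hτ : ContDiff ℝ i τ := h.contDiff_map.of_le (by exact_mod_cast le_top)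
  have hA : ContDiff ℝ i A := h.contDiff.of_le (by exact_mod_cast le_top)
  have h1 : ∀ l ≤ i, ‖iteratedFDeriv ℝ l (w ∘ τ) x‖ ≤ m.factorial * b ^ m * W := by
    intro l hl
    have h2 := norm_iteratedFDeriv_comp_le hw hτ (n := l) (by exact_mod_cast hl) x (C := W) (D := b)
      (fun j hj => Finset.single_le_sum (f := fun j => ‖iteratedFDeriv ℝ j w (τ x)‖)
        (fun _ _ => norm_nonneg _) (Finset.mem_range.2 (by omega)))
      -- The composition bound asks for b^j at order j; b ≥ 1 makes b itself small enough.
      (fun j hj1 hj => (hb j (by omega) hj1 x).trans (le_self_pow₀ hb1 (by omega)))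
    calc _ ≤ l.factorial * W * b ^ l := h2
      _ ≤ m.factorial * W * b ^ m := by
        have : (l.factorial : ℝ) ≤ m.factorial := by
          exact_mod_cast Nat.factorial_le (hl.trans hi)
        gcongr
        exact hl.trans hi
      _ = _ := by ring
  refine (norm_iteratedFDeriv_smul_le hA (hw.comp hτ) x le_rfl).trans ?_
  calc _ ≤ ∑ l ∈ Finset.range (i + 1), 2 ^ m * a * (m.factorial * b ^ m * W) := by
        refine Finset.sum_le_sum fun l hl => ?_
        have hl' := Nat.lt_succ_iff.1 (Finset.mem_range.1 hl)
        have hch : ((i.choose l : ℕ) : ℝ) ≤ 2 ^ m := by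
          exact_mod_cast (Nat.choose_le_two_pow i l).trans (Nat.pow_le_pow_right two_pos hi)
        gcongr
        · exact ha l (hl'.trans hi) x
        · exact h1 _ (Nat.sub_le _ _)
    _ = (i + 1) * (2 ^ m * a * (m.factorial * b ^ m * W)) := by simp
    _ ≤ (m + 1) * (2 ^ m * a * (m.factorial * b ^ m * W)) := by
      have : (i : ℝ) ≤ m := by exact_mod_cast hi
      gcongr
    _ = _ := by ring

lemma IsPullbackPair.hasBoundedDerivs {A : E → ℝ} {τ : E → E'} (h : IsPullbackPair A τ) (k : ℕ) :
    ∃ C : ℝ, 0 < C ∧ ∀ (w : E' → X) (a : ℝ), HasBoundedDerivs k a w →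
      HasBoundedDerivs k (C * a) (pullback X A τ w) := by
  obtain ⟨C, hC, hb⟩ := h.exists_norm_iteratedFDeriv_le (X := X) k
  refine ⟨C * (k + 1), by positivity, fun w a hw => ⟨?_, fun j hj x => ?_⟩⟩
  · exact (h.contDiff.of_le (by exact_mod_cast le_top)).smul
      (hw.contDiff.comp (h.contDiff_map.of_le (by exact_mod_cast le_top)))
  · have ha := hw.nonneg
    calc _ ≤ C * ∑ l ∈ Finset.range (j + 1), ‖iteratedFDeriv ℝ l w (τ x)‖ :=
          hb w j hj (hw.contDiff.of_le (by exact_mod_cast hj)) x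
      _ ≤ C * ∑ l ∈ Finset.range (j + 1), a := by
        gcongr with l hl
        exact hw.bound l (by have := Finset.mem_range.1 hl; omega) _
      _ = C * ((j + 1) * a) := by simp
      _ ≤ C * ((k + 1) * a) := by
        have : (j : ℝ) ≤ k := by exact_mod_cast hj
        gcongr
      _ = _ := by ring

lemma tsupport_pullback_subset (A : E → ℝ) (τ : E → E') (w : E' → X) :
    tsupport (pullback X A τ w) ⊆ tsupport A :=
  closure_mono fun x hx => by
    rw [Function.mem_support] at hx ⊢
    exact fun h => hx (by change A x • w (τ x) = 0; rw [h, zero_smul])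

variable [FiniteDimensional ℝ E] [MeasureSpace E] [BorelSpace E]
  [(volume : Measure E).IsAddHaarMeasure]
  [FiniteDimensional ℝ E'] [MeasureSpace E'] [BorelSpace E']
  [(volume : Measure E').IsAddHaarMeasure]

/-- An expanding map has a measure bounded by a multiple of Lebesgue measure as image of Lebesgue
measure. -/
lemma exists_map_volume_le (hd : Module.finrank ℝ E = Module.finrank ℝ E') {τ : E → E'}
    (hτ : Measurable τ) {s : Set E} (hs : MeasurableSet s) {L : ℝ≥0}
    (hL : ∀ x ∈ s, ∀ y ∈ s, edist x y ≤ L * edist (τ x) (τ y)) :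
    ∃ c : ℝ≥0, c ≠ 0 ∧ Measure.map τ (volume.restrict s) ≤ (c : ℝ≥0∞) • (volume : Measure E') := by
  -- Lebesgue measure is a multiple of Hausdorff measure of the same dimension on both sides. The
  -- inverse of τ on s is Lipschitz, which bounds Hausdorff measure without any Jacobian.
  have e1 := Measure.isAddLeftInvariant_eq_smul (volume : Measure E)
    (Measure.hausdorffMeasure (Module.finrank ℝ E) : Measure E)
  have e2 := Measure.isAddLeftInvariant_eq_smul
    (Measure.hausdorffMeasure (Module.finrank ℝ E') : Measure E') (volume : Measure E')
  set c₁ := (volume : Measure E).addHaarScalarFactor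
    (Measure.hausdorffMeasure (Module.finrank ℝ E) : Measure E)
  set c₂ := (Measure.hausdorffMeasure (Module.finrank ℝ E') : Measure E').addHaarScalarFactor
    (volume : Measure E')
  set d := Module.finrank ℝ E
  refine ⟨c₁ * (L ^ (d : ℝ) * c₂) + 1, by positivity, Measure.le_iff.2 fun t ht => ?_⟩
  rw [Measure.map_apply hτ ht, Measure.restrict_apply (hτ ht)]
  rcases (τ ⁻¹' t ∩ s).eq_empty_or_nonempty with h0 | ⟨x₀, -⟩
  · rw [h0, measure_empty]; exact zero_le
  have hinj : InjOn τ s := fun x hx y hy hxy => by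
    have := hL x hx y hy
    rwa [hxy, edist_self, mul_zero, nonpos_iff_eq_zero, edist_eq_zero] at this
  have : Nonempty E := ⟨x₀⟩
  set σ := Function.invFunOn τ s
  have hσ : ∀ x ∈ s, σ (τ x) = x := fun x hx => hinj.leftInvOn_invFunOn hx
  have hlip : LipschitzOnWith L σ (τ '' s) := by
    rintro _ ⟨x, hx, rfl⟩ _ ⟨y, hy, rfl⟩
    rw [hσ x hx, hσ y hy]
    exact hL x hx y hy
  have hsub : τ ⁻¹' t ∩ s ⊆ σ '' (t ∩ τ '' s) := fun x hx =>
    ⟨τ x, ⟨hx.1, mem_image_of_mem _ hx.2⟩, hσ x hx.2⟩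
  calc (volume : Measure E) (τ ⁻¹' t ∩ s)
      = c₁ * Measure.hausdorffMeasure (d : ℝ) (τ ⁻¹' t ∩ s) := by
        conv_lhs => rw [e1]
        rfl
    _ ≤ c₁ * (L ^ (d : ℝ) * Measure.hausdorffMeasure (d : ℝ) t) := by
        gcongr
        refine (measure_mono hsub).trans (((hlip.mono inter_subset_right).hausdorffMeasure_image_le
          (Nat.cast_nonneg d)).trans ?_)
        gcongr
        exact inter_subset_left
    _ = c₁ * (L ^ (d : ℝ) * (c₂ * (volume : Measure E') t)) := by
        conv_lhs => rw [hd, e2]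
        rw [hd]
        rfl
    _ = ((c₁ * (L ^ (d : ℝ) * c₂) : ℝ≥0) : ℝ≥0∞) * (volume : Measure E') t := by
        push_cast
        rw [ENNReal.coe_rpow_of_nonneg _ (Nat.cast_nonneg d)]
        ring
    _ ≤ _ := by
        rw [Measure.smul_apply, smul_eq_mul]
        gcongr
        exact le_self_add

variable [CompleteSpace X] {p : ℝ}

/-- On the support of the weight, τ carries Lebesgue measure to a measure below a multiple of
Lebesgue measure. The absolute continuity is kept because it makes compositions with almost
everywhere defined functions measurable. -/
lemma IsPullbackPair.exists_eLpNorm_comp_le {A : E → ℝ} {τ : E → E'} (h : IsPullbackPair A τ)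
    (hd : Module.finrank ℝ E = Module.finrank ℝ E') (hp : 1 < p) : ∃ c : ℝ≥0, c ≠ 0 ∧
    Measure.map τ (volume.restrict (tsupport A)) ≪ (volume : Measure E') ∧
    ∀ w : E' → ℝ, AEStronglyMeasurable w volume →
      eLpNorm (w ∘ τ) (ENNReal.ofReal p) (volume.restrict (tsupport A)) ≤
        c * eLpNorm w (ENNReal.ofReal p) volume := by
  obtain ⟨L, hL⟩ := h.lower
  have hτ : Measurable τ := h.contDiff_map.continuous.measurable
  obtain ⟨c, hc, hle⟩ := exists_map_volume_le hd hτ (isClosed_tsupport A).measurableSet hL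
  have hac : Measure.map τ (volume.restrict (tsupport A)) ≪ (volume : Measure E') :=
    (Measure.absolutelyContinuous_of_le hle).trans Measure.smul_absolutelyContinuous
  refine ⟨c ^ (1 / ENNReal.ofReal p).toReal, ?_, hac, fun w hw => ?_⟩
  · exact (NNReal.rpow_pos (pos_iff_ne_zero.2 hc)).ne'
  · rw [← eLpNorm_map_measure (hw.mono_ac hac) hτ.aemeasurable]
    refine (eLpNorm_mono_measure _ hle).trans (le_of_eq ?_)
    rw [eLpNorm_smul_measure_of_ne_top ENNReal.ofReal_ne_top, smul_eq_mul,
      ENNReal.coe_rpow_of_nonneg _ ENNReal.toReal_nonneg]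

omit [NormedSpace ℝ E] [FiniteDimensional ℝ E] [BorelSpace E] [(volume : Measure E).IsAddHaarMeasure]
  [NormedSpace ℝ E'] [FiniteDimensional ℝ E'] [BorelSpace E']
  [(volume : Measure E').IsAddHaarMeasure] in
lemma eLpNorm_comp_le_of_real {Y : Type*} [NormedAddCommGroup Y] {τ : E → E'} {q c : ℝ≥0∞}
    {μ : Measure E} (h : ∀ w : E' → ℝ, AEStronglyMeasurable w volume →
      eLpNorm (w ∘ τ) q μ ≤ c * eLpNorm w q volume) {w : E' → Y}
    (hw : AEStronglyMeasurable w volume) : eLpNorm (w ∘ τ) q μ ≤ c * eLpNorm w q volume := by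
  rw [← eLpNorm_norm (w ∘ τ), ← eLpNorm_norm w]
  exact h (fun x => ‖w x‖) hw.norm

lemma eLpNorm_eq_restrict_of_tsupport {Y : Type*} [NormedAddCommGroup Y] {f : E → Y} {s : Set E}
    (hs : IsClosed s) (hf : ∀ x ∉ s, f x = 0) (q : ℝ≥0∞) :
    eLpNorm f q volume = eLpNorm f q (volume.restrict s) := by
  rw [← eLpNorm_indicator_eq_eLpNorm_restrict hs.measurableSet]
  congr 1
  exact (indicator_eq_self.2 fun x hx => by_contra fun h => hx (hf x h)).symm

/-- For smooth w the pointwise derivative bounds combine with the L_p-bound for composition; density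
gives the rest. -/
lemma IsPullbackPair.exists_sobolevNatENorm_le {A : E → ℝ} {τ : E → E'} (h : IsPullbackPair A τ)
    (hd : Module.finrank ℝ E = Module.finrank ℝ E') (hp : 1 < p) (M : ℕ) :
    ∃ c : ℝ≥0, c ≠ 0 ∧ ∀ m ≤ M, ∀ w : E' → X,
      sobolevNatENorm m p (pullback X A τ w) ≤ c * sobolevNatENorm m p w := by
  obtain ⟨c, hc, hac, hcomp⟩ := h.exists_eLpNorm_comp_le hd hp
  obtain ⟨C, hC, hb⟩ := h.exists_norm_iteratedFDeriv_le (X := X) M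
  have hτ : Measurable τ := h.contDiff_map.continuous.measurable
  have hq := one_le_ofReal hp
  have hts : ∀ (w : E' → X) (i : ℕ), ∀ x ∉ tsupport A,
      iteratedFDeriv ℝ i (pullback X A τ w) x = 0 := fun w i x hx => by
    by_contra h0
    exact hx (tsupport_pullback_subset A τ w
      (support_iteratedFDeriv_subset i (Function.mem_support.2 h0)))
  have h00 : ∀ w : E' → X, sobolevNatENorm 0 p (pullback X A τ w) ≤
      ((C.toNNReal * c + 1 : ℝ≥0) : ℝ≥0∞) * sobolevNatENorm 0 p w := by
    intro w
    by_cases hw : sobolevNatENorm 0 p w < ⊤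
    swap
    · rw [not_lt_top_iff.1 hw, ENNReal.mul_top (by positivity)]; exact le_top
    have hwm := memLp_of_sobolevNatENorm_lt_top hw
    have hz : ∀ x ∉ tsupport A, pullback X A τ w x = 0 := fun x hx =>
      image_eq_zero_of_notMem_tsupport fun h' => hx (tsupport_pullback_subset A τ w h')
    have hle : eLpNorm (pullback X A τ w) (ENNReal.ofReal p) volume ≤
        ENNReal.ofReal C * (c * eLpNorm w (ENNReal.ofReal p) volume) := by
      rw [eLpNorm_eq_restrict_of_tsupport (isClosed_tsupport A) hz]
      refine le_trans (eLpNorm_le_mul_eLpNorm_of_ae_le_mul (g := w ∘ τ) (c := C)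
        (Eventually.of_forall fun x => ?_) _) (mul_le_mul_right (eLpNorm_comp_le_of_real hcomp hwm.1) _)
      -- The derivative bound of order zero, applied to the constant function with value w(τ x),
      -- bounds A x • w(τ x) without any smoothness of w.
      have h1 := hb (fun _ => w (τ x)) 0 (Nat.zero_le _) contDiff_const x
      rw [norm_iteratedFDeriv_zero, zero_add, Finset.sum_range_one, norm_iteratedFDeriv_zero] at h1
      exact h1
    have hmeas : AEStronglyMeasurable (pullback X A τ w) volume := by
      have h1 : AEStronglyMeasurable (pullback X A τ w) (volume.restrict (tsupport A)) :=
        h.contDiff.continuous.aestronglyMeasurable.smul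
          ((hwm.1.mono_ac hac).comp_measurable hτ)
      have e : pullback X A τ w = (tsupport A).indicator (pullback X A τ w) :=
        (indicator_eq_self.2 fun x hx => by_contra fun h => hx (hz x h)).symm
      rw [e]
      exact (aestronglyMeasurable_indicator_iff (isClosed_tsupport A).measurableSet).2 h1
    rw [sobolevNatENorm_zero_eq hp ⟨hmeas, hle.trans_lt (ENNReal.mul_lt_top ENNReal.ofReal_lt_top
      (ENNReal.mul_lt_top ENNReal.coe_lt_top hwm.2))⟩, sobolevNatENorm_zero_eq hp hwm]
    refine hle.trans ?_
    rw [← mul_assoc]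
    gcongr
    push_cast
    exact le_self_add
  refine ⟨(M + 1 : ℕ) * (C.toNNReal * c), by positivity, fun m hm w => ?_⟩
  refine sobolevNatENorm_map_le_of_smooth hp (pullback X A τ) h00 (fun g hg hgm => ?_) w
    (by positivity)
  have hJ : IsSobolevJet m p g (fun j => iteratedFDeriv ℝ j g) :=
    (hg.of_le (by exact_mod_cast le_top) : ContDiff ℝ m g).isSobolevJet hgm
  have hc1 : ContDiff ℝ m (pullback X A τ g) :=
    (h.contDiff.of_le (by exact_mod_cast le_top)).smul ((hg.comp h.contDiff_map).of_le
      (by exact_mod_cast le_top))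
  refine (sobolevNatENorm_le_of_contDiff hc1 (c := ENNReal.ofReal C * (c * sobolevNatENorm m p g))
    (ENNReal.mul_lt_top ENNReal.ofReal_lt_top (ENNReal.mul_lt_top ENNReal.coe_lt_top
      (hJ.lt_top hp))) fun i hi => ?_).trans ?_
  · rw [eLpNorm_eq_restrict_of_tsupport (isClosed_tsupport A) (hts g i)]
    refine (eLpNorm_le_sum_of_norm_le hq (Finset.range (i + 1))
      (G := fun j => iteratedFDeriv ℝ j g ∘ τ) hC.le (fun j _ => ?_) (fun x => ?_)).trans ?_
    · exact ((hg.continuous_iteratedFDeriv (m := j) (by exact_mod_cast le_top)).comp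
        h.contDiff_map.continuous).aestronglyMeasurable
    · refine (hb g i (hi.trans hm) (hg.of_le (by exact_mod_cast le_top)) x).trans (le_of_eq ?_)
      rw [Finset.mul_sum]
      rfl
    · rw [hJ.eq hp]
      refine mul_le_mul_right ?_ _
      rw [Finset.mul_sum]
      calc _ ≤ ∑ j ∈ Finset.range (i + 1),
            c * eLpNorm (iteratedFDeriv ℝ j g) (ENNReal.ofReal p) volume := by
            refine Finset.sum_le_sum fun j hj => ?_
            have hj' := Finset.mem_range.1 hj
            exact eLpNorm_comp_le_of_real hcomp (hgm j (by omega)).1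
        _ ≤ _ := Finset.sum_le_sum_of_subset (Finset.range_subset_range.2 (by omega))
  · have : ((m + 1 : ℕ) : ℝ≥0∞) ≤ ((M + 1 : ℕ) : ℝ≥0∞) := by exact_mod_cast Nat.succ_le_succ hm
    calc _ ≤ ((M + 1 : ℕ) : ℝ≥0∞) * (ENNReal.ofReal C * (c * sobolevNatENorm m p g)) := by gcongr
      _ = _ := by
        rw [ENNReal.coe_mul, ENNReal.coe_mul, ENNReal.coe_natCast, ← mul_assoc, ← mul_assoc,
          ← mul_assoc]
        rfl

lemma IsPullbackPair.exists_besselENorm_le {A : E → ℝ} {τ : E → E'} (h : IsPullbackPair A τ)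
    (hd : Module.finrank ℝ E = Module.finrank ℝ E') (hp : 1 < p) {s : ℝ} (hs : 0 ≤ s) :
    ∃ c : ℝ≥0, ∀ w : E' → X, besselENorm s p (pullback X A τ w) ≤ c * besselENorm s p w := by
  obtain ⟨c, hc, hb⟩ := h.exists_sobolevNatENorm_le (X := X) hd hp ⌈s + 1⌉₊
  refine ⟨c, fun w => besselENorm_map_le hs _ hc (fun m hm f => hb m ?_ f) w⟩
  exact_mod_cast hm.le.trans (Nat.le_ceil _)

end Pullback

/-! ### Construction of pullback pairs from changes of coordinates. -/

section PullbackPairs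

variable {E : Type*} [NormedAddCommGroup E] [NormedSpace ℝ E]
  {E' : Type*} [NormedAddCommGroup E'] [NormedSpace ℝ E']
  {X : Type*} [NormedAddCommGroup X] [NormedSpace ℝ X]

lemma contDiff_of_eq_zero {n : ℕ∞ω} {f : E → X} {U S : Set E} (hU : IsOpen U)
    (hf : ContDiffOn ℝ n f U) (hS : IsClosed S) (hSU : S ⊆ U) (h : ∀ x ∉ S, f x = 0) :
    ContDiff ℝ n f := by
  rw [contDiff_iff_contDiffAt]
  intro x
  by_cases hx : x ∈ S
  · exact hf.contDiffAt (hU.mem_nhds (hSU hx))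
  · refine (contDiffAt_const (c := (0 : X))).congr_of_eventuallyEq ?_
    filter_upwards [hS.isOpen_compl.mem_nhds hx] with y hy using h y hy

lemma ContDiff.exists_bound_of_hasCompactSupport {f : E → X} (hf : ContDiff ℝ ∞ f)
    (h : HasCompactSupport f) (j : ℕ) : ∃ C, ∀ x, ‖iteratedFDeriv ℝ j f x‖ ≤ C :=
  (h.iteratedFDeriv (𝕜 := ℝ) j).exists_bound_of_continuous
    (hf.continuous_iteratedFDeriv (by exact_mod_cast le_top))

lemma exists_contDiff_one_on [FiniteDimensional ℝ E] {s t : Set E} (hs : IsClosed s)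
    (hst : s ⊆ interior t) : ∃ f : E → ℝ, ContDiff ℝ ∞ f ∧ (∀ x ∈ s, f x = 1) ∧ ∀ x ∉ t, f x = 0 := by
  obtain ⟨f, h1, h2, -⟩ := exists_contMDiffMap_one_nhds_of_subset_interior (n := (⊤ : ℕ∞)) 𝓘(ℝ, E) hs hst
  exact ⟨f, f.contMDiff.contDiff, fun x hx => h1.self_of_nhdsSet x hx, h2⟩

/-- Two nested cut-offs make the data global: θ cuts off the weight within K₁, and η, equal to one
on K₁, cuts off the map within K₂. Derivatives are bounded by compactness, and on the support of the
weight the map is still τ. -/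
lemma exists_isPullbackPair [FiniteDimensional ℝ E] {U K : Set E} (hU : IsOpen U) (hK : IsCompact K)
    (hKU : K ⊆ U) {τ : E → E'} (hτ : ContDiffOn ℝ ∞ τ U) {U' : Set E'} {σ : E' → E}
    (hU' : IsOpen U') (hσ : ContDiffOn ℝ ∞ σ U') (hτU : MapsTo τ U U') (hστ : ∀ x ∈ U, σ (τ x) = x)
    {r : E → ℝ} (hr : ContDiffOn ℝ ∞ r U) : ∃ (A : E → ℝ) (τ' : E → E'), IsPullbackPair A τ' ∧
      (∀ x ∈ K, A x = r x) ∧ ∀ x, A x ≠ 0 → x ∈ U ∧ τ' x = τ x := by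
  obtain ⟨K₁, hK₁, hKK₁, hK₁U⟩ := exists_compact_between hK hU hKU
  obtain ⟨K₂, hK₂, hKK₂, hK₂U⟩ := exists_compact_between hK₁ hU hK₁U
  obtain ⟨θ, hθ, hθ1, hθ0⟩ := exists_contDiff_one_on hK.isClosed hKK₁
  obtain ⟨η, hη, hη1, hη0⟩ := exists_contDiff_one_on hK₁.isClosed hKK₂
  have hA : ContDiff ℝ ∞ (fun x => θ x • r x) :=
    contDiff_of_eq_zero hU (hθ.contDiffOn.smul hr) hK₁.isClosed hK₁U fun x hx => by
      rw [hθ0 x hx, zero_smul]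
  have hT : ContDiff ℝ ∞ (fun x => η x • τ x) :=
    contDiff_of_eq_zero hU (hη.contDiffOn.smul hτ) hK₂.isClosed hK₂U fun x hx => by
      rw [hη0 x hx, zero_smul]
  have hts : tsupport (fun x => θ x • r x) ⊆ K₁ := by
    refine closure_minimal (fun x hx => by_contra fun h => hx ?_) hK₁.isClosed
    change θ x • r x = 0
    rw [hθ0 x h, zero_smul]
  have heq : ∀ x ∈ K₁, η x • τ x = τ x := fun x hx => by rw [hη1 x hx, one_smul]
  refine ⟨fun x => θ x • r x, fun x => η x • τ x, ⟨hA, hT, ?_, fun j _ => ?_, ?_⟩, fun x hx => ?_,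
    fun x hx => ?_⟩
  · exact hA.exists_bound_of_hasCompactSupport (hK₁.of_isClosed_subset (isClosed_tsupport _) hts)
  · refine hT.exists_bound_of_hasCompactSupport (HasCompactSupport.of_support_subset_isCompact hK₂
      fun x hx => by_contra fun h => hx ?_) j
    change η x • τ x = 0
    rw [hη0 x h, zero_smul]
  · have hc : IsCompact (τ '' K₁) := hK₁.image_of_continuousOn (hτ.continuousOn.mono hK₁U)
    -- The smooth inverse is Lipschitz on the compact set τ(K₁); this is the lower bound for τ.
    have hl : LocallyLipschitzOn (τ '' K₁) σ := by
      rintro _ ⟨x, hx, rfl⟩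
      obtain ⟨L, t, ht, hL⟩ := ((hσ.contDiffAt (hU'.mem_nhds (hτU (hK₁U hx)))).of_le
        (by exact_mod_cast le_top : (1 : ℕ∞ω) ≤ (∞ : ℕ∞ω))).exists_lipschitzOnWith
      exact ⟨L, t, mem_nhdsWithin_of_mem_nhds ht, hL⟩
    obtain ⟨L, hL⟩ := hl.exists_lipschitzOnWith_of_compact hc
    refine ⟨L, fun x hx y hy => ?_⟩
    rw [heq x (hts hx), heq y (hts hy)]
    have := hL (mem_image_of_mem τ (hts hx)) (mem_image_of_mem τ (hts hy))
    rwa [hστ x (hK₁U (hts hx)), hστ y (hK₁U (hts hy))] at this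
  · change θ x • r x = r x
    rw [hθ1 x hx, one_smul]
  · have h1 : x ∈ K₁ := by_contra fun h => hx (by
      change θ x • r x = 0
      rw [hθ0 x h, zero_smul])
    exact ⟨hK₁U h1, heq x h1⟩

lemma ContinuousLinearMap.exists_bound_iteratedFDeriv (L : E →L[ℝ] X) {j : ℕ} (hj : 1 ≤ j) :
    ∃ C, ∀ x, ‖iteratedFDeriv ℝ j L x‖ ≤ C := by
  obtain ⟨k, rfl⟩ := Nat.exists_eq_add_of_le' hj
  refine ⟨‖L‖, fun x => ?_⟩
  have e : fderiv ℝ L = fun _ => L := funext fun y => L.fderiv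
  rw [← norm_iteratedFDeriv_fderiv, e]
  cases k with
  | zero => rw [norm_iteratedFDeriv_zero]
  | succ k =>
    rw [iteratedFDeriv_succ_const, Pi.zero_apply, norm_zero]
    exact norm_nonneg L

lemma exists_bound_iteratedFDeriv_comp_snd {f : E → X} (hf : ContDiff ℝ ∞ f) {j : ℕ}
    (h : ∃ C, ∀ x, ‖iteratedFDeriv ℝ j f x‖ ≤ C) :
    ∃ C, ∀ x : ℝ × E, ‖iteratedFDeriv ℝ j (fun x : ℝ × E => f x.2) x‖ ≤ C := by
  obtain ⟨C, hC⟩ := h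
  refine ⟨C, fun x => ?_⟩
  have e := (ContinuousLinearMap.snd ℝ ℝ E).iteratedFDeriv_comp_right hf x (i := j)
    (by exact_mod_cast le_top)
  have e' : iteratedFDeriv ℝ j (fun x : ℝ × E => f x.2) x = _ := e
  rw [e']
  refine (ContinuousMultilinearMap.norm_compContinuousLinearMap_le _ _).trans ?_
  calc _ ≤ ‖iteratedFDeriv ℝ j f x.2‖ * 1 := by
        refine mul_le_mul_of_nonneg_left ?_ (norm_nonneg _)
        exact Finset.prod_le_one (fun _ _ => norm_nonneg _)
          fun _ _ => ContinuousLinearMap.norm_snd_le ..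
    _ ≤ C := by rw [mul_one]; exact hC _

/-- For cylinders over B: changes of coordinates on B leave the variable t alone. -/
lemma IsPullbackPair.prod {A : E → ℝ} {τ : E → E'} (h : IsPullbackPair A τ) :
    IsPullbackPair (fun x : ℝ × E => A x.2) (fun x : ℝ × E => (x.1, τ x.2)) where
  contDiff := h.contDiff.comp contDiff_snd
  contDiff_map := contDiff_fst.prodMk (h.contDiff_map.comp contDiff_snd)
  bound j := exists_bound_iteratedFDeriv_comp_snd h.contDiff (h.bound j)
  bound_map j hj := by
    obtain ⟨C₁, h₁⟩ := (ContinuousLinearMap.fst ℝ ℝ E).exists_bound_iteratedFDeriv hj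
    obtain ⟨C₂, h₂⟩ := exists_bound_iteratedFDeriv_comp_snd h.contDiff_map (h.bound_map j hj)
    refine ⟨max C₁ C₂, fun x => ?_⟩
    have e := iteratedFDeriv_prodMk (𝕜 := ℝ) (f := fun x : ℝ × E => x.1)
      (g := fun x : ℝ × E => τ x.2) (x := x) (n := ∞) contDiff_fst.contDiffAt
      (h.contDiff_map.comp contDiff_snd).contDiffAt (i := j) (by exact_mod_cast le_top)
    rw [e, ContinuousMultilinearMap.opNorm_prod]
    exact max_le_max (h₁ x) (h₂ x)
  lower := by
    obtain ⟨L, hL⟩ := h.lower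
    have hsub : ∀ x ∈ tsupport (fun x : ℝ × E => A x.2), x.2 ∈ tsupport A := fun x hx =>
      (tsupport_comp_subset_preimage A continuous_snd) hx
    refine ⟨max 1 L, fun x hx y hy => ?_⟩
    rw [Prod.edist_eq, Prod.edist_eq]
    refine max_le ?_ ((hL _ (hsub x hx) _ (hsub y hy)).trans ?_)
    · calc edist x.1 y.1 = 1 * edist x.1 y.1 := (one_mul _).symm
        _ ≤ _ := by
          gcongr
          · exact_mod_cast le_max_left 1 L
          · exact le_max_left _ _
    · gcongr
      · exact le_max_right 1 L
      · exact le_max_right _ _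

end PullbackPairs

/-! ## Weighted localizations -/

section Patches

variable {EM : Type*} [NormedAddCommGroup EM] [NormedSpace ℝ EM] {H : Type*} [TopologicalSpace H]

/-- A smooth parametrization of an open subset of a manifold, with a weight on the manifold and a
family of densities on the parameter space. -/
structure Patch (I : ModelWithCorners ℝ EM H) (M : Type*) [TopologicalSpace M] [ChartedSpace H M]
    (E : Type*) [NormedAddCommGroup E] [NormedSpace ℝ E] where
  toPartialEquiv : PartialEquiv E M
  isOpen_source : IsOpen toPartialEquiv.source
  isOpen_target : IsOpen toPartialEquiv.target
  contMDiffOn : ContMDiffOn 𝓘(ℝ, E) I ∞ toPartialEquiv toPartialEquiv.source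
  contMDiffOn_symm : ContMDiffOn I 𝓘(ℝ, E) ∞ toPartialEquiv.symm toPartialEquiv.target
  weight : M → ℝ
  density : ℝ → E → ℝ
  density_pos : ∀ δ x, 0 < density δ x
  density_add : ∀ δ δ' x, density (δ + δ') x = density δ x * density δ' x
  contDiff_density : ∀ δ, ContDiff ℝ ∞ (density δ)

namespace Patch

variable {I : ModelWithCorners ℝ EM H} {M : Type*} [TopologicalSpace M] [ChartedSpace H M]
  {E : Type*} [NormedAddCommGroup E] [NormedSpace ℝ E]
  {E' : Type*} [NormedAddCommGroup E'] [NormedSpace ℝ E']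
  {X : Type*} [NormedAddCommGroup X] [NormedSpace ℝ X]

/-- The factor of a localized function. -/
def coeff (P : Patch I M E) (δ : ℝ) : E → ℝ :=
  P.toPartialEquiv.source.indicator fun x => P.density δ x * P.weight (P.toPartialEquiv x)

/-- The localization of a function. -/
def loc (P : Patch I M E) (δ : ℝ) : (M → X) →ₗ[ℝ] (E → X) where
  toFun u x := P.coeff δ x • u (P.toPartialEquiv x)
  map_add' u v := by ext x; simp
  map_smul' c u := funext fun x => smul_comm (P.coeff δ x) c (u (P.toPartialEquiv x))

lemma loc_apply (P : Patch I M E) (δ : ℝ) (u : M → X) (x : E) :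
    P.loc δ u x = P.coeff δ x • u (P.toPartialEquiv x) := rfl

/-- The parameters with nonzero weight. -/
def carrier (P : Patch I M E) : Set E :=
  {x ∈ P.toPartialEquiv.source | P.weight (P.toPartialEquiv x) ≠ 0}

lemma coeff_of_mem (P : Patch I M E) (δ : ℝ) {x : E} (hx : x ∈ P.carrier) :
    P.coeff δ x = P.density δ x * P.weight (P.toPartialEquiv x) := indicator_of_mem hx.1 _

lemma coeff_of_notMem (P : Patch I M E) (δ : ℝ) {x : E} (hx : x ∉ P.carrier) :
    P.coeff δ x = 0 := by
  by_cases h : x ∈ P.toPartialEquiv.source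
  · have : P.weight (P.toPartialEquiv x) = 0 := by_contra fun h' => hx ⟨h, h'⟩
    rw [coeff, indicator_of_mem h, this, mul_zero]
  · exact indicator_of_notMem h _

/-- A weighted pullback, by which the localization in `P` of a function times the weight of `Q` can
be obtained from the localization in `Q`. -/
def Transition (P : Patch I M E) (Q : Patch I M E') : Prop :=
  ∀ δ : ℝ, ∃ (A : E → ℝ) (τ : E → E'), IsPullbackPair A τ ∧ ∀ x ∈ P.carrier,
    A x * Q.coeff δ (τ x) = P.density δ x * Q.weight (P.toPartialEquiv x) ∧
    (A x * Q.coeff δ (τ x) ≠ 0 → Q.toPartialEquiv (τ x) = P.toPartialEquiv x)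

lemma pullback_loc {P : Patch I M E} {Q : Patch I M E'} {δ : ℝ} {A : E → ℝ} {τ : E → E'} {x : E}
    (h : A x * Q.coeff δ (τ x) = P.density δ x * Q.weight (P.toPartialEquiv x) ∧
      (A x * Q.coeff δ (τ x) ≠ 0 → Q.toPartialEquiv (τ x) = P.toPartialEquiv x)) (v : M → X) :
    pullback X A τ (Q.loc δ v) x =
      Q.weight (P.toPartialEquiv x) • P.density δ x • v (P.toPartialEquiv x) := by
  change A x • Q.coeff δ (τ x) • v (Q.toPartialEquiv (τ x)) = _
  rw [smul_smul, smul_smul, mul_comm (Q.weight _), ← h.1]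
  by_cases h0 : A x * Q.coeff δ (τ x) = 0
  · rw [h0, zero_smul, zero_smul]
  · rw [h.2 h0]

/-- The change of coordinates and the quotient of the densities are smooth on the overlap. Only
parameters over the compact set S ∩ T inside it matter, so `exists_isPullbackPair` applies. -/
lemma transition_of_isCompact [FiniteDimensional ℝ E] (P : Patch I M E) (Q : Patch I M E')
    {S T : Set M} (hS : IsCompact S) (hT : IsClosed T) (hP : ∀ q, P.weight q ≠ 0 → q ∈ S)
    (hQ : ∀ q, Q.weight q ≠ 0 → q ∈ T)
    (hST : S ∩ T ⊆ P.toPartialEquiv.target ∩ Q.toPartialEquiv.target) : P.Transition Q := by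
  intro δ
  have hPc := P.contMDiffOn.continuousOn
  have hQc := Q.contMDiffOn.continuousOn
  set U : Set E := P.toPartialEquiv.source ∩ P.toPartialEquiv ⁻¹' Q.toPartialEquiv.target with hU
  set U' : Set E' := Q.toPartialEquiv.source ∩ Q.toPartialEquiv ⁻¹' P.toPartialEquiv.target with hU'
  have hUo : IsOpen U := hPc.isOpen_inter_preimage P.isOpen_source Q.isOpen_target
  have hUo' : IsOpen U' := hQc.isOpen_inter_preimage Q.isOpen_source P.isOpen_target
  have hτ : ContDiffOn ℝ ∞ (Q.toPartialEquiv.symm ∘ P.toPartialEquiv) U :=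
    (Q.contMDiffOn_symm.comp (P.contMDiffOn.mono inter_subset_left) fun x hx => hx.2).contDiffOn
  have hσ : ContDiffOn ℝ ∞ (P.toPartialEquiv.symm ∘ Q.toPartialEquiv) U' :=
    (P.contMDiffOn_symm.comp (Q.contMDiffOn.mono inter_subset_left) fun x hx => hx.2).contDiffOn
  have hQP : ∀ x ∈ U, Q.toPartialEquiv ((Q.toPartialEquiv.symm ∘ P.toPartialEquiv) x) =
      P.toPartialEquiv x := fun x hx => Q.toPartialEquiv.right_inv hx.2
  have hτU : MapsTo (Q.toPartialEquiv.symm ∘ P.toPartialEquiv) U U' := fun x hx => by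
    refine ⟨Q.toPartialEquiv.map_target hx.2, ?_⟩
    rw [mem_preimage, hQP x hx]
    exact P.toPartialEquiv.map_source hx.1
  have hστ : ∀ x ∈ U, (P.toPartialEquiv.symm ∘ Q.toPartialEquiv)
      ((Q.toPartialEquiv.symm ∘ P.toPartialEquiv) x) = x := fun x hx => by
    rw [Function.comp_apply, hQP x hx]
    exact P.toPartialEquiv.left_inv hx.1
  set r : E → ℝ := fun x =>
    P.density δ x * (Q.density δ ((Q.toPartialEquiv.symm ∘ P.toPartialEquiv) x))⁻¹ with hr
  have hrs : ContDiffOn ℝ ∞ r U := (P.contDiff_density δ).contDiffOn.mul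
    (((Q.contDiff_density δ).comp_contDiffOn hτ).inv fun x _ => (Q.density_pos δ _).ne')
  have hK : IsCompact (P.toPartialEquiv.symm '' (S ∩ T)) :=
    (hS.inter_right hT).image_of_continuousOn
      (P.contMDiffOn_symm.continuousOn.mono fun q hq => (hST hq).1)
  have hKU : P.toPartialEquiv.symm '' (S ∩ T) ⊆ U := by
    rintro _ ⟨q, hq, rfl⟩
    refine ⟨P.toPartialEquiv.map_target (hST hq).1, ?_⟩
    rw [mem_preimage, P.toPartialEquiv.right_inv (hST hq).1]
    exact (hST hq).2
  obtain ⟨A, τ, hAτ, hA, hAU⟩ := exists_isPullbackPair hUo hK hKU hτ hUo' hσ hτU hστ hrs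
  have hmemK : ∀ x ∈ P.carrier, Q.weight (P.toPartialEquiv x) ≠ 0 →
      x ∈ P.toPartialEquiv.symm '' (S ∩ T) := fun x hx h =>
    ⟨P.toPartialEquiv x, ⟨hP _ hx.2, hQ _ h⟩, P.toPartialEquiv.left_inv hx.1⟩
  refine ⟨A, τ, hAτ, fun x hx => ⟨?_, fun h => ?_⟩⟩
  · by_cases hAx : A x = 0
    · have hw : Q.weight (P.toPartialEquiv x) = 0 := by_contra fun h => by
        have h1 := hA x (hmemK x hx h)
        rw [hAx, hr] at h1
        exact (mul_pos (P.density_pos δ x) (inv_pos.2 (Q.density_pos δ _))).ne h1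
      rw [hAx, hw, zero_mul, mul_zero]
    · obtain ⟨hxU, e⟩ := hAU x hAx
      have hc : Q.coeff δ (τ x) = Q.density δ (τ x) * Q.weight (P.toPartialEquiv x) := by
        rw [coeff, e, indicator_of_mem (hτU hxU).1, hQP x hxU]
      by_cases hw : Q.weight (P.toPartialEquiv x) = 0
      · rw [hc, hw, mul_zero, mul_zero, mul_zero]
      · rw [hc, hA x (hmemK x hx hw), hr, e, ← mul_assoc,
          inv_mul_cancel_right₀ (Q.density_pos δ _).ne']
  · obtain ⟨hxU, e⟩ := hAU x (left_ne_zero_of_mul h)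
    rw [e, hQP x hxU]

end Patch

/-- Two families of patches, with two parameter spaces, such that the weights form a partition of
unity. -/
structure PatchCover (I : ModelWithCorners ℝ EM H) (M : Type*) [TopologicalSpace M]
    [ChartedSpace H M] (E : Type*) [NormedAddCommGroup E] [NormedSpace ℝ E]
    (E' : Type*) [NormedAddCommGroup E'] [NormedSpace ℝ E'] where
  num : ℕ
  num' : ℕ
  patch : Fin num → Patch I M E
  patch' : Fin num' → Patch I M E'
  sum_weight : ∀ q, ∑ i, (patch i).weight q + ∑ i, (patch' i).weight q = 1
  transition : ∀ i j, (patch i).Transition (patch j)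
  transition_left : ∀ i j, (patch i).Transition (patch' j)
  transition_right : ∀ i j, (patch' i).Transition (patch j)
  transition' : ∀ i j, (patch' i).Transition (patch' j)

namespace PatchCover

variable {I : ModelWithCorners ℝ EM H} {M : Type*} [TopologicalSpace M] [ChartedSpace H M]
  {E : Type*} [NormedAddCommGroup E] [NormedSpace ℝ E] [FiniteDimensional ℝ E]
  [MeasureSpace E] [BorelSpace E] [(volume : Measure E).IsAddHaarMeasure]
  {E' : Type*} [NormedAddCommGroup E'] [NormedSpace ℝ E'] [FiniteDimensional ℝ E']
  [MeasureSpace E'] [BorelSpace E'] [(volume : Measure E').IsAddHaarMeasure]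
  {F : Type*} [NormedAddCommGroup F] [NormedSpace ℝ F] [FiniteDimensional ℝ F]
  [MeasureSpace F] [BorelSpace F] [(volume : Measure F).IsAddHaarMeasure]
  {X : Type*} [NormedAddCommGroup X] [NormedSpace ℝ X]
  {X₀ X₁ X₂ : Type*} [NormedAddCommGroup X₀] [NormedSpace ℝ X₀]
  [NormedAddCommGroup X₁] [NormedSpace ℝ X₁]
  [NormedAddCommGroup X₂] [NormedSpace ℝ X₂] {s p : ℝ}

omit [FiniteDimensional ℝ E] [BorelSpace E] [(volume : Measure E).IsAddHaarMeasure]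
  [FiniteDimensional ℝ E'] [BorelSpace E'] [(volume : Measure E').IsAddHaarMeasure] in
/-- The sum of the norms of the localizations. -/
def norm (C : PatchCover I M E E') (s p δ : ℝ) (u : M → X) : ℝ≥0∞ :=
  ∑ i, besselENorm s p ((C.patch i).loc δ u) + ∑ i, besselENorm s p ((C.patch' i).loc δ u)

/-- The localizations of `v` have bounded derivatives. -/
def HasBoundedDerivs (C : PatchCover I M E E') (k : ℕ) (a : ℝ) (v : M → X) : Prop :=
  (∀ i, _root_.HasBoundedDerivs k a ((C.patch i).loc 0 v)) ∧
    ∀ i, _root_.HasBoundedDerivs k a ((C.patch' i).loc 0 v)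

lemma _root_.HasBoundedDerivs.add {k : ℕ} {a b : ℝ} {f g : F → X} (hf : _root_.HasBoundedDerivs k a f)
    (hg : _root_.HasBoundedDerivs k b g) : _root_.HasBoundedDerivs k (a + b) (f + g) := by
  refine ⟨hf.contDiff.add hg.contDiff, fun j hj x => ?_⟩
  have hj' : ((j : ℕ) : ℕ∞ω) ≤ (k : ℕ∞ω) := by exact_mod_cast hj
  have e := iteratedFDeriv_add_apply (x := x) (hf.contDiff.of_le hj').contDiffAt
    (hg.contDiff.of_le hj').contDiffAt
  calc _ = ‖iteratedFDeriv ℝ j f x + iteratedFDeriv ℝ j g x‖ := congrArg _ e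
    _ ≤ _ := (norm_add_le _ _).trans (add_le_add (hf.bound j hj x) (hg.bound j hj x))

lemma _root_.HasBoundedDerivs.sum {k : ℕ} {ι : Type*} (t : Finset ι) {a : ι → ℝ} {f : ι → F → X}
    (h : ∀ i ∈ t, _root_.HasBoundedDerivs k (a i) (f i)) :
    _root_.HasBoundedDerivs k (∑ i ∈ t, a i) (∑ i ∈ t, f i) := by
  classical
  induction t using Finset.induction_on with
  | empty =>
    refine ⟨(contDiff_const : ContDiff ℝ k fun _ : F => (0 : X)), fun j _ x => ?_⟩
    have e : iteratedFDeriv ℝ j (0 : F → X) = 0 := iteratedFDeriv_zero_fun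
    simp [e]
  | insert i t hi ih =>
    rw [Finset.sum_insert hi, Finset.sum_insert hi]
    exact (h i (Finset.mem_insert_self _ _)).add
      (ih fun j hj => h j (Finset.mem_insert_of_mem hj))

/-- The restriction of a function to a patch, extended to the whole parameter space. -/
lemma exists_extension [CompleteSpace X] (C : PatchCover I M E E') (P : Patch I M F)
    (hP : ∀ i, P.Transition (C.patch i)) (hP' : ∀ i, P.Transition (C.patch' i)) (δ : ℝ)
    (hd : Module.finrank ℝ F = Module.finrank ℝ E) (hd' : Module.finrank ℝ F = Module.finrank ℝ E')
    (hp : 1 < p) (hs : 0 ≤ s) : ∃ T : (M → X) → (F → X),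
      (∀ v, ∀ x ∈ P.carrier, T v x = P.density δ x • v (P.toPartialEquiv x)) ∧
      (∃ K : ℝ≥0, ∀ v, besselENorm s p (T v) ≤ K * C.norm s p δ v) ∧
      (δ = 0 → ∀ k : ℕ, ∃ K : ℝ, 0 < K ∧ ∀ v a, 0 < a → C.HasBoundedDerivs k a v →
        _root_.HasBoundedDerivs k (K * a) (T v)) := by
  choose A τ hAτ hA using fun i => hP i δ
  choose A' τ' hAτ' hA' using fun i => hP' i δ
  -- Each pullback reproduces v times the weight of one patch, and the weights sum to one.
  refine ⟨fun v => ∑ i, pullback X (A i) (τ i) ((C.patch i).loc δ v) +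
    ∑ i, pullback X (A' i) (τ' i) ((C.patch' i).loc δ v), fun v x hx => ?_, ?_, fun hδ k => ?_⟩
  · change (∑ i, pullback X (A i) (τ i) ((C.patch i).loc δ v)) x +
      (∑ i, pullback X (A' i) (τ' i) ((C.patch' i).loc δ v)) x = _
    rw [Finset.sum_apply, Finset.sum_apply]
    simp only [Patch.pullback_loc (hA _ x hx), Patch.pullback_loc (hA' _ x hx)]
    rw [← Finset.sum_smul, ← Finset.sum_smul, ← add_smul, C.sum_weight, one_smul]
  · choose c hc using fun i => (hAτ i).exists_besselENorm_le (X := X) hd hp hs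
    choose c' hc' using fun i => (hAτ' i).exists_besselENorm_le (X := X) hd' hp hs
    have hle : ∀ i, c i ≤ ∑ j, c j := fun i =>
      Finset.single_le_sum (fun _ _ => zero_le) (Finset.mem_univ i)
    have hle' : ∀ i, c' i ≤ ∑ j, c' j := fun i =>
      Finset.single_le_sum (fun _ _ => zero_le) (Finset.mem_univ i)
    refine ⟨∑ i, c i + ∑ i, c' i, fun v => ?_⟩
    refine ((isENorm_besselENorm hp).add_le _ _).trans ((add_le_add
      ((isENorm_besselENorm hp).sum_le _ _) ((isENorm_besselENorm hp).sum_le _ _)).trans ?_)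
    rw [norm, mul_add, Finset.mul_sum, Finset.mul_sum]
    refine add_le_add (Finset.sum_le_sum fun i _ => (hc i _).trans ?_)
      (Finset.sum_le_sum fun i _ => (hc' i _).trans ?_)
    · gcongr
      exact (hle i).trans le_self_add
    · gcongr
      exact (hle' i).trans le_add_self
  · subst hδ
    choose c hc0 hc using fun i => (hAτ i).hasBoundedDerivs (X := X) k
    choose c' hc0' hc' using fun i => (hAτ' i).hasBoundedDerivs (X := X) k
    refine ⟨∑ i, c i + ∑ i, c' i + 1, ?_, fun v a ha hv => ?_⟩
    · have h1 := Finset.sum_nonneg fun i (_ : i ∈ Finset.univ) => (hc0 i).le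
      have h2 := Finset.sum_nonneg fun i (_ : i ∈ Finset.univ) => (hc0' i).le
      linarith
    · have h1 := (HasBoundedDerivs.sum Finset.univ fun i _ => hc i _ a (hv.1 i)).add
        (HasBoundedDerivs.sum Finset.univ fun i _ => hc' i _ a (hv.2 i))
      refine h1.mono le_rfl ?_
      rw [← Finset.sum_mul, ← Finset.sum_mul, ← add_mul]
      exact mul_le_mul_of_nonneg_right (by linarith) ha.le

end PatchCover

end Patches

/-! ### Products and completeness for the norm of a cover. -/

section CoverNorm

lemma exists_common_subseq {ι : Type*} (t : Finset ι) {α Y : Type*} [MeasurableSpace α]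
    {μ : Measure α} [NormedAddCommGroup Y] {q : ℝ≥0∞} (hq : q ≠ 0) {u : ι → ℕ → α → Y}
    {v : ι → α → Y} (hu : ∀ i k, AEStronglyMeasurable (u i k) μ)
    (hv : ∀ i, AEStronglyMeasurable (v i) μ)
    (h : ∀ i, Tendsto (fun k => eLpNorm (u i k - v i) q μ) atTop (𝓝 0)) {ns : ℕ → ℕ}
    (hns : StrictMono ns) : ∃ r : ℕ → ℕ, StrictMono r ∧ ∀ i ∈ t,
      ∀ᵐ x ∂μ, Tendsto (fun k => u i (ns (r k)) x) atTop (𝓝 (v i x)) := by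
  classical
  induction t using Finset.induction_on with
  | empty => exact ⟨id, strictMono_id, by simp⟩
  | insert a t ha ih =>
    obtain ⟨r, hr, h1⟩ := ih
    obtain ⟨ms, -, ⟨r', hr', e⟩, h2⟩ := exists_subseq_tendsto_ae hq (hu a) (hv a) (h a)
      (hns.comp hr)
    refine ⟨r ∘ r', hr.comp hr', fun i hi => ?_⟩
    rcases Finset.mem_insert.1 hi with rfl | hi
    · rw [e] at h2
      exact h2
    · filter_upwards [h1 i hi] with x hx using hx.comp hr'.tendsto_atTop

/-- Presents an extended norm as the norm of a linear map, the form in which `enorm_le_besselENorm`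
interpolates. -/
lemma IsENorm.exists_map.{v} {V : Type v} [AddCommGroup V] [Module ℝ V] {N : V → ℝ≥0∞}
    (h : IsENorm N) : ∃ (Y : Type v) (_ : NormedAddCommGroup Y) (_ : NormedSpace ℝ Y)
      (T : V →ₗ[ℝ] Y), ∀ v, N v < ⊤ → ‖T v‖ₑ = N v := by
  obtain ⟨π, hπ⟩ := h.exists_proj
  refine ⟨SeparationQuotient h.space, inferInstance, inferInstance,
    (SeparationQuotient.mkCLM ℝ h.space).toLinearMap ∘ₗ π, fun v hv => ?_⟩
  have e : π v = ⟨v, hv⟩ := hπ ⟨v, hv⟩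
  change ‖SeparationQuotient.mk (π v)‖ₑ = _
  rw [← ofReal_norm, SeparationQuotient.norm_mk, ofReal_norm, e, h.enorm_eq]

/-- The map from W^m_p to L_p has norm at most one for every m, hence also after interpolation. -/
lemma eLpNorm_le_besselENorm {E : Type*} [NormedAddCommGroup E] [NormedSpace ℝ E]
    [FiniteDimensional ℝ E] [MeasureSpace E] [BorelSpace E] [(volume : Measure E).IsAddHaarMeasure]
    {X : Type*} [NormedAddCommGroup X] [NormedSpace ℝ X] [CompleteSpace X] {s p : ℝ} (hp : 1 < p)
    (hs : 0 ≤ s) {f : E → X} (hf : besselENorm s p f < ⊤) :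
    eLpNorm f (ENNReal.ofReal p) volume ≤ besselENorm s p f := by
  have hN := isENorm_sobolevNatENorm (E := E) (X := X) (m := 0) hp
  obtain ⟨Y, _, _, T, hπ'⟩ := hN.exists_map
  have h1 := enorm_le_besselENorm (s := s) (p := p) hs T (C := 1) (L := 1) one_pos one_pos
    (fun m _ g => by
      by_cases hg : sobolevNatENorm 0 p g < ⊤
      · rw [hπ' g hg]
        simpa using sobolevNatENorm_mono hp (Nat.zero_le m) g
      · have h2 : sobolevNatENorm m p g = ⊤ := by
          have := sobolevNatENorm_mono hp (Nat.zero_le m) g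
          rw [not_lt_top_iff.1 hg] at this
          exact top_le_iff.1 this
        simp [h2]) f
  have hm := memLp_of_besselENorm_lt_top hp hs hf
  rw [hπ' f (by rw [sobolevNatENorm_zero_eq hp hm]; exact hm.2), sobolevNatENorm_zero_eq hp hm] at h1
  simpa using h1

lemma tendsto_eLpNorm_of_besselENorm {E : Type*} [NormedAddCommGroup E] [NormedSpace ℝ E]
    [FiniteDimensional ℝ E] [MeasureSpace E] [BorelSpace E] [(volume : Measure E).IsAddHaarMeasure]
    {X : Type*} [NormedAddCommGroup X] [NormedSpace ℝ X] [CompleteSpace X] {s p : ℝ} (hp : 1 < p)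
    (hs : 0 ≤ s) {g : ℕ → E → X} {w : E → X} (hg : ∀ K, besselENorm s p (g K) < ⊤)
    (h : Tendsto (fun K => besselENorm s p (w - g K)) atTop (𝓝 0)) :
    (∀ K, AEStronglyMeasurable (g K) volume) ∧ AEStronglyMeasurable w volume ∧
      Tendsto (fun K => eLpNorm (g K - w) (ENNReal.ofReal p) volume) atTop (𝓝 0) := by
  have hb := isENorm_besselENorm (E := E) (X := X) (s := s) hp
  obtain ⟨K, hK⟩ := (h.eventually_lt_const (u := 1) one_pos).exists
  have hw : besselENorm s p w < ⊤ := by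
    rw [← sub_add_cancel w (g K)]
    exact (hb.add_le _ _).trans_lt (ENNReal.add_lt_top.2 ⟨hK.trans ENNReal.one_lt_top, hg K⟩)
  refine ⟨fun K => (memLp_of_besselENorm_lt_top hp hs (hg K)).1,
    (memLp_of_besselENorm_lt_top hp hs hw).1, tendsto_of_tendsto_of_tendsto_of_le_of_le
    tendsto_const_nhds h (fun _ => zero_le) fun K => ?_⟩
  change eLpNorm (g K - w) _ _ ≤ besselENorm s p (w - g K)
  rw [hb.sub_comm]
  exact eLpNorm_le_besselENorm hp hs
    ((hb.sub_le _ _).trans_lt (ENNReal.add_lt_top.2 ⟨hg K, hw⟩))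

namespace PatchCover

variable {EM : Type*} [NormedAddCommGroup EM] [NormedSpace ℝ EM] {H : Type*} [TopologicalSpace H]
  {I : ModelWithCorners ℝ EM H} {M : Type*} [TopologicalSpace M] [ChartedSpace H M]
  {E : Type*} [NormedAddCommGroup E] [NormedSpace ℝ E] [FiniteDimensional ℝ E]
  [MeasureSpace E] [BorelSpace E] [(volume : Measure E).IsAddHaarMeasure]
  {E' : Type*} [NormedAddCommGroup E'] [NormedSpace ℝ E'] [FiniteDimensional ℝ E']
  [MeasureSpace E'] [BorelSpace E'] [(volume : Measure E').IsAddHaarMeasure]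
  {F : Type*} [NormedAddCommGroup F] [NormedSpace ℝ F] [FiniteDimensional ℝ F]
  [MeasureSpace F] [BorelSpace F] [(volume : Measure F).IsAddHaarMeasure]
  {X : Type*} [NormedAddCommGroup X] [NormedSpace ℝ X] [CompleteSpace X]
  {X₀ X₁ X₂ : Type*} [NormedAddCommGroup X₀] [NormedSpace ℝ X₀] [CompleteSpace X₀]
  [NormedAddCommGroup X₁] [NormedSpace ℝ X₁] [CompleteSpace X₁]
  [NormedAddCommGroup X₂] [NormedSpace ℝ X₂] [CompleteSpace X₂] {s p : ℝ}

/-- Densities multiply and the weight of P stays with u. The factor v may be replaced by its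
extension T v since only points of the carrier contribute; `exists_besselENorm_mul_le` then applies
to two globally defined functions. -/
lemma exists_besselENorm_loc_mul_le (B : X₁ →L[ℝ] X₂ →L[ℝ] X₀) (C : PatchCover I M E E')
    (P : Patch I M F) (hP : ∀ i, P.Transition (C.patch i)) (hP' : ∀ i, P.Transition (C.patch' i))
    (hd : Module.finrank ℝ F = Module.finrank ℝ E) (hd' : Module.finrank ℝ F = Module.finrank ℝ E')
    (hp : 1 < p) (hs : Module.finrank ℝ F / p < s) (δ δ' : ℝ) : ∃ K : ℝ≥0, ∀ (u : M → X₁)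
      (v : M → X₂), C.norm s p δ' v < ⊤ → besselENorm s p (P.loc δ u) < ⊤ →
      besselENorm s p (P.loc (δ + δ') fun q => B (u q) (v q)) ≤
        K * besselENorm s p (P.loc δ u) * C.norm s p δ' v := by
  have hs0 : 0 ≤ s := le_trans (by positivity) hs.le
  obtain ⟨T, hT, ⟨K₁, hK₁⟩, -⟩ := C.exists_extension (X := X₂) P hP hP' δ' hd hd' hp hs0
  obtain ⟨K₂, hK₂⟩ := exists_besselENorm_mul_le B hp hs
  refine ⟨K₂ * K₁, fun u v hv hu => ?_⟩
  have e : P.loc (δ + δ') (fun q => B (u q) (v q)) = fun x => B (P.loc δ u x) (T v x) := by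
    ext x
    by_cases hx : x ∈ P.carrier
    · rw [hT v x hx, P.loc_apply, P.loc_apply, P.coeff_of_mem _ hx, P.coeff_of_mem _ hx,
        P.density_add, map_smul, map_smul, ContinuousLinearMap.smul_apply, smul_smul]
      congr 1; ring
    · rw [P.loc_apply, P.loc_apply, P.coeff_of_notMem _ hx, P.coeff_of_notMem _ hx, zero_smul,
        zero_smul, map_zero, ContinuousLinearMap.zero_apply]
  rw [e]
  refine (hK₂ _ _ hu ((hK₁ v).trans_lt (ENNReal.mul_lt_top ENNReal.coe_lt_top hv))).trans ?_
  calc _ ≤ K₂ * besselENorm s p (P.loc δ u) * (K₁ * C.norm s p δ' v) := by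
        gcongr
        exact hK₁ v
    _ = _ := by rw [ENNReal.coe_mul]; ring

/-- The whole density stays with u, and v is extended with δ = 0, so that the extension has bounded
derivatives. -/
lemma exists_besselENorm_loc_mul_contDiff_le (B : X₁ →L[ℝ] X₂ →L[ℝ] X₀) (C : PatchCover I M E E')
    (P : Patch I M F) (hP : ∀ i, P.Transition (C.patch i)) (hP' : ∀ i, P.Transition (C.patch' i))
    (hd : Module.finrank ℝ F = Module.finrank ℝ E) (hd' : Module.finrank ℝ F = Module.finrank ℝ E')
    (hp : 1 < p) (hs : 0 ≤ s) {k : ℕ} (hk : s ≤ k) (δ : ℝ) : ∃ K : ℝ≥0, ∀ (u : M → X₁)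
      (v : M → X₂) (a : ℝ), 0 < a → C.HasBoundedDerivs k a v →
      besselENorm s p (P.loc δ fun q => B (u q) (v q)) ≤
        K * ENNReal.ofReal a * besselENorm s p (P.loc δ u) := by
  obtain ⟨T, hT, -, hT'⟩ := C.exists_extension (X := X₂) P hP hP' 0 hd hd' hp hs
  obtain ⟨K₁, hK₁, h₁⟩ := hT' rfl k
  obtain ⟨K₂, h₂⟩ := besselENorm_bilin_le (E := F) hs hp B.flip hk
  refine ⟨K₂ * K₁.toNNReal, fun u v a ha hv => ?_⟩
  -- The density at δ = 0 is positive and idempotent.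
  have hd0 : ∀ x, P.density 0 x = 1 := fun x => by
    have h := P.density_add 0 0 x
    rw [add_zero] at h
    exact (mul_eq_left₀ (P.density_pos 0 x).ne').1 h.symm
  have e : P.loc δ (fun q => B (u q) (v q)) = fun x => B.flip (T v x) (P.loc δ u x) := by
    ext x
    by_cases hx : x ∈ P.carrier
    · rw [hT v x hx, P.loc_apply, P.loc_apply, hd0, one_smul, ContinuousLinearMap.flip_apply,
        map_smul, ContinuousLinearMap.smul_apply]
    · rw [P.loc_apply, P.loc_apply, P.coeff_of_notMem _ hx, zero_smul,
        zero_smul, map_zero]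
  rw [e]
  refine (h₂ _ _ (by positivity) (h₁ v a ha hv) _).trans (le_of_eq ?_)
  rw [ENNReal.ofReal_mul hK₁.le, ENNReal.coe_mul]
  change K₂ * (ENNReal.ofReal K₁ * _) * _ = K₂ * ENNReal.ofReal K₁ * _ * _
  ring

lemma exists_common_constant {n n' : ℕ} (K : Fin n → ℝ≥0) (K' : Fin n' → ℝ≥0) :
    ∃ c : ℝ≥0, (∀ i, K i ≤ c) ∧ ∀ i, K' i ≤ c :=
  ⟨∑ i, K i + ∑ i, K' i, fun i => (Finset.single_le_sum (fun _ _ => zero_le)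
    (Finset.mem_univ i)).trans le_self_add, fun i => (Finset.single_le_sum (fun _ _ => zero_le)
    (Finset.mem_univ i)).trans le_add_self⟩

omit [FiniteDimensional ℝ E] [BorelSpace E] [(volume : Measure E).IsAddHaarMeasure]
  [FiniteDimensional ℝ E'] [BorelSpace E'] [(volume : Measure E').IsAddHaarMeasure]
  [CompleteSpace X] in
lemma besselENorm_loc_le (C : PatchCover I M E E') (δ : ℝ) (u : M → X) (i : Fin C.num) :
    besselENorm s p ((C.patch i).loc δ u) ≤ C.norm s p δ u :=
  (Finset.single_le_sum (f := fun i => besselENorm s p ((C.patch i).loc δ u))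
    (fun _ _ => zero_le) (Finset.mem_univ i)).trans le_self_add

omit [FiniteDimensional ℝ E] [BorelSpace E] [(volume : Measure E).IsAddHaarMeasure]
  [FiniteDimensional ℝ E'] [BorelSpace E'] [(volume : Measure E').IsAddHaarMeasure]
  [CompleteSpace X] in
lemma besselENorm_loc_le' (C : PatchCover I M E E') (δ : ℝ) (u : M → X) (i : Fin C.num') :
    besselENorm s p ((C.patch' i).loc δ u) ≤ C.norm s p δ u :=
  (Finset.single_le_sum (f := fun i => besselENorm s p ((C.patch' i).loc δ u))
    (fun _ _ => zero_le) (Finset.mem_univ i)).trans le_add_self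

theorem exists_norm_mul_le (B : X₁ →L[ℝ] X₂ →L[ℝ] X₀) (C : PatchCover I M E E')
    (hd : Module.finrank ℝ E = Module.finrank ℝ E') (hp : 1 < p)
    (hs : Module.finrank ℝ E / p < s) (δ δ' : ℝ) : ∃ K : ℝ≥0, ∀ (u : M → X₁) (v : M → X₂),
      C.norm s p δ u < ⊤ → C.norm s p δ' v < ⊤ →
      C.norm s p (δ + δ') (fun q => B (u q) (v q)) ≤ K * C.norm s p δ u * C.norm s p δ' v := by
  choose K hK using fun i => C.exists_besselENorm_loc_mul_le B (C.patch i) (C.transition i)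
    (C.transition_left i) rfl hd hp hs δ δ'
  choose K' hK' using fun i => C.exists_besselENorm_loc_mul_le B (C.patch' i) (C.transition_right i)
    (C.transition' i) hd.symm rfl hp (hd ▸ hs) δ δ'
  obtain ⟨c, hc, hc'⟩ := exists_common_constant K K'
  refine ⟨c, fun u v hu hv => ?_⟩
  calc _ ≤ ∑ i, c * besselENorm s p ((C.patch i).loc δ u) * C.norm s p δ' v +
        ∑ i, c * besselENorm s p ((C.patch' i).loc δ u) * C.norm s p δ' v := by
        refine add_le_add (Finset.sum_le_sum fun i _ => ?_) (Finset.sum_le_sum fun i _ => ?_)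
        · refine (hK i u v hv ((C.besselENorm_loc_le δ u i).trans_lt hu)).trans ?_
          gcongr
          exact hc i
        · refine (hK' i u v hv ((C.besselENorm_loc_le' δ u i).trans_lt hu)).trans ?_
          gcongr
          exact hc' i
    _ = _ := by
        rw [← Finset.sum_mul, ← Finset.sum_mul, ← add_mul, ← Finset.mul_sum, ← Finset.mul_sum,
          ← mul_add]
        rfl

theorem exists_norm_mul_contDiff_le (B : X₁ →L[ℝ] X₂ →L[ℝ] X₀) (C : PatchCover I M E E')
    (hd : Module.finrank ℝ E = Module.finrank ℝ E') (hp : 1 < p) (hs : 0 ≤ s) {k : ℕ} (hk : s ≤ k)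
    (δ : ℝ) : ∃ K : ℝ≥0, ∀ (u : M → X₁) (v : M → X₂) (a : ℝ), 0 < a → C.HasBoundedDerivs k a v →
      C.norm s p δ (fun q => B (u q) (v q)) ≤ K * ENNReal.ofReal a * C.norm s p δ u := by
  choose K hK using fun i => C.exists_besselENorm_loc_mul_contDiff_le B (C.patch i) (C.transition i)
    (C.transition_left i) rfl hd hp hs hk δ
  choose K' hK' using fun i => C.exists_besselENorm_loc_mul_contDiff_le B (C.patch' i)
    (C.transition_right i) (C.transition' i) hd.symm rfl hp hs hk δ
  obtain ⟨c, hc, hc'⟩ := exists_common_constant K K'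
  refine ⟨c, fun u v a ha hv => ?_⟩
  calc _ ≤ ∑ i, c * ENNReal.ofReal a * besselENorm s p ((C.patch i).loc δ u) +
        ∑ i, c * ENNReal.ofReal a * besselENorm s p ((C.patch' i).loc δ u) := by
        refine add_le_add (Finset.sum_le_sum fun i _ => ?_) (Finset.sum_le_sum fun i _ => ?_)
        · refine (hK i u v a ha hv).trans ?_
          gcongr
          exact hc i
        · refine (hK' i u v a ha hv).trans ?_
          gcongr
          exact hc' i
    _ = _ := by
        rw [← Finset.mul_sum, ← Finset.mul_sum, ← mul_add]
        rfl

lemma isENorm_norm (C : PatchCover I M E E') (hp : 1 < p) (δ : ℝ) :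
    IsENorm (C.norm (X := X) s p δ) where
  zero := by
    have h1 := (isENorm_besselENorm (E := E) (X := X) (s := s) hp).zero
    have h2 := (isENorm_besselENorm (E := E') (X := X) (s := s) hp).zero
    simp [norm, h1, h2]
  add_le u v := by
    have h1 := (isENorm_besselENorm (E := E) (X := X) (s := s) hp).add_le
    have h2 := (isENorm_besselENorm (E := E') (X := X) (s := s) hp).add_le
    simp only [norm, map_add]
    calc _ ≤ ∑ i, (besselENorm s p ((C.patch i).loc δ u) + besselENorm s p ((C.patch i).loc δ v)) +
          ∑ i, (besselENorm s p ((C.patch' i).loc δ u) + besselENorm s p ((C.patch' i).loc δ v)) :=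
          add_le_add (Finset.sum_le_sum fun i _ => h1 _ _) (Finset.sum_le_sum fun i _ => h2 _ _)
      _ = _ := by
          rw [Finset.sum_add_distrib, Finset.sum_add_distrib]
          abel
  smul_le c u := by
    have h1 := (isENorm_besselENorm (E := E) (X := X) (s := s) hp).smul_le
    have h2 := (isENorm_besselENorm (E := E') (X := X) (s := s) hp).smul_le
    simp only [norm, map_smul]
    rw [mul_add, Finset.mul_sum, Finset.mul_sum]
    exact add_le_add (Finset.sum_le_sum fun i _ => h1 _ _) (Finset.sum_le_sum fun i _ => h2 _ _)

omit [FiniteDimensional ℝ F] [BorelSpace F] [(volume : Measure F).IsAddHaarMeasure]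
  [CompleteSpace X] in
-- Where the coefficient is nonzero, dividing by it shows that the functions converge, so `limUnder`
-- is their limit; elsewhere both sides vanish.
lemma _root_.Patch.loc_limUnder_ae_eq (P : Patch I M F) (δ : ℝ) {f : ℕ → M → X} {w : F → X}
    (h : ∀ᵐ x, Tendsto (fun k => P.loc δ (f k) x) atTop (𝓝 (w x))) :
    P.loc δ (fun q => limUnder atTop fun k => f k q) =ᵐ[volume] w := by
  filter_upwards [h] with x hx
  by_cases h0 : P.coeff δ x = 0
  · have h1 : ∀ u : M → X, P.loc δ u x = 0 := fun u => by rw [P.loc_apply, h0, zero_smul]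
    simp only [h1] at hx ⊢
    exact tendsto_nhds_unique tendsto_const_nhds hx
  · have h1 := hx.const_smul (P.coeff δ x)⁻¹
    simp only [P.loc_apply, inv_smul_smul₀ h0] at h1
    rw [P.loc_apply, h1.limUnder_eq, smul_inv_smul₀ h0]

/-- The localizations of the series converge in H^s_p, but their limits must come from a single
function on the manifold. It is the pointwise limit along a subsequence for which all localizations
converge almost everywhere. -/
lemma EComplete_norm (C : PatchCover I M E E') (hp : 1 < p) (hs : 0 ≤ s) (δ : ℝ) :
    EComplete (C.norm (X := X) s p δ) := by
  intro u hu
  have hq : ENNReal.ofReal p ≠ 0 := (zero_lt_one.trans_le (one_le_ofReal hp)).ne'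
  have hb := isENorm_besselENorm (E := E) (X := X) (s := s) hp
  have hb' := isENorm_besselENorm (E := E') (X := X) (s := s) hp
  have huk : ∀ k, C.norm s p δ (u k) < ⊤ := fun k =>
    (ENNReal.le_tsum k).trans_lt (lt_top_iff_ne_top.2 hu)
  have hsum : ∀ i, ∑' k, besselENorm s p ((C.patch i).loc δ (u k)) ≠ ⊤ := fun i =>
    ((ENNReal.tsum_le_tsum fun k => C.besselENorm_loc_le δ (u k) i).trans_lt
      (lt_top_iff_ne_top.2 hu)).ne
  have hsum' : ∀ i, ∑' k, besselENorm s p ((C.patch' i).loc δ (u k)) ≠ ⊤ := fun i =>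
    ((ENNReal.tsum_le_tsum fun k => C.besselENorm_loc_le' δ (u k) i).trans_lt
      (lt_top_iff_ne_top.2 hu)).ne
  choose w hw using fun i => EComplete_besselENorm hp hs _ (hsum i)
  choose w' hw' using fun i => EComplete_besselENorm hp hs _ (hsum' i)
  set f : ℕ → M → X := fun K => ∑ k ∈ Finset.range K, u k with hf
  have hfN : ∀ K, C.norm s p δ (f K) < ⊤ := fun K =>
    ((C.isENorm_norm hp δ).sum_le _ _).trans_lt (ENNReal.sum_lt_top.2 fun k _ => huk k)
  have t := fun i => tendsto_eLpNorm_of_besselENorm hp hs (g := fun K => (C.patch i).loc δ (f K))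
    (fun K => (C.besselENorm_loc_le δ (f K) i).trans_lt (hfN K))
    (by simpa only [hf, map_sum] using hw i)
  have t' := fun i => tendsto_eLpNorm_of_besselENorm hp hs (g := fun K => (C.patch' i).loc δ (f K))
    (fun K => (C.besselENorm_loc_le' δ (f K) i).trans_lt (hfN K))
    (by simpa only [hf, map_sum] using hw' i)
  obtain ⟨r, hr, h1⟩ := exists_common_subseq Finset.univ hq (fun i => (t i).1) (fun i => (t i).2.1)
    (fun i => (t i).2.2) strictMono_id
  obtain ⟨r', hr', h1'⟩ := exists_common_subseq Finset.univ hq (fun i => (t' i).1)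
    (fun i => (t' i).2.1) (fun i => (t' i).2.2) hr
  set x : M → X := fun q => limUnder atTop fun k => f (r (r' k)) q with hx
  have e : ∀ i, (C.patch i).loc δ x =ᵐ[volume] w i := fun i =>
    (C.patch i).loc_limUnder_ae_eq δ (f := fun k => f (r (r' k))) (by
      filter_upwards [h1 i (Finset.mem_univ i)] with y hy using hy.comp hr'.tendsto_atTop)
  have e' : ∀ i, (C.patch' i).loc δ x =ᵐ[volume] w' i := fun i =>
    (C.patch' i).loc_limUnder_ae_eq δ (f := fun k => f (r (r' k))) (h1' i (Finset.mem_univ i))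
  have g1 : ∀ i, Tendsto (fun K => besselENorm s p ((C.patch i).loc δ (x - f K))) atTop (𝓝 0) :=
    fun i => (hw i).congr fun K => by
      refine besselENorm_congr_ae hp ?_
      rw [map_sub, hf, map_sum]
      exact (e i).symm.sub (ae_eq_refl _)
  have g2 : ∀ i, Tendsto (fun K => besselENorm s p ((C.patch' i).loc δ (x - f K))) atTop (𝓝 0) :=
    fun i => (hw' i).congr fun K => by
      refine besselENorm_congr_ae hp ?_
      rw [map_sub, hf, map_sum]
      exact (e' i).symm.sub (ae_eq_refl _)
  refine ⟨x, ?_⟩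
  have g3 := (tendsto_finsetSum Finset.univ fun i _ => g1 i).add
    (tendsto_finsetSum Finset.univ fun i _ => g2 i)
  simp only [Finset.sum_const_zero, add_zero] at g3
  exact g3

end PatchCover

end CoverNorm

/-! ### Patches from charts of manifolds with boundary. -/

section ChartPatch

variable {EM : Type*} [NormedAddCommGroup EM] [NormedSpace ℝ EM] {H : Type*} [TopologicalSpace H]
  {I : ModelWithCorners ℝ EM H} {M : Type*} [TopologicalSpace M] [ChartedSpace H M]
  {X : Type*} [NormedAddCommGroup X] [NormedSpace ℝ X]

/-- Charts of the maximal atlas are local diffeomorphisms, so being interior can be tested in any of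
them. -/
lemma isInteriorPoint_iff_of_mem_maximalAtlas [IsManifold I ∞ M] {e : OpenPartialHomeomorph M H}
    (he : e ∈ IsManifold.maximalAtlas I ∞ M) {x : M} (hx : x ∈ e.source) :
    I.IsInteriorPoint x ↔ e.extend I x ∈ interior (e.extend I).target := by
  have h1 : I.IsInteriorPoint x ↔ I.IsInteriorPoint (e x) :=
    IsLocalDiffeomorphAt.isInteriorPoint_iff (n := ∞) (by simp)
      ⟨{ toPartialEquiv := e.toPartialEquiv
         open_source := e.open_source
         open_target := e.open_target
         contMDiffOn_toFun := contMDiffOn_of_mem_maximalAtlas he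
         contMDiffOn_invFun := contMDiffOn_symm_of_mem_maximalAtlas he }, hx, fun _ _ => rfl⟩
  have h2 : I.IsInteriorPoint (e x) ↔ I (e x) ∈ interior (range I) := by
    rw [ModelWithCorners.IsInteriorPoint, extChartAt, chartAt_self_eq]
    rfl
  rw [h1, h2, e.extend_target, interior_inter,
    (e.open_target.preimage I.continuous_symm).interior_eq]
  simp [e.map_source hx]

/-- The patch of a chart of a localization, over the interior of the manifold. -/
def FiniteLocalization.patch [IsManifold I ∞ M] (L : FiniteLocalization I M) (i : Fin L.num)
    (w : M → ℝ) : Patch I M EM where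
  toPartialEquiv :=
    { toFun := ((L.chart i).extend I).symm
      invFun := (L.chart i).extend I
      source := interior ((L.chart i).extend I).target
      target := (L.chart i).source ∩ I.interior M
      map_source' := fun z hz => by
        have hz' := interior_subset hz
        have h1 := ((L.chart i).extend I).map_target hz'
        rw [(L.chart i).extend_source] at h1
        refine ⟨h1, (isInteriorPoint_iff_of_mem_maximalAtlas (L.chart_mem i) h1).2 ?_⟩
        rwa [((L.chart i).extend I).right_inv hz']
      map_target' := fun x hx =>
        (isInteriorPoint_iff_of_mem_maximalAtlas (L.chart_mem i) hx.1).1 hx.2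
      left_inv' := fun z hz => ((L.chart i).extend I).right_inv (interior_subset hz)
      right_inv' := fun x hx => (L.chart i).extend_left_inv hx.1 }
  isOpen_source := isOpen_interior
  isOpen_target := (L.chart i).open_source.inter (I.isOpen_interior (n := ∞) (by simp))
  contMDiffOn := (contMDiffOn_extend_symm (L.chart_mem i)).mono (by
    rw [← (L.chart i).extend_target']; exact interior_subset)
  contMDiffOn_symm := ((L.chart i).contMDiffOn_extend (L.chart_mem i)).mono inter_subset_left
  weight q := w q * L.weight i q
  density _ _ := 1
  density_pos _ _ := one_pos
  density_add _ _ _ := (mul_one 1).symm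
  contDiff_density _ := contDiff_const

/-- The patch sees only the interior of the chart target; the rest of the target lies over boundary
points, where `w` vanishes. -/
lemma FiniteLocalization.loc_patch [IsManifold I ∞ M] (L : FiniteLocalization I M) (i : Fin L.num)
    {w : M → ℝ} (hw : ∀ q ∉ I.interior M, w q = 0) (δ : ℝ) (u : M → X) :
    (L.patch i w).loc δ u = L.localize i fun q => w q • u q := by
  ext z
  rw [Patch.loc_apply, Patch.coeff, localize]
  change (interior ((L.chart i).extend I).target).indicator _ z • u (((L.chart i).extend I).symm z)
    = _
  by_cases hz : z ∈ interior ((L.chart i).extend I).target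
  · rw [indicator_of_mem hz, indicator_of_mem (interior_subset hz)]
    change (1 * (w (((L.chart i).extend I).symm z) * L.weight i (((L.chart i).extend I).symm z))) • _
      = _
    rw [one_mul, mul_comm, mul_smul]
  · rw [indicator_of_notMem hz, zero_smul]
    by_cases hz' : z ∈ ((L.chart i).extend I).target
    · rw [indicator_of_mem hz', hw, zero_smul, smul_zero]
      intro h
      have h1 := ((L.chart i).extend I).map_target hz'
      rw [(L.chart i).extend_source] at h1
      have h2 := (isInteriorPoint_iff_of_mem_maximalAtlas (L.chart_mem i) h1).1 h
      rw [((L.chart i).extend I).right_inv hz'] at h2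
      exact hz h2
    · rw [indicator_of_notMem hz']

end ChartPatch

/-! ### The collar and the patches of the conical end. -/

namespace ConicManifold

variable {n : ℕ}
  {Mt : Type*} [TopologicalSpace Mt] [ChartedSpace (EuclideanHalfSpace (n + 1)) Mt]
  [IsManifold (𝓡∂ (n + 1)) ∞ Mt]
  {B : Type*} [TopologicalSpace B] [ChartedSpace (EuclideanSpace ℝ (Fin n)) B]
  [IsManifold (𝓡 n) ∞ B]
  {X : Type*} [NormedAddCommGroup X] [NormedSpace ℝ X]

lemma collar_mem_interior (C : ConicManifold n Mt B) {x : ℝ} (h0 : 0 < x) (h1 : x ≤ 1) (y : B) :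
    C.collar (x, y) ∈ (𝓡∂ (n + 1)).interior Mt := by
  rw [← ModelWithCorners.compl_boundary, ← C.collar_boundary]
  rintro ⟨⟨x', y'⟩, ⟨hx' : x' = 0, -⟩, h⟩
  have := C.collar.injOn (x₁ := (x', y')) (x₂ := (x, y))
    (by rw [C.collar_source, hx']; exact ⟨⟨le_rfl, zero_le_one⟩, mem_univ _⟩)
    (by rw [C.collar_source]; exact ⟨⟨h0.le, h1⟩, mem_univ _⟩) h
  rw [Prod.mk.injEq] at this
  linarith [this.1]

lemma symm_collar (C : ConicManifold n Mt B) {x : ℝ} (hx : x ∈ Icc (0 : ℝ) 1) (y : B) :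
    C.collar.symm (C.collar (x, y)) = (x, y) :=
  C.collar.left_inv (by rw [C.collar_source]; exact ⟨hx, mem_univ _⟩)

lemma collar_mem_target (C : ConicManifold n Mt B) {x : ℝ} (hx : x ∈ Icc (0 : ℝ) 1) (y : B) :
    C.collar (x, y) ∈ C.collar.target :=
  C.collar.map_source (by rw [C.collar_source]; exact ⟨hx, mem_univ _⟩)

lemma collar_symm_mem (C : ConicManifold n Mt B) {q : Mt} (hq : q ∈ C.collar.target) :
    (C.collar.symm q).1 ∈ Icc (0 : ℝ) 1 := by
  have := C.collar.map_target hq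
  rw [C.collar_source] at this
  exact this.1

lemma cutoff_collar (C : ConicManifold n Mt B) (χ : ℝ → ℝ) {x : ℝ} (hx : x ∈ Icc (0 : ℝ) 1)
    (y : B) : C.cutoff χ (C.collar (x, y)) = χ x := by
  rw [cutoff, indicator_of_mem (C.collar_mem_target hx y), C.symm_collar hx]

/-- The points of the collar whose coordinates lie in a given set. -/
def collarSet (C : ConicManifold n Mt B) (s : Set ℝ) (t : Set B) : Set Mt :=
  {q ∈ C.collar.target | (C.collar.symm q).1 ∈ s ∧ (C.collar.symm q).2 ∈ t}

lemma isOpen_collarSet_Ico (C : ConicManifold n Mt B) : IsOpen (C.collarSet (Ico 0 1) univ) := by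
  convert! C.collar_isOpen using 1
  ext q
  refine ⟨fun h => ⟨C.collar.symm q, ⟨h.2.1, mem_univ _⟩, C.collar.right_inv h.1⟩, ?_⟩
  rintro ⟨⟨x, y⟩, ⟨hx, -⟩, rfl⟩
  have hx' : x ∈ Icc (0 : ℝ) 1 := ⟨hx.1, hx.2.le⟩
  refine ⟨C.collar_mem_target hx' y, ?_, mem_univ _⟩
  rw [C.symm_collar hx']
  exact hx

lemma isOpen_collarSet (C : ConicManifold n Mt B) {s : Set ℝ} {t : Set B} (hs : IsOpen s)
    (ht : IsOpen t) : IsOpen (C.collarSet (Ico 0 1 ∩ s) t) := by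
  have h := (C.collar_symm_smooth.continuousOn.mono fun q hq => hq.1).isOpen_inter_preimage
    C.isOpen_collarSet_Ico (hs.prod ht)
  convert! h using 1
  ext q
  exact ⟨fun h => ⟨⟨h.1, h.2.1.1, mem_univ _⟩, h.2.1.2, h.2.2⟩,
    fun h => ⟨h.1.1, ⟨h.1.2.1, h.2.1⟩, h.2.2⟩⟩

lemma isCompact_collarSet (C : ConicManifold n Mt B) {s : Set ℝ} {t : Set B} (hs : IsCompact s)
    (hs' : s ⊆ Icc 0 1) (ht : IsCompact t) : IsCompact (C.collarSet s t) := by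
  have h := (hs.prod ht).image_of_continuousOn (C.collar_smooth.continuousOn.mono fun z hz => by
    rw [C.collar_source]; exact ⟨hs' hz.1, mem_univ _⟩)
  convert! h using 1
  ext q
  refine ⟨fun h => ⟨C.collar.symm q, h.2, C.collar.right_inv h.1⟩, ?_⟩
  rintro ⟨⟨x, y⟩, hxy, rfl⟩
  refine ⟨C.collar_mem_target (hs' hxy.1) y, ?_⟩
  rw [C.symm_collar (hs' hxy.1)]
  exact hxy

/-- The patch of a conical end, with the parameters `(t, z)`, where `x = exp (-t)`. -/
def conePatch (C : ConicManifold n Mt B) (χ : ℝ → ℝ)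
    (P : Patch (𝓡 n) B (EuclideanSpace ℝ (Fin n))) :
    Patch (𝓡∂ (n + 1)) Mt (ℝ × EuclideanSpace ℝ (Fin n)) where
  toPartialEquiv :=
    { toFun := fun p => C.collar (Real.exp (-p.1), P.toPartialEquiv p.2)
      invFun := fun q => (-Real.log (C.collar.symm q).1, P.toPartialEquiv.symm (C.collar.symm q).2)
      source := Ioi 0 ×ˢ P.toPartialEquiv.source
      target := C.collarSet (Ico 0 1 ∩ Ioi 0) P.toPartialEquiv.target
      map_source' := fun p hp => by
        have h1 : Real.exp (-p.1) < 1 := Real.exp_lt_one_iff.2 (neg_lt_zero.2 hp.1)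
        have hx : Real.exp (-p.1) ∈ Icc (0 : ℝ) 1 := ⟨(Real.exp_pos _).le, h1.le⟩
        refine ⟨C.collar_mem_target hx _, ?_⟩
        rw [C.symm_collar hx]
        exact ⟨⟨⟨hx.1, h1⟩, Real.exp_pos _⟩, P.toPartialEquiv.map_source hp.2⟩
      map_target' := fun q hq =>
        ⟨neg_pos.2 (Real.log_neg hq.2.1.2 hq.2.1.1.2), P.toPartialEquiv.map_target hq.2.2⟩
      left_inv' := fun p hp => by
        have h1 : Real.exp (-p.1) < 1 := Real.exp_lt_one_iff.2 (neg_lt_zero.2 hp.1)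
        rw [C.symm_collar ⟨(Real.exp_pos _).le, h1.le⟩]
        simp [P.toPartialEquiv.left_inv hp.2]
      right_inv' := fun q hq => by
        rw [neg_neg, Real.exp_log hq.2.1.2, P.toPartialEquiv.right_inv hq.2.2]
        exact C.collar.right_inv hq.1 }
  isOpen_source := isOpen_Ioi.prod P.isOpen_source
  isOpen_target := C.isOpen_collarSet isOpen_Ioi P.isOpen_target
  contMDiffOn := by
    refine C.collar_smooth.comp (ContMDiffOn.prodMk ?_ ?_) fun p hp => ?_
    · exact ((Real.contDiff_exp.comp contDiff_neg).comp contDiff_fst).contMDiff.contMDiffOn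
    · exact P.contMDiffOn.comp contDiff_snd.contMDiff.contMDiffOn fun p hp => hp.2
    · rw [C.collar_source]
      exact ⟨⟨(Real.exp_pos _).le, (Real.exp_lt_one_iff.2 (neg_lt_zero.2 hp.1)).le⟩, mem_univ _⟩
  contMDiffOn_symm := by
    have h : ContMDiffOn (𝓡∂ (n + 1)) (𝓘(ℝ, ℝ).prod (𝓡 n)) ∞ C.collar.symm
        (C.collarSet (Ico 0 1 ∩ Ioi 0) P.toPartialEquiv.target) :=
      C.collar_symm_smooth.mono fun q hq => hq.1
    refine ContMDiffOn.prodMk_space ?_ ?_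
    · have h1 : ContDiffOn ℝ ∞ (fun x : ℝ => -Real.log x) (Ioi 0) :=
        (Real.contDiffOn_log.mono fun x hx => (ne_of_gt hx : x ≠ 0)).neg
      exact h1.contMDiffOn.comp (contMDiff_fst.comp_contMDiffOn h) fun q hq => hq.2.1.2
    · exact P.contMDiffOn_symm.comp (contMDiff_snd.comp_contMDiffOn h) fun q hq => hq.2.2
  weight q := C.cutoff χ q * P.weight (C.collar.symm q).2
  density δ p := Real.exp (δ * p.1)
  density_pos _ _ := Real.exp_pos _
  density_add δ δ' p := by rw [add_mul, Real.exp_add]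
  contDiff_density δ := Real.contDiff_exp.comp (contDiff_const.mul contDiff_fst)

/-- The coefficient splits into a factor in t, the same for all cone patches, and a factor in z. A
transition therefore acts on z alone. -/
lemma coeff_conePatch (C : ConicManifold n Mt B) (χ : ℝ → ℝ)
    (P : Patch (𝓡 n) B (EuclideanSpace ℝ (Fin n))) (hP : ∀ x, P.density 0 x = 1) (δ t : ℝ)
    (z : EuclideanSpace ℝ (Fin n)) :
    (C.conePatch χ P).coeff δ (t, z) =
      (Ioi 0).indicator (fun t => Real.exp (δ * t) * χ (Real.exp (-t))) t * P.coeff 0 z := by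
  rw [Patch.coeff, Patch.coeff]
  change (Ioi 0 ×ˢ P.toPartialEquiv.source).indicator _ _ = _
  by_cases ht : t ∈ Ioi (0 : ℝ)
  · by_cases hz : z ∈ P.toPartialEquiv.source
    · have hx : Real.exp (-t) ∈ Icc (0 : ℝ) 1 :=
        ⟨(Real.exp_pos _).le, (Real.exp_lt_one_iff.2 (neg_lt_zero.2 ht)).le⟩
      rw [indicator_of_mem (show (t, z) ∈ Ioi (0 : ℝ) ×ˢ P.toPartialEquiv.source from ⟨ht, hz⟩), indicator_of_mem ht,
        indicator_of_mem hz, hP, one_mul]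
      change Real.exp (δ * t) * (C.cutoff χ (C.collar (Real.exp (-t), P.toPartialEquiv z)) *
        P.weight (C.collar.symm (C.collar (Real.exp (-t), P.toPartialEquiv z))).2) = _
      rw [C.symm_collar hx, C.cutoff_collar χ hx, mul_assoc]
    · rw [indicator_of_notMem fun h => hz h.2, indicator_of_notMem hz, mul_zero]
  · rw [indicator_of_notMem fun h => ht h.1, indicator_of_notMem ht, zero_mul]

/-- The end is unbounded in t, so compactness is of no direct use. The transition on B, taken with δ
= 0, is extended by the identity in t instead. -/
lemma conePatch_transition (C : ConicManifold n Mt B) (χ : ℝ → ℝ)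
    {P Q : Patch (𝓡 n) B (EuclideanSpace ℝ (Fin n))} (hP : ∀ x, P.density 0 x = 1)
    (hQ : ∀ x, Q.density 0 x = 1) (h : P.Transition Q) :
    (C.conePatch χ P).Transition (C.conePatch χ Q) := by
  intro δ
  obtain ⟨A, τ, hAτ, hA⟩ := h 0
  refine ⟨fun p => A p.2, fun p => (p.1, τ p.2), hAτ.prod, ?_⟩
  rintro ⟨t, z⟩ ⟨⟨ht, hz⟩, hw⟩
  have hx : Real.exp (-t) ∈ Icc (0 : ℝ) 1 :=
    ⟨(Real.exp_pos _).le, (Real.exp_lt_one_iff.2 (neg_lt_zero.2 ht)).le⟩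
  have hz' : z ∈ P.carrier := by
    refine ⟨hz, fun h0 => hw ?_⟩
    change _ * P.weight (C.collar.symm (C.collar (Real.exp (-t), P.toPartialEquiv z))).2 = 0
    rw [C.symm_collar hx, h0, mul_zero]
  obtain ⟨h1, h2⟩ := hA z hz'
  rw [hP, one_mul] at h1
  change A z * (C.conePatch χ Q).coeff δ (t, τ z) = Real.exp (δ * t) *
      (C.cutoff χ (C.collar (Real.exp (-t), P.toPartialEquiv z)) *
        Q.weight (C.collar.symm (C.collar (Real.exp (-t), P.toPartialEquiv z))).2) ∧
    (A z * (C.conePatch χ Q).coeff δ (t, τ z) ≠ 0 →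
      C.collar (Real.exp (-t), Q.toPartialEquiv (τ z)) =
        C.collar (Real.exp (-t), P.toPartialEquiv z))
  rw [coeff_conePatch C χ Q hQ, C.symm_collar hx, C.cutoff_collar χ hx, indicator_of_mem ht,
    mul_left_comm, h1, mul_assoc]
  exact ⟨rfl, fun h3 => by rw [h2 (by rw [h1]; exact fun h4 => h3 (by simp [h4]))]⟩

end ConicManifold

/-! ### The cover of a conic manifold and its norm. -/

namespace ConicManifold

variable {n : ℕ}
  {Mt : Type*} [TopologicalSpace Mt] [ChartedSpace (EuclideanHalfSpace (n + 1)) Mt]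
  [IsManifold (𝓡∂ (n + 1)) ∞ Mt]
  {B : Type*} [TopologicalSpace B] [ChartedSpace (EuclideanSpace ℝ (Fin n)) B]
  [IsManifold (𝓡 n) ∞ B]
  {X : Type*} [NormedAddCommGroup X] [NormedSpace ℝ X] {χ : ℝ → ℝ}

lemma cutoff_eq_one_of_notMem_interior (C : ConicManifold n Mt B) (hχ : IsConeCutoff χ) {q : Mt}
    (hq : q ∉ (𝓡∂ (n + 1)).interior Mt) : C.cutoff χ q = 1 := by
  rw [← mem_compl_iff, ModelWithCorners.compl_interior, ← C.collar_boundary] at hq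
  obtain ⟨⟨x, y⟩, ⟨hx : x = 0, -⟩, rfl⟩ := hq
  subst hx
  rw [C.cutoff_collar χ ⟨le_rfl, zero_le_one⟩, hχ.eq_one.self_of_nhds, Pi.one_apply]

/-- The cut-off function is one on an open neighbourhood of the boundary, and it vanishes outside
a smaller collar. -/
lemma exists_cutoff_bounds (C : ConicManifold n Mt B) (hχ : IsConeCutoff χ) : ∃ ε > (0 : ℝ),
    ∃ r < (1 : ℝ), (∀ x, |x| < ε → χ x = 1) ∧ (∀ x, r < x → χ x = 0) ∧
      (∀ q ∉ (𝓡∂ (n + 1)).interior Mt, q ∈ C.collarSet (Ico 0 1 ∩ Iio ε) univ) ∧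
      (∀ q ∈ C.collarSet (Ico 0 1 ∩ Iio ε) univ, C.cutoff χ q = 1) ∧
      (∀ q, C.cutoff χ q ≠ 0 → q ∈ C.collarSet (Icc 0 r) univ) := by
  obtain ⟨ε, hε, h1⟩ := Metric.eventually_nhds_iff.1 hχ.eq_one
  obtain ⟨r, hr, h0⟩ := hχ.eq_zero
  refine ⟨ε, hε, r, hr, fun x hx => h1 (by simpa using hx), fun x hx => h0 x hx.le, fun q hq => ?_,
    fun q hq => ?_, fun q hq => ?_⟩
  · rw [← mem_compl_iff, ModelWithCorners.compl_interior, ← C.collar_boundary] at hq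
    obtain ⟨⟨x, y⟩, ⟨hx : x = 0, -⟩, rfl⟩ := hq
    subst hx
    refine ⟨C.collar_mem_target ⟨le_rfl, zero_le_one⟩ y, ?_⟩
    rw [C.symm_collar ⟨le_rfl, zero_le_one⟩]
    exact ⟨⟨⟨le_rfl, zero_lt_one⟩, hε⟩, mem_univ _⟩
  · rw [cutoff, indicator_of_mem hq.1]
    refine h1 ?_
    rw [Real.dist_eq, sub_zero, abs_of_nonneg hq.2.1.1.1]
    exact hq.2.1.2
  · have hq' := mem_of_indicator_ne_zero hq
    refine ⟨hq', ⟨(C.collar_symm_mem hq').1, ?_⟩, mem_univ _⟩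
    by_contra! h
    rw [cutoff, indicator_of_mem hq'] at hq
    exact hq (h0 _ h.le)

/-- Separates the density, the only place where δ enters, from the cut-off part; this is the form
compared with `conePart`. -/
lemma loc_conePatch (C : ConicManifold n Mt B) (χ : ℝ → ℝ) (LB : FiniteLocalization (𝓡 n) B)
    (i : Fin LB.num) (δ t : ℝ) (z : EuclideanSpace ℝ (Fin n)) (u : Mt → X) :
    (C.conePatch χ (LB.patch i fun _ => 1)).loc δ u (t, z) =
      (Ioi 0).indicator (fun t => Real.exp (δ * t)) t •
        LB.localize i (fun y => χ (Real.exp (-t)) • u (C.collar (Real.exp (-t), y))) z := by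
  have hb := congrFun (LB.loc_patch i (w := fun _ => 1) (by simp [ModelWithCorners.interior_eq_univ])
    0 fun y => χ (Real.exp (-t)) • u (C.collar (Real.exp (-t), y))) z
  simp only [one_smul] at hb
  rw [← hb, Patch.loc_apply, Patch.loc_apply, C.coeff_conePatch χ _ fun _ => rfl]
  change _ • u (C.collar (Real.exp (-t), ((LB.chart i).extend (𝓡 n)).symm z)) =
    _ • _ • χ (Real.exp (-t)) • u (C.collar (Real.exp (-t), ((LB.chart i).extend (𝓡 n)).symm z))
  by_cases ht : t ∈ Ioi (0 : ℝ)
  · rw [indicator_of_mem ht, indicator_of_mem ht, smul_smul, smul_smul]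
    congr 1
    ring
  · rw [indicator_of_notMem ht, indicator_of_notMem ht, zero_mul, zero_smul, zero_smul]

variable [CompactSpace Mt] [T2Space Mt] [CompactSpace B] [T2Space B]

/-- Compact sets which contain the supports of the weights. -/
lemma exists_isCompact_supports (C : ConicManifold n Mt B) (hχ : IsConeCutoff χ)
    (LB : FiniteLocalization (𝓡 n) B) (LM : FiniteLocalization (𝓡∂ (n + 1)) Mt) :
    ∃ (S : Fin LB.num → Set Mt) (T : Fin LM.num → Set Mt),
      (∀ i, IsCompact (S i)) ∧ (∀ j, IsCompact (T j)) ∧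
      (∀ i q, (C.conePatch χ (LB.patch i fun _ => 1)).weight q ≠ 0 → q ∈ S i) ∧
      (∀ j q, (LM.patch j fun q => 1 - C.cutoff χ q).weight q ≠ 0 → q ∈ T j) ∧
      (∀ j, T j ⊆ (LM.patch j fun q => 1 - C.cutoff χ q).toPartialEquiv.target) ∧
      ∀ i j, S i ∩ T j ⊆ (C.conePatch χ (LB.patch i fun _ => 1)).toPartialEquiv.target := by
  obtain ⟨ε, hε, r, hr, -, -, hb, h1, h0⟩ := C.exists_cutoff_bounds hχ
  refine ⟨fun i => C.collarSet (Icc 0 r) (tsupport (LB.weight i)),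
    fun j => tsupport (LM.weight j) ∩ (C.collarSet (Ico 0 1 ∩ Iio ε) univ)ᶜ,
    fun i => C.isCompact_collarSet isCompact_Icc (Icc_subset_Icc_right hr.le)
      (isClosed_tsupport _).isCompact,
    fun j => ((isClosed_tsupport _).inter
      (C.isOpen_collarSet isOpen_Iio isOpen_univ).isClosed_compl).isCompact,
    fun i q hq => ?_, fun j q hq => ?_, fun j q hq => ?_, fun i j q hq => ?_⟩
  · have h2 := h0 q (left_ne_zero_of_mul hq)
    exact ⟨h2.1, h2.2.1, subset_tsupport _ (right_ne_zero_of_mul (right_ne_zero_of_mul hq))⟩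
  · refine ⟨subset_tsupport _ (right_ne_zero_of_mul hq), fun h => left_ne_zero_of_mul hq ?_⟩
    exact sub_eq_zero.2 (h1 q h).symm
  · exact ⟨LM.weight_tsupport j hq.1, by_contra fun h => hq.2 (hb q h)⟩
  · obtain ⟨⟨hc, hx, hy⟩, hq1, hq2⟩ := hq
    have hx0 : (C.collar.symm q).1 ∈ Ico (0 : ℝ) 1 := ⟨hx.1, hx.2.trans_lt hr⟩
    have hxε : ε ≤ (C.collar.symm q).1 := by
      by_contra! h
      exact hq2 ⟨hc, ⟨hx0, h⟩, mem_univ _⟩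
    have hu : (C.collar.symm q).2 ∈ (𝓡 n).interior B := by
      rw [ModelWithCorners.interior_eq_univ]
      exact mem_univ _
    exact ⟨hc, ⟨hx0, hε.trans_le hxε⟩, LB.weight_tsupport i hy, hu⟩

/-- The patches of a conic manifold. -/
def cover (C : ConicManifold n Mt B) (hχ : IsConeCutoff χ) (LB : FiniteLocalization (𝓡 n) B)
    (LM : FiniteLocalization (𝓡∂ (n + 1)) Mt) :
    PatchCover (𝓡∂ (n + 1)) Mt (ℝ × EuclideanSpace ℝ (Fin n)) (EuclideanSpace ℝ (Fin (n + 1))) where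
  num := LB.num
  num' := LM.num
  patch i := C.conePatch χ (LB.patch i fun _ => 1)
  patch' i := LM.patch i fun q => 1 - C.cutoff χ q
  sum_weight q := by
    change ∑ i, C.cutoff χ q * (1 * LB.weight i (C.collar.symm q).2) +
      ∑ i, (1 - C.cutoff χ q) * LM.weight i q = 1
    rw [← Finset.mul_sum, ← Finset.mul_sum, ← Finset.mul_sum, LB.weight_sum, LM.weight_sum]
    ring
  -- Two cone patches overlap along the whole end; compactness is needed on B only. In the other
  -- three cases a factor 1 - χ keeps the supports away from the boundary.
  transition i j := by
    refine C.conePatch_transition χ (fun _ => rfl) (fun _ => rfl) ?_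
    have hm : ∀ l, ∀ q, (LB.patch l fun _ => 1).weight q ≠ 0 → q ∈ tsupport (LB.weight l) :=
      fun l q hq => subset_tsupport _ (right_ne_zero_of_mul hq)
    refine Patch.transition_of_isCompact _ _ (isClosed_tsupport _).isCompact (isClosed_tsupport _)
      (hm i) (hm j) fun q hq => ?_
    have hu : q ∈ (𝓡 n).interior B := by
      rw [ModelWithCorners.interior_eq_univ]
      exact mem_univ q
    exact ⟨⟨LB.weight_tsupport i hq.1, hu⟩, ⟨LB.weight_tsupport j hq.2, hu⟩⟩
  transition_left i j := by
    obtain ⟨S, T, hS, hT, hcS, hcT, hTt, hST⟩ := C.exists_isCompact_supports hχ LB LM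
    exact Patch.transition_of_isCompact _ _ (hS i) (hT j).isClosed (hcS i) (hcT j)
      fun q hq => ⟨hST i j hq, hTt j hq.2⟩
  transition_right j i := by
    obtain ⟨S, T, hS, hT, hcS, hcT, hTt, hST⟩ := C.exists_isCompact_supports hχ LB LM
    exact Patch.transition_of_isCompact _ _ (hT j) (hS i).isClosed (hcT j) (hcS i)
      fun q hq => ⟨hTt j hq.1, hST i j hq.symm⟩
  transition' i j := by
    obtain ⟨S, T, hS, hT, hcS, hcT, hTt, hST⟩ := C.exists_isCompact_supports hχ LB LM
    exact Patch.transition_of_isCompact _ _ (hT i) (hT j).isClosed (hcT i) (hcT j)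
      fun q hq => ⟨hTt i hq.1, hTt j hq.2⟩

/-- After the shift of γ by (n+1)/2 the weight becomes the exponent of a density, and exponents add
under products. -/
lemma mellinENorm_eq (C : ConicManifold n Mt B) (hχ : IsConeCutoff χ)
    (LB : FiniteLocalization (𝓡 n) B) (LM : FiniteLocalization (𝓡∂ (n + 1)) Mt) (s γ p : ℝ)
    (u : Mt → X) : C.mellinENorm χ LB LM s γ p u =
      (C.cover hχ LB LM).norm s p (γ - ((n : ℝ) + 1) / 2) u := by
  refine congrArg₂ (· + ·) (Finset.sum_congr rfl fun i _ => congrArg _ ?_)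
    (Finset.sum_congr rfl fun i _ => congrArg _ ?_)
  · ext ⟨t, z⟩
    change LB.localize i (C.conePart χ γ u t) z =
      (C.conePatch χ (LB.patch i fun _ => 1)).loc (γ - ((n : ℝ) + 1) / 2) u (t, z)
    rw [C.loc_conePatch]
    by_cases ht : t ∈ Ioi (0 : ℝ)
    · rw [indicator_of_mem ht, FiniteLocalization.localize, FiniteLocalization.localize,
        ← indicator_const_smul_apply]
      refine congrFun (congrArg _ (funext fun z => ?_)) z
      rw [conePart, if_pos (mem_Ioi.1 ht), smul_comm]
    · rw [indicator_of_notMem ht, zero_smul]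
      simp [conePart, if_neg (show ¬0 < t from ht), FiniteLocalization.localize]
  · change LM.localize i (C.regularPart χ u) = (LM.patch i fun q => 1 - C.cutoff χ q).loc _ u
    rw [LM.loc_patch i fun q hq => by rw [C.cutoff_eq_one_of_notMem_interior hχ hq, sub_self]]
    rfl

end ConicManifold

/-! ### The change of variables x = e^{-t}. -/

section ConeCalculus

variable {Y : Type*} [NormedAddCommGroup Y] [NormedSpace ℝ Y]

lemma contDiffAt_exp_smul_comp {j : ℕ} (a : ℝ) {g : ℝ → Y} (hg : ContDiffOn ℝ j g (Ioo 0 1)) {t : ℝ}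
    (ht : 0 < t) : ContDiffAt ℝ j (fun t => Real.exp (-(a * t)) • g (Real.exp (-t))) t := by
  have hx : Real.exp (-t) ∈ Ioo (0 : ℝ) 1 :=
    ⟨Real.exp_pos _, Real.exp_lt_one_iff.2 (neg_lt_zero.2 ht)⟩
  have h1 : ContDiffAt ℝ j g (Real.exp (-t)) := hg.contDiffAt (isOpen_Ioo.mem_nhds hx)
  have h2 : ContDiff ℝ j fun t : ℝ => Real.exp (-t) := Real.contDiff_exp.comp contDiff_neg
  have h3 : ContDiff ℝ j fun t : ℝ => Real.exp (-(a * t)) :=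
    Real.contDiff_exp.comp (contDiff_const.mul contDiff_id).neg
  exact h3.contDiffAt.smul (h1.comp t h2.contDiffAt)

/-- Derivatives under the change of variables `x = exp (-t)`. -/
lemma exists_bound_iteratedDeriv_exp_smul_comp (j : ℕ) : ∀ a : ℝ, ∃ K : ℝ, 0 ≤ K ∧
    ∀ (g : ℝ → Y) (N : ℝ), ContDiffOn ℝ j g (Ioo 0 1) →
      (∀ l ≤ j, ∀ x ∈ Ioo (0 : ℝ) 1, ‖iteratedDeriv l g x‖ ≤ N) → ∀ t > (0 : ℝ),
      Real.exp (a * t) * ‖iteratedDeriv j (fun t => Real.exp (-(a * t)) • g (Real.exp (-t))) t‖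
        ≤ K * N := by
  induction j with
  | zero =>
    refine fun a => ⟨1, zero_le_one, fun g N _ hN t ht => ?_⟩
    have hx : Real.exp (-t) ∈ Ioo (0 : ℝ) 1 :=
      ⟨Real.exp_pos _, Real.exp_lt_one_iff.2 (neg_lt_zero.2 ht)⟩
    have h1 := hN 0 le_rfl _ hx
    rw [iteratedDeriv_zero] at h1 ⊢
    rwa [norm_smul, Real.norm_of_nonneg (Real.exp_pos _).le, ← mul_assoc, ← Real.exp_add,
      add_neg_cancel, Real.exp_zero, one_mul, one_mul]
  | succ j ih =>
    intro a
    obtain ⟨K₁, h₁, H₁⟩ := ih a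
    obtain ⟨K₂, h₂, H₂⟩ := ih (a + 1)
    refine ⟨|a| * K₁ + K₂, by positivity, fun g N hg hN t ht => ?_⟩
    have hg1 : ContDiffOn ℝ j g (Ioo 0 1) := hg.of_le (by exact_mod_cast j.le_succ)
    have hg2 : ContDiffOn ℝ j (deriv g) (Ioo 0 1) := by
      have := (contDiffOn_succ_iff_deriv_of_isOpen (n := j) isOpen_Ioo).1 (by exact_mod_cast hg)
      exact this.2.2
    have hN0 : 0 ≤ N := (norm_nonneg _).trans (hN 0 (Nat.zero_le _) (1 / 2) (by norm_num))
    have B₁ := H₁ g N hg1 (fun l hl => hN l (by omega)) t ht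
    have B₂ := H₂ (deriv g) N hg2 (fun l hl x hx => by
      rw [← iteratedDeriv_succ']; exact hN _ (by omega) x hx) t ht
    have C₁ := contDiffAt_exp_smul_comp a hg1 ht
    have C₂ := contDiffAt_exp_smul_comp (a + 1) hg2 ht
    -- Differentiating e^{-at} g(e^{-t}) gives -a times itself minus the same expression for a + 1
    -- and g'. So the induction needs all exponents at once.
    have e : deriv (fun t => Real.exp (-(a * t)) • g (Real.exp (-t))) =ᶠ[𝓝 t]
        ((-a) • fun t => Real.exp (-(a * t)) • g (Real.exp (-t))) -
          fun t => Real.exp (-((a + 1) * t)) • deriv g (Real.exp (-t)) := by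
      filter_upwards [Ioi_mem_nhds ht] with r hr
      have hx : Real.exp (-r) ∈ Ioo (0 : ℝ) 1 :=
        ⟨Real.exp_pos _, Real.exp_lt_one_iff.2 (neg_lt_zero.2 hr)⟩
      have d1 : HasDerivAt g (deriv g (Real.exp (-r))) (Real.exp (-r)) :=
        ((hg.contDiffAt (isOpen_Ioo.mem_nhds hx)).differentiableAt
          (by simp)).hasDerivAt
      have d2 : HasDerivAt (fun r : ℝ => Real.exp (-r)) (Real.exp (-r) * (-1)) r :=
        (hasDerivAt_id r).neg.exp
      have d3 : HasDerivAt (fun r : ℝ => Real.exp (-(a * r))) (Real.exp (-(a * r)) * (-(a * 1))) r :=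
        ((hasDerivAt_id r).const_mul a).neg.exp
      have d4 := (d3.smul (d1.scomp r d2)).deriv
      refine d4.trans ?_
      change _ = (-a) • Real.exp (-(a * r)) • g (Real.exp (-r)) -
        Real.exp (-((a + 1) * r)) • deriv g (Real.exp (-r))
      have e1 : Real.exp (-((a + 1) * r)) = Real.exp (-(a * r)) * Real.exp (-r) := by
        rw [← Real.exp_add]; congr 1; ring
      rw [e1]
      simp only [smul_smul, Function.comp_apply]
      module
    have C₃ : ContDiffAt ℝ j ((-a) • fun t => Real.exp (-(a * t)) • g (Real.exp (-t))) t :=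
      C₁.const_smul (-a)
    rw [iteratedDeriv_succ', e.iteratedDeriv_eq, iteratedDeriv_sub C₃ C₂,
      iteratedDeriv_const_smul C₁]
    -- For t > 0 the stronger weight of the second term dominates.
    have hle : Real.exp (a * t) ≤ Real.exp ((a + 1) * t) := Real.exp_le_exp.2 (by linarith)
    calc _ ≤ Real.exp (a * t) * (|a| * ‖iteratedDeriv j
            (fun t => Real.exp (-(a * t)) • g (Real.exp (-t))) t‖ + ‖iteratedDeriv j
            (fun t => Real.exp (-((a + 1) * t)) • deriv g (Real.exp (-t))) t‖) := by
          refine mul_le_mul_of_nonneg_left ((norm_sub_le _ _).trans ?_) (Real.exp_pos _).le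
          rw [norm_smul, norm_neg, Real.norm_eq_abs]
      _ = |a| * (Real.exp (a * t) * ‖iteratedDeriv j
            (fun t => Real.exp (-(a * t)) • g (Real.exp (-t))) t‖) + Real.exp (a * t) *
            ‖iteratedDeriv j (fun t => Real.exp (-((a + 1) * t)) • deriv g (Real.exp (-t))) t‖ := by
          ring
      _ ≤ |a| * (K₁ * N) + K₂ * N := by
          refine add_le_add (mul_le_mul_of_nonneg_left B₁ (abs_nonneg a)) (le_trans ?_ B₂)
          exact mul_le_mul_of_nonneg_right hle (norm_nonneg _)
      _ = _ := by ring

end ConeCalculus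

/-! ### Mixed partial derivatives on a product with the line. -/

section PartialDerivatives

variable {E : Type} [NormedAddCommGroup E] [NormedSpace ℝ E]

/-- The derivative in the first variable. -/
def derivFst {Y : Type*} [NormedAddCommGroup Y] [NormedSpace ℝ Y] (F : ℝ × E → Y) (x : ℝ × E) : Y :=
  fderiv ℝ F x (1, 0)

/-- The derivative in the second variable. -/
def fderivSnd {Y : Type*} [NormedAddCommGroup Y] [NormedSpace ℝ Y] (F : ℝ × E → Y) (x : ℝ × E) :
    E →L[ℝ] Y :=
  (fderiv ℝ F x).comp (ContinuousLinearMap.inr ℝ ℝ E)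

universe v
variable {Y : Type v} [NormedAddCommGroup Y] [NormedSpace ℝ Y] {F : ℝ × E → Y}

lemma ContDiff.derivFst {j : ℕ} (hF : ContDiff ℝ (j + 1) F) : ContDiff ℝ j (derivFst F) :=
  (hF.fderiv_right le_rfl).clm_apply contDiff_const

lemma ContDiff.fderivSnd {j : ℕ} (hF : ContDiff ℝ (j + 1) F) : ContDiff ℝ j (fderivSnd F) :=
  (hF.fderiv_right le_rfl).clm_comp contDiff_const

lemma hasDerivAt_fst (hF : Differentiable ℝ F) (t : ℝ) (z : E) :
    HasDerivAt (fun t => F (t, z)) (derivFst F (t, z)) t :=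
  (hF (t, z)).hasFDerivAt.comp_hasDerivAt t ((hasDerivAt_id t).prodMk (hasDerivAt_const t z))

lemma fderiv_snd_eq (hF : Differentiable ℝ F) (t : ℝ) (z : E) :
    fderiv ℝ (fun z => F (t, z)) z = fderivSnd F (t, z) :=
  ((hF (t, z)).hasFDerivAt.comp z ((hasFDerivAt_const t z).prodMk (hasFDerivAt_id z))).fderiv.trans
    (by ext; simp [fderivSnd])

lemma derivFst_fderivSnd (hF : ContDiff ℝ 2 F) : derivFst (fderivSnd F) = fderivSnd (derivFst F) := by
  have hd : Differentiable ℝ (fderiv ℝ F) := (hF.fderiv_right (m := 1) le_rfl).differentiable (by simp)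
  ext x y
  have h1 : fderiv ℝ (fderivSnd F) x = _ :=
    ((hd x).hasFDerivAt.clm_comp (hasFDerivAt_const (ContinuousLinearMap.inr ℝ ℝ E) x)).fderiv
  have h2 : fderiv ℝ (derivFst F) x = _ :=
    ((hd x).hasFDerivAt.clm_apply (hasFDerivAt_const ((1, 0) : ℝ × E) x)).fderiv
  rw [derivFst, fderivSnd, h1, h2]
  have h3 := (hF.contDiffAt (x := x)).isSymmSndFDerivAt (by simp)
  simpa using h3 (1, 0) (0, y)

lemma iteratedFDeriv_snd_succ {m : ℕ} (hF : Differentiable ℝ F) (t : ℝ) (z : E) :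
    iteratedFDeriv ℝ (m + 1) (fun z => F (t, z)) z =
      (continuousMultilinearCurryRightEquiv' ℝ m E Y).symm
        (iteratedFDeriv ℝ m (fun z => fderivSnd F (t, z)) z) := by
  rw [iteratedFDeriv_succ_eq_comp_right, Function.comp_apply]
  simp only [fderiv_snd_eq hF]

/-- One derivative in the second variable is peeled off at a time and exchanged with the first by
symmetry. It takes values in a new space, so the induction ranges over all target spaces. -/
lemma hasDerivAt_iteratedFDeriv_snd (m : ℕ) : ∀ {Y : Type v} [NormedAddCommGroup Y]
    [NormedSpace ℝ Y] {F : ℝ × E → Y}, ContDiff ℝ (m + 1) F → ∀ (t : ℝ) (z : E),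
    HasDerivAt (fun t => iteratedFDeriv ℝ m (fun z => F (t, z)) z)
      (iteratedFDeriv ℝ m (fun z => derivFst F (t, z)) z) t := by
  induction m with
  | zero =>
    intro Y _ _ F hF t z
    simp only [iteratedFDeriv_zero_eq_comp, Function.comp_apply]
    exact (continuousMultilinearCurryFin0 ℝ E Y).symm.toContinuousLinearEquiv.hasFDerivAt
      |>.comp_hasDerivAt t (hasDerivAt_fst (hF.differentiable (by simp)) t z)
  | succ m ih =>
    intro Y _ _ F hF t z
    have h2 : ContDiff ℝ 2 F := hF.of_le (by
      have : 2 ≤ m + 1 + 1 := by omega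
      exact_mod_cast this)
    have hF' : ContDiff ℝ ((m + 1 : ℕ) + 1) F := hF
    have h1 := ih hF'.fderivSnd t z
    rw [derivFst_fderivSnd h2] at h1
    simp only [iteratedFDeriv_snd_succ (hF.differentiable (by simp)),
      iteratedFDeriv_snd_succ (hF'.derivFst.differentiable (by simp))]
    exact (continuousMultilinearCurryRightEquiv' ℝ m E Y).symm.toContinuousLinearEquiv.hasFDerivAt
      |>.comp_hasDerivAt t h1

lemma contDiff_iteratedFDeriv_snd (j m : ℕ) : ∀ {Y : Type v} [NormedAddCommGroup Y]
    [NormedSpace ℝ Y] {F : ℝ × E → Y}, ContDiff ℝ (j + m : ℕ) F → ∀ z : E,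
    ContDiff ℝ j (fun t => iteratedFDeriv ℝ m (fun z => F (t, z)) z) := by
  induction m with
  | zero =>
    intro Y _ _ F hF z
    simp only [iteratedFDeriv_zero_eq_comp, Function.comp_apply]
    exact (continuousMultilinearCurryFin0 ℝ E Y).symm.toContinuousLinearEquiv.contDiff.comp
      (hF.comp (contDiff_id.prodMk contDiff_const))
  | succ m ih =>
    intro Y _ _ F hF z
    have hF' : ContDiff ℝ ((j + m : ℕ) + 1) F := hF
    simp only [iteratedFDeriv_snd_succ (hF'.differentiable (by simp))]
    exact (continuousMultilinearCurryRightEquiv' ℝ m E Y).symm.toContinuousLinearEquiv.contDiff.comp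
      (ih hF'.fderivSnd z)

lemma norm_iteratedFDeriv_clm_comp_le {G Z : Type*} [NormedAddCommGroup G] [NormedSpace ℝ G]
    [NormedAddCommGroup Z] [NormedSpace ℝ Z] (L : Y →L[ℝ] Z) (hL : ‖L‖ ≤ 1) {i : ℕ} {f : G → Y}
    (hf : ContDiff ℝ i f) (x : G) :
    ‖iteratedFDeriv ℝ i (fun x => L (f x)) x‖ ≤ ‖iteratedFDeriv ℝ i f x‖ := by
  have h := L.iteratedFDeriv_comp_left hf.contDiffAt le_rfl (x := x)
  calc _ = ‖L.compContinuousMultilinearMap (iteratedFDeriv ℝ i f x)‖ := congrArg _ h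
    _ ≤ ‖L‖ * ‖iteratedFDeriv ℝ i f x‖ := L.norm_compContinuousMultilinearMap_le _
    _ ≤ _ := mul_le_of_le_one_left (norm_nonneg _) hL

/-- Bounds for the mixed partial derivatives bound the full derivative. -/
lemma norm_iteratedFDeriv_le_of_mixed {N : ℝ} (i : ℕ) : ∀ {Y : Type v} [NormedAddCommGroup Y]
    [NormedSpace ℝ Y] {F : ℝ × E → Y}, ContDiff ℝ i F →
    (∀ j m, j + m ≤ i → ∀ (t : ℝ) (z : E),
      ‖iteratedDeriv j (fun t => iteratedFDeriv ℝ m (fun z => F (t, z)) z) t‖ ≤ N) →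
    ∀ x, ‖iteratedFDeriv ℝ i F x‖ ≤ 2 ^ i * N := by
  induction i with
  | zero =>
    rintro Y _ _ F - h ⟨t, z⟩
    simpa using h 0 0 le_rfl t z
  | succ i ih =>
    intro Y _ _ F hF h x
    have hF' : ContDiff ℝ (i + 1) F := hF
    have hd : Differentiable ℝ F := hF'.differentiable (by simp)
    have h1 := ih hF'.derivFst (fun j m hjm t z => by
      have e : (fun t => iteratedFDeriv ℝ m (fun z => derivFst F (t, z)) z) =
          deriv fun t => iteratedFDeriv ℝ m (fun z => F (t, z)) z := funext fun t =>
        (hasDerivAt_iteratedFDeriv_snd m (hF'.of_le (by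
          have : m + 1 ≤ i + 1 := by omega
          exact_mod_cast this)) t z).deriv.symm
      rw [e, ← iteratedDeriv_succ']
      exact h (j + 1) m (by omega) t z) x
    have h2 := ih hF'.fderivSnd (fun j m hjm t z => by
      have e : (fun t => iteratedFDeriv ℝ m (fun z => fderivSnd F (t, z)) z) =
          (continuousMultilinearCurryRightEquiv' ℝ m E Y) ∘
            fun t => iteratedFDeriv ℝ (m + 1) (fun z => F (t, z)) z := funext fun t => by
        rw [Function.comp_apply, iteratedFDeriv_snd_succ hd, LinearIsometryEquiv.apply_symm_apply]
      rw [e, ← norm_iteratedFDeriv_eq_norm_iteratedDeriv,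
        LinearIsometryEquiv.norm_iteratedFDeriv_comp_left,
        norm_iteratedFDeriv_eq_norm_iteratedDeriv]
      exact h j (m + 1) (by omega) t z) x
    set L₁ : Y →L[ℝ] (ℝ × E →L[ℝ] Y) :=
      ContinuousLinearMap.smulRightL ℝ (ℝ × E) Y (ContinuousLinearMap.fst ℝ ℝ E) with hL₁
    set L₂ : (E →L[ℝ] Y) →L[ℝ] (ℝ × E →L[ℝ] Y) :=
      (ContinuousLinearMap.compL ℝ (ℝ × E) E Y).flip (ContinuousLinearMap.snd ℝ ℝ E) with hL₂
    have n₁ : ‖L₁‖ ≤ 1 := ContinuousLinearMap.opNorm_le_bound _ zero_le_one fun y => by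
      refine ContinuousLinearMap.opNorm_le_bound _ (by positivity) fun w => ?_
      change ‖w.1 • y‖ ≤ _
      rw [norm_smul, one_mul, mul_comm]
      exact mul_le_mul_of_nonneg_left (norm_fst_le w) (norm_nonneg _)
    have n₂ : ‖L₂‖ ≤ 1 := ContinuousLinearMap.opNorm_le_bound _ zero_le_one fun T => by
      refine ContinuousLinearMap.opNorm_le_bound _ (by positivity) fun w => ?_
      change ‖T w.2‖ ≤ _
      rw [one_mul]
      exact (T.le_opNorm _).trans (mul_le_mul_of_nonneg_left (norm_snd_le w) (norm_nonneg _))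
    -- The total derivative is the sum of the two partial ones, embedded by maps of norm at most
    -- one. Each order thus contributes a factor 2.
    have e : fderiv ℝ F = (fun x => L₁ (derivFst F x)) + fun x => L₂ (fderivSnd F x) := by
      refine funext fun x => ContinuousLinearMap.ext fun w => ?_
      change _ = w.1 • fderiv ℝ F x (1, 0) + fderiv ℝ F x (0, w.2)
      rw [← map_smul, ← map_add]
      simp
    rw [← norm_iteratedFDeriv_fderiv, e]
    have e2 := iteratedFDeriv_add_apply (x := x) (L₁.contDiff.comp hF'.derivFst).contDiffAt
      (L₂.contDiff.comp hF'.fderivSnd).contDiffAt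
    calc _ = ‖iteratedFDeriv ℝ i (fun x => L₁ (derivFst F x)) x +
          iteratedFDeriv ℝ i (fun x => L₂ (fderivSnd F x)) x‖ := congrArg _ e2
      _ ≤ 2 ^ i * N + 2 ^ i * N := (norm_add_le _ _).trans (add_le_add
          ((norm_iteratedFDeriv_clm_comp_le L₁ n₁ hF'.derivFst x).trans h1)
          ((norm_iteratedFDeriv_clm_comp_le L₂ n₂ hF'.fderivSnd x).trans h2))
      _ = _ := by ring

end PartialDerivatives

/-! ### Regularity of localizations. -/

section ConeBounds

variable {EM : Type*} [NormedAddCommGroup EM] [NormedSpace ℝ EM] {H : Type*} [TopologicalSpace H]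
  {I : ModelWithCorners ℝ EM H} {M : Type*} [TopologicalSpace M] [ChartedSpace H M]
  {E : Type*} [NormedAddCommGroup E] [NormedSpace ℝ E]
  {X : Type*} [NormedAddCommGroup X] [NormedSpace ℝ X]

/-- The localization is regular on the open source and vanishes off a closed subset of it, so its
extension by zero is regular. -/
lemma Patch.contDiff_loc (P : Patch I M E) {S : Set E} (hS : IsClosed S)
    (hSU : S ⊆ P.toPartialEquiv.source) (hPS : P.carrier ⊆ S)
    (hw : ContMDiffOn I 𝓘(ℝ, ℝ) ∞ P.weight P.toPartialEquiv.target) (δ : ℝ) {k : ℕ} {v : M → X}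
    (hv : ContMDiffOn I 𝓘(ℝ, X) k v P.toPartialEquiv.target) : ContDiff ℝ k (P.loc δ v) := by
  have hk : ((k : ℕ) : ℕ∞ω) ≤ (∞ : ℕ∞ω) := by exact_mod_cast le_top
  have hm : MapsTo P.toPartialEquiv P.toPartialEquiv.source P.toPartialEquiv.target :=
    P.toPartialEquiv.mapsTo
  have h1 : ContDiffOn ℝ k (fun x => (P.density δ x * P.weight (P.toPartialEquiv x)) •
      v (P.toPartialEquiv x)) P.toPartialEquiv.source := by
    refine ContDiffOn.smul (((P.contDiff_density δ).of_le hk).contDiffOn.mul ?_) ?_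
    · exact ((hw.comp P.contMDiffOn hm).contDiffOn).of_le hk
    · exact (hv.comp (P.contMDiffOn.of_le hk) hm).contDiffOn
  refine contDiff_of_eq_zero P.isOpen_source (h1.congr fun x hx => ?_) hS hSU fun x hx => ?_
  · rw [P.loc_apply, Patch.coeff, indicator_of_mem hx]
  · rw [P.loc_apply, P.coeff_of_notMem δ fun h => hx (hPS h), zero_smul]

end ConeBounds

/-! ### Localizations of functions with bounded conic derivatives. -/

namespace ConicManifold

variable {n : ℕ}
  {Mt : Type*} [TopologicalSpace Mt] [ChartedSpace (EuclideanHalfSpace (n + 1)) Mt]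
  [IsManifold (𝓡∂ (n + 1)) ∞ Mt]
  {B : Type*} [TopologicalSpace B] [ChartedSpace (EuclideanSpace ℝ (Fin n)) B]
  [IsManifold (𝓡 n) ∞ B]
  {X : Type*} [NormedAddCommGroup X] [NormedSpace ℝ X] {χ : ℝ → ℝ}

lemma contMDiffOn_cutoff_collarSet (C : ConicManifold n Mt B) (hχ : IsConeCutoff χ) (s : Set ℝ)
    (t : Set B) :
    ContMDiffOn (𝓡∂ (n + 1)) 𝓘(ℝ, ℝ) ∞ (C.cutoff χ) (C.collarSet s t) := by
  have h : ContMDiffOn (𝓡∂ (n + 1)) (𝓘(ℝ, ℝ).prod (𝓡 n)) ∞ C.collar.symm (C.collarSet s t) :=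
    C.collar_symm_smooth.mono fun q hq => hq.1
  have h1 := hχ.smooth.contMDiff.comp_contMDiffOn (contMDiff_fst.comp_contMDiffOn h)
  exact h1.congr fun q hq => indicator_of_mem hq.1 _

variable [T2Space Mt] [CompactSpace B]

lemma contMDiff_cutoff (C : ConicManifold n Mt B) (hχ : IsConeCutoff χ) :
    ContMDiff (𝓡∂ (n + 1)) 𝓘(ℝ, ℝ) ∞ (C.cutoff χ) := by
  intro q
  obtain ⟨ε, hε, r, hr, -, -, hb, h1, h0⟩ := C.exists_cutoff_bounds hχ
  by_cases hq : q ∈ C.collarSet (Ico 0 1) univ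
  · exact (C.contMDiffOn_cutoff_collarSet hχ _ _).contMDiffAt (C.isOpen_collarSet_Ico.mem_nhds hq)
  · have hq' : q ∈ (C.collarSet (Icc 0 r) univ)ᶜ := fun h =>
      hq ⟨h.1, ⟨h.2.1.1, h.2.1.2.trans_lt hr⟩, mem_univ _⟩
    have ho : IsOpen (C.collarSet (Icc 0 r) univ)ᶜ :=
      (C.isCompact_collarSet isCompact_Icc (Icc_subset_Icc_right hr.le)
        isCompact_univ).isClosed.isOpen_compl
    refine (contMDiffAt_const (c := (0 : ℝ))).congr_of_eventuallyEq ?_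
    filter_upwards [ho.mem_nhds hq'] with x hx
    exact by_contra fun h => hx (h0 x h)

lemma contDiff_loc_conePatch (C : ConicManifold n Mt B) (hχ : IsConeCutoff χ)
    (LB : FiniteLocalization (𝓡 n) B) (i : Fin LB.num) (δ : ℝ) {k : ℕ} {v : Mt → X}
    (hv : ContMDiffOn (𝓡∂ (n + 1)) 𝓘(ℝ, X) k v ((𝓡∂ (n + 1)).interior Mt)) :
    ContDiff ℝ k ((C.conePatch χ (LB.patch i fun _ => 1)).loc δ v) := by
  obtain ⟨ε, hε, r, hr, -, hr0, -⟩ := C.exists_cutoff_bounds hχ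
  -- The bound `r` may be nonpositive; enlarging it makes -log r' meaningful and still positive.
  set r' := max r (1 / 2) with hr'
  have hr1 : r' < 1 := max_lt hr (by norm_num)
  have hrp : 0 < r' := lt_of_lt_of_le (by norm_num) (le_max_right _ _)
  have hK : IsCompact ((LB.chart i).extend (𝓡 n) '' tsupport (LB.weight i)) :=
    (isClosed_tsupport _).isCompact.image_of_continuousOn
      (((LB.chart i).continuousOn_extend).mono (by
        rw [(LB.chart i).extend_source]; exact LB.weight_tsupport i))
  have hKs : (LB.chart i).extend (𝓡 n) '' tsupport (LB.weight i) ⊆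
      (LB.patch i fun _ => 1).toPartialEquiv.source := by
    rintro _ ⟨y, hy, rfl⟩
    refine (LB.patch i fun _ => 1).toPartialEquiv.symm_mapsTo ⟨LB.weight_tsupport i hy, ?_⟩
    rw [ModelWithCorners.interior_eq_univ]
    exact mem_univ _
  refine Patch.contDiff_loc _ (S := Ici (-Real.log r') ×ˢ
      ((LB.chart i).extend (𝓡 n) '' tsupport (LB.weight i))) (isClosed_Ici.prod hK.isClosed)
    ?_ ?_ ?_ δ (hv.mono ?_)
  · rintro ⟨t, z⟩ ⟨ht, hz⟩
    exact ⟨(neg_pos.2 (Real.log_neg hrp hr1)).trans_le ht, hKs hz⟩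
  · rintro ⟨t, z⟩ ⟨⟨ht, hz⟩, hw⟩
    have hx : Real.exp (-t) ∈ Icc (0 : ℝ) 1 :=
      ⟨(Real.exp_pos _).le, (Real.exp_lt_one_iff.2 (neg_lt_zero.2 ht)).le⟩
    have hw' : C.cutoff χ (C.collar (Real.exp (-t), ((LB.chart i).extend (𝓡 n)).symm z)) *
      (1 * LB.weight i (C.collar.symm (C.collar (Real.exp (-t),
        ((LB.chart i).extend (𝓡 n)).symm z))).2) ≠ 0 := hw
    rw [C.cutoff_collar χ hx, C.symm_collar hx, one_mul] at hw'
    refine ⟨?_, ((LB.chart i).extend (𝓡 n)).symm z, subset_tsupport _ (right_ne_zero_of_mul hw'),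
      ((LB.chart i).extend (𝓡 n)).right_inv (interior_subset hz)⟩
    have h1 : Real.exp (-t) ≤ r' := by
      by_contra! h
      exact left_ne_zero_of_mul hw' (hr0 _ ((le_max_left _ _).trans_lt h))
    have h2 := Real.log_le_log (Real.exp_pos _) h1
    rw [Real.log_exp] at h2
    change -Real.log r' ≤ t
    linarith
  · have h : ContMDiffOn (𝓡∂ (n + 1)) (𝓘(ℝ, ℝ).prod (𝓡 n)) ∞ C.collar.symm
        (C.collarSet (Ico 0 1 ∩ Ioi 0) ((LB.chart i).source ∩ (𝓡 n).interior B)) :=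
      C.collar_symm_smooth.mono fun q hq => hq.1
    exact (C.contMDiff_cutoff hχ).contMDiffOn.mul (contMDiffOn_const.mul
      ((LB.weight_smooth i).comp_contMDiffOn (contMDiff_snd.comp_contMDiffOn h)))
  · rintro q ⟨hq, ⟨hx, hx0⟩, -⟩
    rw [← C.collar.right_inv hq]
    exact C.collar_mem_interior hx0 hx.2.le _

lemma contDiff_loc_patch [CompactSpace Mt] (C : ConicManifold n Mt B) (hχ : IsConeCutoff χ)
    (LM : FiniteLocalization (𝓡∂ (n + 1)) Mt) (i : Fin LM.num) (δ : ℝ) {k : ℕ} {v : Mt → X}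
    (hv : ContMDiffOn (𝓡∂ (n + 1)) 𝓘(ℝ, X) k v ((𝓡∂ (n + 1)).interior Mt)) :
    ContDiff ℝ k ((LM.patch i fun q => 1 - C.cutoff χ q).loc δ v) := by
  obtain ⟨ε, hε, r, hr, -, -, hb, h1, h0⟩ := C.exists_cutoff_bounds hχ
  set T := tsupport (LM.weight i) ∩ (C.collarSet (Ico 0 1 ∩ Iio ε) univ)ᶜ with hT
  have hTc : IsCompact T := ((isClosed_tsupport _).inter
    (C.isOpen_collarSet isOpen_Iio isOpen_univ).isClosed_compl).isCompact
  have hTs : T ⊆ (LM.chart i).source := fun q hq => LM.weight_tsupport i hq.1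
  have hTt : T ⊆ (LM.patch i fun q => 1 - C.cutoff χ q).toPartialEquiv.target := fun q hq =>
    ⟨hTs hq, by_contra fun h => hq.2 (hb q h)⟩
  have hK : IsCompact ((LM.chart i).extend (𝓡∂ (n + 1)) '' T) :=
    hTc.image_of_continuousOn (((LM.chart i).continuousOn_extend).mono (by
      rw [(LM.chart i).extend_source]; exact hTs))
  refine Patch.contDiff_loc _ hK.isClosed ?_ ?_ ?_ δ (hv.mono inter_subset_right)
  · rintro _ ⟨q, hq, rfl⟩
    exact (LM.patch i fun q => 1 - C.cutoff χ q).toPartialEquiv.symm_mapsTo (hTt hq)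
  · rintro z ⟨hz, hw⟩
    refine ⟨((LM.chart i).extend (𝓡∂ (n + 1))).symm z,
      ⟨subset_tsupport _ (right_ne_zero_of_mul hw), fun h => left_ne_zero_of_mul hw ?_⟩,
      ((LM.chart i).extend (𝓡∂ (n + 1))).right_inv (interior_subset hz)⟩
    exact sub_eq_zero.2 (h1 _ h).symm
  · exact ((contMDiff_const.sub (C.contMDiff_cutoff hχ)).mul (LM.weight_smooth i)).contMDiffOn

/-- Bounds for a cone localization in terms of the conic derivatives. -/
lemma exists_hasBoundedDerivs_conePatch (C : ConicManifold n Mt B) (hχ : IsConeCutoff χ)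
    (LB : FiniteLocalization (𝓡 n) B) (k : ℕ) (X : Type*) [NormedAddCommGroup X]
    [NormedSpace ℝ X] : ∃ K : ℝ, 0 ≤ K ∧ ∀ (i : Fin LB.num) (N : ℝ)
      (v : Mt → X), ContMDiffOn (𝓡∂ (n + 1)) 𝓘(ℝ, X) k v ((𝓡∂ (n + 1)).interior Mt) →
      (∀ j m, j + m ≤ k → ∀ x ∈ Ioo (0 : ℝ) 1, ∀ z, ‖iteratedDeriv j (fun x' : ℝ => (x' ^ m)⁻¹ •
        iteratedFDeriv ℝ m (LB.localize i fun y => χ x' • v (C.collar (x', y))) z) x‖ ≤ N) →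
      HasBoundedDerivs k (K * N) ((C.conePatch χ (LB.patch i fun _ => 1)).loc 0 v) := by
  choose K hK0 hK using fun m j =>
    exists_bound_iteratedDeriv_exp_smul_comp (Y := EuclideanSpace ℝ (Fin n) [×m]→L[ℝ] X) j m
  set S := ∑ m ∈ Finset.range (k + 1), ∑ j ∈ Finset.range (k + 1), K m j with hS
  have hS0 : 0 ≤ S := Finset.sum_nonneg fun m _ => Finset.sum_nonneg fun j _ => hK0 m j
  have hKS : ∀ m j, j + m ≤ k → K m j ≤ S := fun m j hjm => by
    refine (Finset.single_le_sum (f := fun j => K m j) (fun j _ => hK0 m j)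
      (Finset.mem_range.2 (show j < k + 1 by omega))).trans ?_
    exact Finset.single_le_sum (f := fun m => ∑ j ∈ Finset.range (k + 1), K m j)
      (fun m _ => Finset.sum_nonneg fun j _ => hK0 m j)
      (Finset.mem_range.2 (show m < k + 1 by omega))
  obtain ⟨ε, hε, r, hr, -, hr0, -⟩ := C.exists_cutoff_bounds hχ
  refine ⟨2 ^ k * S, by positivity, fun i N v hv hN => ?_⟩
  have hN0 : 0 ≤ N := (norm_nonneg _).trans (hN 0 0 (Nat.zero_le _) (1 / 2) (by norm_num) 0)
  have hF := C.contDiff_loc_conePatch hχ LB i 0 hv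
  set F := (C.conePatch χ (LB.patch i fun _ => 1)).loc 0 v with hFdef
  set f : ℝ → EuclideanSpace ℝ (Fin n) → X := fun x =>
    LB.localize i fun y => χ x • v (C.collar (x, y)) with hf
  have hF1 : ∀ t > (0 : ℝ), (fun z => F (t, z)) = f (Real.exp (-t)) := fun t ht => by
    ext z
    rw [hFdef, loc_conePatch, indicator_of_mem (show t ∈ Ioi 0 from ht), zero_mul, Real.exp_zero,
      one_smul]
  have hF2 : ∀ t, Real.exp (-t) > r → (fun z => F (t, z)) = fun _ => 0 := fun t ht => by
    ext z
    rw [hFdef, loc_conePatch, hr0 _ ht]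
    simp [FiniteLocalization.localize]
  have hmixed : ∀ j m, j + m ≤ k → ∀ t z,
      ‖iteratedDeriv j (fun t => iteratedFDeriv ℝ m (fun z => F (t, z)) z) t‖ ≤ S * N := by
    intro j m hjm t z
    rcases lt_or_ge 0 t with ht | ht
    -- The m-th derivative in z is e^{-mt} g(e^{-t}), where g carries the factor x^{-m} of the conic
    -- derivatives; this is the change of variables with a = m.
    · set g : ℝ → EuclideanSpace ℝ (Fin n) [×m]→L[ℝ] X := fun x =>
        (x ^ m)⁻¹ • iteratedFDeriv ℝ m (f x) z with hg
      have hgs : ContDiffOn ℝ j g (Ioo 0 1) := by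
        have h1 := contDiff_iteratedFDeriv_snd j m (hF.of_le (by exact_mod_cast hjm)) z
        have h2 : ContDiffOn ℝ j (fun x : ℝ => -Real.log x) (Ioo 0 1) :=
          (Real.contDiffOn_log.mono fun x hx => (ne_of_gt hx.1 : x ≠ 0)).neg
        have h3 : ContDiffOn ℝ j (fun x : ℝ => (x ^ m)⁻¹) (Ioo 0 1) :=
          (contDiff_id.pow m).contDiffOn.inv fun x hx => (pow_pos hx.1 m).ne'
        refine (h3.smul (h1.comp_contDiffOn h2)).congr fun x hx => ?_
        change _ = (x ^ m)⁻¹ • iteratedFDeriv ℝ m (fun z => F (-Real.log x, z)) z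
        rw [hF1 _ (neg_pos.2 (Real.log_neg hx.1 hx.2)), neg_neg,
          Real.exp_log hx.1]
      have e : (fun t => iteratedFDeriv ℝ m (fun z => F (t, z)) z) =ᶠ[𝓝 t]
          fun t => Real.exp (-(m * t)) • g (Real.exp (-t)) := by
        filter_upwards [Ioi_mem_nhds ht] with t' ht'
        have h1 : Real.exp (-(m * t')) = Real.exp (-t') ^ m := by
          rw [← Real.exp_nat_mul]; congr 1; ring
        rw [hF1 t' ht', h1, hg, smul_inv_smul₀ (pow_pos (Real.exp_pos _) m).ne']
      rw [e.iteratedDeriv_eq]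
      refine le_trans (le_trans ?_ (hK m j g N hgs (fun l hl x hx => hN l m (by omega) x hx z) t ht))
        (mul_le_mul_of_nonneg_right (hKS m j hjm) hN0)
      -- The factor e^{mt} ≥ 1 is dropped: conic bounds give decay that is not needed here.
      exact le_mul_of_one_le_left (norm_nonneg _) (Real.one_le_exp (by positivity))
    -- For t ≤ 0 one has e^{-t} ≥ 1 > r, so the function vanishes near t.
    · have h1 : Real.exp (-t) > r := hr.trans_le (Real.one_le_exp (neg_nonneg.2 ht))
      have h2 : Continuous fun t : ℝ => Real.exp (-t) := by fun_prop
      have e : (fun t => iteratedFDeriv ℝ m (fun z => F (t, z)) z) =ᶠ[𝓝 t] fun _ => 0 := by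
        filter_upwards [(h2.tendsto t).eventually_const_lt h1] with t' ht'
        rw [hF2 t' ht']
        exact congrFun iteratedFDeriv_zero_fun z
      rw [e.iteratedDeriv_eq]
      simp only [iteratedDeriv_const, ite_self, norm_zero]
      positivity
  refine ⟨hF, fun l hl x => ?_⟩
  refine (norm_iteratedFDeriv_le_of_mixed l (hF.of_le (by exact_mod_cast hl))
    (fun j m hjm => hmixed j m (hjm.trans hl)) x).trans ?_
  rw [mul_assoc]
  exact mul_le_mul_of_nonneg_right (pow_le_pow_right₀ one_le_two hl) (by positivity)

/-- A function with finite conic norm has localizations with bounded derivatives. -/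
lemma exists_hasBoundedDerivs_cover [CompactSpace Mt] [T2Space B] (C : ConicManifold n Mt B)
    (hχ : IsConeCutoff χ)
    (LB : FiniteLocalization (𝓡 n) B) (LM : FiniteLocalization (𝓡∂ (n + 1)) Mt) (k : ℕ)
    (X : Type*) [NormedAddCommGroup X] [NormedSpace ℝ X] :
    ∃ K : ℝ, 0 ≤ K ∧ ∀ (v : Mt → X) (a : ℝ), C.conicCkENorm χ LB LM k v ≤ ENNReal.ofReal a →
      0 ≤ a → (C.cover hχ LB LM).HasBoundedDerivs k (K * a) v := by
  obtain ⟨K, hK0, hK⟩ := C.exists_hasBoundedDerivs_conePatch hχ LB k X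
  refine ⟨K + 1, by positivity, fun v a hva ha => ?_⟩
  have hv : ContMDiffOn (𝓡∂ (n + 1)) 𝓘(ℝ, X) k v ((𝓡∂ (n + 1)).interior Mt) := by
    by_contra h
    rw [conicCkENorm, iInf_neg h] at hva
    exact ENNReal.ofReal_ne_top (top_le_iff.1 hva)
  rw [conicCkENorm, iInf_pos hv] at hva
  refine ⟨fun i => (hK i a v hv fun j m hjm x hx z => ?_).mono le_rfl
    (mul_le_mul_of_nonneg_right (by linarith) ha), fun i => ⟨C.contDiff_loc_patch hχ LM i 0 hv,
      fun j hj z => ?_⟩⟩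
  · rw [← ENNReal.ofReal_le_ofReal_iff ha, ofReal_norm]
    refine le_trans ?_ (le_add_self.trans hva)
    refine le_trans ?_ (Finset.single_le_sum (fun _ _ => zero_le) (Finset.mem_univ i))
    have hmem : (j, m) ∈ (Finset.range (k + 1) ×ˢ Finset.range (k + 1)).filter
        (fun jm => jm.1 + jm.2 ≤ k) := by
      simp only [Finset.mem_filter, Finset.mem_product, Finset.mem_range]
      omega
    refine le_trans ?_ (Finset.single_le_sum (fun _ _ => zero_le) hmem)
    exact le_iSup₂_of_le x hx (le_iSup_of_le z le_rfl)
  · have e : (C.cover hχ LB LM).patch' i = LM.patch i fun q => 1 - C.cutoff χ q := rfl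
    rw [e, LM.loc_patch i fun q hq => by rw [C.cutoff_eq_one_of_notMem_interior hχ hq, sub_self]]
    refine le_trans ?_ (le_mul_of_one_le_left ha (by linarith : 1 ≤ K + 1))
    rw [← ENNReal.ofReal_le_ofReal_iff ha, ofReal_norm]
    refine le_trans ?_ (le_self_add.trans hva)
    refine le_trans ?_ (Finset.single_le_sum (fun _ _ => zero_le) (Finset.mem_univ i))
    refine le_trans ?_ (Finset.single_le_sum (fun _ _ => zero_le)
      (Finset.mem_range.2 (Nat.lt_succ_of_le hj)))
    exact le_iSup (fun z => ‖iteratedFDeriv ℝ j (LM.localize i (C.regularPart χ v)) z‖ₑ) z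

end ConicManifold

/-! ### Banach algebras from extended norms. -/

/-- An extended norm which is bounded by a multiple of a submultiplicative one. -/
lemma exists_banachAlgebra {R : Type u} [NonUnitalCommRing R] [Module ℂ R] [IsScalarTower ℂ R R]
    [SMulCommClass ℂ R R] (N : R → ℝ≥0∞) (hN : ∀ x, N x < ⊤) (h0 : N 0 = 0)
    (hadd : ∀ x y, N (x + y) ≤ N x + N y) (hsmul : ∀ (c : ℂ) x, N (c • x) ≤ ‖c‖ₑ * N x)
    (K : ℝ≥0) (hmul : ∀ x y, N (x * y) ≤ K * N x * N y)
    (hc : ∀ x : ℕ → R, ∑' k, N (x k) ≠ ⊤ →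
      ∃ y, Tendsto (fun m => N (y - ∑ k ∈ Finset.range m, x k)) atTop (𝓝 0)) :
    ∃ (A : Type u) (_ : NonUnitalNormedCommRing A) (_ : NormedSpace ℂ A)
      (_ : IsScalarTower ℂ A A) (_ : SMulCommClass ℂ A A) (_ : CompleteSpace A) (π : R →ₙₐ[ℂ] A),
      Function.Surjective π ∧ ∃ K : ℝ≥0, ∀ x : R, ‖π x‖ₑ ≤ K * N x ∧ N x ≤ K * ‖π x‖ₑ := by
  -- The norm c N is submultiplicative because c ≥ K, and c ≥ 1 makes c a constant for both
  -- comparisons with N.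
  set c : ℝ≥0 := max 1 K with hcdef
  have hc1 : 1 ≤ c := le_max_left _ _
  have hreal : ∀ (c : ℝ) (x : R), N (c • x) ≤ ‖c‖ₑ * N x := fun c x => by
    have := hsmul (c : ℂ) x
    rw [Complex.coe_smul] at this
    simpa [enorm_eq_nnnorm] using this
  have hE : IsENorm N := ⟨h0, hadd, hreal⟩
  let ring : NonUnitalSeminormedCommRing R :=
    { AddGroupSeminorm.toSeminormedAddCommGroup (E := R)
        { toFun := fun x => c * (N x).toReal
          map_zero' := by simp [h0]
          add_le' := fun x y => by
            rw [← mul_add, ← ENNReal.toReal_add (hN x).ne (hN y).ne]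
            exact mul_le_mul_of_nonneg_left (ENNReal.toReal_mono
              (ENNReal.add_lt_top.2 ⟨hN x, hN y⟩).ne (hadd x y)) c.2
          neg' := fun x => by simp [hE.neg] }, ‹NonUnitalCommRing R› with
      norm_mul_le := fun x y => by
        change c * (N (x * y)).toReal ≤ c * (N x).toReal * (c * (N y).toReal)
        have h1 : (N (x * y)).toReal ≤ K * (N x).toReal * (N y).toReal := by
          have := ENNReal.toReal_mono (ENNReal.mul_lt_top (ENNReal.mul_lt_top ENNReal.coe_lt_top
            (hN x)) (hN y)).ne (hmul x y)
          simpa using this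
        have h2 : (K : ℝ) * (N x).toReal * (N y).toReal ≤ c * (N x).toReal * (N y).toReal := by
          have : (K : ℝ) ≤ c := le_max_right _ _
          gcongr
        calc _ ≤ c * (c * (N x).toReal * (N y).toReal) :=
              mul_le_mul_of_nonneg_left (h1.trans h2) c.2
          _ = _ := by ring }
  have hnorm : ∀ x : R, ‖x‖ = c * (N x).toReal := fun _ => rfl
  let space : NormedSpace ℂ R :=
    { norm_smul_le := fun a x => by
        rw [hnorm, hnorm, mul_left_comm]
        refine mul_le_mul_of_nonneg_left ?_ c.2
        have := ENNReal.toReal_mono (ENNReal.mul_lt_top enorm_lt_top (hN x)).ne (hsmul a x)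
        simpa using this }
  have henorm : ∀ x : R, ‖x‖ₑ = c * N x := fun x => by
    rw [← ofReal_norm, hnorm, ENNReal.ofReal_mul c.coe_nonneg, ENNReal.ofReal_toReal (hN x).ne]
    simp
  have hcomplete : CompleteSpace R := by
    rw [← SeparationQuotient.completeSpace_iff]
    refine NormedAddCommGroup.completeSpace_of_summable_imp_tendsto fun u hu => ?_
    choose v hv using fun k => SeparationQuotient.surjective_mk (u k)
    have hle : ∀ k, N (v k) ≤ ENNReal.ofReal ‖u k‖ := fun k => by
      rw [← hv k, SeparationQuotient.norm_mk, ofReal_norm, henorm]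
      exact le_mul_of_one_le_left zero_le (by exact_mod_cast hc1)
    obtain ⟨y, hy⟩ := hc v ((ENNReal.tsum_le_tsum hle).trans_lt hu.tsum_ofReal_lt_top).ne
    refine ⟨SeparationQuotient.mk y, ?_⟩
    have h1 : Tendsto (fun m => ∑ k ∈ Finset.range m, v k) atTop (𝓝 y) := by
      rw [tendsto_iff_norm_sub_tendsto_zero]
      have h2 := (ENNReal.tendsto_toReal ENNReal.zero_ne_top).comp hy
      have h3 := h2.const_mul (c : ℝ)
      rw [ENNReal.toReal_zero, mul_zero] at h3
      refine h3.congr fun m => ?_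
      rw [norm_sub_rev, hnorm, Function.comp_apply]
    refine ((SeparationQuotient.continuous_mk.tendsto y).comp h1).congr fun m => ?_
    simp_rw [← hv]
    exact map_sum (SeparationQuotient.mkCLM ℂ R) v _
  have : CompleteSpace (SeparationQuotient R) := SeparationQuotient.completeSpace_iff.2 hcomplete
  have t1 : IsScalarTower ℂ (SeparationQuotient R) (SeparationQuotient R) := ⟨fun a x y => by
    obtain ⟨x, rfl⟩ := SeparationQuotient.surjective_mk x
    obtain ⟨y, rfl⟩ := SeparationQuotient.surjective_mk y
    exact congrArg SeparationQuotient.mk (smul_assoc a x y)⟩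
  have t2 : SMulCommClass ℂ (SeparationQuotient R) (SeparationQuotient R) := ⟨fun a x y => by
    obtain ⟨x, rfl⟩ := SeparationQuotient.surjective_mk x
    obtain ⟨y, rfl⟩ := SeparationQuotient.surjective_mk y
    exact congrArg SeparationQuotient.mk (smul_comm a x y)⟩
  let π : R →ₙₐ[ℂ] SeparationQuotient R :=
    { toFun := SeparationQuotient.mk
      map_smul' := fun _ _ => rfl
      map_zero' := rfl
      map_add' := fun _ _ => rfl
      map_mul' := fun _ _ => rfl }
  have hπ : ∀ x, ‖π x‖ₑ = c * N x := fun x => by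
    rw [← henorm, ← ofReal_norm, ← ofReal_norm]
    exact congrArg _ (SeparationQuotient.norm_mk x)
  refine ⟨SeparationQuotient R, inferInstance, inferInstance, t1, t2, this, π,
    SeparationQuotient.surjective_mk, c, fun x => ⟨(hπ x).le, ?_⟩⟩
  rw [hπ]
  have h1 : (1 : ℝ≥0∞) ≤ c := by exact_mod_cast hc1
  exact (le_mul_of_one_le_left zero_le h1).trans (le_mul_of_one_le_left zero_le h1)

/-! ### Complex scalars in spaces defined by real structures. -/

section ComplexScalars

variable {E : Type*} [NormedAddCommGroup E] [NormedSpace ℝ E] [FiniteDimensional ℝ E]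
  [MeasureSpace E] [BorelSpace E] [(volume : Measure E).IsAddHaarMeasure] {p s : ℝ}

/-- Multiplication by a complex number is real linear and maps a jet to a jet. -/
lemma sobolevNatENorm_complex_smul_le (hp : 1 < p) (m : ℕ) (c : ℂ) (f : E → ℂ) :
    sobolevNatENorm m p (fun x => c • f x) ≤ ‖c‖ₑ * sobolevNatENorm m p f := by
  rcases eq_or_ne c 0 with rfl | hc
  · have e : (fun x => (0 : ℂ) • f x) = 0 := funext fun x => zero_smul ℂ (f x)
    rw [e, (isENorm_sobolevNatENorm hp).zero]
    exact zero_le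
  by_cases hf : sobolevNatENorm m p f < ⊤
  swap; · rw [not_lt_top_iff.1 hf, ENNReal.mul_top (by simpa using hc)]; exact le_top
  obtain ⟨F, hF⟩ := exists_isSobolevJet_of_lt hf
  have h : IsSobolevJet m p (c • f) fun j => c • F j :=
    ⟨hF.memLp.const_smul c, fun j hj => (hF.deriv_memLp j hj).const_smul c, fun j hj φ hφ hφc w => by
      have h1 : ∀ {a : E → ℝ} {g : E → ℂ}, ∫ x, a x • c • g x = c • ∫ x, a x • g x := fun {a g} => by
        rw [← integral_smul]
        exact integral_congr_ae (ae_of_all _ fun x => smul_comm (a x) c (g x))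
      refine h1.trans ((congrArg (c • ·) (hF.weak j hj φ hφ hφc w)).trans ?_)
      change c • (-1 : ℝ) ^ j • _ = (-1 : ℝ) ^ j • ∫ x, φ x • c • F j x w
      rw [h1, smul_comm]⟩
  rw [hF.eq hp, Finset.mul_sum]
  exact h.le.trans (Finset.sum_le_sum fun j _ => (eLpNorm_const_smul (𝕜 := ℂ) c (F j) _ _).le)

lemma besselENorm_complex_smul_le (hp : 1 < p) (hs : 0 ≤ s) (c : ℂ) (f : E → ℂ) :
    besselENorm s p (fun x => c • f x) ≤ ‖c‖ₑ * besselENorm s p f := by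
  rcases eq_or_ne c 0 with rfl | hc
  · have e : (fun x => (0 : ℂ) • f x) = 0 := funext fun x => zero_smul ℂ (f x)
    rw [e, (isENorm_besselENorm hp).zero]
    exact zero_le
  let T : (E → ℂ) →ₗ[ℝ] (E → ℂ) :=
    { toFun := fun f x => c • f x
      map_add' := fun f g => funext fun x => smul_add c (f x) (g x)
      map_smul' := fun a f => funext fun x => smul_comm c a (f x) }
  exact besselENorm_map_le hs T (M := ‖c‖₊) (by simpa using hc)
    (fun m _ f => sobolevNatENorm_complex_smul_le hp m c f) f

end ComplexScalars

/-! ### A multiplier that lowers the exponent of the density. -/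

section ExponentialWeight

/-- A smooth function on the line which is exponentially decreasing for `t > 0`. -/
lemma exists_hasBoundedDerivs_exp {E : Type*} [NormedAddCommGroup E] [NormedSpace ℝ E] {b : ℝ}
    (hb : 0 ≤ b) (k : ℕ) : ∃ (a : ℝ → ℝ) (K : ℝ), 0 < K ∧ (∀ t > 0, a t = Real.exp (-(b * t))) ∧
      HasBoundedDerivs k K fun p : ℝ × E => a p.1 := by
  -- The transition is complete for t ≥ 0, so the exponential is exact there, and `a` vanishes for t
  -- ≤ -1, where the exponential would be unbounded.
  set a : ℝ → ℝ := fun t => Real.smoothTransition (t + 1) * Real.exp (-(b * t)) with ha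
  have h1 : ∀ t > 0, a t = Real.exp (-(b * t)) := fun t ht => by
    rw [ha]
    change Real.smoothTransition (t + 1) * _ = _
    rw [Real.smoothTransition.one_of_one_le (by linarith), one_mul]
  have hs : ContDiff ℝ k a :=
    (Real.smoothTransition.contDiff.comp (contDiff_id.add contDiff_const)).mul
      (Real.contDiff_exp.comp (contDiff_const.mul contDiff_id).neg)
  have hbd : ∀ j ≤ k, ∃ c, ∀ t, ‖iteratedDeriv j a t‖ ≤ c := by
    intro j hj
    obtain ⟨c₁, hc₁⟩ := (isCompact_Icc (a := (-2 : ℝ)) (b := 1)).exists_bound_of_continuousOn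
      (hs.continuous_iteratedDeriv j (by exact_mod_cast hj)).continuousOn
    obtain ⟨c₂, -, hc₂⟩ := exists_bound_iteratedDeriv_exp_smul_comp (Y := ℝ) j b
    -- Three ranges: zero below -2, compactness on [-2, 1], and beyond 1 the change of variables
    -- applied to the constant function.
    refine ⟨max c₁ (max c₂ 0), fun t => ?_⟩
    rcases lt_or_ge t (-2) with ht | ht
    · have e : a =ᶠ[𝓝 t] fun _ => 0 := by
        filter_upwards [Iio_mem_nhds ht] with r hr
        rw [ha]
        change Real.smoothTransition (r + 1) * _ = _
        rw [Real.smoothTransition.zero_of_nonpos (by linarith [mem_Iio.1 hr]), zero_mul]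
      rw [e.iteratedDeriv_eq]
      simp [iteratedDeriv_const]
    rcases le_or_gt t 1 with ht' | ht'
    · exact (hc₁ t ⟨ht, ht'⟩).trans (le_max_left _ _)
    · have ht0 : 0 < t := by linarith
      have e : a =ᶠ[𝓝 t] fun t => Real.exp (-(b * t)) • (fun _ => (1 : ℝ)) (Real.exp (-t)) := by
        filter_upwards [Ioi_mem_nhds ht0] with r hr
        rw [h1 r hr, smul_eq_mul, mul_one]
      rw [e.iteratedDeriv_eq]
      have h2 := hc₂ (fun _ => 1) 1 contDiffOn_const (fun l _ x _ => by
        rw [iteratedDeriv_const]; split_ifs <;> simp) t ht0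
      rw [mul_one] at h2
      refine le_trans (le_trans ?_ h2) ((le_max_left _ _).trans (le_max_right _ _))
      exact le_mul_of_one_le_left (norm_nonneg _) (Real.one_le_exp (by positivity))
  choose! c hc using hbd
  refine ⟨a, ∑ j ∈ Finset.range (k + 1), c j + 1, ?_, h1, hs.comp contDiff_fst, fun j hj x => ?_⟩
  · have := Finset.sum_nonneg fun j (hj : j ∈ Finset.range (k + 1)) =>
      (norm_nonneg _).trans (hc j (Nat.lt_succ_iff.1 (Finset.mem_range.1 hj)) 0)
    linarith
  · have e : iteratedFDeriv ℝ j (fun x : ℝ × E => a x.1) x = _ :=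
      (ContinuousLinearMap.fst ℝ ℝ E).iteratedFDeriv_comp_right hs x (i := j) (by exact_mod_cast hj)
    rw [e]
    refine (ContinuousMultilinearMap.norm_compContinuousLinearMap_le _ _).trans ?_
    calc _ ≤ ‖iteratedFDeriv ℝ j a x.1‖ * 1 := by
          refine mul_le_mul_of_nonneg_left ?_ (norm_nonneg _)
          exact Finset.prod_le_one (fun _ _ => norm_nonneg _)
            fun _ _ => ContinuousLinearMap.norm_fst_le ..
      _ ≤ c j := by
          rw [mul_one, norm_iteratedFDeriv_eq_norm_iteratedDeriv]
          exact hc j hj _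
      _ ≤ ∑ j ∈ Finset.range (k + 1), c j := Finset.single_le_sum (f := c) (fun i hi =>
          (norm_nonneg _).trans (hc i (Nat.lt_succ_iff.1 (Finset.mem_range.1 hi)) 0))
          (Finset.mem_range.2 (Nat.lt_succ_of_le hj))
      _ ≤ _ := by linarith

end ExponentialWeight

/-! ### Products in Mellin-Sobolev spaces. -/

namespace ConicManifold


variable {n : ℕ}
  {Mt : Type u} [TopologicalSpace Mt] [ChartedSpace (EuclideanHalfSpace (n + 1)) Mt]
  [IsManifold (𝓡∂ (n + 1)) ∞ Mt] [CompactSpace Mt] [T2Space Mt]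
  {B : Type*} [TopologicalSpace B] [ChartedSpace (EuclideanSpace ℝ (Fin n)) B]
  [IsManifold (𝓡 n) ∞ B] [CompactSpace B] [T2Space B]
  {X : Type*} [NormedAddCommGroup X] [NormedSpace ℝ X] [CompleteSpace X] {χ : ℝ → ℝ}
  {X₀ X₁ X₂ : Type*} [NormedAddCommGroup X₀] [NormedSpace ℝ X₀] [CompleteSpace X₀]
  [NormedAddCommGroup X₁] [NormedSpace ℝ X₁] [CompleteSpace X₁]
  [NormedAddCommGroup X₂] [NormedSpace ℝ X₂] [CompleteSpace X₂] {s p : ℝ}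

instance : (volume : Measure (ℝ × EuclideanSpace ℝ (Fin n))).IsAddHaarMeasure :=
  inferInstanceAs ((volume : Measure ℝ).prod
    (volume : Measure (EuclideanSpace ℝ (Fin n)))).IsAddHaarMeasure

/-- The spaces decrease with the weight. -/
lemma exists_norm_cover_mono (C : ConicManifold n Mt B) (hχ : IsConeCutoff χ)
    (LB : FiniteLocalization (𝓡 n) B) (LM : FiniteLocalization (𝓡∂ (n + 1)) Mt) (hs : 0 ≤ s)
    (hp : 1 < p) {δ δ' : ℝ} (h : δ ≤ δ') (X : Type*) [NormedAddCommGroup X] [NormedSpace ℝ X]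
    [CompleteSpace X] : ∃ K : ℝ≥0, ∀ u : Mt → X,
      (C.cover hχ LB LM).norm s p δ u ≤ K * (C.cover hχ LB LM).norm s p δ' u := by
  obtain ⟨k, hk⟩ := exists_nat_ge s
  obtain ⟨a, K, hK0, ha, haK⟩ := exists_hasBoundedDerivs_exp (E := EuclideanSpace ℝ (Fin n))
    (sub_nonneg.2 h) k
  obtain ⟨c, hc⟩ := besselENorm_bilin_le (E := ℝ × EuclideanSpace ℝ (Fin n)) hs hp
    (ContinuousLinearMap.lsmul ℝ ℝ : ℝ →L[ℝ] X →L[ℝ] X) hk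
  refine ⟨c * K.toNNReal + 1, fun u => ?_⟩
  have e : ∀ i : Fin LB.num, (C.conePatch χ (LB.patch i fun _ => 1)).loc δ u =
      fun x => ContinuousLinearMap.lsmul ℝ ℝ (a x.1)
        ((C.conePatch χ (LB.patch i fun _ => 1)).loc δ' u x) := by
    intro i
    ext ⟨t, z⟩
    change (C.conePatch χ (LB.patch i fun _ => 1)).loc δ u (t, z) =
      a t • (C.conePatch χ (LB.patch i fun _ => 1)).loc δ' u (t, z)
    rw [C.loc_conePatch, C.loc_conePatch, smul_smul]
    congr 1
    by_cases ht : t ∈ Ioi (0 : ℝ)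
    · rw [indicator_of_mem ht, indicator_of_mem ht, ha t ht, ← Real.exp_add]
      congr 1
      ring
    · rw [indicator_of_notMem ht, indicator_of_notMem ht, mul_zero]
  rw [PatchCover.norm, PatchCover.norm, mul_add, Finset.mul_sum]
  refine add_le_add (Finset.sum_le_sum fun i _ => ?_) ?_
  · refine (congrArg (besselENorm s p) (e i)).le.trans ((hc K _ hK0 haK _).trans ?_)
    rw [ENNReal.coe_add, ENNReal.coe_mul]
    exact mul_le_mul_left le_self_add _
  · exact le_mul_of_one_le_left zero_le (by rw [ENNReal.coe_add, ENNReal.coe_one]; exact le_add_self)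

lemma norm_cover_complex_smul_le (C : ConicManifold n Mt B) (hχ : IsConeCutoff χ)
    (LB : FiniteLocalization (𝓡 n) B) (LM : FiniteLocalization (𝓡∂ (n + 1)) Mt) (hs : 0 ≤ s)
    (hp : 1 < p) (δ : ℝ) (c : ℂ) (u : Mt → ℂ) :
    (C.cover hχ LB LM).norm s p δ (c • u) ≤ ‖c‖ₑ * (C.cover hχ LB LM).norm s p δ u := by
  rw [PatchCover.norm, PatchCover.norm, mul_add, Finset.mul_sum, Finset.mul_sum]
  refine add_le_add (Finset.sum_le_sum fun i _ => ?_) (Finset.sum_le_sum fun i _ => ?_)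
  · refine le_trans (le_of_eq ?_) (besselENorm_complex_smul_le hp hs c _)
    exact congrArg _ (funext fun x => smul_comm _ c (u _))
  · refine le_trans (le_of_eq ?_) (besselENorm_complex_smul_le hp hs c _)
    exact congrArg _ (funext fun x => smul_comm _ c (u _))

lemma finrank_cylinder : Module.finrank ℝ (ℝ × EuclideanSpace ℝ (Fin n)) = n + 1 := by
  rw [Module.finrank_prod, Module.finrank_self, finrank_euclideanSpace_fin, add_comm]

lemma exists_norm_cover_mul_le (C : ConicManifold n Mt B) (hχ : IsConeCutoff χ)
    (LB : FiniteLocalization (𝓡 n) B) (LM : FiniteLocalization (𝓡∂ (n + 1)) Mt) (hp : 1 < p)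
    (hs : ((n : ℝ) + 1) / p < s) (mul : X₁ →L[ℝ] X₂ →L[ℝ] X₀) (δ δ' : ℝ) : ∃ K : ℝ≥0,
      ∀ (u : Mt → X₁) (v : Mt → X₂), (C.cover hχ LB LM).norm s p δ u < ⊤ →
      (C.cover hχ LB LM).norm s p δ' v < ⊤ →
      (C.cover hχ LB LM).norm s p (δ + δ') (fun q => mul (u q) (v q)) ≤
        K * (C.cover hχ LB LM).norm s p δ u * (C.cover hχ LB LM).norm s p δ' v := by
  refine PatchCover.exists_norm_mul_le mul _ ?_ hp ?_ δ δ'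
  · rw [finrank_cylinder, finrank_euclideanSpace_fin]
  · rw [finrank_cylinder]
    exact_mod_cast hs

/-- The Banach algebra of the functions of finite norm. -/
lemma exists_banachAlgebra_mellin (C : ConicManifold n Mt B) (hχ : IsConeCutoff χ)
    (LB : FiniteLocalization (𝓡 n) B) (LM : FiniteLocalization (𝓡∂ (n + 1)) Mt) (hp : 1 < p)
    (hs : ((n : ℝ) + 1) / p < s) {δ : ℝ} (hδ : 0 ≤ δ) :
    ∃ S : NonUnitalSubalgebra ℂ (Mt → ℂ),
      (∀ u : Mt → ℂ, u ∈ S ↔ (C.cover hχ LB LM).norm s p δ u < ⊤) ∧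
      ∃ (A : Type u) (_ : NonUnitalNormedCommRing A) (_ : NormedSpace ℂ A)
        (_ : IsScalarTower ℂ A A) (_ : SMulCommClass ℂ A A) (_ : CompleteSpace A)
        (π : S →ₙₐ[ℂ] A), Function.Surjective π ∧ ∃ K : ℝ≥0, ∀ u : S,
          ‖π u‖ₑ ≤ K * (C.cover hχ LB LM).norm s p δ (u : Mt → ℂ) ∧
          (C.cover hχ LB LM).norm s p δ (u : Mt → ℂ) ≤ K * ‖π u‖ₑ := by
  have hs0 : 0 ≤ s := le_trans (by positivity) hs.le
  have hN := (C.cover hχ LB LM).isENorm_norm (s := s) (X := ℂ) hp δ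
  have hcs := C.norm_cover_complex_smul_le hχ LB LM hs0 hp δ
  have hcomp := (C.cover hχ LB LM).EComplete_norm (X := ℂ) hp hs0 δ
  obtain ⟨K₁, hK₁⟩ := C.exists_norm_cover_mul_le hχ LB LM hp hs (ContinuousLinearMap.mul ℝ ℂ) δ δ
  -- The product has exponent 2δ, and δ ≥ 0 brings it back to δ. This is where γ ≥ (n+1)/2 is used.
  obtain ⟨K₂, hK₂⟩ := C.exists_norm_cover_mono hχ LB LM hs0 hp (le_add_of_nonneg_left hδ : δ ≤ δ + δ) ℂ
  set N := (C.cover hχ LB LM).norm (X := ℂ) s p δ with hNdef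
  have hmul : ∀ u v : Mt → ℂ, N u < ⊤ → N v < ⊤ → N (u * v) ≤ (K₂ * K₁ : ℝ≥0) * N u * N v :=
    fun u v hu hv => by
      refine (hK₂ _).trans ?_
      rw [ENNReal.coe_mul, mul_assoc, mul_assoc, ← mul_assoc (K₁ : ℝ≥0∞)]
      gcongr
      exact hK₁ u v hu hv
  let S : NonUnitalSubalgebra ℂ (Mt → ℂ) :=
    { carrier := {u | N u < ⊤}
      add_mem' := fun {u v} hu hv => (hN.add_le u v).trans_lt (ENNReal.add_lt_top.2 ⟨hu, hv⟩)
      zero_mem' := hN.zero.trans_lt ENNReal.zero_lt_top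
      mul_mem' := fun {u v} hu hv => (hmul u v hu hv).trans_lt
        (ENNReal.mul_lt_top (ENNReal.mul_lt_top ENNReal.coe_lt_top hu) hv)
      smul_mem' := fun c u hu => (hcs c u).trans_lt (ENNReal.mul_lt_top enorm_lt_top hu) }
  have hfin : ∀ u : S, N u < ⊤ := fun u => u.2
  refine ⟨S, fun u => Iff.rfl, exists_banachAlgebra (R := S) (fun u => N u) hfin hN.zero
    (fun u v => hN.add_le u v) (fun c u => hcs c u) (K₂ * K₁)
    (fun u v => hmul u v u.2 v.2) fun x hx => ?_⟩
  obtain ⟨y, hy⟩ := hcomp (fun k => (x k : Mt → ℂ)) hx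
  have e : ∀ m, ((∑ k ∈ Finset.range m, x k : S) : Mt → ℂ) = ∑ k ∈ Finset.range m, (x k : Mt → ℂ) :=
    fun m => map_sum (NonUnitalSubalgebraClass.subtype S) x _
  obtain ⟨m, hm⟩ := (hy.eventually_lt_const (u := 1) one_pos).exists
  have hyS : N y < ⊤ := by
    rw [← sub_add_cancel y (∑ k ∈ Finset.range m, (x k : Mt → ℂ))]
    refine (hN.add_le _ _).trans_lt (ENNReal.add_lt_top.2 ⟨hm.trans ENNReal.one_lt_top, ?_⟩)
    rw [← e]
    exact hfin _
  refine ⟨⟨y, hyS⟩, hy.congr fun m => ?_⟩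
  rw [← e]
  rfl

lemma exists_norm_cover_mul_contDiff_le (C : ConicManifold n Mt B) (hχ : IsConeCutoff χ)
    (LB : FiniteLocalization (𝓡 n) B) (LM : FiniteLocalization (𝓡∂ (n + 1)) Mt) (hs : 0 ≤ s)
    (hp : 1 < p) (mul : X₁ →L[ℝ] X₂ →L[ℝ] X₀) (δ : ℝ) {k : ℕ} (hk : s ≤ k) : ∃ K : ℝ≥0,
      ∀ (u : Mt → X₁) (v : Mt → X₂), (C.cover hχ LB LM).norm s p δ u < ⊤ →
      C.conicCkENorm χ LB LM k v < ⊤ →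
      (C.cover hχ LB LM).norm s p δ (fun q => mul (u q) (v q)) ≤
        K * (C.cover hχ LB LM).norm s p δ u * C.conicCkENorm χ LB LM k v := by
  obtain ⟨K₁, hK₁⟩ := PatchCover.exists_norm_mul_contDiff_le (s := s) mul (C.cover hχ LB LM)
    (by rw [finrank_cylinder, finrank_euclideanSpace_fin]) hp hs hk δ
  obtain ⟨K₂, hK₂0, hK₂⟩ := C.exists_hasBoundedDerivs_cover hχ LB LM k X₂
  refine ⟨K₁ * (K₂ + 1).toNNReal, fun u v hu hv => ?_⟩
  set a := (C.conicCkENorm χ LB LM k v).toReal with ha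
  -- The multiplier estimate needs a positive bound for v, whose norm may vanish; η tends to zero
  -- afterwards.
  have h1 : ∀ η > (0 : ℝ), (C.cover hχ LB LM).norm s p δ (fun q => mul (u q) (v q)) ≤
      K₁ * ENNReal.ofReal ((K₂ + 1) * (a + η)) * (C.cover hχ LB LM).norm s p δ u := fun η hη => by
    have ha0 : 0 ≤ a := ENNReal.toReal_nonneg
    have h2 := hK₂ v (a + η) ((ENNReal.ofReal_toReal hv.ne).symm.le.trans
      (ENNReal.ofReal_le_ofReal (by linarith))) (by linarith)
    have h3 : K₂ * (a + η) ≤ (K₂ + 1) * (a + η) := by nlinarith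
    exact hK₁ u v _ (by positivity) ⟨fun i => (h2.1 i).mono le_rfl h3,
      fun i => (h2.2 i).mono le_rfl h3⟩
  have h4 : Tendsto (fun η : ℝ => K₁ * ENNReal.ofReal ((K₂ + 1) * (a + η)) *
      (C.cover hχ LB LM).norm s p δ u) (𝓝[>] 0) (𝓝 (K₁ * ENNReal.ofReal ((K₂ + 1) * (a + 0)) *
      (C.cover hχ LB LM).norm s p δ u)) := by
    refine ENNReal.Tendsto.mul_const (ENNReal.Tendsto.const_mul ?_ (Or.inr ENNReal.coe_ne_top))
      (Or.inr hu.ne)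
    have h5 : Continuous fun η : ℝ => ENNReal.ofReal ((K₂ + 1) * (a + η)) :=
      ENNReal.continuous_ofReal.comp (by fun_prop)
    exact (h5.tendsto 0).mono_left nhdsWithin_le_nhds
  refine (ge_of_tendsto h4 (eventually_mem_nhdsWithin.mono h1)).trans (le_of_eq ?_)
  rw [add_zero, ENNReal.ofReal_mul (by positivity), ha, ENNReal.ofReal_toReal hv.ne,
    ENNReal.coe_mul]
  change K₁ * (ENNReal.ofReal (K₂ + 1) * _) * _ = K₁ * ENNReal.ofReal (K₂ + 1) * _ * _
  ring

end ConicManifold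

theorem mainTheorem4 {n : ℕ}
    {Mt : Type u} [TopologicalSpace Mt] [ChartedSpace (EuclideanHalfSpace (n + 1)) Mt]
    [IsManifold (𝓡∂ (n + 1)) ∞ Mt] [CompactSpace Mt] [T2Space Mt]
    {B : Type*} [TopologicalSpace B] [ChartedSpace (EuclideanSpace ℝ (Fin n)) B]
    [IsManifold (𝓡 n) ∞ B] [CompactSpace B] [T2Space B]
    (C : ConicManifold n Mt B) (χ : ℝ → ℝ) (hχ : IsConeCutoff χ)
    (LB : FiniteLocalization (𝓡 n) B) (LM : FiniteLocalization (𝓡∂ (n + 1)) Mt)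
    {X₀ X₁ X₂ : Type*} [NormedAddCommGroup X₀] [NormedSpace ℝ X₀] [CompleteSpace X₀]
    [NormedAddCommGroup X₁] [NormedSpace ℝ X₁] [CompleteSpace X₁]
    [NormedAddCommGroup X₂] [NormedSpace ℝ X₂] [CompleteSpace X₂]
    (mul : X₁ →L[ℝ] X₂ →L[ℝ] X₀)
    (s p : ℝ) (hs : 0 ≤ s) (hp : 1 < p) :
    -- (i), the multiplication of two Mellin-Sobolev functions
    (((n : ℝ) + 1) / p < s →
      (∀ γ γ' : ℝ, ∃ K : ℝ≥0, ∀ (u : Mt → X₁) (v : Mt → X₂),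
          C.mellinENorm χ LB LM s γ p u < ⊤ → C.mellinENorm χ LB LM s γ' p v < ⊤ →
          C.mellinENorm χ LB LM s (γ + γ' - ((n : ℝ) + 1) / 2) p (fun q => mul (u q) (v q)) ≤
            K * C.mellinENorm χ LB LM s γ p u * C.mellinENorm χ LB LM s γ' p v) ∧
      -- the Banach algebra property of the `ℂ`-valued space, with the pointwise multiplication:
      -- functions of finite norm, modulo functions of norm zero, form a Banach algebra `A`
      (∀ γ : ℝ, ((n : ℝ) + 1) / 2 ≤ γ →
        ∃ S : NonUnitalSubalgebra ℂ (Mt → ℂ),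
          (∀ u : Mt → ℂ, u ∈ S ↔ C.mellinENorm χ LB LM s γ p u < ⊤) ∧
          ∃ (A : Type u) (_ : NonUnitalNormedCommRing A) (_ : NormedSpace ℂ A)
            (_ : IsScalarTower ℂ A A) (_ : SMulCommClass ℂ A A) (_ : CompleteSpace A)
            (π : S →ₙₐ[ℂ] A),
            Function.Surjective π ∧
            ∃ K : ℝ≥0, ∀ u : S,
              ‖π u‖ₑ ≤ K * C.mellinENorm χ LB LM s γ p (u : Mt → ℂ) ∧
              C.mellinENorm χ LB LM s γ p (u : Mt → ℂ) ≤ K * ‖π u‖ₑ)) ∧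
    -- (ii), the multiplication of a Mellin-Sobolev function by a conic `BC^k`-function
    (∀ (γ : ℝ) (k : ℕ), s ≤ k → ∃ K : ℝ≥0, ∀ (u : Mt → X₁) (v : Mt → X₂),
        C.mellinENorm χ LB LM s γ p u < ⊤ → C.conicCkENorm χ LB LM k v < ⊤ →
        C.mellinENorm χ LB LM s γ p (fun q => mul (u q) (v q)) ≤
          K * C.mellinENorm χ LB LM s γ p u * C.conicCkENorm χ LB LM k v) := by
  refine ⟨fun hsp => ⟨fun γ γ' => ?_, fun γ hγ => ?_⟩, fun γ k hk => ?_⟩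
  · obtain ⟨K, hK⟩ := C.exists_norm_cover_mul_le hχ LB LM hp hsp mul
      (γ - ((n : ℝ) + 1) / 2) (γ' - ((n : ℝ) + 1) / 2)
    refine ⟨K, fun u v hu hv => ?_⟩
    simp only [C.mellinENorm_eq hχ] at hu hv ⊢
    -- The exponents of the densities add, which accounts for the loss of (n+1)/2 in the weight.
    have e : γ + γ' - ((n : ℝ) + 1) / 2 - ((n : ℝ) + 1) / 2 =
        γ - ((n : ℝ) + 1) / 2 + (γ' - ((n : ℝ) + 1) / 2) := by ring
    rw [e]
    exact hK u v hu hv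
  · simp only [C.mellinENorm_eq hχ]
    exact C.exists_banachAlgebra_mellin hχ LB LM hp hsp (sub_nonneg.2 hγ)
  · obtain ⟨K, hK⟩ := C.exists_norm_cover_mul_contDiff_le hχ LB LM hs hp mul
      (γ - ((n : ℝ) + 1) / 2) hk
    refine ⟨K, fun u v hu hv => ?_⟩
    rw [C.mellinENorm_eq hχ] at hu
    rw [C.mellinENorm_eq hχ, C.mellinENorm_eq hχ]
    exact hK u v hu hv

end
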